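/- **Setting.** Let $H$ be a separable complex Hilbert space with a conjugation $x\mapsto\overline{x}$ (an antilinear isometric involution), inner product $\langle\cdot,\cdot\rangle$ linear in the first argument. Let $S_2(H)$ be the Hilbert space of Hilbert–Schmidt operators on $H$, $(f\otimes g)v=\langle v,g\rangle f$, $\overline{A}x=\overline{A\overline{x}}$, $A^\dagger$ the adjoint, $A^{\top}=\overline{A}^{\,\dagger}$. For random elements $Y,Z$ of $S_2(H)$ with mean zero, $\operatorname{cov}(Y,Z)=\mathbb E(Y\otimes Z)$, the operator $C\mapsto\mathbb E[\langle C,Z\rangle Y]$ on $S_2(H)$. Let $(\epsilon_t)_{t\in\mathbb Z}$ be i.i.d. with values in a measurable space $S$, let $(\epsilon'_t)$ be an independent copy, and let $X_t=g(\epsilon_t,\epsilon_{t-1},\dots)$ with $g:S^{\infty}\to H$ measurable. Let $\mathcal G_t=\sigma(\epsilon_t,\epsilon_{t-1},\dots)$, let $\mathcal G_{t,\{0\}}$ be defined like $\mathcal G_t$ but with $\epsilon_0$ replaced by $\epsilon_0'$, and $P_0(Y)=\mathbb E[Y|\mathcal G_0]-\mathbb E[Y|\mathcal G_{-1}]$.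 *Dependence condition* ($p=4$): $\mathbb E X_t=0$, $\mathbb E\|X_t\|^4<\infty$ and $\sum_{j\ge0}\big(\mathbb E\|X_j-\mathbb E[X_j|\mathcal G_{j,\{0\}}]\|^4\big)^{1/4}<\infty$. *Lag-window conditions*: $w:\mathbb R\to\mathbb R$ is even, bounded, continuous except at finitely many points, $\lim_{x\to0}w(x)=w(0)=1$; $\kappa^2:=\int_{\mathbb R}w(x)^2\,dx<\infty$; $\lim_{b\downarrow0}b\sum_{h\in\mathbb Z}w(bh)^2=\kappa^2$; and $\sup_{0<b\le1}b\sum_{|h|\ge M/b}w(bh)^2\to0$ as $M\to\infty$. Let $C_h=\mathbb E(X_h\otimes X_0)$, $\mathcal F^{(\lambda)}=\frac1{2\pi}\sum_{h\in\mathbb Z}C_he^{-\mathrm i\lambda h}$ and $$\hat{\mathcal F}^{\lambda}=\frac1{2\pi T}\sum_{s,t=1}^{T}w(b_T(t-s))\,e^{\mathrm i\lambda(t-s)}\,X_s\otimes X_t .$$ **Theorem.** Assume the dependence condition and the lag-window conditions. Let $\lambda_1,\dots,\lambda_d\in[0,\pi]$ be distinct and, if some $\lambda_j\in\{0,\pi\}$,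 assume that $X$ is real, i.e. $\overline{X_t}=X_t$ almost surely for all $t$. Then there are independent zero-mean complex Gaussian elements $\mathfrak F^{\lambda_1},\dots,\mathfrak F^{\lambda_d}$ of $S_2(H)$ such that, with $\mathcal F=\mathcal F^{(\lambda_j)}$ and $\mathrm 1_j=1$ if $\lambda_j\in\{0,\pi\}$, $\mathrm 1_j=0$ otherwise, for all $C\in S_2(H)$ $$\operatorname{cov}(\mathfrak F^{\lambda_j},\mathfrak F^{\lambda_j})\,C=\kappa^2\big(\mathcal F C\mathcal F^\dagger+\mathrm 1_j\,\mathcal F C^{\top}\mathcal F^\dagger\big),\qquad \operatorname{cov}(\mathfrak F^{\lambda_j},\overline{\mathfrak F^{\lambda_j}})\,C=\kappa^2\big(\mathrm 1_j\,\mathcal F C\mathcal F^\dagger+\mathcal F C^{\top}\mathcal F^\dagger\big),$$ and for all bandwidths with $b_T\to0$ and $b_TT\to\infty$, as $T\to\infty$, $$\sqrt{b_TT}\,\big(\hat{\mathcal F}^{\lambda_j}-\mathbb E\hat{\mathcal F}^{\lambda_j}\big)_{j=1,\dots,d}\Rightarrow\big(\mathfrak F^{\lambda_j}\big)_{j=1,\dots,d}\quad\text{in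 }S_2(H)^d .$$ If moreover $\sum_{h\in\mathbb Z}|h|\,(\mathbb E\|P_0(X_h)\|^2)^{1/2}<\infty$ and $w(x)-1=O(x)$ as $x\to0$, then for all bandwidths with $b_T\to0$, $b_TT\to\infty$ and $b_T=o(T^{-1/3})$, $$\sqrt{b_TT}\,\big(\hat{\mathcal F}^{\lambda_j}-\mathcal F^{(\lambda_j)}\big)_{j=1,\dots,d}\Rightarrow\big(\mathfrak F^{\lambda_j}\big)_{j=1,\dots,d}.$$ -/

import Mathlib

open MeasureTheory ProbabilityTheory Filter Topology
open scoped ENNReal InnerProductSpace ComplexConjugate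

noncomputable section

/-! ### The Hilbert space of Hilbert–Schmidt operators -/

section HilbertSchmidt

set_option linter.unusedSectionVars false

variable (H : Type*) [NormedAddCommGroup H] [InnerProductSpace ℂ H] [CompleteSpace H]

/-- The index set of a chosen orthonormal basis of `H`. -/
def onbIndex : Set H := (exists_hilbertBasis ℂ H).choose

/-- A chosen orthonormal (Hilbert) basis of `H`. -/
def onb : HilbertBasis (onbIndex H) ℂ H := (exists_hilbertBasis ℂ H).choose_spec.choose

variable {H}

/-- Parseval's identity in `[0,∞]`. -/
theorem tsum_enorm_inner_sq {ι : Type*} (b : HilbertBasis ι ℂ H) (x : H) :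
    ∑' i, ‖inner ℂ (b i) x‖ₑ ^ 2 = ‖x‖ₑ ^ 2 := by
  have h := b.hasSum_inner_mul_inner x x
  have h2 : HasSum (fun i => ‖inner ℂ (b i) x‖ ^ 2) (‖x‖ ^ 2) := by
    have h3 := Complex.hasSum_re h
    convert h3 using 1
    · ext i
      rw [← inner_conj_symm x (b i), ← Complex.normSq_eq_conj_mul_self, Complex.ofReal_re,
        Complex.normSq_eq_norm_sq]
    · exact norm_sq_eq_re_inner (𝕜 := ℂ) x
  have h4 := h2.tsum_eq
  have h5 : ∀ i, ‖inner ℂ (b i) x‖ₑ ^ 2 = ENNReal.ofReal (‖inner ℂ (b i) x‖ ^ 2) := fun i => by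
    rw [ENNReal.ofReal_pow (norm_nonneg _), ofReal_norm]
  simp_rw [h5]
  rw [← ENNReal.ofReal_tsum_of_nonneg (fun i => by positivity) h2.summable, h4,
    ENNReal.ofReal_pow (norm_nonneg _), ofReal_norm]

theorem tsum_enorm_sq_adjoint {ι κ : Type*} (b : HilbertBasis ι ℂ H) (c : HilbertBasis κ ℂ H)
    (A : H →L[ℂ] H) :
    ∑' i, ‖A (b i)‖ₑ ^ 2 = ∑' j, ‖ContinuousLinearMap.adjoint A (c j)‖ₑ ^ 2 := by
  simp_rw [← tsum_enorm_inner_sq c (A _), ← tsum_enorm_inner_sq b (ContinuousLinearMap.adjoint A _)]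
  rw [ENNReal.tsum_comm]
  refine tsum_congr fun j => tsum_congr fun i => ?_
  rw [ContinuousLinearMap.adjoint_inner_right, ← inner_conj_symm, RCLike.enorm_conj]

/-- `∑ᵢ ‖A eᵢ‖²` does not depend on the orthonormal basis. -/
theorem tsum_enorm_sq_basis {ι κ : Type*} (b : HilbertBasis ι ℂ H) (c : HilbertBasis κ ℂ H)
    (A : H →L[ℂ] H) : ∑' i, ‖A (b i)‖ₑ ^ 2 = ∑' j, ‖A (c j)‖ₑ ^ 2 := by
  rw [tsum_enorm_sq_adjoint b c, ← tsum_enorm_sq_adjoint c c]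

variable (H) in
/-- The bounded operators `A` on `H` with `∑ᵢ ‖A eᵢ‖² < ∞`. -/
def hsSubmodule : Submodule ℂ (H →L[ℂ] H) where
  carrier := {A | Memℓp (fun i => A (onb H i)) 2}
  add_mem' := fun hA hB => hA.add hB
  zero_mem' := zero_memℓp
  smul_mem' := fun c _ hA => hA.const_smul c

variable (H) in
/-- The space `S₂(H)` of Hilbert–Schmidt operators on `H`. -/
def S2 : Type _ := hsSubmodule H

namespace S2

instance : AddCommGroup (S2 H) := inferInstanceAs (AddCommGroup (hsSubmodule H))
instance : Module ℂ (S2 H) := inferInstanceAs (Module ℂ (hsSubmodule H))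

/-- A bounded operator with finite Hilbert–Schmidt norm, as an element of `S₂(H)`. -/
def ofMem (A : H →L[ℂ] H) (hA : A ∈ hsSubmodule H) : S2 H := (⟨A, hA⟩ : hsSubmodule H)

/-- The underlying bounded operator of a Hilbert–Schmidt operator. -/
def op (A : S2 H) : H →L[ℂ] H := Subtype.val (p := fun A => A ∈ hsSubmodule H) A

theorem op_injective : Function.Injective (op : S2 H → H →L[ℂ] H) := Subtype.val_injective

@[simp] theorem op_ofMem (A : H →L[ℂ] H) (hA : A ∈ hsSubmodule H) : (ofMem A hA).op = A := rfl
@[simp] theorem op_add (A B : S2 H) : (A + B).op = A.op + B.op := rfl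
@[simp] theorem op_smul (c : ℂ) (A : S2 H) : (c • A).op = c • A.op := rfl

variable (H) in
/-- `A ↦ (A eᵢ)ᵢ`, from `S₂(H)` to `ℓ²(H)`. The Hilbert–Schmidt norm and inner product are pulled
back along it: `‖A‖² = ∑ᵢ ‖A eᵢ‖²` and `⟪A, B⟫ = ∑ᵢ ⟪A eᵢ, B eᵢ⟫`. -/
def toLp : S2 H →ₗ[ℂ] lp (fun _ : onbIndex H => H) 2 where
  toFun A := ⟨fun i => A.op (onb H i), A.2⟩
  map_add' _ _ := rfl
  map_smul' _ _ := rfl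

@[simp] theorem toLp_apply (A : S2 H) (i : onbIndex H) :
    (toLp H A : ∀ _ : onbIndex H, H) i = A.op (onb H i) := rfl

theorem toLp_injective : Function.Injective (toLp H) := by
  intro A B h
  apply op_injective
  have hd : Dense ((Submodule.span ℂ (Set.range (onb H)) : Submodule ℂ H) : Set H) :=
    Submodule.dense_iff_topologicalClosure_eq_top.2 (onb H).dense_span
  refine ContinuousLinearMap.ext_on hd ?_
  rintro _ ⟨i, rfl⟩
  exact congrFun (congrArg Subtype.val h) i

instance : NormedAddCommGroup (S2 H) := NormedAddCommGroup.induced _ _ (toLp H) toLp_injective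

instance : InnerProductSpace ℂ (S2 H) where
  toNormedSpace := NormedSpace.induced ℂ (S2 H) _ (toLp H)
  inner A B := inner ℂ (toLp H A) (toLp H B)
  norm_sq_eq_re_inner A := norm_sq_eq_re_inner (𝕜 := ℂ) (toLp H A)
  conj_inner_symm A B := inner_conj_symm (toLp H A) (toLp H B)
  add_left A B C := by rw [map_add, inner_add_left]
  smul_left A B r := by rw [map_smul, inner_smul_left]

theorem norm_toLp (A : S2 H) : ‖toLp H A‖ = ‖A‖ := rfl

theorem isometry_toLp : Isometry (toLp H) := AddMonoidHomClass.isometry_of_norm _ norm_toLp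

theorem inner_def (A B : S2 H) : inner ℂ A B = ∑' i, inner ℂ (A.op (onb H i)) (B.op (onb H i)) :=
  rfl

theorem enorm_sq (A : S2 H) : ‖A‖ₑ ^ 2 = ∑' i, ‖A.op (onb H i)‖ₑ ^ 2 := by
  have h0 : (0 : ℝ) < (2 : ℝ≥0∞).toReal := by norm_num
  have h1 := lp.norm_rpow_eq_tsum h0 (toLp H A)
  have hs : Summable fun i => ‖A.op (onb H i)‖ ^ 2 := by
    simpa using (memℓp_gen_iff h0).1 (toLp H A).2
  simp only [ENNReal.toReal_ofNat, Real.rpow_ofNat, toLp_apply, norm_toLp] at h1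
  rw [← ofReal_norm, ← ENNReal.ofReal_pow (norm_nonneg _), h1,
    ENNReal.ofReal_tsum_of_nonneg (fun i => by positivity) hs]
  refine tsum_congr fun i => ?_
  rw [ENNReal.ofReal_pow (norm_nonneg _), ofReal_norm]

/-- The Hilbert–Schmidt norm computed in an arbitrary orthonormal basis. -/
theorem enorm_sq_basis {ι : Type*} (b : HilbertBasis ι ℂ H) (A : S2 H) :
    ‖A‖ₑ ^ 2 = ∑' i, ‖A.op (b i)‖ₑ ^ 2 := by
  rw [enorm_sq, tsum_enorm_sq_basis (onb H) b]

theorem _root_.mem_hsSubmodule_iff {ι : Type*} (b : HilbertBasis ι ℂ H) (A : H →L[ℂ] H) :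
    A ∈ hsSubmodule H ↔ ∑' i, ‖A (b i)‖ₑ ^ 2 ≠ ∞ := by
  rw [tsum_enorm_sq_basis b (onb H)]
  have h0 : (0 : ℝ) < (2 : ℝ≥0∞).toReal := by norm_num
  change Memℓp (fun i => A (onb H i)) 2 ↔ _
  rw [memℓp_gen_iff h0]
  simp only [ENNReal.toReal_ofNat, Real.rpow_ofNat]
  have h5 : ∀ i, ‖A (onb H i)‖ₑ ^ 2 = ENNReal.ofReal (‖A (onb H i)‖ ^ 2) := fun i => by
    rw [ENNReal.ofReal_pow (norm_nonneg _), ofReal_norm]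
  simp_rw [h5]
  refine ⟨fun h => h.tsum_ofReal_ne_top, fun h => ?_⟩
  have := ENNReal.summable_toReal h
  refine this.congr fun i => ?_
  rw [ENNReal.toReal_ofReal (by positivity)]

theorem norm_op_apply_le (A : S2 H) (x : H) : ‖A.op x‖ ≤ ‖A‖ * ‖x‖ := by
  have h : ‖A.op x‖ₑ ^ 2 ≤ (‖A‖ₑ * ‖x‖ₑ) ^ 2 := by
    rw [mul_pow, enorm_sq, tsum_enorm_sq_adjoint (onb H) (onb H), ← ENNReal.tsum_mul_right,
      ← tsum_enorm_inner_sq (onb H)]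
    refine ENNReal.tsum_le_tsum fun i => ?_
    rw [← ContinuousLinearMap.adjoint_inner_left, ← mul_pow]
    gcongr
    rw [← ofReal_norm, ← ofReal_norm, ← ofReal_norm, ← ENNReal.ofReal_mul (norm_nonneg _)]
    exact ENNReal.ofReal_le_ofReal (norm_inner_le_norm _ _)
  have h' := (ENNReal.pow_le_pow_left_iff (two_ne_zero)).1 h
  rw [← enorm_norm A, ← enorm_norm x, ← enorm_mul, ← enorm_norm (A.op x),
    Real.enorm_of_nonneg (norm_nonneg _), Real.enorm_of_nonneg (by positivity)] at h'
  exact (ENNReal.ofReal_le_ofReal_iff (by positivity)).1 h'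

theorem norm_op_le (A : S2 H) : ‖A.op‖ ≤ ‖A‖ :=
  A.op.opNorm_le_bound (norm_nonneg _) A.norm_op_apply_le

instance : CompleteSpace (S2 H) := by
  refine Metric.complete_of_cauchySeq_tendsto fun u hu => ?_
  have hu1 : CauchySeq fun n => (u n).op := by
    rw [Metric.cauchySeq_iff] at hu ⊢
    intro ε hε
    obtain ⟨N, hN⟩ := hu ε hε
    refine ⟨N, fun m hm n hn => lt_of_le_of_lt ?_ (hN m hm n hn)⟩
    rw [dist_eq_norm, dist_eq_norm]
    exact norm_op_le (u m - u n)
  obtain ⟨A, hA⟩ := cauchySeq_tendsto_of_complete hu1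
  have hu2 : CauchySeq fun n => toLp H (u n) := (isometry_toLp.uniformContinuous).comp_cauchySeq hu
  obtain ⟨f, hf⟩ := cauchySeq_tendsto_of_complete hu2
  have hfi : ∀ i, (f : ∀ _ : onbIndex H, H) i = A (onb H i) := by
    intro i
    have h1 : Tendsto (fun n => (u n).op (onb H i)) atTop (𝓝 (A (onb H i))) :=
      ((ContinuousLinearMap.apply ℂ H (onb H i)).continuous.tendsto A).comp hA
    have h2 : Tendsto (fun n => (u n).op (onb H i)) atTop
        (𝓝 ((f : ∀ _ : onbIndex H, H) i)) := by
      rw [tendsto_iff_norm_sub_tendsto_zero] at hf ⊢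
      refine squeeze_zero (fun _ => norm_nonneg _) (fun n => ?_) hf
      exact lp.norm_apply_le_norm (by norm_num) (toLp H (u n) - f) i
    exact tendsto_nhds_unique h2 h1
  have hmem : A ∈ hsSubmodule H := by
    have := f.2
    have he : (f : ∀ _ : onbIndex H, H) = fun i => A (onb H i) := funext hfi
    change Memℓp (fun i => A (onb H i)) 2
    rw [← he]
    exact this
  refine ⟨ofMem A hmem, ?_⟩
  rw [isometry_toLp.isEmbedding.tendsto_nhds_iff]
  have he : toLp H (ofMem A hmem) = f := Subtype.ext (funext fun i => (hfi i).symm)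
  rw [he]
  exact hf

theorem rankOne_mem (f g : H) : InnerProductSpace.rankOne ℂ f g ∈ hsSubmodule H := by
  rw [mem_hsSubmodule_iff (onb H), tsum_enorm_sq_adjoint (onb H) (onb H)]
  simp only [InnerProductSpace.adjoint_rankOne, InnerProductSpace.rankOne_apply, enorm_smul, mul_pow]
  rw [ENNReal.tsum_mul_right]
  have : ∑' i, ‖inner ℂ f (onb H i)‖ₑ ^ 2 = ‖f‖ₑ ^ 2 := by
    rw [← tsum_enorm_inner_sq (onb H) f]
    refine tsum_congr fun i => ?_
    rw [← inner_conj_symm, RCLike.enorm_conj]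
  rw [this]
  exact ENNReal.mul_ne_top (by simp) (by simp)

/-- The rank-one operator `f ⊗ g`, that is `v ↦ ⟨v, g⟩ f` with `⟨·,·⟩` linear in its first
argument, as an element of `S₂(H)`. -/
def tens (f g : H) : S2 H :=
  ofMem (InnerProductSpace.rankOne ℂ f g) (rankOne_mem f g)

@[simp] theorem op_tens (f g : H) : (tens f g).op = InnerProductSpace.rankOne ℂ f g := rfl

theorem norm_tens (f g : H) : ‖tens f g‖ = ‖f‖ * ‖g‖ := by
  have h : ‖tens f g‖ₑ ^ 2 = (‖f‖ₑ * ‖g‖ₑ) ^ 2 := by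
    rw [enorm_sq]
    simp only [op_tens, InnerProductSpace.rankOne_apply, enorm_smul, mul_pow]
    rw [ENNReal.tsum_mul_right, mul_comm]
    congr 1
    rw [← tsum_enorm_inner_sq (onb H) g]
    refine tsum_congr fun i => ?_
    rw [← inner_conj_symm, RCLike.enorm_conj]
  have h' := congrArg ENNReal.toReal h
  simp only [ENNReal.toReal_pow, ENNReal.toReal_mul, toReal_enorm] at h'
  exact (pow_left_inj₀ (norm_nonneg _) (by positivity) two_ne_zero).1 h'

theorem continuous_tens : Continuous fun p : H × H => tens p.1 p.2 := by
  rw [continuous_iff_continuousAt]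
  rintro ⟨f, g⟩
  rw [ContinuousAt, tendsto_iff_norm_sub_tendsto_zero]
  have key : ∀ p : H × H, ‖tens p.1 p.2 - tens f g‖ ≤ ‖p.1 - f‖ * ‖p.2‖ + ‖f‖ * ‖p.2 - g‖ := by
    intro p
    have : tens p.1 p.2 - tens f g = tens (p.1 - f) p.2 + tens f (p.2 - g) := by
      apply op_injective
      change InnerProductSpace.rankOne ℂ p.1 p.2 - InnerProductSpace.rankOne ℂ f g
        = InnerProductSpace.rankOne ℂ (p.1 - f) p.2 + InnerProductSpace.rankOne ℂ f (p.2 - g)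
      simp
    rw [this, ← norm_tens, ← norm_tens]
    exact norm_add_le _ _
  refine squeeze_zero (fun _ => norm_nonneg _) key ?_
  have hc : Continuous fun p : H × H => ‖p.1 - f‖ * ‖p.2‖ + ‖f‖ * ‖p.2 - g‖ := by fun_prop
  simpa using hc.tendsto (f, g)

theorem hasSum_tens (A : S2 H) : HasSum (fun i => tens (A.op (onb H i)) (onb H i)) A := by
  classical
  have h := lp.hasSum_single (p := 2) (by norm_num) (toLp H A)
  have hi : IsInducing (toLp H) := isometry_toLp.isEmbedding.isInducing
  rw [← hi.hasSum_iff (g := toLp H)]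
  convert h using 1
  ext i j
  have ho := orthonormal_iff_ite.1 (onb H).orthonormal i j
  by_cases hij : j = i
  · subst hij
    simp [(onb H).orthonormal.norm_eq_one]
  · simp [ho, hij, Ne.symm hij]

instance [SecondCountableTopology H] : SecondCountableTopology (S2 H) := by
  have h1 : TopologicalSpace.IsSeparable (Set.range fun p : H × H => tens p.1 p.2) :=
    TopologicalSpace.isSeparable_range continuous_tens
  have h2 := (h1.span (R := ℂ)).closure
  have h3 : closure ((Submodule.span ℂ (Set.range fun p : H × H => tens p.1 p.2) :
      Submodule ℂ (S2 H)) : Set (S2 H)) = Set.univ := by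
    refine Set.eq_univ_of_forall fun A => ?_
    refine mem_closure_of_tendsto (hasSum_tens A) (Eventually.of_forall fun s => ?_)
    exact Submodule.sum_mem _ fun i _ => Submodule.subset_span ⟨(_, _), rfl⟩
  rw [h3, TopologicalSpace.isSeparable_univ_iff] at h2
  exact UniformSpace.secondCountable_of_separable _

instance : MeasurableSpace (S2 H) := borel (S2 H)
instance : BorelSpace (S2 H) := ⟨rfl⟩

end S2

/-- The conjugate operator `Ā g = conj (A (conj g))`, for a conjugation `J` of `H`. -/
def conjOp (J : H ≃ₗᵢ⋆[ℂ] H) (A : H →L[ℂ] H) : H →L[ℂ] H :=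
  (J : H →L⋆[ℂ] H).comp (A.comp (J : H →L⋆[ℂ] H))

@[simp] theorem conjOp_apply (J : H ≃ₗᵢ⋆[ℂ] H) (A : H →L[ℂ] H) (x : H) :
    conjOp J A x = J (A (J x)) := rfl

theorem inner_conj_conj (J : H ≃ₗᵢ⋆[ℂ] H) (x y : H) : inner ℂ (J x) (J y) = inner ℂ y x := by
  have hI : ∀ z, Complex.I • J z = - J (Complex.I • z) := fun z => by
    rw [LinearIsometryEquiv.map_smulₛₗ]; simp
  rw [← inner_conj_symm y x, inner_eq_sum_norm_sq_div_four, inner_eq_sum_norm_sq_div_four]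
  simp only [RCLike.I_to_complex, hI, sub_neg_eq_add, ← sub_eq_add_neg, ← map_add, ← map_sub,
    LinearIsometryEquiv.norm_map]
  simp only [map_div₀, map_add, map_sub, map_mul, map_pow, Complex.conj_ofReal, Complex.conj_I,
    map_ofNat, Complex.coe_algebraMap]
  ring

theorem conjOp_mem (J : H ≃ₗᵢ⋆[ℂ] H) {A : H →L[ℂ] H} (hA : A ∈ hsSubmodule H) :
    conjOp J A ∈ hsSubmodule H := by
  rw [mem_hsSubmodule_iff (onb H)] at hA ⊢
  rw [tsum_enorm_sq_adjoint (onb H) (onb H)] at hA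
  convert hA using 1
  simp only [conjOp_apply]
  have h1 : ∀ i, ‖J (A (J (onb H i)))‖ₑ ^ 2 = ∑' j, ‖inner ℂ
      (J.symm (ContinuousLinearMap.adjoint A (onb H j))) (onb H i)‖ₑ ^ 2 := fun i => by
    rw [← ofReal_norm, LinearIsometryEquiv.norm_map, ofReal_norm, ← tsum_enorm_inner_sq (onb H)]
    refine tsum_congr fun j => ?_
    have h3 := inner_conj_conj J (J.symm (ContinuousLinearMap.adjoint A (onb H j))) (onb H i)
    rw [LinearIsometryEquiv.apply_symm_apply] at h3
    rw [← ContinuousLinearMap.adjoint_inner_left, h3, ← inner_conj_symm, RCLike.enorm_conj]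
  simp_rw [h1]
  rw [ENNReal.tsum_comm]
  refine tsum_congr fun j => ?_
  have h2 := tsum_enorm_inner_sq (onb H) (J.symm (ContinuousLinearMap.adjoint A (onb H j)))
  rw [← ofReal_norm (J.symm _), LinearIsometryEquiv.norm_map, ofReal_norm] at h2
  rw [← h2]
  refine tsum_congr fun i => ?_
  rw [← inner_conj_symm, RCLike.enorm_conj]

/-- The conjugate of a Hilbert–Schmidt operator. -/
def S2.conj (J : H ≃ₗᵢ⋆[ℂ] H) (A : S2 H) : S2 H := S2.ofMem (conjOp J A.op) (conjOp_mem J A.2)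

/-- The Kronecker product of operators, `(A ⊗̃ B) C = A C B†`. -/
def kron (A B C : H →L[ℂ] H) : H →L[ℂ] H := A ∘L C ∘L ContinuousLinearMap.adjoint B

/-- The transpose Kronecker product, `(A ⊗̃_⊤ B) C = (A ⊗̃ B̄) (C̄†)`. -/
def kronT (J : H ≃ₗᵢ⋆[ℂ] H) (A B C : H →L[ℂ] H) : H →L[ℂ] H :=
  kron A (conjOp J B) (ContinuousLinearMap.adjoint (conjOp J C))

/-- `ν` is the law of a zero-mean complex Gaussian element `Z` of `S₂(H)`, that is, `(Re Z, Im Z)`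
is jointly Gaussian, with covariance operator `cov(Z, Z) = E (Z ⊗ Z)` equal to `Γ` and
pseudocovariance operator `cov(Z, Z̄) = E (Z ⊗ Z̄)` equal to `P`. Here `S₂(H)` is regarded as a real
Banach space in `IsGaussian`. -/
structure IsCenteredComplexGaussian (J : H ≃ₗᵢ⋆[ℂ] H) (ν : Measure (S2 H))
    (Γ P : (H →L[ℂ] H) → (H →L[ℂ] H)) : Prop where
  gaussian : IsGaussian ν
  mean : ∫ z, z ∂ν = 0
  cov : ∀ C : S2 H, ((∫ z, InnerProductSpace.rankOne ℂ z z ∂ν) C).op = Γ C.op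
  pseudocov : ∀ C : S2 H, ((∫ z, InnerProductSpace.rankOne ℂ z (z.conj J) ∂ν) C).op = P C.op

end HilbertSchmidt

/-! ### Stationary functional time series -/

section TimeSeries

variable {Ω S H : Type*} [MeasurableSpace Ω] [MeasurableSpace S]

/-- `X_t = g(ε_t, ε_{t-1}, …)`. -/
def causal (g : (ℕ → S) → H) (ε : ℤ → Ω → S) (t : ℤ) (ω : Ω) : H := g fun k => ε (t - k) ω

/-- `G_t = σ(ε_t, ε_{t-1}, …)`. -/
@[reducible] def pastSigma (ε : ℤ → Ω → S) (t : ℤ) : MeasurableSpace Ω :=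
  ⨆ k : ℕ, MeasurableSpace.comap (ε (t - k)) inferInstance

open Classical in
/-- The innovations `ε_{t,I}`: `ε'_t` for `t ∈ I` and `ε_t` otherwise. -/
def coupled (ε ε' : ℤ → Ω → S) (I : Set ℤ) (t : ℤ) : Ω → S := if t ∈ I then ε' t else ε t

/-- `ε` is an i.i.d. sequence and `ε'` an independent copy of it. -/
structure IsIIDWithCopy (μ : Measure Ω) (ε ε' : ℤ → Ω → S) : Prop where
  measurable : ∀ t, Measurable (ε t)
  measurable_copy : ∀ t, Measurable (ε' t)
  indep : iIndepFun ε μ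
  ident : ∀ t, IdentDistrib (ε t) (ε 0) μ μ
  ident_copy : IdentDistrib (fun ω t => ε' t ω) (fun ω t => ε t ω) μ μ
  indep_copy : IndepFun (fun ω t => ε t ω) (fun ω t => ε' t ω) μ

variable [NormedAddCommGroup H] [InnerProductSpace ℂ H] [CompleteSpace H]

/-- The dependence coefficient `ν_p(X_t) = (E ‖X_t - E[X_t | G_{t,{0}}]‖^p)^{1/p}`. -/
def depCoeff (μ : Measure Ω) (ε ε' : ℤ → Ω → S) (X : ℤ → Ω → H) (p : ℝ≥0∞) (t : ℤ) : ℝ≥0∞ :=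
  eLpNorm (X t - μ[X t | pastSigma (coupled ε ε' {0}) t]) p μ

/-- The projection `P_k Y = E[Y | G_k] - E[Y | G_{k-1}]`. -/
def martProj (μ : Measure Ω) (ε : ℤ → Ω → S) (k : ℤ) (Y : Ω → H) : Ω → H :=
  μ[Y | pastSigma ε k] - μ[Y | pastSigma ε (k - 1)]

/-- `X` is centered, lies in `L^p`, and has summable dependence coefficients `ν_p(X_j)`, `j ≥ 0`. -/
structure DependenceCondition (μ : Measure Ω) (ε ε' : ℤ → Ω → S) (X : ℤ → Ω → H)
    (p : ℝ≥0∞) : Prop where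
  memLp : ∀ t, MemLp (X t) p μ
  centered : ∀ t, ∫ ω, X t ω ∂μ = 0
  summable : ∑' j : ℕ, depCoeff μ ε ε' X p j ≠ ∞

/-- The lag-`h` covariance operator `C_h = E (X_h ⊗ X_0)` of a centered process. -/
def lagCov (μ : Measure Ω) (X : ℤ → Ω → H) (h : ℤ) : S2 H := ∫ ω, S2.tens (X h ω) (X 0 ω) ∂μ

/-- The spectral density operator `F^{(λ)} = (2π)⁻¹ ∑_h C_h e^{-iλh}`. -/
def specDensity (μ : Measure Ω) (X : ℤ → Ω → H) (lam : ℝ) : S2 H :=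
  (1 / (2 * Real.pi) : ℂ) •
    ∑' h : ℤ, Complex.exp (-Complex.I * lam * h) • lagCov μ X h

/-- The lag-window estimator
`(2πT)⁻¹ ∑_{s,t=1}^T w(b(t-s)) e^{iλ(t-s)} (X_s ⊗ X_t)` with bandwidth `b`. -/
def specEstimator (X : ℤ → Ω → H) (w : ℝ → ℝ) (b : ℝ) (T : ℕ) (lam : ℝ) (ω : Ω) : S2 H :=
  (1 / (2 * Real.pi * T) : ℂ) •
    ∑ s ∈ Finset.Icc (1 : ℤ) T, ∑ t ∈ Finset.Icc (1 : ℤ) T,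
      ((w (b * ((t : ℝ) - s)) : ℂ) * Complex.exp (Complex.I * lam * ((t : ℂ) - s))) •
        S2.tens (X s ω) (X t ω)

end TimeSeries

/-- `∫ w²`. -/
def windowEnergy (w : ℝ → ℝ) : ℝ := ∫ x, w x ^ 2

/-- The conditions on the lag window `w`. The sums over lags are taken in `[0,∞]`. -/
structure LagWindow (w : ℝ → ℝ) : Prop where
  even : ∀ x, w (-x) = w x
  bounded : ∃ M, ∀ x, |w x| ≤ M
  tendsto_zero : Tendsto w (𝓝 0) (𝓝 1)
  continuousAt : ∃ D : Set ℝ, D.Finite ∧ ∀ x ∉ D, ContinuousAt w x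
  integrable_sq : Integrable fun x => w x ^ 2
  riemann : Tendsto (fun b : ℝ => ∑' h : ℤ, ENNReal.ofReal (b * w (b * h) ^ 2)) (𝓝[>] 0)
    (𝓝 (ENNReal.ofReal (windowEnergy w)))
  tail : Tendsto (fun M : ℝ => ⨆ b ∈ Set.Ioc (0 : ℝ) 1,
    ∑' h : {h : ℤ // M / b ≤ |(h : ℝ)|}, ENNReal.ofReal (b * w (b * (h : ℤ)) ^ 2)) atTop (𝓝 0)

/-- The indicator of `{0, π}`. -/
def indZeroPi (lam : ℝ) : ℂ := Set.indicator {0, Real.pi} 1 lam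

end

/-! The limit law is identified through the real linear functionals `Re ∑ⱼ ⟪Cⱼ, zⱼ⟫` of the
deviations. In the separable Hilbert space of values, a tight sequence whose characteristic
functionals converge pointwise converges weakly (`exists_tendsto_of_tendsto_charFunDual`), and a
limiting functional `exp (-V/2)` with `V` quadratic belongs to a centered Gaussian law
(`gaussian_of_charFunDual`). What remains is a scalar central limit theorem for quadratic forms,
tightness, and the identification of `V`.

All moment bounds come from one source. The innovations may be taken to be the coordinates of a
product space, where conditional expectation is the explicit average `condE` over the remaining
coordinates. Splitting `f - E f` into martingale increments `P_k f` gives `‖f - E f‖_r² ≤ 4 ∑ ‖P_k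
f‖_r²` for `r = 2, 4` (`eLpNorm_sub_integral_sq_le`). For a quadratic form `∑ α_st X_s ⊗ Y_t` this
yields a bound by `∑ |α_st|²` times a constant made of the summed dependence coefficients
(`eLpNorm_quadForm_sub_integral_sq_le`). For the lag-window weights `(b/T) ∑ |α_st|²` tends to `κ²`,
so the scaled form depends continuously on the process in the seminorm `coeffSum`, uniformly in
large `T`; so do the spectral operators (`enorm_specSum_sub_le`). It is therefore enough to treat
bounded, finite-rank, `m`-dependent processes, which approximate every admissible process
(`exists_mdep_approx`). Tightness follows from the same approximation, since finite rank confines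
the form to a fixed finite-dimensional subspace.

For a bounded `m`-dependent process the central limit theorem (`MDep.tendsto_charFun`) is proved by
blocks of length `L` with `1/b ≪ L ≪ T`, separated by gaps of length `m`. The block forms are
i.i.d., the bound with `r = 4` gives Lyapunov's condition, and the pairs that lie in no common block
carry the energy `(b/T) (F(T) - N F(ℓ))`, where `F(n)` is the squared Frobenius norm of the weights
on `[1, n]²`. Both parts of this difference tend to `κ²`, so the remainder is negligible.

For the variance, the covariance of two forms is the sum of two pairing terms and a fourth-order
cumulant. The cumulant is nonzero for only `O(T)` quadruples of times and contributes `O(b)`. The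
pairing terms reduce to the sums `b ∑ w(bh)² e^{iθh}` with `θ = λ ± λ'`, which tend to `κ²` if `θ ∈
2πℤ` and to zero otherwise (`LagWindow.tendsto_windowTrig`). For frequencies in `[0, π]` the
difference resonates only if `λ = λ'`, and the sum only if `λ = λ' ∈ {0, π}`. Hence the limits at
distinct frequencies are independent and the extra terms appear at `0` and `π` alone. Polarization
then recovers the covariance and pseudocovariance operators (`covariance_operators`), using that the
spectral operator is self-adjoint and, for a real process at `0` and `π`, commutes with the
conjugation.

The bias is at most `(K b + 1/T) ∑ |h| ‖C_h‖`, and `√(bT)` times it is of order `√(b³T) + √(b/T)`,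
which tends to zero when `b = o(T^{-1/3})`. -/

noncomputable section

/-! ### Conditional expectation on a product space as averaging over coordinates -/

section CoordinateAveraging

set_option linter.unusedSectionVars false

variable {S : Type*} [MeasurableSpace S]

/-- The law of an i.i.d. sequence indexed by `ℤ` with marginal `π`. -/
def iidLaw (π : Measure S) [IsProbabilityMeasure π] : Measure (ℤ → S) :=
  Measure.infinitePi fun _ => π

instance (π : Measure S) [IsProbabilityMeasure π] : IsProbabilityMeasure (iidLaw π) :=
  inferInstanceAs (IsProbabilityMeasure (Measure.infinitePi fun _ : ℤ => π))

open Classical in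
/-- The sequence with the coordinates of `ω` on `A` and those of `ω'` off `A`. -/
def mer (A : Set ℤ) (ω ω' : ℤ → S) : ℤ → S := fun i => if i ∈ A then ω i else ω' i

theorem mer_of_mem {A : Set ℤ} {i : ℤ} (h : i ∈ A) (ω ω' : ℤ → S) : mer A ω ω' i = ω i :=
  if_pos h

theorem mer_of_notMem {A : Set ℤ} {i : ℤ} (h : i ∉ A) (ω ω' : ℤ → S) : mer A ω ω' i = ω' i :=
  if_neg h

theorem measurable_mer (A : Set ℤ) :
    Measurable fun p : (ℤ → S) × (ℤ → S) => mer A p.1 p.2 := by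
  refine measurable_pi_lambda _ fun i => ?_
  by_cases h : i ∈ A
  · simp only [mer_of_mem h]; fun_prop
  · simp only [mer_of_notMem h]; fun_prop

theorem measurable_mer_right (A : Set ℤ) (ω : ℤ → S) : Measurable fun ω' => mer A ω ω' :=
  (measurable_mer A).comp measurable_prodMk_left

variable (π : Measure S) [IsProbabilityMeasure π]

/-- A box factors into its sides in `A` and its sides off `A`, and the two arguments are
independent, so the merged sequence is again i.i.d. The properties of `condE` rest on Fubini
together with this invariance. -/
theorem measurePreserving_mer (A : Set ℤ) :
    MeasurePreserving (fun p : (ℤ → S) × (ℤ → S) => mer A p.1 p.2)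
      ((iidLaw π).prod (iidLaw π)) (iidLaw π) := by
  classical
  refine ⟨measurable_mer A, ?_⟩
  refine Measure.eq_infinitePi _ fun s t ht => ?_
  rw [Measure.map_apply (measurable_mer A) (.pi s.countable_toSet fun i _ => ht i)]
  have : (fun p : (ℤ → S) × (ℤ → S) => mer A p.1 p.2) ⁻¹' (Set.pi s t)
      = (Set.pi (s.filter (· ∈ A) : Finset ℤ) t) ×ˢ (Set.pi (s.filter (· ∉ A) : Finset ℤ) t) := by
    ext p
    simp only [Set.mem_preimage, Set.mem_pi, Finset.mem_coe, Set.mem_prod, Finset.mem_filter]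
    constructor
    · intro h
      exact ⟨fun i hi => by simpa only [mer_of_mem hi.2] using h i hi.1,
        fun i hi => by simpa only [mer_of_notMem hi.2] using h i hi.1⟩
    · intro h i hi
      by_cases hA : i ∈ A
      · rw [mer_of_mem hA]; exact h.1 i ⟨hi, hA⟩
      · rw [mer_of_notMem hA]; exact h.2 i ⟨hi, hA⟩
  rw [this, Measure.prod_prod, iidLaw, Measure.infinitePi_pi _ fun i _ => ht i,
    Measure.infinitePi_pi _ fun i _ => ht i, Finset.prod_filter_mul_prod_filter_not]

/-- The time shift. -/
def shift (t : ℤ) (ω : ℤ → S) : ℤ → S := fun i => ω (i + t)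

theorem measurable_shift (t : ℤ) : Measurable (shift t : (ℤ → S) → ℤ → S) := by
  unfold shift; fun_prop

theorem shift_shift (s t : ℤ) (ω : ℤ → S) : shift s (shift t ω) = shift (s + t) ω := by
  funext i; simp [shift, add_assoc]

@[simp] theorem shift_zero (ω : ℤ → S) : shift 0 ω = ω := by
  funext i; simp [shift]

theorem measurePreserving_shift (t : ℤ) :
    MeasurePreserving (shift t : (ℤ → S) → ℤ → S) (iidLaw π) (iidLaw π) :=
  ⟨measurable_shift t, Measure.map_infinitePi_infinitePi_of_inj (P := fun _ : ℤ => π)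
    (f := fun i : ℤ => i + t) (add_left_injective t)⟩

/-- The time shift as a measurable equivalence. -/
def shiftEquiv (t : ℤ) : (ℤ → S) ≃ᵐ (ℤ → S) where
  toFun := shift t
  invFun := shift (-t)
  left_inv ω := by rw [shift_shift]; simp
  right_inv ω := by rw [shift_shift]; simp
  measurable_toFun := measurable_shift t
  measurable_invFun := measurable_shift (-t)

theorem shift_mer (A : Set ℤ) (t : ℤ) (ω ω' : ℤ → S) :
    shift t (mer A ω ω') = mer {i | i + t ∈ A} (shift t ω) (shift t ω') := by
  funext i
  by_cases h : i + t ∈ A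
  · rw [mer_of_mem (A := {i | i + t ∈ A}) h]; exact mer_of_mem h _ _
  · rw [mer_of_notMem (A := {i | i + t ∈ A}) h]; exact mer_of_notMem h _ _

theorem mer_mer (A B : Set ℤ) (ω ω' ω'' : ℤ → S) :
    mer B (mer A ω ω') ω'' = mer (A ∩ B) ω (mer B ω' ω'') := by
  funext i
  by_cases hA : i ∈ A <;> by_cases hB : i ∈ B <;> simp [mer, hA, hB]

theorem DependsOn.apply_mer {β : Type*} {f : (ℤ → S) → β} {A : Set ℤ} (hf : DependsOn f A)
    {B : Set ℤ} (h : A ⊆ B) (ω ω' : ℤ → S) : f (mer B ω ω') = f ω :=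
  hf fun _ hi => mer_of_mem (h hi) _ _

theorem DependsOn.apply_mer_of_disjoint {β : Type*} {f : (ℤ → S) → β} {A : Set ℤ}
    (hf : DependsOn f A) {B : Set ℤ} (h : Disjoint A B) (ω ω' : ℤ → S) :
    f (mer B ω ω') = f ω' :=
  hf fun _ hi => mer_of_notMem (Set.disjoint_left.1 h hi) _ _

variable {E : Type*} [NormedAddCommGroup E] [NormedSpace ℝ E]

/-- The average of `f` over the coordinates off `A`, that is, the conditional expectation of `f`
given the coordinates in `A`. -/
def condE (A : Set ℤ) (f : (ℤ → S) → E) (ω : ℤ → S) : E := ∫ ω', f (mer A ω ω') ∂iidLaw π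

variable {π} {f g : (ℤ → S) → E} {A B : Set ℤ}

theorem stronglyMeasurable_condE (A : Set ℤ) (hf : StronglyMeasurable f) :
    StronglyMeasurable (condE π A f) :=
  StronglyMeasurable.integral_prod_right' (f := fun p : (ℤ → S) × (ℤ → S) => f (mer A p.1 p.2))
    (hf.comp_measurable (measurable_mer A))

theorem dependsOn_condE_inter (hf : DependsOn f B) : DependsOn (condE π A f) (A ∩ B) := by
  intro x y h
  refine integral_congr_ae (Eventually.of_forall fun ω' => hf fun i hi => ?_)
  by_cases hA : i ∈ A
  · simp only [mer_of_mem hA]; exact h i ⟨hA, hi⟩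
  · simp only [mer_of_notMem hA]

theorem dependsOn_condE : DependsOn (condE π A f) A := by
  simpa using dependsOn_condE_inter (π := π) (A := A) (dependsOn_univ f)

theorem condE_of_dependsOn [CompleteSpace E] (hf : DependsOn f B) (h : B ⊆ A) :
    condE π A f = f := by
  funext ω
  simp only [condE, hf.apply_mer h, integral_const, probReal_univ, one_smul]

theorem condE_empty : condE π ∅ f = fun _ => ∫ ω, f ω ∂iidLaw π := by
  funext ω
  refine integral_congr_ae (Eventually.of_forall fun ω' => ?_)
  exact congrArg f (funext fun i => mer_of_notMem (Set.notMem_empty i) _ _)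

theorem ae_integrable_mer (A : Set ℤ) (hf : Integrable f (iidLaw π)) :
    ∀ᵐ ω ∂iidLaw π, Integrable (fun ω' => f (mer A ω ω')) (iidLaw π) :=
  (((measurePreserving_mer π A).integrable_comp_of_integrable hf)).prod_right_ae

theorem integrable_condE (A : Set ℤ) (hf : Integrable f (iidLaw π)) :
    Integrable (condE π A f) (iidLaw π) :=
  Integrable.integral_prod_left (f := fun p : (ℤ → S) × (ℤ → S) => f (mer A p.1 p.2))
    ((measurePreserving_mer π A).integrable_comp_of_integrable hf)

/-- Integrating the merged variables recovers the integral. -/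
theorem integral_integral_mer (A : Set ℤ) (hf : Integrable f (iidLaw π)) :
    ∫ ω, ∫ ω', f (mer A ω ω') ∂iidLaw π ∂iidLaw π = ∫ ω, f ω ∂iidLaw π := by
  have hm := measurePreserving_mer π A
  have h2 := integral_prod _ (hm.integrable_comp_of_integrable hf)
  have h3 := integral_map (μ := (iidLaw π).prod (iidLaw π)) (measurable_mer A).aemeasurable
    (f := f) (by rw [hm.map_eq]; exact hf.aestronglyMeasurable)
  rw [hm.map_eq] at h3
  exact h2.symm.trans h3.symm

theorem integral_condE (A : Set ℤ) (hf : Integrable f (iidLaw π)) :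
    ∫ ω, condE π A f ω ∂iidLaw π = ∫ ω, f ω ∂iidLaw π := integral_integral_mer A hf

theorem condE_add (A : Set ℤ) (hf : Integrable f (iidLaw π)) (hg : Integrable g (iidLaw π)) :
    condE π A (f + g) =ᵐ[iidLaw π] condE π A f + condE π A g := by
  filter_upwards [ae_integrable_mer A hf, ae_integrable_mer A hg] with ω h1 h2
  exact integral_add h1 h2

theorem condE_sub (A : Set ℤ) (hf : Integrable f (iidLaw π)) (hg : Integrable g (iidLaw π)) :
    condE π A (f - g) =ᵐ[iidLaw π] condE π A f - condE π A g := by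
  filter_upwards [ae_integrable_mer A hf, ae_integrable_mer A hg] with ω h1 h2
  exact integral_sub h1 h2

theorem condE_sum {ι : Type*} (A : Set ℤ) (s : Finset ι) {F : ι → (ℤ → S) → E}
    (hF : ∀ i ∈ s, Integrable (F i) (iidLaw π)) :
    condE π A (fun ω => ∑ i ∈ s, F i ω) =ᵐ[iidLaw π] fun ω => ∑ i ∈ s, condE π A (F i) ω := by
  have : ∀ᵐ ω ∂iidLaw π, ∀ i ∈ s, Integrable (fun ω' => F i (mer A ω ω')) (iidLaw π) :=
    (Finset.eventually_all s).2 fun i hi => ae_integrable_mer A (hF i hi)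
  filter_upwards [this] with ω h
  exact integral_finsetSum s h

theorem condE_const_smul {𝕜 : Type*} [RCLike 𝕜] [NormedSpace 𝕜 E] [SMulCommClass ℝ 𝕜 E]
    (A : Set ℤ) (c : 𝕜) (f : (ℤ → S) → E) :
    condE π A (fun ω => c • f ω) = fun ω => c • condE π A f ω := by
  funext ω
  exact integral_smul c _

/-- Independence of the coordinates makes the averages commute, with no nesting of `A` and `B`
required. Two nested merges are one merge along `A ∩ B` by `mer_mer`, and the remaining double
integral collapses by `measurePreserving_mer`. -/
theorem condE_condE (A B : Set ℤ) (hf : Integrable f (iidLaw π)) :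
    condE π A (condE π B f) =ᵐ[iidLaw π] condE π (A ∩ B) f := by
  filter_upwards [ae_integrable_mer (A ∩ B) hf] with ω h
  have hm := (measurePreserving_mer π B)
  have e := hm.map_eq
  have h2 := hm.integrable_comp_of_integrable h
  have h3 := integral_prod _ h2
  calc condE π A (condE π B f) ω
      = ∫ ω', ∫ ω'', f (mer (A ∩ B) ω (mer B ω' ω'')) ∂iidLaw π ∂iidLaw π := by
        simp only [condE, mer_mer]
    _ = ∫ p, f (mer (A ∩ B) ω (mer B p.1 p.2)) ∂((iidLaw π).prod (iidLaw π)) := h3.symm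
    _ = condE π (A ∩ B) f ω := by
        have := integral_map (μ := (iidLaw π).prod (iidLaw π)) (measurable_mer B).aemeasurable
          (f := fun ω' => f (mer (A ∩ B) ω ω')) (by rw [e]; exact h.aestronglyMeasurable)
        rw [e] at this
        exact this.symm

theorem condE_comp_shift (A : Set ℤ) (t : ℤ) (f : (ℤ → S) → E) :
    condE π A (f ∘ shift t) = condE π {i | i + t ∈ A} f ∘ shift t := by
  funext ω
  simp only [condE, Function.comp, shift_mer]
  exact (MeasurePreserving.integral_comp' (f := shiftEquiv t) (measurePreserving_shift π t)
    fun ω' => f (mer {i | i + t ∈ A} (shift t ω) ω'))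

/-- Jensen's inequality, in the form of monotonicity of the `Lᵖ` norms on the probability space of
the averaged coordinates, followed by invariance under merging. -/
theorem eLpNorm_condE_le (A : Set ℤ) (hf : AEStronglyMeasurable f (iidLaw π)) {p : ℝ≥0∞}
    (hp : 1 ≤ p) : eLpNorm (condE π A f) p (iidLaw π) ≤ eLpNorm f p (iidLaw π) := by
  have hm := measurePreserving_mer π A
  have hq := hm.quasiMeasurePreserving
  rcases eq_or_ne p ∞ with rfl | hpt
  · simp only [eLpNorm_exponent_top]
    have h1 : ∀ᵐ ω ∂iidLaw π, ‖f ω‖ₑ ≤ eLpNormEssSup f (iidLaw π) := ae_le_eLpNormEssSup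
    refine eLpNormEssSup_le_of_ae_enorm_bound ?_
    filter_upwards [Measure.ae_ae_of_ae_prod (hq.ae h1)] with ω h2
    calc ‖condE π A f ω‖ₑ ≤ ∫⁻ ω', ‖f (mer A ω ω')‖ₑ ∂iidLaw π :=
          enorm_integral_le_lintegral_enorm _
      _ ≤ ∫⁻ _, eLpNormEssSup f (iidLaw π) ∂iidLaw π := lintegral_mono_ae h2
      _ = _ := by simp
  · have hp0 : p ≠ 0 := (lt_of_lt_of_le one_pos hp).ne'
    have hpr : 0 < p.toReal := ENNReal.toReal_pos hp0 hpt
    rw [eLpNorm_eq_lintegral_rpow_enorm_toReal hp0 hpt,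
      eLpNorm_eq_lintegral_rpow_enorm_toReal hp0 hpt]
    refine ENNReal.rpow_le_rpow ?_ (by positivity)
    have hf2 := hf.comp_quasiMeasurePreserving hq
    calc ∫⁻ ω, ‖condE π A f ω‖ₑ ^ p.toReal ∂iidLaw π
        ≤ ∫⁻ ω, ∫⁻ ω', ‖f (mer A ω ω')‖ₑ ^ p.toReal ∂iidLaw π ∂iidLaw π := by
          refine lintegral_mono_ae ?_
          filter_upwards [hf2.prodMk_left] with ω hω
          have h1 := eLpNorm_le_eLpNorm_of_exponent_le (μ := iidLaw π) hp hω
          rw [eLpNorm_one_eq_lintegral_enorm, eLpNorm_eq_lintegral_rpow_enorm_toReal hp0 hpt] at h1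
          calc ‖condE π A f ω‖ₑ ^ p.toReal
              ≤ (∫⁻ ω', ‖f (mer A ω ω')‖ₑ ∂iidLaw π) ^ p.toReal := by
                gcongr; exact enorm_integral_le_lintegral_enorm _
            _ ≤ ((∫⁻ ω', ‖f (mer A ω ω')‖ₑ ^ p.toReal ∂iidLaw π) ^ (1 / p.toReal)) ^ p.toReal := by
                gcongr; exact h1
            _ = _ := by rw [← ENNReal.rpow_mul, one_div, inv_mul_cancel₀ hpr.ne', ENNReal.rpow_one]
      _ = ∫⁻ p', ‖f (mer A p'.1 p'.2)‖ₑ ^ p.toReal ∂((iidLaw π).prod (iidLaw π)) :=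
          (lintegral_prod _ (hf2.enorm.pow_const _)).symm
      _ = ∫⁻ ω, ‖f ω‖ₑ ^ p.toReal ∂iidLaw π := by
          have h3 : AEMeasurable (fun ω => ‖f ω‖ₑ ^ p.toReal) (iidLaw π) := hf.enorm.pow_const _
          conv_rhs => rw [← hm.map_eq]
          rw [lintegral_map' (by rw [hm.map_eq]; exact h3) (measurable_mer A).aemeasurable]

theorem memLp_condE (A : Set ℤ) (hfm : StronglyMeasurable f) {p : ℝ≥0∞} (hp : 1 ≤ p)
    (hf : MemLp f p (iidLaw π)) : MemLp (condE π A f) p (iidLaw π) :=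
  ⟨(stronglyMeasurable_condE A hfm).aestronglyMeasurable,
    (eLpNorm_condE_le A hf.1 hp).trans_lt hf.2⟩

theorem eLpNorm_comp_shift (hf : AEStronglyMeasurable f (iidLaw π)) (p : ℝ≥0∞) (t : ℤ) :
    eLpNorm (f ∘ shift t) p (iidLaw π) = eLpNorm f p (iidLaw π) :=
  eLpNorm_comp_measurePreserving hf (measurePreserving_shift π t)

theorem integral_comp_shift (f : (ℤ → S) → E) (t : ℤ) :
    ∫ ω, f (shift t ω) ∂iidLaw π = ∫ ω, f ω ∂iidLaw π :=
  MeasurePreserving.integral_comp' (f := shiftEquiv t) (measurePreserving_shift π t) f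

/-- Functions of finitely many coordinates are dense in `Lᵖ`, and each is fixed by `condE π (I n)`
once `I n` contains its coordinates. As the averages are contractions, the error is at most twice
the distance to such a function. The sets `I n` need not increase. -/
theorem tendsto_eLpNorm_condE_sub {p : ℝ≥0∞} (hp : 1 ≤ p) (hpt : p ≠ ∞) [CompleteSpace E]
    (hf : MemLp f p (iidLaw π)) {I : ℕ → Set ℤ} (hI : ∀ F : Finset ℤ, ∀ᶠ n in atTop, ↑F ⊆ I n) :
    Tendsto (fun n => eLpNorm (condE π (I n) f - f) p (iidLaw π)) atTop (𝓝 0) := by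
  classical
  have hdense : ∀ η : ℝ≥0∞, η ≠ 0 → ∃ h : (ℤ → S) → E, eLpNorm (f - h) p (iidLaw π) ≤ η ∧
      (AEStronglyMeasurable h (iidLaw π) ∧ ∃ F : Finset ℤ, DependsOn h (F : Set ℤ)) := by
    intro η hη
    refine MemLp.induction_dense hpt
      (fun h => AEStronglyMeasurable h (iidLaw π) ∧ ∃ F : Finset ℤ, DependsOn h (F : Set ℤ))
      ?_ ?_ (fun f hf => hf.1) hf hη
    -- Indicators: cylinders form a ring that generates the product σ-algebra, so `s` is close in
    -- measure to a cylinder, and the measure of the symmetric difference controls the `Lᵖ`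
    -- distance.
    · intro c s hs _ δ hδ
      obtain ⟨δ', hδ', hδ''⟩ := exists_eLpNorm_indicator_le (μ := iidLaw π) hpt c hδ
      have hδ0 : (0 : ℝ≥0∞) < δ' := by exact_mod_cast hδ'
      obtain ⟨t, ht, hts⟩ := exists_measure_symmDiff_lt_of_generateFrom_isSetRing
        (μ := iidLaw π) (isSetRing_measurableCylinders (α := fun _ : ℤ => S))
        ⟨{Set.univ}, by simp, by simpa using univ_mem_measurableCylinders (fun _ : ℤ => S), by simp⟩
        (generateFrom_measurableCylinders (α := fun _ : ℤ => S)).symm hs hδ0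
      have htm : MeasurableSet t := .of_mem_measurableCylinders ht
      refine ⟨t.indicator fun _ => c, ?_, aestronglyMeasurable_const.indicator htm, ?_⟩
      · have := hδ'' (symmDiff t s) hts.le
        refine le_trans (le_of_eq ?_) this
        refine eLpNorm_congr_norm_ae (Eventually.of_forall fun ω => ?_)
        by_cases h1 : ω ∈ t <;> by_cases h2 : ω ∈ s <;>
          simp [Set.indicator, Set.mem_symmDiff, h1, h2]
      · rw [mem_measurableCylinders] at ht
        obtain ⟨F, U, _, rfl⟩ := ht
        refine ⟨F, fun x y hxy => ?_⟩
        have : F.restrict x = F.restrict y := funext fun i => hxy i i.2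
        simp only [Set.indicator, mem_cylinder, this]
    · rintro u v ⟨hu, F, hF⟩ ⟨hv, F', hF'⟩
      refine ⟨hu.add hv, F ∪ F', fun x y hxy => ?_⟩
      have h1 := hF fun i hi => hxy i (by simp [Finset.mem_coe.1 hi])
      have h2 := hF' fun i hi => hxy i (by simp [Finset.mem_coe.1 hi])
      simp [h1, h2]
  rw [ENNReal.tendsto_nhds_zero]
  intro η hη
  -- The cap at `1` ensures that `f - h`, and hence `h`, lies in `Lᵖ` even when `η = ∞`.
  have hδ : min (η / 2) 1 ≠ 0 := (lt_min (ENNReal.half_pos hη.ne') one_pos).ne'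
  obtain ⟨h, hfh, hm, F, hF⟩ := hdense _ hδ
  have hLh : MemLp h p (iidLaw π) := by
    have : MemLp (f - h) p (iidLaw π) :=
      ⟨hf.1.sub hm, (hfh.trans (min_le_right _ _)).trans_lt ENNReal.one_lt_top⟩
    simpa using hf.sub this
  filter_upwards [hI F] with n hn
  have e1 : condE π (I n) f - f =ᵐ[iidLaw π] condE π (I n) (f - h) - (f - h) := by
    filter_upwards [condE_sub (I n) (hf.integrable hp) (hLh.integrable hp)] with ω hω
    simp only [Pi.sub_apply] at hω ⊢
    rw [hω, condE_of_dependsOn hF hn]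
    abel
  rw [eLpNorm_congr_ae e1]
  have hfhm := hf.1.sub hm
  have hc := integrable_condE (I n) ((hf.sub hLh).integrable hp)
  calc eLpNorm (condE π (I n) (f - h) - (f - h)) p (iidLaw π)
      ≤ eLpNorm (condE π (I n) (f - h)) p (iidLaw π) + eLpNorm (f - h) p (iidLaw π) :=
        eLpNorm_sub_le hc.1 hfhm hp
    _ ≤ η / 2 + η / 2 := add_le_add
        ((eLpNorm_condE_le (I n) hfhm hp).trans (hfh.trans (min_le_left _ _)))
        (hfh.trans (min_le_left _ _))
    _ = η := ENNReal.add_halves η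

end CoordinateAveraging

/-! ### Martingale moment inequalities and covariance bounds -/

section MomentInequalities

set_option linter.unusedSectionVars false

/-! ### Orthogonality and the fourth moment of a sum -/

section Orthogonal

variable {α E : Type*} [MeasurableSpace α] {μ : Measure α} [NormedAddCommGroup E]
  [InnerProductSpace ℝ E]

theorem eLpNorm_two_sq_eq {f : α → E} (hf : MemLp f 2 μ) :
    eLpNorm f 2 μ ^ 2 = ENNReal.ofReal (∫ x, ‖f x‖ ^ 2 ∂μ) := by
  rw [eLpNorm_eq_lintegral_rpow_enorm_toReal two_ne_zero (by simp),
    ofReal_integral_eq_lintegral_ofReal (by simpa using hf.integrable_norm_pow two_ne_zero)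
      (Eventually.of_forall fun x => by positivity)]
  simp only [ENNReal.toReal_ofNat, ENNReal.rpow_ofNat]
  rw [← ENNReal.rpow_natCast, ← ENNReal.rpow_mul]
  norm_num

theorem eLpNorm_four_pow_eq {f : α → E} (hf : MemLp f 4 μ) :
    eLpNorm f 4 μ ^ 4 = ENNReal.ofReal (∫ x, ‖f x‖ ^ 4 ∂μ) := by
  rw [eLpNorm_eq_lintegral_rpow_enorm_toReal four_ne_zero (by simp),
    ofReal_integral_eq_lintegral_ofReal (by simpa using hf.integrable_norm_pow four_ne_zero)
      (Eventually.of_forall fun x => by positivity)]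
  simp only [ENNReal.toReal_ofNat, ENNReal.rpow_ofNat]
  rw [← ENNReal.rpow_natCast, ← ENNReal.rpow_mul]
  norm_num

theorem integrable_inner_of_memLp_two {M D : α → E} (hM : MemLp M 2 μ) (hD : MemLp D 2 μ) :
    Integrable (fun x => ⟪M x, D x⟫_ℝ) μ := by
  have iM : Integrable (fun x => ‖M x‖ ^ 2) μ := by simpa using hM.integrable_norm_pow two_ne_zero
  have iD : Integrable (fun x => ‖D x‖ ^ 2) μ := by simpa using hD.integrable_norm_pow two_ne_zero
  refine (iM.add iD).mono' (hM.1.inner hD.1) (Eventually.of_forall fun x => ?_)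
  have := norm_inner_le_norm (𝕜 := ℝ) (M x) (D x)
  simp only [Pi.add_apply]
  nlinarith [sq_nonneg (‖M x‖ - ‖D x‖), sq_nonneg (‖M x‖), sq_nonneg (‖D x‖)]

theorem integrable_inner_of_memLp_four {M D : α → E} (hM : MemLp M 4 μ) (hD : MemLp D 4 μ) :
    Integrable (fun x => ⟪‖M x‖ ^ 2 • M x, D x⟫_ℝ) μ := by
  have iM : Integrable (fun x => ‖M x‖ ^ 4) μ := by simpa using hM.integrable_norm_pow four_ne_zero
  have iD : Integrable (fun x => ‖D x‖ ^ 4) μ := by simpa using hD.integrable_norm_pow four_ne_zero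
  refine (iM.add iD).mono' (((hM.1.norm.pow 2).smul hM.1).inner hD.1)
    (Eventually.of_forall fun x => ?_)
  rw [real_inner_smul_left, norm_mul, norm_pow, norm_norm]
  have h1 := norm_inner_le_norm (𝕜 := ℝ) (M x) (D x)
  have ha := norm_nonneg (M x)
  have hb := norm_nonneg (D x)
  simp only [Pi.add_apply]
  calc ‖M x‖ ^ 2 * ‖⟪M x, D x⟫_ℝ‖ ≤ ‖M x‖ ^ 2 * (‖M x‖ * ‖D x‖) := by gcongr
    _ ≤ ‖M x‖ ^ 4 + ‖D x‖ ^ 4 := by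
      generalize ‖M x‖ = a at *
      generalize ‖D x‖ = c at *
      nlinarith [sq_nonneg (a ^ 2 - c ^ 2), sq_nonneg (a ^ 2 - a * c), sq_nonneg (a * c),
        sq_nonneg (a ^ 2), sq_nonneg (c ^ 2)]

theorem eLpNorm_two_add_sq_le {M D : α → E} (hM : MemLp M 2 μ) (hD : MemLp D 2 μ)
    (h : ∫ x, ⟪M x, D x⟫_ℝ ∂μ = 0) :
    eLpNorm (M + D) 2 μ ^ 2 ≤ eLpNorm M 2 μ ^ 2 + eLpNorm D 2 μ ^ 2 := by
  have iM : Integrable (fun x => ‖M x‖ ^ 2) μ := by simpa using hM.integrable_norm_pow two_ne_zero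
  have iD : Integrable (fun x => ‖D x‖ ^ 2) μ := by simpa using hD.integrable_norm_pow two_ne_zero
  have iMD : Integrable (fun x => ⟪M x, D x⟫_ℝ) μ := integrable_inner_of_memLp_two hM hD
  have i1 : Integrable (fun x => ‖M x‖ ^ 2 + 2 * ⟪M x, D x⟫_ℝ) μ := iM.add (iMD.const_mul 2)
  rw [eLpNorm_two_sq_eq hM, eLpNorm_two_sq_eq hD, eLpNorm_two_sq_eq (hM.add hD),
    ← ENNReal.ofReal_add (by positivity) (by positivity)]
  refine ENNReal.ofReal_le_ofReal (le_of_eq ?_)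
  simp only [Pi.add_apply, norm_add_sq_real]
  rw [integral_add i1 iD, integral_add iM (iMD.const_mul 2),
    integral_const_mul, h]
  ring

/-- The `L⁴` substitute for Pythagoras. The orthogonality hypothesis removes the term of first order
in `D` from `E‖M + D‖⁴`, and what is left is dominated by a perfect square. Iterating this single
step gives a Burkholder inequality. -/
theorem eLpNorm_four_add_sq_le {M D : α → E} (hM : MemLp M 4 μ) (hD : MemLp D 4 μ)
    (h : ∫ x, ⟪‖M x‖ ^ 2 • M x, D x⟫_ℝ ∂μ = 0) :
    eLpNorm (M + D) 4 μ ^ 2 ≤ eLpNorm M 4 μ ^ 2 + 4 * eLpNorm D 4 μ ^ 2 := by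
  have iM : Integrable (fun x => ‖M x‖ ^ 4) μ := by simpa using hM.integrable_norm_pow four_ne_zero
  have iD : Integrable (fun x => ‖D x‖ ^ 4) μ := by simpa using hD.integrable_norm_pow four_ne_zero
  have iMD4 : Integrable (fun x => ‖(M + D) x‖ ^ 4) μ := by
    simpa using (hM.add hD).integrable_norm_pow four_ne_zero
  have hi := integrable_inner_of_memLp_four hM hD
  have sq4 : ∀ {f : α → E}, MemLp f 4 μ → MemLp (fun x => ‖f x‖ ^ 2) 2 μ := by
    intro f hf
    have h2 := hf.norm_rpow_div 2
    simp only [ENNReal.toReal_ofNat, Real.rpow_ofNat] at h2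
    convert h2 using 1
    rw [show (4 : ℝ≥0∞) = 2 * 2 by norm_num, ENNReal.mul_div_cancel_right (by simp) (by simp)]
  have hM2 := sq4 hM
  have hD2 := sq4 hD
  have iX : Integrable (fun x => ‖M x‖ ^ 2 * ‖D x‖ ^ 2) μ := hM2.integrable_mul hD2
  set m := ∫ x, ‖M x‖ ^ 4 ∂μ with hm
  set d := ∫ x, ‖D x‖ ^ 4 ∂μ with hd
  have hm0 : 0 ≤ m := integral_nonneg fun x => by positivity
  have hd0 : 0 ≤ d := integral_nonneg fun x => by positivity
  have hCS : ∫ x, ‖M x‖ ^ 2 * ‖D x‖ ^ 2 ∂μ ≤ √m * √d := by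
    have := integral_mul_le_Lp_mul_Lq_of_nonneg (μ := μ) (p := 2) (q := 2)
      Real.HolderConjugate.two_two (f := fun x => ‖M x‖ ^ 2) (g := fun x => ‖D x‖ ^ 2)
      (Eventually.of_forall fun x => by positivity) (Eventually.of_forall fun x => by positivity)
      (by simpa using hM2) (by simpa using hD2)
    simp only [Real.rpow_ofNat, ← pow_mul] at this
    norm_num at this
    rw [Real.sqrt_eq_rpow, Real.sqrt_eq_rpow]
    exact this
  -- The pointwise bound and Cauchy–Schwarz give `m + 8 √m √d + 3 d`, which is below `(√m + 4 √d)²`.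
  -- The constant `4` of the statement is half of this `8`.
  have key : ∫ x, ‖(M + D) x‖ ^ 4 ∂μ ≤ (√m + 4 * √d) ^ 2 := by
    have hpt : ∀ x, ‖(M + D) x‖ ^ 4 ≤ ‖M x‖ ^ 4 + 4 * ⟪‖M x‖ ^ 2 • M x, D x⟫_ℝ
        + 8 * (‖M x‖ ^ 2 * ‖D x‖ ^ 2) + 3 * ‖D x‖ ^ 4 := by
      intro x
      have e : ‖(M + D) x‖ ^ 4 = (‖M x‖ ^ 2 + 2 * ⟪M x, D x⟫_ℝ + ‖D x‖ ^ 2) ^ 2 := by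
        rw [← norm_add_sq_real]; simp only [Pi.add_apply]; ring
      rw [e, real_inner_smul_left]
      have hx := abs_real_inner_le_norm (M x) (D x)
      have ha := norm_nonneg (M x)
      have hb := norm_nonneg (D x)
      obtain ⟨h1, h2⟩ := abs_le.1 hx
      generalize ⟪M x, D x⟫_ℝ = y at *
      generalize ‖M x‖ = a at *
      generalize ‖D x‖ = c at *
      have hy2 : y ^ 2 ≤ (a * c) ^ 2 := by nlinarith [mul_nonneg ha hb]
      have hyc : y * c ^ 2 ≤ a * c * c ^ 2 := by gcongr
      nlinarith [sq_nonneg (a * c - c ^ 2)]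
    have i1 : Integrable (fun x => ‖M x‖ ^ 4 + 4 * ⟪‖M x‖ ^ 2 • M x, D x⟫_ℝ) μ :=
      iM.add (hi.const_mul 4)
    have i2 : Integrable (fun x => ‖M x‖ ^ 4 + 4 * ⟪‖M x‖ ^ 2 • M x, D x⟫_ℝ
        + 8 * (‖M x‖ ^ 2 * ‖D x‖ ^ 2)) μ := i1.add (iX.const_mul 8)
    have h1 := integral_mono iMD4 (i2.add (iD.const_mul 3)) hpt
    simp only [Pi.add_apply] at h1
    rw [integral_add i2 (iD.const_mul 3), integral_add i1 (iX.const_mul 8),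
      integral_add iM (hi.const_mul 4), integral_const_mul, integral_const_mul, integral_const_mul,
      h] at h1
    have e1 := Real.sq_sqrt hm0
    have e2 := Real.sq_sqrt hd0
    rw [← hm, ← hd] at h1
    simp only [Pi.add_apply]
    have e3 : (√m + 4 * √d) ^ 2 = m + 8 * (√m * √d) + 16 * d := by rw [← e1, ← e2]; simp; ring
    linarith
  have hfin : ∀ {f : α → E}, MemLp f 4 μ → eLpNorm f 4 μ ^ 2
      = ENNReal.ofReal (√(∫ x, ‖f x‖ ^ 4 ∂μ)) := by
    intro f hf
    have h4 := eLpNorm_four_pow_eq hf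
    have hI : 0 ≤ ∫ x, ‖f x‖ ^ 4 ∂μ := integral_nonneg fun x => by positivity
    have : (eLpNorm f 4 μ ^ 2) ^ 2 = ENNReal.ofReal (√(∫ x, ‖f x‖ ^ 4 ∂μ)) ^ 2 := by
      rw [← ENNReal.ofReal_pow (Real.sqrt_nonneg _), Real.sq_sqrt hI, ← h4, ← pow_mul]
    exact (ENNReal.pow_right_strictMono two_ne_zero).injective this
  rw [hfin hM, hfin hD, hfin (hM.add hD), ← hm, ← hd]
  rw [show (4 : ℝ≥0∞) = ENNReal.ofReal 4 by norm_num, ← ENNReal.ofReal_mul (by norm_num),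
    ← ENNReal.ofReal_add (by positivity) (by positivity)]
  exact ENNReal.ofReal_le_ofReal (Real.sqrt_le_left (by positivity) |>.2 key)

end Orthogonal

/-! ### Martingale differences along the coordinates -/

variable {S : Type*} [MeasurableSpace S] {π : Measure S} [IsProbabilityMeasure π]

section Bilinear

variable {E F G : Type*} [NormedAddCommGroup E] [NormedSpace ℝ E] [CompleteSpace E]
  [NormedAddCommGroup F] [NormedSpace ℝ F] [CompleteSpace F]
  [NormedAddCommGroup G] [NormedSpace ℝ G] [CompleteSpace G]

/-- As `M` is a function of the coordinates in `A`, it is constant in the inner integral of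
`integral_integral_mer`, and a bounded linear map commutes with that integral. -/
theorem integral_bilin_condE (b : E →L[ℝ] F →L[ℝ] G) {M : (ℤ → S) → E} {D : (ℤ → S) → F}
    {A : Set ℤ} (hM : DependsOn M A) (hi : Integrable (fun ω => b (M ω) (D ω)) (iidLaw π))
    (hD : Integrable D (iidLaw π)) :
    ∫ ω, b (M ω) (D ω) ∂iidLaw π = ∫ ω, b (M ω) (condE π A D ω) ∂iidLaw π := by
  rw [← integral_integral_mer A hi]
  refine integral_congr_ae ?_
  filter_upwards [ae_integrable_mer A hD] with ω hω
  simp only [hM.apply_mer subset_rfl]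
  exact (b (M ω)).integral_comp_comm hω

theorem integral_bilin_eq_zero (b : E →L[ℝ] F →L[ℝ] G) {M : (ℤ → S) → E} {D : (ℤ → S) → F}
    {A : Set ℤ} (hM : DependsOn M A) (hi : Integrable (fun ω => b (M ω) (D ω)) (iidLaw π))
    (hD : Integrable D (iidLaw π)) (h0 : condE π A D =ᵐ[iidLaw π] 0) :
    ∫ ω, b (M ω) (D ω) ∂iidLaw π = 0 := by
  rw [integral_bilin_condE b hM hi hD]
  rw [integral_congr_ae (g := fun _ => 0) (h0.mono fun ω hω => by simp [hω])]
  simp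

end Bilinear

/-- The increment of the conditional expectations of `f` given the past when the coordinate `k`
is revealed. -/
def coordProj {E : Type*} [NormedAddCommGroup E] [NormedSpace ℝ E] (π : Measure S)
    [IsProbabilityMeasure π] (k : ℤ) (f : (ℤ → S) → E) : (ℤ → S) → E :=
  condE π (Set.Iic k) f - condE π (Set.Iic (k - 1)) f

section Projections

variable {E : Type*} [NormedAddCommGroup E] [NormedSpace ℝ E] [CompleteSpace E]
  {f : (ℤ → S) → E}

theorem integrable_coordProj (k : ℤ) (hf : Integrable f (iidLaw π)) :
    Integrable (coordProj π k f) (iidLaw π) :=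
  (integrable_condE _ hf).sub (integrable_condE _ hf)

/-- Averaging out the coordinate `k` and conditioning on `Iic k` amounts to conditioning on `Iic (k
- 1)`. So the increment is a conditional expectation of `f - condE π {k}ᶜ f`, and its norm is at
most the effect of averaging out one innovation, which is what the dependence coefficients measure.
-/
theorem coordProj_ae_eq (k : ℤ) (hf : Integrable f (iidLaw π)) :
    coordProj π k f =ᵐ[iidLaw π] condE π (Set.Iic k) (f - condE π {k}ᶜ f) := by
  have h1 := condE_condE (Set.Iic k) {k}ᶜ hf
  have h2 := condE_sub (Set.Iic k) hf (integrable_condE {k}ᶜ hf)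
  have h3 : Set.Iic k ∩ {k}ᶜ = Set.Iic (k - 1) := by
    ext i; simp only [Set.mem_inter_iff, Set.mem_Iic, Set.mem_compl_iff, Set.mem_singleton_iff]
    omega
  rw [h3] at h1
  filter_upwards [h1, h2] with ω e1 e2
  rw [e2]
  simp only [coordProj, Pi.sub_apply, e1]

theorem eLpNorm_coordProj_le (k : ℤ) {p : ℝ≥0∞} (hp : 1 ≤ p) (hf : Integrable f (iidLaw π)) :
    eLpNorm (coordProj π k f) p (iidLaw π) ≤ eLpNorm (f - condE π {k}ᶜ f) p (iidLaw π) := by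
  rw [eLpNorm_congr_ae (coordProj_ae_eq k hf)]
  exact eLpNorm_condE_le _ (hf.1.sub (integrable_condE _ hf).1) hp

theorem coordProj_sum {ι : Type*} (k : ℤ) (s : Finset ι) {F : ι → (ℤ → S) → E}
    (hF : ∀ i ∈ s, Integrable (F i) (iidLaw π)) :
    coordProj π k (fun ω => ∑ i ∈ s, F i ω)
      =ᵐ[iidLaw π] fun ω => ∑ i ∈ s, coordProj π k (F i) ω := by
  filter_upwards [condE_sum (Set.Iic k) s hF, condE_sum (Set.Iic (k - 1)) s hF] with ω h1 h2
  simp only [coordProj, Pi.sub_apply, h1, h2, Finset.sum_sub_distrib]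

theorem coordProj_const_smul {𝕜 : Type*} [RCLike 𝕜] [NormedSpace 𝕜 E] [SMulCommClass ℝ 𝕜 E]
    (k : ℤ) (c : 𝕜) (f : (ℤ → S) → E) :
    coordProj π k (fun ω => c • f ω) = fun ω => c • coordProj π k f ω := by
  funext ω
  simp only [coordProj, condE_const_smul, Pi.sub_apply, smul_sub]

theorem coordProj_comp_shift (k t : ℤ) (f : (ℤ → S) → E) :
    coordProj π k (f ∘ shift t) = coordProj π (k - t) f ∘ shift t := by
  have h : ∀ j : ℤ, {i : ℤ | i + t ∈ Set.Iic j} = Set.Iic (j - t) := fun j => by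
    ext i; simp only [Set.mem_ofPred_eq, Set.mem_Iic]; omega
  rw [coordProj, condE_comp_shift, condE_comp_shift, h, h, coordProj,
    show k - 1 - t = k - t - 1 by ring]
  rfl

/-- The conditional expectation of `f` given the coordinates `a, …, a + j - 1`. -/
def windowE (π : Measure S) [IsProbabilityMeasure π] (f : (ℤ → S) → E) (a : ℤ) (j : ℕ) :
    (ℤ → S) → E := condE π (Set.Ico a (a + j)) f

theorem windowE_zero (a : ℤ) : windowE π f a 0 = fun _ => ∫ ω, f ω ∂iidLaw π := by
  simp [windowE, condE_empty]

/-- The increments over growing windows are martingale differences. Starting from the empty window,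
where `windowE` is the mean, avoids a filtration that begins at `-∞`. -/
theorem condE_windowE_succ_sub (a : ℤ) (j : ℕ) (hf : Integrable f (iidLaw π)) :
    condE π (Set.Ico a (a + j)) (windowE π f a (j + 1) - windowE π f a j) =ᵐ[iidLaw π] 0 := by
  have h1 := condE_condE (Set.Ico a (a + j)) (Set.Ico a (a + (j + 1 : ℕ))) hf
  have h2 := condE_condE (Set.Ico a (a + j)) (Set.Ico a (a + j)) hf
  have h3 := condE_sub (Set.Ico a (a + j)) (integrable_condE (Set.Ico a (a + (j + 1 : ℕ))) hf)
    (integrable_condE (Set.Ico a (a + j)) hf)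
  have e : Set.Ico a (a + j) ∩ Set.Ico a (a + (j + 1 : ℕ)) = Set.Ico a (a + j) := by
    ext i; simp only [Set.mem_inter_iff, Set.mem_Ico]; push_cast; omega
  rw [e] at h1
  rw [Set.inter_self] at h2
  filter_upwards [h1, h2, h3] with ω e1 e2 e3
  simp only [windowE]
  rw [e3, Pi.sub_apply, e1, e2, sub_self]; rfl

/-- Intersecting two consecutive half-lines with `Ici a` gives two consecutive windows. The window
increment is thus an average of the increment `coordProj` and inherits its norm bound. -/
theorem windowE_succ_sub_ae_eq (a : ℤ) (j : ℕ) (hf : Integrable f (iidLaw π)) :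
    windowE π f a (j + 1) - windowE π f a j
      =ᵐ[iidLaw π] condE π (Set.Ici a) (coordProj π (a + j) f) := by
  have h1 := condE_condE (Set.Ici a) (Set.Iic (a + j)) hf
  have h2 := condE_condE (Set.Ici a) (Set.Iic (a + j - 1)) hf
  have h3 := condE_sub (Set.Ici a) (integrable_condE (Set.Iic (a + j)) hf)
    (integrable_condE (Set.Iic (a + j - 1)) hf)
  have e1 : Set.Ici a ∩ Set.Iic (a + j) = Set.Ico a (a + (j + 1 : ℕ)) := by
    ext i; simp only [Set.mem_inter_iff, Set.mem_Ico, Set.mem_Iic, Set.mem_Ici]; push_cast; omega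
  have e2 : Set.Ici a ∩ Set.Iic (a + j - 1) = Set.Ico a (a + j) := by
    ext i; simp only [Set.mem_inter_iff, Set.mem_Ico, Set.mem_Iic, Set.mem_Ici]; omega
  rw [e1] at h1
  rw [e2] at h2
  filter_upwards [h1, h2, h3] with ω k1 k2 k3
  simp only [coordProj, windowE, Pi.sub_apply] at k3 ⊢
  rw [k3, k1, k2]

theorem eLpNorm_windowE_succ_sub_le (a : ℤ) (j : ℕ) (hf : Integrable f (iidLaw π)) {p : ℝ≥0∞}
    (hp : 1 ≤ p) : eLpNorm (windowE π f a (j + 1) - windowE π f a j) p (iidLaw π)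
      ≤ eLpNorm (coordProj π (a + j) f) p (iidLaw π) := by
  rw [eLpNorm_congr_ae (windowE_succ_sub_ae_eq a j hf)]
  exact eLpNorm_condE_le _ (integrable_coordProj _ hf).1 hp

theorem tendsto_windowE {p : ℝ≥0∞} (hp : 1 ≤ p) (hpt : p ≠ ∞) (hf : MemLp f p (iidLaw π)) :
    Tendsto (fun n : ℕ => eLpNorm (windowE π f (-n) (2 * n + 1) - f) p (iidLaw π))
      atTop (𝓝 0) := by
  refine tendsto_eLpNorm_condE_sub hp hpt hf fun F => ?_
  obtain ⟨N, hN⟩ : ∃ N : ℕ, ∀ i ∈ F, i.natAbs ≤ N :=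
    ⟨F.sup Int.natAbs, fun i hi => Finset.le_sup (f := Int.natAbs) hi⟩
  filter_upwards [eventually_ge_atTop N] with n hn i hi
  have := hN i hi
  simp only [Set.mem_Ico]
  push_cast
  omega

end Projections

section Moments

variable {E : Type*} [NormedAddCommGroup E] [InnerProductSpace ℝ E] [CompleteSpace E]
  {f : (ℤ → S) → E}

theorem memLp_windowE (hfm : StronglyMeasurable f) {p : ℝ≥0∞} (hp : 1 ≤ p)
    (hf : MemLp f p (iidLaw π)) (a : ℤ) (j : ℕ) : MemLp (windowE π f a j) p (iidLaw π) :=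
  memLp_condE _ hfm hp hf

/-- Burkholder's inequality by induction on the length of the window. For `r = 4` the vector `‖M‖²
M` is again a function of the earlier coordinates, so the hypothesis of `eLpNorm_four_add_sq_le`
holds at every step; for `r = 2` Pythagoras gives the constant `1`, relaxed to `4`. -/
theorem eLpNorm_windowE_sub_sq_le (hfm : StronglyMeasurable f) {r : ℝ≥0∞} (hr : r = 2 ∨ r = 4)
    (hf : MemLp f r (iidLaw π)) (a : ℤ) (j : ℕ) :
    eLpNorm (windowE π f a j - windowE π f a 0) r (iidLaw π) ^ 2
      ≤ 4 * ∑ i ∈ Finset.range j, eLpNorm (coordProj π (a + i) f) r (iidLaw π) ^ 2 := by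
  have hr1 : 1 ≤ r := by rcases hr with rfl | rfl <;> norm_num
  have hfi := hf.integrable hr1
  induction j with
  | zero => simp
  | succ j ih =>
    have hW := fun j => memLp_windowE hfm hr1 hf a j
    have hM : MemLp (windowE π f a j - windowE π f a 0) r (iidLaw π) := (hW j).sub (hW 0)
    have hD : MemLp (windowE π f a (j + 1) - windowE π f a j) r (iidLaw π) := (hW _).sub (hW j)
    have hdep : DependsOn (windowE π f a j - windowE π f a 0) (Set.Ico a (a + j)) := by
      intro x y h
      have h1 : windowE π f a j x = windowE π f a j y := dependsOn_condE h
      simp only [Pi.sub_apply, h1, windowE_zero]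
    have hD0 := condE_windowE_succ_sub a j hfi
    have hDi := hD.integrable hr1
    have hstep : eLpNorm (windowE π f a (j + 1) - windowE π f a 0) r (iidLaw π) ^ 2
        ≤ eLpNorm (windowE π f a j - windowE π f a 0) r (iidLaw π) ^ 2
          + 4 * eLpNorm (windowE π f a (j + 1) - windowE π f a j) r (iidLaw π) ^ 2 := by
      have e : windowE π f a (j + 1) - windowE π f a 0
          = (windowE π f a j - windowE π f a 0) + (windowE π f a (j + 1) - windowE π f a j) := by
        abel
      rw [e]
      rcases hr with rfl | rfl
      · refine (eLpNorm_two_add_sq_le hM hD ?_).trans ?_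
        · exact integral_bilin_eq_zero (innerSL ℝ) hdep (integrable_inner_of_memLp_two hM hD) hDi hD0
        · gcongr
          exact le_mul_of_one_le_left (by simp) (by norm_num)
      · have hi := integrable_inner_of_memLp_four hM hD
        refine eLpNorm_four_add_sq_le hM hD ?_
        refine integral_bilin_eq_zero (innerSL ℝ) (M := fun ω =>
          ‖(windowE π f a j - windowE π f a 0) ω‖ ^ 2 •
            (windowE π f a j - windowE π f a 0) ω) ?_ hi hDi hD0
        intro x y h
        simp only [hdep h]
    rw [Finset.sum_range_succ, mul_add]
    refine hstep.trans ?_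
    gcongr
    exact eLpNorm_windowE_succ_sub_le a j hfi hr1

/-- An Efron–Stein type inequality in `L²` and `L⁴`. -/
theorem eLpNorm_sub_integral_sq_le (hfm : StronglyMeasurable f) {r : ℝ≥0∞} (hr : r = 2 ∨ r = 4)
    (hf : MemLp f r (iidLaw π)) :
    eLpNorm (fun ω => f ω - ∫ ω', f ω' ∂iidLaw π) r (iidLaw π) ^ 2
      ≤ 4 * ∑' k : ℤ, eLpNorm (coordProj π k f) r (iidLaw π) ^ 2 := by
  have hr1 : 1 ≤ r := by rcases hr with rfl | rfl <;> norm_num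
  have hrt : r ≠ ∞ := by rcases hr with rfl | rfl <;> simp
  set B := 4 * ∑' k : ℤ, eLpNorm (coordProj π k f) r (iidLaw π) ^ 2 with hB
  have h1 : ∀ n : ℕ, eLpNorm (windowE π f (-n) (2 * n + 1) - windowE π f (-n) 0) r (iidLaw π)
      ≤ B ^ (1 / 2 : ℝ) := by
    intro n
    have h2 : eLpNorm (windowE π f (-n) (2 * n + 1) - windowE π f (-n) 0) r (iidLaw π) ^ 2
        ≤ B := by
      refine (eLpNorm_windowE_sub_sq_le hfm hr hf _ _).trans ?_
      rw [hB]
      gcongr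
      have hinj : Function.Injective (fun i : ℕ => (-n : ℤ) + i) := fun i j h => by
        simpa using h
      calc ∑ i ∈ Finset.range (2 * n + 1), eLpNorm (coordProj π (-n + i) f) r (iidLaw π) ^ 2
          ≤ ∑' i : ℕ, eLpNorm (coordProj π (-n + i) f) r (iidLaw π) ^ 2 :=
            ENNReal.sum_le_tsum _
        _ ≤ _ := ENNReal.tsum_comp_le_tsum_of_injective hinj
            (fun k => eLpNorm (coordProj π k f) r (iidLaw π) ^ 2)
    calc eLpNorm (windowE π f (-n) (2 * n + 1) - windowE π f (-n) 0) r (iidLaw π)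
        = (eLpNorm (windowE π f (-n) (2 * n + 1) - windowE π f (-n) 0) r (iidLaw π) ^ 2)
            ^ (1 / 2 : ℝ) := by
          rw [← ENNReal.rpow_natCast, ← ENNReal.rpow_mul]; norm_num
      _ ≤ _ := by gcongr
  -- The bound `B` does not depend on the window, which now exhausts `ℤ`.
  have h3 : eLpNorm (fun ω => f ω - ∫ ω', f ω' ∂iidLaw π) r (iidLaw π) ≤ B ^ (1 / 2 : ℝ) := by
    have ht := (tendsto_windowE hr1 hrt hf).add_const (B ^ (1 / 2 : ℝ))
    rw [zero_add] at ht
    refine ge_of_tendsto' ht fun n => ?_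
    have hW := memLp_windowE hfm hr1 hf (-n) (2 * n + 1)
    have hW0 := memLp_windowE hfm hr1 hf (-n) 0
    calc eLpNorm (fun ω => f ω - ∫ ω', f ω' ∂iidLaw π) r (iidLaw π)
        = eLpNorm ((f - windowE π f (-n) (2 * n + 1))
          + (windowE π f (-n) (2 * n + 1) - windowE π f (-n) 0)) r (iidLaw π) := by
          congr 1; funext ω; simp [windowE_zero]
      _ ≤ _ := (eLpNorm_add_le (hf.sub hW).1 (hW.sub hW0).1 hr1)
      _ ≤ _ := by
          rw [eLpNorm_sub_comm]
          gcongr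
          exact h1 n
  calc eLpNorm (fun ω => f ω - ∫ ω', f ω' ∂iidLaw π) r (iidLaw π) ^ 2
      ≤ (B ^ (1 / 2 : ℝ)) ^ 2 := by gcongr
    _ = B := by rw [← ENNReal.rpow_natCast, ← ENNReal.rpow_mul]; norm_num

end Moments

section Covariance

variable {E F G : Type*} [NormedAddCommGroup E] [NormedSpace ℝ E] [CompleteSpace E]
  [NormedAddCommGroup F] [NormedSpace ℝ F] [CompleteSpace F]
  [NormedAddCommGroup G] [NormedSpace ℝ G] [CompleteSpace G]

theorem enorm_bilin_le {b : E →L[ℝ] F →L[ℝ] G} (hb : ∀ x y, ‖b x y‖ ≤ ‖x‖ * ‖y‖) {α : Type*}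
    [MeasurableSpace α] {μ : Measure α} {X : α → E} {Y : α → F} (hX : AEStronglyMeasurable X μ)
    (hY : AEStronglyMeasurable Y μ) :
    ‖∫ x, b (X x) (Y x) ∂μ‖ₑ ≤ eLpNorm X 2 μ * eLpNorm Y 2 μ := by
  refine (enorm_integral_le_lintegral_enorm _).trans ?_
  rw [← eLpNorm_one_eq_lintegral_enorm]
  have := eLpNorm_le_eLpNorm_mul_eLpNorm'_of_norm (p := 2) (q := 2) (r := 1) hX hY
    (fun x y => b x y) 1 (Eventually.of_forall fun x => by simpa using hb (X x) (Y x))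
  simpa using this

theorem integrable_bilin (b : E →L[ℝ] F →L[ℝ] G) {α : Type*} [MeasurableSpace α] {μ : Measure α}
    {X : α → E} {Y : α → F} (hX : MemLp X 2 μ) (hY : MemLp Y 2 μ) :
    Integrable (fun x => b (X x) (Y x)) μ := by
  rw [← memLp_one_iff_integrable]
  exact hX.of_bilin (p := 2) (q := 2) (r := 1) (fun x y => b x y) ‖b‖₊ hY
    (b.aestronglyMeasurable_comp₂ hX.1 hY.1)
    (Eventually.of_forall fun x => b.le_opNorm₂ (X x) (Y x))

variable {X : (ℤ → S) → E} {Y : (ℤ → S) → F}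

/-- When the window grows by one coordinate, the two mixed terms pair a function of the old window
with a martingale difference and integrate to zero; only the diagonal terms remain. The empty window
contributes nothing because one of the means vanishes. -/
theorem integral_bilin_windowE (b : E →L[ℝ] F →L[ℝ] G) (hXm : StronglyMeasurable X)
    (hYm : StronglyMeasurable Y) (hX : MemLp X 2 (iidLaw π)) (hY : MemLp Y 2 (iidLaw π))
    (h0 : ∫ ω, X ω ∂iidLaw π = 0) (a : ℤ) (j : ℕ) :
    ∫ ω, b (windowE π X a j ω) (windowE π Y a j ω) ∂iidLaw π
      = ∑ i ∈ Finset.range j, ∫ ω, b ((windowE π X a (i + 1) - windowE π X a i) ω)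
          ((windowE π Y a (i + 1) - windowE π Y a i) ω) ∂iidLaw π := by
  have hXi := hX.integrable one_le_two
  have hYi := hY.integrable one_le_two
  have hWX : ∀ j, MemLp (windowE π X a j) 2 (iidLaw π) := fun j =>
    memLp_condE _ hXm one_le_two hX
  have hWY : ∀ j, MemLp (windowE π Y a j) 2 (iidLaw π) := fun j =>
    memLp_condE _ hYm one_le_two hY
  induction j with
  | zero => simp [windowE_zero, h0]
  | succ j ih =>
    rw [Finset.sum_range_succ, ← ih]
    set DX := windowE π X a (j + 1) - windowE π X a j with hDX
    set DY := windowE π Y a (j + 1) - windowE π Y a j with hDY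
    have hDXL : MemLp DX 2 (iidLaw π) := (hWX _).sub (hWX _)
    have hDYL : MemLp DY 2 (iidLaw π) := (hWY _).sub (hWY _)
    have e : ∀ ω, b (windowE π X a (j + 1) ω) (windowE π Y a (j + 1) ω)
        = b (windowE π X a j ω) (windowE π Y a j ω) + b (DX ω) (DY ω)
          + b (windowE π X a j ω) (DY ω) + b.flip (windowE π Y a j ω) (DX ω) := by
      intro ω
      simp only [hDX, hDY, Pi.sub_apply, map_sub, sub_apply,
        ContinuousLinearMap.flip_apply]
      abel
    simp only [e]
    have i1 := integrable_bilin b (hWX j) (hWY j)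
    have i2 := integrable_bilin b hDXL hDYL
    have i3 := integrable_bilin b (hWX j) hDYL
    have i4 := integrable_bilin b.flip (hWY j) hDXL
    have i12 : Integrable (fun ω => b (windowE π X a j ω) (windowE π Y a j ω) + b (DX ω) (DY ω))
      (iidLaw π) := i1.add i2
    have i123 : Integrable (fun ω => b (windowE π X a j ω) (windowE π Y a j ω) + b (DX ω) (DY ω)
      + b (windowE π X a j ω) (DY ω)) (iidLaw π) := i12.add i3
    rw [integral_add i123 i4, integral_add i12 i3, integral_add i1 i2,
      integral_bilin_eq_zero b (M := windowE π X a j) (A := Set.Ico a (a + j)) dependsOn_condE i3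
        (hDYL.integrable one_le_two) (condE_windowE_succ_sub a j hYi),
      integral_bilin_eq_zero b.flip (M := windowE π Y a j) (A := Set.Ico a (a + j)) dependsOn_condE i4
        (hDXL.integrable one_le_two) (condE_windowE_succ_sub a j hXi)]
    simp

/-- The covariance of two centered variables is controlled by their martingale increments. -/
theorem enorm_integral_bilin_le_tsum {b : E →L[ℝ] F →L[ℝ] G} (hb : ∀ x y, ‖b x y‖ ≤ ‖x‖ * ‖y‖)
    (hXm : StronglyMeasurable X) (hYm : StronglyMeasurable Y) (hX : MemLp X 2 (iidLaw π))
    (hY : MemLp Y 2 (iidLaw π)) (h0 : ∫ ω, X ω ∂iidLaw π = 0) :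
    ‖∫ ω, b (X ω) (Y ω) ∂iidLaw π‖ₑ ≤ ∑' k : ℤ, eLpNorm (coordProj π k X) 2 (iidLaw π)
      * eLpNorm (coordProj π k Y) 2 (iidLaw π) := by
  have hXi := hX.integrable one_le_two
  have hYi := hY.integrable one_le_two
  set B := ∑' k : ℤ, eLpNorm (coordProj π k X) 2 (iidLaw π)
      * eLpNorm (coordProj π k Y) 2 (iidLaw π) with hB
  have hWX : ∀ a j, MemLp (windowE π X a j) 2 (iidLaw π) := fun a j =>
    memLp_condE _ hXm one_le_two hX
  have hWY : ∀ a j, MemLp (windowE π Y a j) 2 (iidLaw π) := fun a j =>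
    memLp_condE _ hYm one_le_two hY
  have h1 : ∀ n : ℕ, ‖∫ ω, b (windowE π X (-n) (2 * n + 1) ω) (windowE π Y (-n) (2 * n + 1) ω)
      ∂iidLaw π‖ₑ ≤ B := by
    intro n
    rw [integral_bilin_windowE b hXm hYm hX hY h0]
    refine (enorm_sum_le _ _).trans ?_
    have hinj : Function.Injective (fun i : ℕ => (-n : ℤ) + i) := fun i j h => by simpa using h
    calc ∑ i ∈ Finset.range (2 * n + 1),
          ‖∫ ω, b ((windowE π X (-n) (i + 1) - windowE π X (-n) i) ω)
          ((windowE π Y (-n) (i + 1) - windowE π Y (-n) i) ω) ∂iidLaw π‖ₑ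
        ≤ ∑ i ∈ Finset.range (2 * n + 1), eLpNorm (coordProj π (-n + i) X) 2 (iidLaw π)
          * eLpNorm (coordProj π (-n + i) Y) 2 (iidLaw π) := by
          refine Finset.sum_le_sum fun i _ => ?_
          refine (enorm_bilin_le hb ((hWX _ _).sub (hWX _ _)).1
            ((hWY _ _).sub (hWY _ _)).1).trans ?_
          exact mul_le_mul' (eLpNorm_windowE_succ_sub_le _ _ hXi one_le_two)
            (eLpNorm_windowE_succ_sub_le _ _ hYi one_le_two)
      _ ≤ ∑' i : ℕ, eLpNorm (coordProj π (-n + i) X) 2 (iidLaw π)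
          * eLpNorm (coordProj π (-n + i) Y) 2 (iidLaw π) := ENNReal.sum_le_tsum _
      _ ≤ _ := ENNReal.tsum_comp_le_tsum_of_injective hinj (fun k =>
          eLpNorm (coordProj π k X) 2 (iidLaw π) * eLpNorm (coordProj π k Y) 2 (iidLaw π))
  have tX := tendsto_windowE one_le_two (by simp) hX
  have tY := tendsto_windowE one_le_two (by simp) hY
  have ht := ((ENNReal.Tendsto.mul_const tX (Or.inr hY.2.ne)).add
    (ENNReal.Tendsto.const_mul tY (Or.inr hX.2.ne))).add_const B
  simp only [zero_mul, mul_zero, zero_add] at ht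
  refine ge_of_tendsto' ht fun n => ?_
  set WX := windowE π X (-n) (2 * n + 1)
  set WY := windowE π Y (-n) (2 * n + 1)
  have hwx : MemLp WX 2 (iidLaw π) := hWX _ _
  have hwy : MemLp WY 2 (iidLaw π) := hWY _ _
  -- The factors are replaced by their windowed versions one at a time; both errors vanish as the
  -- window grows.
  have e : ∀ ω, b (X ω) (Y ω) = b (WX ω) (WY ω) - (b ((WX - X) ω) (Y ω) + b (WX ω) ((WY - Y) ω)) := by
    intro ω
    simp only [Pi.sub_apply, map_sub, sub_apply]
    abel
  simp only [e]
  have j1 := integrable_bilin b (hwx.sub hX) hY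
  have j2 := integrable_bilin b hwx (hwy.sub hY)
  have j12 : Integrable (fun ω => b ((WX - X) ω) (Y ω) + b (WX ω) ((WY - Y) ω)) (iidLaw π) :=
    j1.add j2
  rw [integral_sub (integrable_bilin b hwx hwy) j12, integral_add j1 j2]
  refine (enorm_sub_le).trans ?_
  rw [add_comm]
  refine add_le_add ((enorm_add_le _ _).trans (add_le_add ?_ ?_)) (h1 n)
  · exact enorm_bilin_le hb (hwx.sub hX).1 hY.1
  · refine (enorm_bilin_le hb hwx.1 (hwy.sub hY).1).trans ?_
    gcongr
    exact eLpNorm_condE_le _ hX.1 one_le_two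

end Covariance

end MomentInequalities

/-! ### Moments of tensor-valued quadratic forms -/

section QuadraticForms

set_option linter.unusedSectionVars false

/-! ### The tensor product as a bounded real bilinear map -/

namespace S2

variable {H : Type*} [NormedAddCommGroup H] [InnerProductSpace ℂ H] [CompleteSpace H]

theorem tens_add_left (f f' g : H) : tens (f + f') g = tens f g + tens f' g := by
  apply op_injective; simp

theorem tens_add_right (f g g' : H) : tens f (g + g') = tens f g + tens f g' := by
  apply op_injective; simp

theorem tens_smul_left (c : ℂ) (f g : H) : tens (c • f) g = c • tens f g := by
  apply op_injective; simp

theorem tens_smul_right (c : ℂ) (f g : H) : tens f (c • g) = conj c • tens f g := by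
  apply op_injective; ext x; simp [smul_smul]

variable (H) in
/-- The map `(f, g) ↦ f ⊗ g` as a bounded real bilinear map. -/
def tensL : H →L[ℝ] H →L[ℝ] S2 H :=
  LinearMap.mkContinuous₂ (LinearMap.mk₂ ℝ tens tens_add_left
    (fun c f g => by
      rw [← Complex.coe_smul c f, tens_smul_left, Complex.coe_smul]) tens_add_right
    (fun c f g => by
      rw [← Complex.coe_smul c g, tens_smul_right, Complex.conj_ofReal, Complex.coe_smul]))
    1 (fun f g => by simp [norm_tens])

@[simp] theorem tensL_apply (f g : H) : tensL H f g = tens f g := rfl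

theorem tens_sum_left {ι : Type*} (s : Finset ι) (f : ι → H) (g : H) :
    tens (∑ i ∈ s, f i) g = ∑ i ∈ s, tens (f i) g := by
  simp only [← tensL_apply, map_sum, sum_apply]

theorem tens_sum_right {ι : Type*} (s : Finset ι) (f : H) (g : ι → H) :
    tens f (∑ i ∈ s, g i) = ∑ i ∈ s, tens f (g i) := by
  simp only [← tensL_apply, map_sum]

theorem tens_sub_left (f f' g : H) : tens (f - f') g = tens f g - tens f' g := by
  simp only [← tensL_apply, map_sub, sub_apply]

theorem tens_sub_right (f g g' : H) : tens f (g - g') = tens f g - tens f g' := by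
  simp only [← tensL_apply, map_sub]

theorem stronglyMeasurable_tens {α : Type*} [MeasurableSpace α] {f g : α → H}
    (hf : StronglyMeasurable f) (hg : StronglyMeasurable g) :
    StronglyMeasurable fun x => tens (f x) (g x) :=
  continuous_tens.comp_stronglyMeasurable (hf.prodMk hg)

theorem aestronglyMeasurable_tens {α : Type*} [MeasurableSpace α] {μ : Measure α} {f g : α → H}
    (hf : AEStronglyMeasurable f μ) (hg : AEStronglyMeasurable g μ) :
    AEStronglyMeasurable (fun x => tens (f x) (g x)) μ :=
  (tensL H).aestronglyMeasurable_comp₂ hf hg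

theorem eLpNorm_tens_le {α : Type*} [MeasurableSpace α] {μ : Measure α} {f g : α → H}
    (hf : AEStronglyMeasurable f μ) (hg : AEStronglyMeasurable g μ) (p q r : ℝ≥0∞)
    [ENNReal.HolderTriple p q r] :
    eLpNorm (fun x => tens (f x) (g x)) r μ ≤ eLpNorm f p μ * eLpNorm g q μ := by
  simpa using eLpNorm_le_eLpNorm_mul_eLpNorm'_of_norm (p := p) (q := q) (r := r) hf hg
    (fun x y => tens x y) 1 (Eventually.of_forall fun x => by simp [norm_tens])

theorem memLp_tens {α : Type*} [MeasurableSpace α] {μ : Measure α} {f g : α → H} {p q r : ℝ≥0∞}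
    [ENNReal.HolderTriple p q r] (hf : MemLp f p μ) (hg : MemLp g q μ) :
    MemLp (fun x => tens (f x) (g x)) r μ :=
  ⟨aestronglyMeasurable_tens hf.1 hg.1, (eLpNorm_tens_le hf.1 hg.1 p q r).trans_lt
    (ENNReal.mul_lt_top hf.2 hg.2)⟩

end S2

/-! ### Sums in `[0, ∞]` -/

theorem ENNReal.mul_add_mul_le_sq_add_sq (a b : ℝ≥0∞) : a * b + b * a ≤ a ^ 2 + b ^ 2 := by
  wlog h : a ≤ b generalizing a b
  · rw [add_comm, add_comm (a ^ 2)]; exact this b a (le_of_not_ge h)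
  obtain ⟨c, rfl⟩ := exists_add_of_le h
  calc a * (a + c) + (a + c) * a = 2 * a ^ 2 + 2 * (a * c) := by ring
    _ ≤ 2 * a ^ 2 + 2 * (a * c) + c ^ 2 := le_self_add
    _ = a ^ 2 + (a + c) ^ 2 := by ring

theorem ENNReal.add_sq_le (a b : ℝ≥0∞) : (a + b) ^ 2 ≤ 2 * (a ^ 2 + b ^ 2) := by
  calc (a + b) ^ 2 = a ^ 2 + b ^ 2 + (a * b + b * a) := by ring
    _ ≤ a ^ 2 + b ^ 2 + (a ^ 2 + b ^ 2) := add_le_add_right (ENNReal.mul_add_mul_le_sq_add_sq a b) _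
    _ = _ := by ring

theorem ENNReal.sum_mul_sq_le {ι : Type*} (s : Finset ι) (a v : ι → ℝ≥0∞) :
    (∑ i ∈ s, a i * v i) ^ 2 ≤ (∑ i ∈ s, v i) * ∑ i ∈ s, a i ^ 2 * v i := by
  have h2 : 2 * (∑ i ∈ s, a i * v i) ^ 2 ≤ 2 * ((∑ i ∈ s, v i) * ∑ i ∈ s, a i ^ 2 * v i) := by
    calc 2 * (∑ i ∈ s, a i * v i) ^ 2
        = ∑ i ∈ s, ∑ j ∈ s, (a i * a j + a j * a i) * (v i * v j) := by
          rw [sq, Finset.sum_mul_sum, Finset.mul_sum]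
          refine Finset.sum_congr rfl fun i _ => ?_
          rw [Finset.mul_sum]
          exact Finset.sum_congr rfl fun j _ => by ring
      _ ≤ ∑ i ∈ s, ∑ j ∈ s, (a i ^ 2 + a j ^ 2) * (v i * v j) := by
          refine Finset.sum_le_sum fun i _ => Finset.sum_le_sum fun j _ => ?_
          exact mul_le_mul_left (ENNReal.mul_add_mul_le_sq_add_sq _ _) _
      _ = ∑ i ∈ s, ∑ j ∈ s, (v j * (a i ^ 2 * v i)) + ∑ i ∈ s, ∑ j ∈ s, (v i * (a j ^ 2 * v j)) := by
          rw [← Finset.sum_add_distrib]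
          refine Finset.sum_congr rfl fun i _ => ?_
          rw [← Finset.sum_add_distrib]
          exact Finset.sum_congr rfl fun j _ => by ring
      _ = _ := by
          rw [Finset.sum_comm, ← Finset.sum_mul_sum]; ring
  exact (ENNReal.mul_le_mul_iff_right (by simp) (by simp)).1 h2

/-- Young's inequality for convolutions, `ℓ² * ℓ¹ → ℓ²`, by Cauchy–Schwarz with weights `ν (t - k)`.
It converts bounds on the individual martingale increments into a bound by `∑ a_t²`. -/
theorem ENNReal.tsum_sum_mul_sq_le (I : Finset ℤ) (a ν : ℤ → ℝ≥0∞) :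
    ∑' k : ℤ, (∑ t ∈ I, a t * ν (t - k)) ^ 2 ≤ (∑' j, ν j) ^ 2 * ∑ t ∈ I, a t ^ 2 := by
  have hN : ∀ t : ℤ, ∑' k : ℤ, ν (t - k) = ∑' j, ν j := fun t =>
    (Equiv.subLeft t).tsum_eq ν
  calc ∑' k : ℤ, (∑ t ∈ I, a t * ν (t - k)) ^ 2
      ≤ ∑' k : ℤ, (∑' j, ν j) * ∑ t ∈ I, a t ^ 2 * ν (t - k) := by
        refine ENNReal.tsum_le_tsum fun k => (ENNReal.sum_mul_sq_le _ _ _).trans ?_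
        gcongr
        have hinj : Function.Injective (fun t : ℤ => t - k) := sub_left_injective
        exact (ENNReal.sum_le_tsum (f := fun t : ℤ => ν (t - k)) I).trans
          (ENNReal.tsum_comp_le_tsum_of_injective hinj ν)
    _ = (∑' j, ν j) ^ 2 * ∑ t ∈ I, a t ^ 2 := by
        rw [ENNReal.tsum_mul_left, Summable.tsum_finsetSum fun _ _ => ENNReal.summable]
        simp only [ENNReal.tsum_mul_left, hN]
        rw [← Finset.sum_mul]
        ring

/-! ### Dependence coefficients on the sequence space -/

variable {S : Type*} [MeasurableSpace S] {π : Measure S} [IsProbabilityMeasure π]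

/-- `X` lies in `Lᵖ`, and replacing the coordinate `k` by its average changes `X_t` in `Lᵖ` by at
most `ν (t - k)`. -/
structure CoeffBound {E : Type*} [NormedAddCommGroup E] [NormedSpace ℝ E] (π : Measure S)
    [IsProbabilityMeasure π] (X : ℤ → (ℤ → S) → E) (p : ℝ≥0∞) (ν : ℤ → ℝ≥0∞) : Prop where
  meas : ∀ t, StronglyMeasurable (X t)
  memLp : ∀ t, MemLp (X t) p (iidLaw π)
  coeff : ∀ t k, eLpNorm (X t - condE π {k}ᶜ (X t)) p (iidLaw π) ≤ ν (t - k)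

theorem eLpNorm_complex_sub_integral_sq_le {E : Type*} [NormedAddCommGroup E]
    [InnerProductSpace ℂ E] [CompleteSpace E] {f : (ℤ → S) → E} (hfm : StronglyMeasurable f)
    {r : ℝ≥0∞} (hr : r = 2 ∨ r = 4) (hf : MemLp f r (iidLaw π)) :
    eLpNorm (fun ω => f ω - ∫ ω', f ω' ∂iidLaw π) r (iidLaw π) ^ 2
      ≤ 4 * ∑' k : ℤ, eLpNorm (coordProj π k f) r (iidLaw π) ^ 2 := by
  let _ : InnerProductSpace ℝ E := InnerProductSpace.complexToReal
  exact eLpNorm_sub_integral_sq_le hfm hr hf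

variable {H : Type*} [NormedAddCommGroup H] [InnerProductSpace ℂ H] [CompleteSpace H]

/-- Fourth moments of linear combinations of a process with summable dependence coefficients. -/
theorem CoeffBound.eLpNorm_sum_sq_le {X : ℤ → (ℤ → S) → H} {ν : ℤ → ℝ≥0∞}
    (hX : CoeffBound π X 4 ν) (h0 : ∀ t, ∫ ω, X t ω ∂iidLaw π = 0) (I : Finset ℤ) (β : ℤ → ℂ) :
    eLpNorm (fun ω => ∑ t ∈ I, β t • X t ω) 4 (iidLaw π) ^ 2
      ≤ 4 * ((∑' j, ν j) ^ 2 * ∑ t ∈ I, ‖β t‖ₑ ^ 2) := by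
  have hXi : ∀ t, Integrable (X t) (iidLaw π) := fun t => (hX.memLp t).integrable (by norm_num)
  have hβi : ∀ t, Integrable (fun ω => β t • X t ω) (iidLaw π) := fun t => (hXi t).smul (β t)
  have hfm : StronglyMeasurable fun ω => ∑ t ∈ I, β t • X t ω :=
    Finset.stronglyMeasurable_fun_sum _ fun t _ => (hX.meas t).const_smul (β t)
  have hfL : MemLp (fun ω => ∑ t ∈ I, β t • X t ω) 4 (iidLaw π) :=
    memLp_finsetSum _ fun t _ => (hX.memLp t).const_smul (β t)
  have hm : ∫ ω, ∑ t ∈ I, β t • X t ω ∂iidLaw π = 0 := by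
    rw [integral_finsetSum _ fun t _ => hβi t]
    refine Finset.sum_eq_zero fun t _ => ?_
    rw [integral_smul, h0, smul_zero]
  have h := eLpNorm_complex_sub_integral_sq_le hfm (Or.inr rfl) hfL
  simp only [hm, sub_zero] at h
  refine h.trans ?_
  gcongr
  refine le_trans (ENNReal.tsum_le_tsum fun k => ?_)
    (ENNReal.tsum_sum_mul_sq_le I (fun t => ‖β t‖ₑ) ν)
  gcongr
  rw [eLpNorm_congr_ae (coordProj_sum k I fun t _ => hβi t)]
  have := eLpNorm_sum_le (μ := iidLaw π) (p := 4) (s := I)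
    (f := fun t => coordProj π k (fun ω => β t • X t ω))
    (fun t _ => (integrable_coordProj k (hβi t)).1) (by norm_num)
  simp only [Finset.sum_fn] at this
  refine this.trans (Finset.sum_le_sum fun t _ => ?_)
  rw [coordProj_const_smul]
  refine (eLpNorm_const_smul_le (c := β t) (f := coordProj π k (X t))).trans ?_
  gcongr
  exact (eLpNorm_coordProj_le k (by norm_num) (hXi t)).trans (hX.coeff t k)

/-- The quadratic form `∑ α_{st} X_s ⊗ Y_t`. -/
def quadForm (α : ℤ → ℤ → ℂ) (I : Finset ℤ) (X Y : ℤ → (ℤ → S) → H) (ω : ℤ → S) : S2 H :=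
  ∑ s ∈ I, ∑ t ∈ I, α s t • S2.tens (X s ω) (Y t ω)

section Quad

variable {X Y : ℤ → (ℤ → S) → H} {p r : ℝ≥0∞} [ENNReal.HolderTriple p 4 r]
  [ENNReal.HolderTriple 4 p r] {νX νY νX' νY' : ℤ → ℝ≥0∞}

theorem stronglyMeasurable_quadForm (α : ℤ → ℤ → ℂ) (I : Finset ℤ)
    (hX : ∀ t, StronglyMeasurable (X t)) (hY : ∀ t, StronglyMeasurable (Y t)) :
    StronglyMeasurable (quadForm α I X Y) :=
  Finset.stronglyMeasurable_fun_sum _ fun s _ => Finset.stronglyMeasurable_fun_sum _ fun t _ =>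
    (S2.stronglyMeasurable_tens (hX s) (hY t)).const_smul (α s t)

theorem memLp_quadForm {p q r : ℝ≥0∞} [ENNReal.HolderTriple p q r] (α : ℤ → ℤ → ℂ) (I : Finset ℤ)
    (hX : ∀ t, MemLp (X t) p (iidLaw π)) (hY : ∀ t, MemLp (Y t) q (iidLaw π)) :
    MemLp (quadForm α I X Y) r (iidLaw π) :=
  memLp_finsetSum _ fun s _ => memLp_finsetSum _ fun t _ =>
    (S2.memLp_tens (hX s) (hY t)).const_smul (α s t)

/-- Let `AX`, `AY` denote the processes averaged over the coordinate `k`. Telescoping from `X ⊗ Y`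
to `AX ⊗ AY` leaves `R1` and `R2`, in which the effect of `k` on one variable is tensored with a
whole linear form in the other process, and `W`, which does not depend on `k`. The linear forms are
kept together in `L⁴`, since a termwise bound would lose their square-root cancellation. The effect
of `k` is measured in `Lᵖ`: the cases used are `p = 4, r = 2` and `p = ∞, r = 4`. -/
theorem eLpNorm_quadForm_sub_condE_le (hX : CoeffBound π X 4 νX) (hX' : CoeffBound π X p νX')
    (hY : CoeffBound π Y 4 νY) (hY' : CoeffBound π Y p νY') (hr : 1 ≤ r) (hp : 1 ≤ p)
    (α : ℤ → ℤ → ℂ) (I : Finset ℤ) (k : ℤ) :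
    eLpNorm (quadForm α I X Y - condE π {k}ᶜ (quadForm α I X Y)) r (iidLaw π)
      ≤ 2 * (∑ s ∈ I, eLpNorm (fun ω => ∑ t ∈ I, conj (α s t) • Y t ω) 4 (iidLaw π) * νX' (s - k)
        + ∑ t ∈ I, eLpNorm (fun ω => ∑ s ∈ I, α s t • X s ω) 4 (iidLaw π) * νY' (t - k)) := by
  have hXi : ∀ t, Integrable (X t) (iidLaw π) := fun t => (hX.memLp t).integrable (by norm_num)
  have hYi : ∀ t, Integrable (Y t) (iidLaw π) := fun t => (hY.memLp t).integrable (by norm_num)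
  set K : Set ℤ := {k}ᶜ with hK
  set AX := fun s => condE π K (X s) with hAX
  set AY := fun s => condE π K (Y s) with hAY
  have hAXm : ∀ t, StronglyMeasurable (AX t) := fun t => stronglyMeasurable_condE K (hX.meas t)
  have hAYm : ∀ t, StronglyMeasurable (AY t) := fun t => stronglyMeasurable_condE K (hY.meas t)
  have hAX4 : ∀ t, MemLp (AX t) 4 (iidLaw π) := fun t =>
    memLp_condE K (hX.meas t) (by norm_num) (hX.memLp t)
  have hAXp : ∀ t, MemLp (AX t) p (iidLaw π) := fun t =>
    memLp_condE K (hX.meas t) hp (hX'.memLp t)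
  have hAYp : ∀ t, MemLp (AY t) p (iidLaw π) := fun t =>
    memLp_condE K (hY.meas t) hp (hY'.memLp t)
  -- The conjugate appears because `⊗` is antilinear in its second argument.
  set U := fun (s : ℤ) (ω : ℤ → S) => ∑ t ∈ I, conj (α s t) • Y t ω with hU
  set V := fun (t : ℤ) (ω : ℤ → S) => ∑ s ∈ I, α s t • X s ω with hV
  set AV := fun (t : ℤ) (ω : ℤ → S) => ∑ s ∈ I, α s t • AX s ω with hAV
  have hUL : ∀ s, MemLp (U s) 4 (iidLaw π) := fun s =>
    memLp_finsetSum _ fun t _ => (hY.memLp t).const_smul _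
  have hVL : ∀ s, MemLp (V s) 4 (iidLaw π) := fun s =>
    memLp_finsetSum _ fun t _ => (hX.memLp t).const_smul _
  have hAVL : ∀ s, MemLp (AV s) 4 (iidLaw π) := fun s =>
    memLp_finsetSum _ fun t _ => (hAX4 t).const_smul _
  have hAVn : ∀ t, eLpNorm (AV t) 4 (iidLaw π) ≤ eLpNorm (V t) 4 (iidLaw π) := by
    intro t
    have h1 := condE_sum (π := π) K I (F := fun s ω => α s t • X s ω)
      fun s _ => (hXi s).smul (α s t)
    have h2 : condE π K (V t) =ᵐ[iidLaw π] AV t := by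
      filter_upwards [h1] with ω hω
      simp only [hV, hAV, hω, condE_const_smul, hAX]
    rw [← eLpNorm_congr_ae h2]
    exact eLpNorm_condE_le K (hVL t).1 (by norm_num)
  set R1 := fun ω => ∑ s ∈ I, S2.tens ((X s - AX s) ω) (U s ω) with hR1
  set R2 := fun ω => ∑ t ∈ I, S2.tens (AV t ω) ((Y t - AY t) ω) with hR2
  set W := quadForm α I AX AY with hW
  have hQ : quadForm α I X Y = (R1 + R2) + W := by
    funext ω
    have e1 : R1 ω = ∑ s ∈ I, ∑ t ∈ I, (α s t • S2.tens (X s ω) (Y t ω)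
        - α s t • S2.tens (AX s ω) (Y t ω)) := by
      simp only [hR1, hU, S2.tens_sum_right, S2.tens_smul_right, Complex.conj_conj, Pi.sub_apply,
        S2.tens_sub_left, smul_sub]
    have e2 : R2 ω = ∑ s ∈ I, ∑ t ∈ I, (α s t • S2.tens (AX s ω) (Y t ω)
        - α s t • S2.tens (AX s ω) (AY t ω)) := by
      rw [Finset.sum_comm]
      simp only [hR2, hAV, S2.tens_sum_left, S2.tens_smul_left, Pi.sub_apply,
        S2.tens_sub_right, Finset.sum_sub_distrib]
    simp only [Pi.add_apply, e1, e2, hW, quadForm, Finset.sum_sub_distrib]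
    abel
  have hR1L : MemLp R1 r (iidLaw π) :=
    memLp_finsetSum _ fun s _ => S2.memLp_tens (p := p) (q := 4)
      ((hX'.memLp s).sub (hAXp s)) (hUL s)
  have hR2L : MemLp R2 r (iidLaw π) :=
    memLp_finsetSum _ fun s _ => S2.memLp_tens (p := 4) (q := p)
      (hAVL s) ((hY'.memLp s).sub (hAYp s))
  have hWL : MemLp W r (iidLaw π) := memLp_quadForm (p := 4) (q := p) α I hAX4 hAYp
  have hRL := hR1L.add hR2L
  have hAW : condE π K W = W := condE_of_dependsOn (B := K) (fun x y h => by
    have h1 : ∀ s, AX s x = AX s y := fun s => dependsOn_condE h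
    have h2 : ∀ s, AY s x = AY s y := fun s => dependsOn_condE h
    simp only [hW, quadForm, h1, h2]) subset_rfl
  have hdiff : quadForm α I X Y - condE π K (quadForm α I X Y)
      =ᵐ[iidLaw π] (R1 + R2) - condE π K (R1 + R2) := by
    rw [hQ]
    filter_upwards [condE_add K (hRL.integrable hr) (hWL.integrable hr)] with ω hω
    simp only [Pi.sub_apply, hω, Pi.add_apply, hAW]
    abel
  rw [eLpNorm_congr_ae hdiff]
  calc eLpNorm ((R1 + R2) - condE π K (R1 + R2)) r (iidLaw π)
      ≤ eLpNorm (R1 + R2) r (iidLaw π) + eLpNorm (condE π K (R1 + R2)) r (iidLaw π) :=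
        eLpNorm_sub_le hRL.1 (integrable_condE K (hRL.integrable hr)).1 hr
    _ ≤ 2 * eLpNorm (R1 + R2) r (iidLaw π) := by
        rw [two_mul]; gcongr; exact eLpNorm_condE_le K hRL.1 hr
    _ ≤ 2 * (eLpNorm R1 r (iidLaw π) + eLpNorm R2 r (iidLaw π)) := by
        gcongr; exact eLpNorm_add_le hR1L.1 hR2L.1 hr
    _ ≤ _ := by
        gcongr
        · have := eLpNorm_sum_le (μ := iidLaw π) (p := r) (s := I)
            (f := fun s ω => S2.tens ((X s - AX s) ω) (U s ω))
            (fun s _ => S2.aestronglyMeasurable_tens ((hX'.memLp s).sub (hAXp s)).1 (hUL s).1) hr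
          simp only [Finset.sum_fn] at this
          refine this.trans (Finset.sum_le_sum fun s _ => ?_)
          refine (S2.eLpNorm_tens_le ((hX'.memLp s).sub (hAXp s)).1 (hUL s).1 p 4 r).trans ?_
          rw [mul_comm]
          gcongr
          exact hX'.coeff s k
        · have := eLpNorm_sum_le (μ := iidLaw π) (p := r) (s := I)
            (f := fun t ω => S2.tens (AV t ω) ((Y t - AY t) ω))
            (fun s _ => S2.aestronglyMeasurable_tens (hAVL s).1 ((hY'.memLp s).sub (hAYp s)).1) hr
          simp only [Finset.sum_fn] at this
          refine this.trans (Finset.sum_le_sum fun s _ => ?_)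
          refine (S2.eLpNorm_tens_le (hAVL s).1 ((hY'.memLp s).sub (hAYp s)).1 4 p r).trans ?_
          gcongr
          · exact hAVn s
          · exact hY'.coeff s k

/-- Moments of quadratic forms of processes with summable dependence coefficients are controlled
by the Frobenius norm of the coefficients. -/
theorem eLpNorm_quadForm_sub_integral_sq_le (hX : CoeffBound π X 4 νX)
    (hX' : CoeffBound π X p νX') (hY : CoeffBound π Y 4 νY) (hY' : CoeffBound π Y p νY')
    (hX0 : ∀ t, ∫ ω, X t ω ∂iidLaw π = 0) (hY0 : ∀ t, ∫ ω, Y t ω ∂iidLaw π = 0)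
    (hr : r = 2 ∨ r = 4) (hp : 1 ≤ p) (α : ℤ → ℤ → ℂ) (I : Finset ℤ) :
    eLpNorm (fun ω => quadForm α I X Y ω - ∫ ω', quadForm α I X Y ω' ∂iidLaw π) r (iidLaw π) ^ 2
      ≤ 128 * ((∑' j, νX' j) ^ 2 * (∑' j, νY j) ^ 2 + (∑' j, νY' j) ^ 2 * (∑' j, νX j) ^ 2)
        * ∑ s ∈ I, ∑ t ∈ I, ‖α s t‖ₑ ^ 2 := by
  have hr1 : 1 ≤ r := by rcases hr with rfl | rfl <;> norm_num
  have hQL : MemLp (quadForm α I X Y) r (iidLaw π) :=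
    memLp_quadForm (p := p) (q := 4) α I hX'.memLp hY.memLp
  have hQm := stronglyMeasurable_quadForm α I hX.meas hY.meas
  refine (eLpNorm_complex_sub_integral_sq_le hQm hr hQL).trans ?_
  set u := fun s => eLpNorm (fun ω => ∑ t ∈ I, conj (α s t) • Y t ω) 4 (iidLaw π) with hu
  set v := fun t => eLpNorm (fun ω => ∑ s ∈ I, α s t • X s ω) 4 (iidLaw π) with hv
  -- Here `8 = 2² · 2`: the square of the factor in `eLpNorm_quadForm_sub_condE_le`, times the `2`
  -- in `(x + y)² ≤ 2 (x² + y²)`. Young's inequality performs the sum over `k`.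
  have h1 : ∑' k : ℤ, eLpNorm (coordProj π k (quadForm α I X Y)) r (iidLaw π) ^ 2
      ≤ 8 * ((∑' j, νX' j) ^ 2 * ∑ s ∈ I, u s ^ 2 + (∑' j, νY' j) ^ 2 * ∑ t ∈ I, v t ^ 2) := by
    calc ∑' k : ℤ, eLpNorm (coordProj π k (quadForm α I X Y)) r (iidLaw π) ^ 2
        ≤ ∑' k : ℤ, 8 * ((∑ s ∈ I, u s * νX' (s - k)) ^ 2
            + (∑ t ∈ I, v t * νY' (t - k)) ^ 2) := by
          refine ENNReal.tsum_le_tsum fun k => ?_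
          have h2 := (eLpNorm_coordProj_le k hr1 (hQL.integrable hr1)).trans
            (eLpNorm_quadForm_sub_condE_le hX hX' hY hY' hr1 hp α I k)
          calc _ ≤ (2 * (∑ s ∈ I, u s * νX' (s - k) + ∑ t ∈ I, v t * νY' (t - k))) ^ 2 := by
                gcongr
            _ = 4 * (∑ s ∈ I, u s * νX' (s - k) + ∑ t ∈ I, v t * νY' (t - k)) ^ 2 := by ring
            _ ≤ 4 * (2 * ((∑ s ∈ I, u s * νX' (s - k)) ^ 2
                + (∑ t ∈ I, v t * νY' (t - k)) ^ 2)) := by gcongr; exact ENNReal.add_sq_le _ _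
            _ = _ := by ring
      _ = 8 * (∑' k : ℤ, (∑ s ∈ I, u s * νX' (s - k)) ^ 2
            + ∑' k : ℤ, (∑ t ∈ I, v t * νY' (t - k)) ^ 2) := by
          rw [ENNReal.tsum_mul_left, ENNReal.tsum_add]
      _ ≤ _ := by
          gcongr
          · exact ENNReal.tsum_sum_mul_sq_le I u νX'
          · exact ENNReal.tsum_sum_mul_sq_le I v νY'
  -- Each linear form costs `4 (∑ ν)²` times the squared norm of one row or one column of `α`;
  -- summed up, these give the Frobenius norm. The total constant is `4 · 8 · 4 = 128`.
  have hu2 : ∑ s ∈ I, u s ^ 2 ≤ 4 * ((∑' j, νY j) ^ 2 * ∑ s ∈ I, ∑ t ∈ I, ‖α s t‖ₑ ^ 2) := by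
    rw [Finset.mul_sum, Finset.mul_sum]
    refine Finset.sum_le_sum fun s _ => ?_
    simpa using hY.eLpNorm_sum_sq_le hY0 I fun t => conj (α s t)
  have hv2 : ∑ s ∈ I, v s ^ 2 ≤ 4 * ((∑' j, νX j) ^ 2 * ∑ s ∈ I, ∑ t ∈ I, ‖α s t‖ₑ ^ 2) := by
    rw [Finset.sum_comm (f := fun s t => ‖α s t‖ₑ ^ 2), Finset.mul_sum, Finset.mul_sum]
    refine Finset.sum_le_sum fun t _ => ?_
    exact hX.eLpNorm_sum_sq_le hX0 I fun s => α s t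
  calc 4 * ∑' k : ℤ, eLpNorm (coordProj π k (quadForm α I X Y)) r (iidLaw π) ^ 2
      ≤ 4 * (8 * ((∑' j, νX' j) ^ 2 * (4 * ((∑' j, νY j) ^ 2 * ∑ s ∈ I, ∑ t ∈ I, ‖α s t‖ₑ ^ 2))
        + (∑' j, νY' j) ^ 2 * (4 * ((∑' j, νX j) ^ 2 * ∑ s ∈ I, ∑ t ∈ I, ‖α s t‖ₑ ^ 2)))) := by
        refine mul_le_mul_right (h1.trans ?_) _
        gcongr
    _ = _ := by ring

end Quad

theorem holderTriple_four_four_two : ENNReal.HolderTriple 4 4 2 := by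
  constructor
  rw [show (4 : ℝ≥0∞) = 2 * 2 by norm_num, ENNReal.mul_inv (by simp) (by simp), ← mul_add,
    ENNReal.inv_two_add_inv_two, mul_one]

end QuadraticForms

/-! ### Limits of lattice sums of the lag window -/

section WindowSums

theorem summable_of_tsum_enorm_ne_top {ι E : Type*} [NormedAddCommGroup E] [CompleteSpace E]
    {f : ι → E} (h : ∑' i, ‖f i‖ₑ ≠ ∞) : Summable f := by
  refine Summable.of_norm ?_
  refine (ENNReal.summable_toReal h).congr fun i => ?_
  simp

theorem ENNReal.tsum_mul_sq_le {ι : Type*} (x y : ι → ℝ≥0∞) :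
    (∑' i, x i * y i) ^ 2 ≤ (∑' i, x i ^ 2) * ∑' i, y i ^ 2 := by
  let _ : MeasurableSpace ι := ⊤
  have h := ENNReal.lintegral_mul_le_Lp_mul_Lq (Measure.count : Measure ι)
    Real.HolderConjugate.two_two (f := x) (g := y) measurable_from_top.aemeasurable
    measurable_from_top.aemeasurable
  simp only [lintegral_count, Pi.mul_apply, ENNReal.rpow_ofNat] at h
  calc (∑' i, x i * y i) ^ 2
      ≤ ((∑' i, x i ^ 2) ^ (1 / 2 : ℝ) * (∑' i, y i ^ 2) ^ (1 / 2 : ℝ)) ^ 2 := by gcongr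
    _ = _ := by
      rw [mul_pow, ← ENNReal.rpow_natCast, ← ENNReal.rpow_mul, ← ENNReal.rpow_natCast,
        ← ENNReal.rpow_mul]
      norm_num

theorem ENNReal.tendsto_zero_of_sq {ι : Type*} {l : Filter ι} {f : ι → ℝ≥0∞}
    (h : Tendsto (fun i => f i ^ 2) l (𝓝 0)) : Tendsto f l (𝓝 0) := by
  have := (ENNReal.continuous_rpow_const (y := (1 / 2 : ℝ))).tendsto 0
  have h2 := this.comp h
  simp only [Function.comp_def] at h2
  rw [ENNReal.zero_rpow_of_pos (by norm_num)] at h2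
  refine h2.congr fun i => ?_
  rw [← ENNReal.rpow_natCast, ← ENNReal.rpow_mul]; norm_num

/-- A lattice sum with spacing `b` is the integral of a step function constant on the cells `[bh, bh
+ b)`. Limits of such sums thereby become dominated convergence on the line. -/
theorem lintegral_comp_floor_div {b : ℝ} (hb : 0 < b) (g : ℤ → ℝ≥0∞) :
    ∫⁻ x : ℝ, g ⌊x / b⌋ = ENNReal.ofReal b * ∑' h, g h := by
  have hm : Measurable fun x : ℝ => ⌊x / b⌋ := (measurable_id.div_const b).floor
  rw [← lintegral_map (μ := volume) (measurable_from_top (f := g)) hm, lintegral_countable',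
    ← ENNReal.tsum_mul_left]
  refine tsum_congr fun h => ?_
  rw [Measure.map_apply hm (measurableSet_singleton h), mul_comm]
  congr 1
  have : (fun x : ℝ => ⌊x / b⌋) ⁻¹' {h} = Set.Ico (b * h) (b * h + b) := by
    ext x
    simp only [Set.mem_preimage, Set.mem_singleton_iff, Int.floor_eq_iff, Set.mem_Ico,
      le_div_iff₀ hb, div_lt_iff₀ hb]
    constructor <;> rintro ⟨h1, h2⟩ <;> constructor <;> nlinarith
  rw [this, Real.volume_Ico]
  congr 1; ring

variable {w : ℝ → ℝ}

/-- The normalized sum of squares of the lag window at bandwidth `b`. -/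
def windowSq (w : ℝ → ℝ) (b : ℝ) : ℝ≥0∞ := ENNReal.ofReal b * ∑' h : ℤ, ‖w (b * h)‖ₑ ^ 2

/-- The part of `windowSq` at lags of size at least `M / b`. -/
def windowTail (w : ℝ → ℝ) (M b : ℝ) : ℝ≥0∞ :=
  ENNReal.ofReal b * ∑' h : ℤ, if M / b ≤ |(h : ℝ)| then ‖w (b * h)‖ₑ ^ 2 else 0

theorem Real.enorm_sq_eq_ofReal (x : ℝ) : ‖x‖ₑ ^ 2 = ENNReal.ofReal (x ^ 2) := by
  rw [← ofReal_norm, ← ENNReal.ofReal_pow (norm_nonneg _), Real.norm_eq_abs, sq_abs]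

theorem LagWindow.tendsto_windowSq (hw : LagWindow w) :
    Tendsto (windowSq w) (𝓝[>] 0) (𝓝 (ENNReal.ofReal (windowEnergy w))) := by
  refine hw.riemann.congr' ?_
  filter_upwards [self_mem_nhdsWithin] with b hb
  rw [windowSq, ← ENNReal.tsum_mul_left]
  refine tsum_congr fun h => ?_
  rw [Real.enorm_sq_eq_ofReal, ENNReal.ofReal_mul (le_of_lt hb)]

theorem LagWindow.exists_windowTail_le (hw : LagWindow w) {η : ℝ≥0∞} (hη : 0 < η) :
    ∃ M : ℝ, 0 < M ∧ ∀ b ∈ Set.Ioc (0 : ℝ) 1, windowTail w M b ≤ η := by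
  have h := (ENNReal.tendsto_nhds_zero.1 hw.tail η hη).and (eventually_gt_atTop 0)
  obtain ⟨M, hM, hM0⟩ := h.exists
  refine ⟨M, hM0, fun b hb => le_trans (le_of_eq ?_) ((le_iSup₂ (f := fun (b : ℝ)
    (_ : b ∈ Set.Ioc (0 : ℝ) 1) => ∑' h : {h : ℤ // M / b ≤ |(h : ℝ)|},
      ENNReal.ofReal (b * w (b * (h : ℤ)) ^ 2)) b hb).trans hM)⟩
  rw [windowTail, ← ENNReal.tsum_mul_left]
  have : ∀ h : ℤ, (ENNReal.ofReal b * if M / b ≤ |(h : ℝ)| then ‖w (b * h)‖ₑ ^ 2 else 0)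
      = Set.indicator {h : ℤ | M / b ≤ |(h : ℝ)|} (fun h : ℤ => ENNReal.ofReal (b * w (b * h) ^ 2))
        h := by
    intro h
    simp only [Set.indicator, Set.mem_ofPred_eq]
    split_ifs with hh
    · rw [Real.enorm_sq_eq_ofReal, ENNReal.ofReal_mul hb.1.le]
    · simp
  simp_rw [this]
  exact (tsum_subtype {h : ℤ | M / b ≤ |(h : ℝ)|}
    (fun h : ℤ => ENNReal.ofReal (b * w (b * h) ^ 2))).symm

/-- The squared `ℓ²` distance of the window at lags `h + k` and `h`. -/
def windowDiff (w : ℝ → ℝ) (k : ℤ) (b : ℝ) : ℝ≥0∞ :=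
  ENNReal.ofReal b * ∑' h : ℤ, ‖w (b * (h + k : ℤ)) - w (b * h)‖ₑ ^ 2

theorem tendsto_mul_floor_div (x : ℝ) (k : ℤ) :
    Tendsto (fun b : ℝ => b * ((⌊x / b⌋ + k : ℤ) : ℝ)) (𝓝[>] 0) (𝓝 x) := by
  have h1 : Tendsto (fun b : ℝ => x + b * k) (𝓝[>] 0) (𝓝 x) := by
    have : Tendsto (fun b : ℝ => x + b * k) (𝓝 0) (𝓝 (x + 0 * k)) :=
      Continuous.tendsto (by fun_prop) 0
    simpa using this.mono_left nhdsWithin_le_nhds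
  have h2 : Tendsto (fun b : ℝ => x + b * k - b) (𝓝[>] 0) (𝓝 x) := by
    have : Tendsto (fun b : ℝ => x + b * k - b) (𝓝 0) (𝓝 (x + 0 * k - 0)) :=
      Continuous.tendsto (by fun_prop) 0
    simpa using this.mono_left nhdsWithin_le_nhds
  refine tendsto_of_tendsto_of_tendsto_of_le_of_le' h2 h1 ?_ ?_
  · filter_upwards [self_mem_nhdsWithin] with b hb
    have hb' : (0 : ℝ) < b := hb
    have h3 := Int.lt_floor_add_one (x / b)
    rw [div_lt_iff₀ hb'] at h3
    push_cast
    nlinarith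
  · filter_upwards [self_mem_nhdsWithin] with b hb
    have hb' : (0 : ℝ) < b := hb
    have h3 := Int.floor_le (x / b)
    rw [le_div_iff₀ hb'] at h3
    push_cast
    nlinarith

/-- In the step-function picture both lattice points `b ⌊x/b⌋` and `b (⌊x/b⌋ + k)` tend to `x`, and
`w` is continuous off a finite set, so the integrand tends to zero almost everywhere. -/
theorem LagWindow.tendsto_windowDiff_near (hw : LagWindow w) (k : ℤ) (M : ℝ) :
    Tendsto (fun b : ℝ => ENNReal.ofReal b * ∑' h : ℤ, if M / b ≤ |(h : ℝ)| then 0 else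
      ‖w (b * (h + k : ℤ)) - w (b * h)‖ₑ ^ 2) (𝓝[>] 0) (𝓝 0) := by
  obtain ⟨K, hK⟩ := hw.bounded
  obtain ⟨D, hD, hDc⟩ := hw.continuousAt
  have hm : ∀ b : ℝ, Measurable fun x : ℝ => ⌊x / b⌋ := fun b => (measurable_id.div_const b).floor
  set Φ : ℝ → ℝ → ℝ≥0∞ := fun b x => if M / b ≤ |((⌊x / b⌋ : ℤ) : ℝ)| then 0 else
      ‖w (b * (⌊x / b⌋ + k : ℤ)) - w (b * ⌊x / b⌋)‖ₑ ^ 2 with hΦ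
  have h1 : Tendsto (fun b : ℝ => ∫⁻ x, Φ b x) (𝓝[>] 0) (𝓝 (∫⁻ _ : ℝ, 0)) := by
    -- For `b ≤ 1`, a lag with `b |h| < M` forces `|x| ≤ M + 1`, and there the difference of two
    -- values of `w` is at most `2K`.
    refine tendsto_lintegral_filter_of_dominated_convergence
      (Set.indicator (Set.Icc (-M - 1) (M + 1)) fun _ => ENNReal.ofReal (2 * K) ^ 2) ?_ ?_ ?_ ?_
    · refine Eventually.of_forall fun b => ?_
      exact (measurable_from_top (f := fun h : ℤ => if M / b ≤ |(h : ℝ)| then 0 else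
        ‖w (b * (h + k : ℤ)) - w (b * h)‖ₑ ^ 2)).comp (hm b)
    · filter_upwards [Ioc_mem_nhdsGT (zero_lt_one' ℝ)] with b hb
      refine Eventually.of_forall fun x => ?_
      simp only [hΦ]
      split_ifs with h
      · exact zero_le
      · have hb' := hb.1
        rw [not_le, lt_div_iff₀ hb'] at h
        have h1 := Int.floor_le (x / b)
        have h2 := Int.lt_floor_add_one (x / b)
        rw [le_div_iff₀ hb'] at h1
        rw [div_lt_iff₀ hb'] at h2
        have h3 : |((⌊x / b⌋ : ℤ) : ℝ) * b| < M := by rwa [abs_mul, abs_of_pos hb']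
        obtain ⟨h4, h5⟩ := abs_lt.1 h3
        have hb1 := hb.2
        rw [Set.indicator_of_mem (show x ∈ Set.Icc (-M - 1) (M + 1) by
          constructor <;> nlinarith)]
        gcongr
        rw [← ofReal_norm]
        refine ENNReal.ofReal_le_ofReal ?_
        refine (norm_sub_le _ _).trans ?_
        have := hK (b * (⌊x / b⌋ + k : ℤ))
        have := hK (b * ⌊x / b⌋)
        simp only [Real.norm_eq_abs]
        linarith
    · rw [lintegral_indicator measurableSet_Icc]
      simp [ENNReal.mul_eq_top]
    · have hae : ∀ᵐ x : ℝ, x ∉ D := by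
        rw [ae_iff]; simpa using hD.measure_zero volume
      filter_upwards [hae] with x hx
      have hc := hDc x hx
      have t1 := hc.tendsto.comp (tendsto_mul_floor_div x k)
      have t2 := hc.tendsto.comp (tendsto_mul_floor_div x 0)
      have t3 := ((ENNReal.continuous_pow 2).tendsto _).comp (t1.sub t2).enorm
      simp only [sub_self, enorm_zero, ne_eq, OfNat.ofNat_ne_zero, not_false_eq_true, zero_pow,
        Function.comp_def, add_zero] at t3
      refine tendsto_of_tendsto_of_tendsto_of_le_of_le tendsto_const_nhds t3 (fun _ => zero_le)
        fun b => ?_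
      simp only [hΦ]
      split_ifs
      · exact zero_le
      · exact le_rfl
  simp only [lintegral_zero] at h1
  refine h1.congr' ?_
  filter_upwards [self_mem_nhdsWithin] with b hb
  exact lintegral_comp_floor_div hb (fun h : ℤ => if M / b ≤ |(h : ℝ)| then 0 else
        ‖w (b * (h + k : ℤ)) - w (b * h)‖ₑ ^ 2)

theorem enorm_sub_sq_le (x y : ℝ) : ‖x - y‖ₑ ^ 2 ≤ 2 * (‖x‖ₑ ^ 2 + ‖y‖ₑ ^ 2) :=
  (pow_le_pow_left' enorm_sub_le 2).trans (ENNReal.add_sq_le _ _)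

/-- Near lags are handled by almost everywhere continuity of `w`, far lags by the uniform tail
condition. Continuity alone would not do, since `w` need not have compact support. -/
theorem LagWindow.tendsto_windowDiff (hw : LagWindow w) (k : ℤ) :
    Tendsto (windowDiff w k) (𝓝[>] 0) (𝓝 0) := by
  rw [ENNReal.tendsto_nhds_zero]
  intro η hη
  -- The far part is at most twice the sum of two tails, that of the window and that of its shift,
  -- whence `η / 2 / 4`. The near region is cut at `M + |k|` so that, for `b ≤ 1`, the shifted far
  -- lags still exceed `M / b`.
  obtain ⟨M, hM, hMt⟩ := hw.exists_windowTail_le (η := η / 2 / 4)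
    (ENNReal.div_pos (ENNReal.half_pos hη.ne').ne' (by simp))
  have hnear := ENNReal.tendsto_nhds_zero.1 (hw.tendsto_windowDiff_near k (M + |(k : ℝ)|)) (η / 2)
    (ENNReal.half_pos hη.ne')
  filter_upwards [hnear, Ioc_mem_nhdsGT (zero_lt_one' ℝ)] with b hb1 hb
  have hb0 := hb.1
  have htail := hMt b hb
  have hsplit : windowDiff w k b ≤ (ENNReal.ofReal b * ∑' h : ℤ,
      if (M + |(k : ℝ)|) / b ≤ |(h : ℝ)| then 0 else
      ‖w (b * (h + k : ℤ)) - w (b * h)‖ₑ ^ 2)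
      + 2 * (windowTail w M b + windowTail w M b) := by
    have hshift : windowTail w M b = ENNReal.ofReal b * ∑' h : ℤ,
        if M / b ≤ |((h + k : ℤ) : ℝ)| then ‖w (b * (h + k : ℤ))‖ₑ ^ 2 else 0 := by
      rw [windowTail, ← (Equiv.addRight k).tsum_eq]
      rfl
    nth_rewrite 1 [hshift]
    rw [windowTail, windowDiff, ← mul_add, ← mul_assoc, mul_comm 2, mul_assoc, ← mul_add,
      ← ENNReal.tsum_add]
    refine mul_le_mul_right ?_ _
    rw [← ENNReal.tsum_mul_left, ← ENNReal.tsum_add]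
    refine ENNReal.tsum_le_tsum fun h => ?_
    by_cases hh : (M + |(k : ℝ)|) / b ≤ |(h : ℝ)|
    · have hk : |(k : ℝ)| ≤ |(k : ℝ)| / b := le_div_self (abs_nonneg _) hb0 hb.2
      rw [add_div] at hh
      have h1 : M / b ≤ |(h : ℝ)| := by
        have : 0 ≤ |(k : ℝ)| := abs_nonneg _
        linarith
      have h2 : M / b ≤ |((h + k : ℤ) : ℝ)| := by
        have := abs_sub_abs_le_abs_sub (h : ℝ) (-k)
        rw [abs_neg, sub_neg_eq_add] at this
        push_cast
        linarith
      rw [if_pos (by rw [add_div]; exact hh), if_pos h1, if_pos h2, zero_add]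
      exact enorm_sub_sq_le _ _
    · rw [if_neg hh]
      exact le_self_add
  calc windowDiff w k b ≤ η / 2 + 2 * (η / 2 / 4 + η / 2 / 4) := by
        refine hsplit.trans ?_
        gcongr
    _ = η := by
        rw [show 2 * (η / 2 / 4 + η / 2 / 4) = 4 * (η / 2 / 4) by ring,
          ENNReal.mul_div_cancel (by simp) (by simp), ENNReal.add_halves]

theorem enorm_exp_I_mul (θ : ℝ) (h : ℤ) : ‖Complex.exp (Complex.I * θ * h)‖ₑ = 1 := by
  have : Complex.I * θ * h = ((θ * h : ℝ) : ℂ) * Complex.I := by push_cast; ring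
  rw [← ofReal_norm, this, Complex.norm_exp_ofReal_mul_I, ENNReal.ofReal_one]

theorem enorm_complex_ofReal (x : ℝ) : ‖(x : ℂ)‖ₑ = ‖x‖ₑ := by
  rw [← ofReal_norm, Complex.norm_real, ofReal_norm]

theorem tsum_enorm_shift (w : ℝ → ℝ) (b : ℝ) (k : ℤ) :
    ∑' h : ℤ, ‖w (b * (h + k : ℤ))‖ₑ ^ 2 = ∑' h : ℤ, ‖w (b * h)‖ₑ ^ 2 :=
  (Equiv.addRight k).tsum_eq fun h : ℤ => ‖w (b * h)‖ₑ ^ 2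

/-- The trigonometric sum `b ∑_h w(bh)² e^{iθh}`. -/
def windowTrig (w : ℝ → ℝ) (θ b : ℝ) : ℂ :=
  b * ∑' h : ℤ, ((w (b * h) : ℂ) ^ 2 * Complex.exp (Complex.I * θ * h))

theorem summable_windowTrig {b : ℝ} (h : ∑' h : ℤ, ‖w (b * h)‖ₑ ^ 2 ≠ ∞) (θ : ℝ) :
    Summable fun h : ℤ => ((w (b * h) : ℂ) ^ 2 * Complex.exp (Complex.I * θ * h)) := by
  refine summable_of_tsum_enorm_ne_top ?_
  simpa only [enorm_mul, enorm_pow, enorm_exp_I_mul, mul_one, enorm_complex_ofReal] using h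

theorem LagWindow.eventually_tsum_ne_top (hw : LagWindow w) :
    ∀ᶠ b in 𝓝[>] (0 : ℝ), ∑' h : ℤ, ‖w (b * h)‖ₑ ^ 2 ≠ ∞ := by
  have h := hw.tendsto_windowSq.eventually (Iio_mem_nhds ENNReal.ofReal_lt_top)
  filter_upwards [h, self_mem_nhdsWithin] with b hb hb0 ht
  rw [windowSq, ht, ENNReal.mul_top] at hb
  · exact absurd hb (by simp)
  · simpa using hb0

/-- At resonance the sum is `windowSq` itself. Otherwise this is a Riemann–Lebesgue lemma by
summation by parts: multiplication by `e^{iθ} - 1` produces the differences `w(b(h-1))² - w(bh)²`,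
these factor, and Cauchy–Schwarz bounds the square of the result by a multiple of `windowDiff` times
`windowSq`, of which the first tends to zero. -/
theorem LagWindow.tendsto_windowTrig (hw : LagWindow w) (θ : ℝ) :
    Tendsto (windowTrig w θ) (𝓝[>] 0)
      (𝓝 (if Complex.exp (Complex.I * θ) = 1 then (windowEnergy w : ℂ) else 0)) := by
  split_ifs with hθ
  · have he : ∀ h : ℤ, Complex.exp (Complex.I * θ * h) = 1 := fun h => by
      rw [mul_comm, Complex.exp_int_mul, hθ, one_zpow]
    have hκ : 0 ≤ windowEnergy w := integral_nonneg fun x => sq_nonneg _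
    have h1 := (ENNReal.tendsto_toReal ENNReal.ofReal_ne_top).comp hw.tendsto_windowSq
    rw [ENNReal.toReal_ofReal hκ] at h1
    have h2 := (Complex.continuous_ofReal.tendsto _).comp h1
    refine h2.congr' ?_
    filter_upwards [self_mem_nhdsWithin, hw.eventually_tsum_ne_top] with b hb hfin
    simp only [Function.comp, windowSq, windowTrig, he, mul_one]
    rw [ENNReal.toReal_mul, ENNReal.toReal_ofReal (le_of_lt hb),
      ENNReal.tsum_toReal_eq (ENNReal.ne_top_of_tsum_ne_top hfin)]
    push_cast
    congr 1
    refine tsum_congr fun h => ?_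
    rw [Real.enorm_sq_eq_ofReal, ENNReal.toReal_ofReal (sq_nonneg _)]
    push_cast; rfl
  · have hbound : ∀ᶠ b in 𝓝[>] (0 : ℝ), ‖(Complex.exp (Complex.I * θ) - 1) * windowTrig w θ b‖ₑ ^ 2
        ≤ windowDiff w (-1) b * (2 * (windowSq w b + windowSq w b)) := by
      filter_upwards [self_mem_nhdsWithin, hw.eventually_tsum_ne_top] with b hb hfin
      have hs := summable_windowTrig hfin θ
      have hs' := (Equiv.addRight (-1 : ℤ)).summable_iff.2 hs
      simp only [Function.comp_def, Equiv.coe_addRight] at hs'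
      have e1 : (Complex.exp (Complex.I * θ) - 1) * windowTrig w θ b
          = b * ∑' h : ℤ, ((w (b * (h + -1 : ℤ)) : ℂ) ^ 2 - (w (b * h) : ℂ) ^ 2)
            * Complex.exp (Complex.I * θ * h) := by
        have e2 : Complex.exp (Complex.I * θ) * ∑' h : ℤ, ((w (b * h) : ℂ) ^ 2
            * Complex.exp (Complex.I * θ * h))
            = ∑' h : ℤ, (w (b * (h + -1 : ℤ)) : ℂ) ^ 2 * Complex.exp (Complex.I * θ * h) := by
          rw [← (Equiv.addRight (-1 : ℤ)).tsum_eq, ← tsum_mul_left]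
          refine tsum_congr fun h => ?_
          simp only [Equiv.coe_addRight]
          rw [mul_left_comm, ← Complex.exp_add]
          congr 2; push_cast; ring
        have hs2 : Summable fun h : ℤ => (w (b * (h + -1 : ℤ)) : ℂ) ^ 2
            * Complex.exp (Complex.I * θ * h) := by
          refine (hs'.mul_left (Complex.exp (Complex.I * θ))).congr fun h => ?_
          rw [mul_left_comm, ← Complex.exp_add]
          congr 2; push_cast; ring
        simp only [sub_mul]
        rw [hs2.tsum_sub hs, ← e2, windowTrig]
        ring
      rw [e1, enorm_mul, enorm_complex_ofReal, Real.enorm_of_nonneg (le_of_lt hb)]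
      calc (ENNReal.ofReal b * ‖∑' h : ℤ, ((w (b * (h + -1 : ℤ)) : ℂ) ^ 2 - (w (b * h) : ℂ) ^ 2)
            * Complex.exp (Complex.I * θ * h)‖ₑ) ^ 2
          ≤ (ENNReal.ofReal b * ∑' h : ℤ, ‖w (b * (h + -1 : ℤ)) - w (b * h)‖ₑ
            * (‖w (b * (h + -1 : ℤ))‖ₑ + ‖w (b * h)‖ₑ)) ^ 2 := by
            gcongr
            refine (enorm_tsum_le_tsum_enorm).trans (ENNReal.tsum_le_tsum fun h => ?_)
            rw [enorm_mul, enorm_exp_I_mul, mul_one, sq_sub_sq, mul_comm, enorm_mul,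
              ← Complex.ofReal_sub, ← Complex.ofReal_add, enorm_complex_ofReal,
              enorm_complex_ofReal]
            gcongr
            exact enorm_add_le _ _
        _ ≤ ENNReal.ofReal b ^ 2 * ((∑' h : ℤ, ‖w (b * (h + -1 : ℤ)) - w (b * h)‖ₑ ^ 2)
            * ∑' h : ℤ, (‖w (b * (h + -1 : ℤ))‖ₑ + ‖w (b * h)‖ₑ) ^ 2) := by
            rw [mul_pow]
            gcongr
            exact ENNReal.tsum_mul_sq_le _ _
        _ ≤ ENNReal.ofReal b ^ 2 * ((∑' h : ℤ, ‖w (b * (h + -1 : ℤ)) - w (b * h)‖ₑ ^ 2)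
            * (2 * (∑' h : ℤ, ‖w (b * h)‖ₑ ^ 2 + ∑' h : ℤ, ‖w (b * h)‖ₑ ^ 2))) := by
            nth_rewrite 1 [← tsum_enorm_shift w b (-1)]
            rw [← ENNReal.tsum_add]
            refine mul_le_mul_right (mul_le_mul_right ?_ _) _
            rw [← ENNReal.tsum_mul_left]
            exact ENNReal.tsum_le_tsum fun h => ENNReal.add_sq_le _ _
        _ = _ := by
            rw [windowDiff, windowSq]; ring
    have hlim : Tendsto (fun b => windowDiff w (-1) b * (2 * (windowSq w b + windowSq w b)))
        (𝓝[>] 0) (𝓝 0) := by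
      have h1 := ENNReal.Tendsto.const_mul (a := 2)
        (hw.tendsto_windowSq.add hw.tendsto_windowSq) (Or.inr (by simp))
      have h2 := ENNReal.Tendsto.mul (hw.tendsto_windowDiff (-1))
        (Or.inr (ENNReal.mul_ne_top (by simp) (by simp))) h1 (Or.inr (by simp))
      rwa [zero_mul] at h2
    have h3 : Tendsto (fun b => ‖(Complex.exp (Complex.I * θ) - 1) * windowTrig w θ b‖ₑ)
        (𝓝[>] 0) (𝓝 0) := ENNReal.tendsto_zero_of_sq
      (tendsto_of_tendsto_of_tendsto_of_le_of_le' tendsto_const_nhds hlim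
        (Eventually.of_forall fun _ => zero_le) hbound)
    have h4 := (tendsto_zero_iff_enorm_tendsto_zero.2 h3).const_mul
      (Complex.exp (Complex.I * θ) - 1)⁻¹
    rw [mul_zero] at h4
    refine h4.congr fun b => ?_
    rw [inv_mul_cancel_left₀ (sub_ne_zero.2 hθ)]

variable {ι : Type*} {l : Filter ι} {b : ι → ℝ} {τ : ι → ℕ}

theorem tendsto_natCast_inv_of_bandwidth (hb : Tendsto b l (𝓝[>] 0))
    (hbτ : Tendsto (fun i => b i * τ i) l atTop) : Tendsto (fun i => ((τ i : ℝ))⁻¹) l (𝓝 0) := by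
  have h1 := (hb.mono_right nhdsWithin_le_nhds).mul hbτ.inv_tendsto_atTop
  rw [zero_mul] at h1
  refine h1.congr' ?_
  filter_upwards [hb.eventually self_mem_nhdsWithin] with i hi
  have hi' : b i ≠ 0 := (show (0 : ℝ) < b i from hi).ne'
  simp only [Pi.inv_apply, mul_inv]
  rw [mul_inv_cancel_left₀ hi']

/-- For `|h| < M/b` the defect `1 - c` is at most `M/(bτ) + C/τ`, which tends to zero because `bτ →
∞`; the lags beyond `M/b` carry little energy. The bandwidth and the length `τ` are kept separate so
that the limits also apply to blocks shorter than the sample. -/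
theorem LagWindow.tendsto_taper (hw : LagWindow w) (hb : Tendsto b l (𝓝[>] 0))
    (hbτ : Tendsto (fun i => b i * τ i) l atTop) {c : ι → ℤ → ℝ} (hc0 : ∀ i h, 0 ≤ c i h)
    {C : ℝ} (hc : ∀ i h, 0 < τ i → 1 - c i h ≤ (|(h : ℝ)| + C) / τ i) :
    Tendsto (fun i => ENNReal.ofReal (b i) * ∑' h : ℤ, ‖w (b i * h)‖ₑ ^ 2
      * ENNReal.ofReal (1 - c i h)) l (𝓝 0) := by
  rw [ENNReal.tendsto_nhds_zero]
  intro η hη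
  obtain ⟨M, hM, hMt⟩ := hw.exists_windowTail_le (ENNReal.half_pos hη.ne')
  have hτ := tendsto_natCast_inv_of_bandwidth hb hbτ
  have h1 : Tendsto (fun i => (b i * τ i)⁻¹ * M + C * (τ i : ℝ)⁻¹) l (𝓝 0) := by
    have := (hbτ.inv_tendsto_atTop.mul_const M).add (hτ.const_mul C)
    simpa using this
  have h2 := ENNReal.Tendsto.mul (ENNReal.tendsto_ofReal h1) (Or.inr ENNReal.ofReal_ne_top)
    (hw.tendsto_windowSq.comp hb) (Or.inr (by simp))
  rw [ENNReal.ofReal_zero, zero_mul] at h2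
  have h3 := ENNReal.tendsto_nhds_zero.1 h2 _ (ENNReal.half_pos hη.ne')
  filter_upwards [h3, hb.eventually (Ioc_mem_nhdsGT (zero_lt_one' ℝ)),
    hbτ.eventually_gt_atTop 0] with i h4 hbi hpos
  have hb0 := hbi.1
  have hτ0 : 0 < τ i := by
    rcases Nat.eq_zero_or_pos (τ i) with h | h
    · rw [h] at hpos; simp at hpos
    · exact h
  have hτr : (0 : ℝ) < τ i := by exact_mod_cast hτ0
  calc ENNReal.ofReal (b i) * ∑' h : ℤ, ‖w (b i * h)‖ₑ ^ 2 * ENNReal.ofReal (1 - c i h)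
      ≤ windowTail w M (b i)
        + ENNReal.ofReal ((b i * τ i)⁻¹ * M + C * (τ i : ℝ)⁻¹) * windowSq w (b i) := by
        rw [windowTail, windowSq, mul_left_comm, ← mul_add]
        refine mul_le_mul_right ?_ _
        rw [← ENNReal.tsum_mul_left, ← ENNReal.tsum_add]
        refine ENNReal.tsum_le_tsum fun h => ?_
        by_cases hh : M / b i ≤ |(h : ℝ)|
        · rw [if_pos hh]
          refine le_trans ?_ le_self_add
          refine mul_le_of_le_one_right zero_le ?_
          rw [← ENNReal.ofReal_one]
          exact ENNReal.ofReal_le_ofReal (by linarith [hc0 i h])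
        · rw [if_neg hh, zero_add, mul_comm]
          gcongr
          refine (hc i h hτ0).trans ?_
          rw [not_le] at hh
          rw [mul_inv, ← div_eq_mul_inv C, mul_comm, ← mul_assoc, ← div_eq_mul_inv,
            ← div_eq_mul_inv, ← add_div]
          gcongr
    _ ≤ η / 2 + η / 2 := add_le_add (hMt _ hbi) h4
    _ = η := ENNReal.add_halves η

/-- Comparison with `windowTrig`: replacing `w(b(h + k))` by `w(bh)` is controlled by `windowDiff`
through Cauchy–Schwarz, and removing the taper by `tendsto_taper`. -/
theorem LagWindow.tendsto_tapered_tsum (hw : LagWindow w) (hb : Tendsto b l (𝓝[>] 0))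
    (hbτ : Tendsto (fun i => b i * τ i) l atTop) {c : ι → ℤ → ℝ} (hc0 : ∀ i h, 0 ≤ c i h)
    (hc1 : ∀ i h, c i h ≤ 1) {C : ℝ}
    (hc : ∀ i h, 0 < τ i → 1 - c i h ≤ (|(h : ℝ)| + C) / τ i) (k : ℤ) (θ : ℝ) :
    Tendsto (fun i => (b i : ℂ) * ∑' h : ℤ, (w (b i * h) * w (b i * (h + k : ℤ)) * c i h : ℂ)
      * Complex.exp (Complex.I * θ * h)) l
      (𝓝 (if Complex.exp (Complex.I * θ) = 1 then (windowEnergy w : ℂ) else 0)) := by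
  have hV := (hw.tendsto_windowTrig θ).comp hb
  have h1 : Tendsto (fun i => ENNReal.ofReal (b i) * ∑' h : ℤ, ‖w (b i * h)‖ₑ
      * ‖w (b i * (h + k : ℤ)) - w (b i * h)‖ₑ) l (𝓝 0) := by
    refine ENNReal.tendsto_zero_of_sq ?_
    have h2 := ENNReal.Tendsto.mul (hw.tendsto_windowSq.comp hb) (Or.inr (by simp))
      ((hw.tendsto_windowDiff k).comp hb) (Or.inr (by simp))
    rw [mul_zero] at h2
    refine tendsto_of_tendsto_of_tendsto_of_le_of_le tendsto_const_nhds h2 (fun _ => zero_le)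
      fun i => ?_
    simp only [Function.comp, windowSq, windowDiff]
    calc _ ≤ ENNReal.ofReal (b i) ^ 2 * ((∑' h : ℤ, ‖w (b i * h)‖ₑ ^ 2)
        * ∑' h : ℤ, ‖w (b i * (h + k : ℤ)) - w (b i * h)‖ₑ ^ 2) := by
          rw [mul_pow]; gcongr; exact ENNReal.tsum_mul_sq_le _ _
      _ = _ := by ring
  have h2 := h1.add (hw.tendsto_taper hb hbτ hc0 hc)
  rw [add_zero] at h2
  have h3 : Tendsto (fun i => ((b i : ℂ) * ∑' h : ℤ, (w (b i * h) * w (b i * (h + k : ℤ)) * c i h : ℂ)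
      * Complex.exp (Complex.I * θ * h)) - windowTrig w θ (b i)) l (𝓝 0) := by
    rw [tendsto_zero_iff_enorm_tendsto_zero]
    refine tendsto_of_tendsto_of_tendsto_of_le_of_le' tendsto_const_nhds h2
      (Eventually.of_forall fun _ => zero_le) ?_
    filter_upwards [hb.eventually self_mem_nhdsWithin, hb.eventually hw.eventually_tsum_ne_top]
      with i hbi hfin
    have hbi' : (0 : ℝ) < b i := hbi
    have hs := summable_windowTrig hfin θ
    have hs2 : Summable fun h : ℤ => (w (b i * h) * w (b i * (h + k : ℤ)) * c i h : ℂ)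
        * Complex.exp (Complex.I * θ * h) := by
      refine summable_of_tsum_enorm_ne_top ?_
      have hfin2 : ∑' h : ℤ, (‖w (b i * h)‖ₑ ^ 2 + ‖w (b i * (h + k : ℤ))‖ₑ ^ 2) ≠ ∞ := by
        rw [ENNReal.tsum_add, tsum_enorm_shift]
        exact ENNReal.add_ne_top.2 ⟨hfin, hfin⟩
      refine ne_top_of_le_ne_top hfin2 (ENNReal.tsum_le_tsum fun h => ?_)
      simp only [enorm_mul, enorm_exp_I_mul, mul_one, enorm_complex_ofReal]
      have : ‖c i h‖ₑ ≤ 1 := by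
        rw [Real.enorm_of_nonneg (hc0 i h), ← ENNReal.ofReal_one]
        exact ENNReal.ofReal_le_ofReal (hc1 i h)
      refine (mul_le_of_le_one_right zero_le this).trans ?_
      exact le_trans le_self_add (ENNReal.mul_add_mul_le_sq_add_sq _ _)
    rw [windowTrig, ← mul_sub, ← hs2.tsum_sub hs, enorm_mul, enorm_complex_ofReal,
      Real.enorm_of_nonneg hbi'.le, ← mul_add, ← ENNReal.tsum_add]
    refine mul_le_mul_right ?_ _
    refine (enorm_tsum_le_tsum_enorm).trans (ENNReal.tsum_le_tsum fun h => ?_)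
    rw [← sub_mul, enorm_mul, enorm_exp_I_mul, mul_one]
    have e : (w (b i * h) * w (b i * (h + k : ℤ)) * c i h : ℂ) - (w (b i * h) : ℂ) ^ 2
        = ((w (b i * h) * (w (b i * (h + k : ℤ)) - w (b i * h)) * c i h
          - w (b i * h) ^ 2 * (1 - c i h) : ℝ) : ℂ) := by push_cast; ring
    rw [e, enorm_complex_ofReal]
    refine enorm_sub_le.trans (add_le_add ?_ ?_)
    · rw [enorm_mul, enorm_mul]
      refine mul_le_of_le_one_right zero_le ?_
      rw [Real.enorm_of_nonneg (hc0 i h), ← ENNReal.ofReal_one]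
      exact ENNReal.ofReal_le_ofReal (hc1 i h)
    · rw [enorm_mul, enorm_pow, Real.enorm_of_nonneg (sub_nonneg.2 (hc1 i h))]
  have h4 := h3.add hV
  simpa using h4

/-- The number of `s` for which `s`, `s + h`, `s - u` and `s + h - v` all lie in `[1, n]`. -/
def overlapCount (n : ℕ) (u v h : ℤ) : ℕ :=
  ((Finset.Icc (1 : ℤ) n).filter fun s => s + h ∈ Finset.Icc (1 : ℤ) n ∧
    s - u ∈ Finset.Icc (1 : ℤ) n ∧ s + h - v ∈ Finset.Icc (1 : ℤ) n).card

theorem overlapCount_le (n : ℕ) (u v h : ℤ) : overlapCount n u v h ≤ n := by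
  refine (Finset.card_filter_le _ _).trans ?_
  simp

theorem le_overlapCount (n : ℕ) (u v h : ℤ) :
    (n : ℤ) - |h| - |u| - |v| ≤ overlapCount n u v h := by
  have hsub : Finset.Icc (1 + max 0 (-h) + max 0 u + max 0 v)
      (n - max 0 h - max 0 (-u) - max 0 (-v)) ⊆
      (Finset.Icc (1 : ℤ) n).filter fun s => s + h ∈ Finset.Icc (1 : ℤ) n ∧
        s - u ∈ Finset.Icc (1 : ℤ) n ∧ s + h - v ∈ Finset.Icc (1 : ℤ) n := by
    intro s hs
    simp only [Finset.mem_filter, Finset.mem_Icc] at hs ⊢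
    omega
  have h1 := Finset.card_le_card hsub
  rw [Int.card_Icc] at h1
  change _ ≤ overlapCount n u v h at h1
  have h2 : |h| = max 0 h + max 0 (-h) := by rw [abs_eq_max_neg]; omega
  have h3 : |u| = max 0 u + max 0 (-u) := by rw [abs_eq_max_neg]; omega
  have h4 : |v| = max 0 v + max 0 (-v) := by rw [abs_eq_max_neg]; omega
  omega

theorem sum_sum_overlap_eq_tsum (n : ℕ) (u v : ℤ) (f : ℤ → ℂ) :
    ∑ s ∈ Finset.Icc (1 : ℤ) n, ∑ t ∈ Finset.Icc (1 : ℤ) n,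
      (if s - u ∈ Finset.Icc (1 : ℤ) n ∧ t - v ∈ Finset.Icc (1 : ℤ) n then f (t - s) else 0)
      = ∑' h : ℤ, f h * overlapCount n u v h := by
  have h1 : ∀ s ∈ Finset.Icc (1 : ℤ) n, HasSum (fun h : ℤ =>
      if s + h ∈ Finset.Icc (1 : ℤ) n ∧ s - u ∈ Finset.Icc (1 : ℤ) n
        ∧ s + h - v ∈ Finset.Icc (1 : ℤ) n then f h else 0)
      (∑ t ∈ Finset.Icc (1 : ℤ) n,
      (if s - u ∈ Finset.Icc (1 : ℤ) n ∧ t - v ∈ Finset.Icc (1 : ℤ) n then f (t - s) else 0)) := by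
    intro s _
    have h2 : HasSum (fun t : ℤ => if t ∈ Finset.Icc (1 : ℤ) n ∧ s - u ∈ Finset.Icc (1 : ℤ) n
        ∧ t - v ∈ Finset.Icc (1 : ℤ) n then f (t - s) else 0)
        (∑ t ∈ Finset.Icc (1 : ℤ) n, (if t ∈ Finset.Icc (1 : ℤ) n ∧ s - u ∈ Finset.Icc (1 : ℤ) n
        ∧ t - v ∈ Finset.Icc (1 : ℤ) n then f (t - s) else 0)) :=
      hasSum_sum_of_ne_finset_zero fun t ht => if_neg fun h => ht h.1
    have h3 := (Equiv.addLeft s).hasSum_iff.2 h2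
    have e : (∑ t ∈ Finset.Icc (1 : ℤ) n, (if t ∈ Finset.Icc (1 : ℤ) n ∧ s - u ∈ Finset.Icc (1 : ℤ) n
        ∧ t - v ∈ Finset.Icc (1 : ℤ) n then f (t - s) else 0)) = ∑ t ∈ Finset.Icc (1 : ℤ) n,
      (if s - u ∈ Finset.Icc (1 : ℤ) n ∧ t - v ∈ Finset.Icc (1 : ℤ) n then f (t - s) else 0) :=
      Finset.sum_congr rfl fun t ht => by simp only [ht, true_and]
    rw [e] at h3
    simpa only [Function.comp_def, Equiv.coe_addLeft, add_sub_cancel_left] using h3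
  rw [← (hasSum_sum h1).tsum_eq]
  refine tsum_congr fun h => ?_
  rw [Finset.sum_ite, Finset.sum_const_zero, add_zero, Finset.sum_const, nsmul_eq_mul, mul_comm]
  rfl

/-- Grouping the pairs by their lag `h = t - s` leaves one sum with the taper `overlapCount / τ`,
whose defect is at most `(|h| + |u| + |v|) / τ`. The second window factor is evaluated at `(t - v) -
(s - u) = h + (u - v)`. -/
theorem LagWindow.tendsto_overlap_sum (hw : LagWindow w) (hb : Tendsto b l (𝓝[>] 0))
    (hbτ : Tendsto (fun i => b i * τ i) l atTop) (u v : ℤ) (θ : ℝ) :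
    Tendsto (fun i => ((b i / τ i : ℝ) : ℂ) * ∑ s ∈ Finset.Icc (1 : ℤ) (τ i),
      ∑ t ∈ Finset.Icc (1 : ℤ) (τ i),
      (if s - u ∈ Finset.Icc (1 : ℤ) (τ i) ∧ t - v ∈ Finset.Icc (1 : ℤ) (τ i) then
        (w (b i * (t - s : ℤ)) * w (b i * (t - s + (u - v) : ℤ)) : ℂ)
          * Complex.exp (Complex.I * θ * (t - s : ℤ)) else 0)) l
      (𝓝 (if Complex.exp (Complex.I * θ) = 1 then (windowEnergy w : ℂ) else 0)) := by
  refine (hw.tendsto_tapered_tsum hb hbτ (c := fun i h => (overlapCount (τ i) u v h : ℝ) / τ i)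
    (fun i h => by positivity) (fun i h => div_le_one_of_le₀
      (by exact_mod_cast overlapCount_le _ _ _ _) (by positivity)) (C := |(u : ℝ)| + |(v : ℝ)|)
    (fun i h hi => ?_) (u - v) θ).congr fun i => ?_
  · have hi' : (0 : ℝ) < τ i := by exact_mod_cast hi
    rw [← div_self hi'.ne', ← sub_div]
    gcongr
    have := le_overlapCount (τ i) u v h
    have h2 : ((τ i : ℝ)) - |(h : ℝ)| - |(u : ℝ)| - |(v : ℝ)| ≤ overlapCount (τ i) u v h := by
      exact_mod_cast this
    linarith
  · rw [sum_sum_overlap_eq_tsum (τ i) u v fun h => (w (b i * h) * w (b i * (h + (u - v) : ℤ)) : ℂ)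
          * Complex.exp (Complex.I * θ * h)]
    push_cast
    rw [div_mul_eq_mul_div, mul_div_assoc, ← tsum_div_const]
    congr 1
    refine tsum_congr fun h => ?_
    ring

theorem LagWindow.tendsto_sum_sq (hw : LagWindow w) (hb : Tendsto b l (𝓝[>] 0))
    (hbτ : Tendsto (fun i => b i * τ i) l atTop) :
    Tendsto (fun i => b i / τ i * ∑ s ∈ Finset.Icc (1 : ℤ) (τ i),
      ∑ t ∈ Finset.Icc (1 : ℤ) (τ i), w (b i * (t - s)) ^ 2) l (𝓝 (windowEnergy w)) := by
  have h := hw.tendsto_overlap_sum hb hbτ 0 0 0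
  simp only [Complex.ofReal_zero, mul_zero, Complex.exp_zero, if_true, zero_mul, mul_one] at h
  have h2 := (Complex.continuous_re.tendsto _).comp h
  simp only [Complex.ofReal_re] at h2
  refine h2.congr fun i => ?_
  simp only [Function.comp]
  rw [Complex.re_ofReal_mul, Complex.re_sum]
  congr 1
  refine Finset.sum_congr rfl fun s hs => ?_
  rw [Complex.re_sum]
  refine Finset.sum_congr rfl fun t ht => ?_
  rw [if_pos (by rw [sub_zero, sub_zero]; exact ⟨hs, ht⟩), ← Complex.ofReal_mul, Complex.ofReal_re]
  push_cast
  ring_nf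

end WindowSums

/-! ### Fourth-order cumulants of bounded functions of the coordinates -/

section FourthOrder

set_option linter.unusedSectionVars false

variable {S : Type*} [MeasurableSpace S] {π : Measure S} [IsProbabilityMeasure π]
variable {E : Type*} [NormedAddCommGroup E] [NormedSpace ℝ E] [CompleteSpace E]

/-- Bounded strongly measurable functions. -/
structure BddMeas {α : Type*} [MeasurableSpace α] (f : α → E) : Prop where
  meas : StronglyMeasurable f
  bdd : ∃ M, ∀ x, ‖f x‖ ≤ M

namespace BddMeas

variable {α β : Type*} [MeasurableSpace α] [MeasurableSpace β]

theorem comp {f : α → E} (hf : BddMeas f) {g : β → α} (hg : Measurable g) :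
    BddMeas fun x => f (g x) :=
  ⟨hf.meas.comp_measurable hg, hf.bdd.imp fun _ h x => h (g x)⟩

theorem memLp {f : α → E} (hf : BddMeas f) (μ : Measure α) [IsFiniteMeasure μ] (p : ℝ≥0∞) :
    MemLp f p μ := by
  obtain ⟨M, hM⟩ := hf.bdd
  exact MemLp.of_bound hf.meas.aestronglyMeasurable M (Eventually.of_forall hM)

theorem integrable {f : α → E} (hf : BddMeas f) (μ : Measure α) [IsFiniteMeasure μ] :
    Integrable f μ := memLp_one_iff_integrable.1 (hf.memLp μ 1)

theorem bilin {F G : Type*} [NormedAddCommGroup F] [NormedSpace ℝ F] [NormedAddCommGroup G]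
    [NormedSpace ℝ G] {f : α → E} {g : α → F} (hf : BddMeas f) (hg : BddMeas g)
    (B : E →L[ℝ] F →L[ℝ] G) : BddMeas fun x => B (f x) (g x) := by
  refine ⟨?_, ?_⟩
  · have : Continuous fun p : E × F => B p.1 p.2 := by fun_prop
    exact this.comp_stronglyMeasurable (hf.meas.prodMk hg.meas)
  · obtain ⟨M, hM⟩ := hf.bdd
    obtain ⟨N, hN⟩ := hg.bdd
    refine ⟨‖B‖ * M * N, fun x => (B.le_opNorm₂ _ _).trans ?_⟩
    have h1 := norm_nonneg (f x)
    have h2 := norm_nonneg (g x)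
    have h3 := norm_nonneg B
    have h4 := hM x
    have h5 := hN x
    have : 0 ≤ M := h1.trans h4
    gcongr

theorem mul {f g : α → ℂ} (hf : BddMeas f) (hg : BddMeas g) : BddMeas fun x => f x * g x :=
  hf.bilin hg (ContinuousLinearMap.mul ℝ ℂ)

theorem sum {ι : Type*} {s : Finset ι} {f : ι → α → E} (hf : ∀ i ∈ s, BddMeas (f i)) :
    BddMeas fun x => ∑ i ∈ s, f i x := by
  classical
  induction s using Finset.induction_on with
  | empty => exact ⟨by simpa using stronglyMeasurable_const, 0, by simp⟩
  | insert a s ha ih =>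
    obtain ⟨h1, N, hN⟩ := ih fun i hi => hf i (Finset.mem_insert_of_mem hi)
    obtain ⟨h2, M, hM⟩ := hf a (Finset.mem_insert_self _ _)
    simp only [Finset.sum_insert ha]
    exact ⟨h2.add h1, M + N, fun x => (norm_add_le _ _).trans (add_le_add (hM x) (hN x))⟩

theorem const_mul {f : α → ℂ} (hf : BddMeas f) (c : ℂ) : BddMeas fun x => c * f x := by
  obtain ⟨h1, N, hN⟩ := hf
  refine ⟨h1.const_mul c, ‖c‖ * N, fun x => ?_⟩
  rw [norm_mul]
  exact mul_le_mul_of_nonneg_left (hN x) (norm_nonneg c)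

end BddMeas

/-- `f` and `g` are functions of disjoint sets of coordinates. -/
def SepCoord {F G : Type*} (f : (ℤ → S) → F) (g : (ℤ → S) → G) : Prop :=
  ∃ A : Set ℤ, DependsOn f A ∧ DependsOn g Aᶜ

theorem SepCoord.symm {F G : Type*} {f : (ℤ → S) → F} {g : (ℤ → S) → G} (h : SepCoord f g) :
    SepCoord g f := by
  obtain ⟨A, h1, h2⟩ := h
  exact ⟨Aᶜ, h2, by rwa [compl_compl]⟩

theorem SepCoord.integral_comp₂ {F G K : Type*} [NormedAddCommGroup K] [NormedSpace ℝ K]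
    {f : (ℤ → S) → F} {g : (ℤ → S) → G}
    (h : SepCoord f g) (Φ : F → G → K) (hi : Integrable (fun ω => Φ (f ω) (g ω)) (iidLaw π)) :
    ∫ ω, Φ (f ω) (g ω) ∂iidLaw π = ∫ ω, ∫ ω', Φ (f ω) (g ω') ∂iidLaw π ∂iidLaw π := by
  obtain ⟨A, h1, h2⟩ := h
  rw [← integral_integral_mer A hi]
  simp only [h1.apply_mer subset_rfl, h2.apply_mer_of_disjoint disjoint_compl_left]

theorem SepCoord.integral_mul {f g : (ℤ → S) → ℂ} (h : SepCoord f g) (hf : BddMeas f)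
    (hg : BddMeas g) :
    ∫ ω, f ω * g ω ∂iidLaw π = (∫ ω, f ω ∂iidLaw π) * ∫ ω, g ω ∂iidLaw π := by
  rw [h.integral_comp₂ (fun x y => x * y) ((hf.mul hg).integrable _)]
  simp only [integral_const_mul, integral_mul_const]

theorem SepCoord.integral_bilin_eq_zero {f g : (ℤ → S) → E} (h : SepCoord f g) (hf : BddMeas f)
    (hg : BddMeas g) (h0 : ∫ ω, g ω ∂iidLaw π = 0) (B : E →L[ℝ] E →L[ℝ] ℂ) :
    ∫ ω, B (f ω) (g ω) ∂iidLaw π = 0 := by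
  rw [h.integral_comp₂ (fun x y => B x y) ((hf.bilin hg B).integrable _)]
  have : ∀ x, ∫ ω', B x (g ω') ∂iidLaw π = 0 := fun x => by
    rw [(B x).integral_comp_comm (hg.integrable _), h0, map_zero]
  simp only [this, integral_zero]

variable (π) in
/-- `E B(f₁, f₂') B'(f₃, f₄')`, where `(f₂', f₄')` is an independent copy of `(f₂, f₄)`. -/
def crossMoment (B B' : E →L[ℝ] E →L[ℝ] ℂ) (f₁ f₂ f₃ f₄ : (ℤ → S) → E) : ℂ :=
  ∫ ω, ∫ ω', B (f₁ ω) (f₂ ω') * B' (f₃ ω) (f₄ ω') ∂iidLaw π ∂iidLaw π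

variable (π) in
/-- The fourth-order joint cumulant of `B(f₁, f₂)` and `B'(f₃, f₄)` for centered `fᵢ`. -/
def cumulant₄ (B B' : E →L[ℝ] E →L[ℝ] ℂ) (f₁ f₂ f₃ f₄ : (ℤ → S) → E) : ℂ :=
  ∫ ω, B (f₁ ω) (f₂ ω) * B' (f₃ ω) (f₄ ω) ∂iidLaw π
    - (∫ ω, B (f₁ ω) (f₂ ω) ∂iidLaw π) * (∫ ω, B' (f₃ ω) (f₄ ω) ∂iidLaw π)
    - crossMoment π B B' f₁ f₂ f₃ f₄ - crossMoment π B B'.flip f₁ f₂ f₄ f₃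

variable {B B' : E →L[ℝ] E →L[ℝ] ℂ} {f₁ f₂ f₃ f₄ : (ℤ → S) → E}

theorem bddMeas_cross (B B' : E →L[ℝ] E →L[ℝ] ℂ) (h₁ : BddMeas f₁) (h₂ : BddMeas f₂)
    (h₃ : BddMeas f₃) (h₄ : BddMeas f₄) :
    BddMeas fun p : (ℤ → S) × (ℤ → S) => B (f₁ p.1) (f₂ p.2) * B' (f₃ p.1) (f₄ p.2) :=
  ((h₁.comp measurable_fst).bilin (h₂.comp measurable_snd) B).mul
    ((h₃.comp measurable_fst).bilin (h₄.comp measurable_snd) B')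

theorem crossMoment_eq_zero_right (h₂ : BddMeas f₂) (h₄ : BddMeas f₄) (h : SepCoord f₂ f₄)
    (h0 : ∫ ω, f₂ ω ∂iidLaw π = 0) : crossMoment π B B' f₁ f₂ f₃ f₄ = 0 := by
  have : ∀ x y, ∫ ω', B x (f₂ ω') * B' y (f₄ ω') ∂iidLaw π = 0 := fun x y => by
    rw [h.integral_comp₂ (fun z z' => B x z * B' y z')]
    · simp only [integral_const_mul, integral_mul_const]
      rw [(B x).integral_comp_comm (h₂.integrable _), h0, map_zero, zero_mul]
    · refine ((?_ : BddMeas _).mul ?_).integrable _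
      · exact BddMeas.bilin (f := fun _ => x) ⟨stronglyMeasurable_const, ‖x‖, fun _ => le_rfl⟩ h₂ B
      · exact BddMeas.bilin (f := fun _ => y) ⟨stronglyMeasurable_const, ‖y‖, fun _ => le_rfl⟩ h₄ B'
  simp only [crossMoment, this, integral_zero]

theorem crossMoment_flip (h₁ : BddMeas f₁) (h₂ : BddMeas f₂) (h₃ : BddMeas f₃)
    (h₄ : BddMeas f₄) : crossMoment π B.flip B'.flip f₂ f₁ f₄ f₃ = crossMoment π B B' f₁ f₂ f₃ f₄ := by
  rw [crossMoment, crossMoment]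
  exact integral_integral_swap ((bddMeas_cross B.flip B'.flip h₂ h₁ h₄ h₃).integrable _)

theorem crossMoment_eq_zero_left (h₁ : BddMeas f₁) (h₂ : BddMeas f₂) (h₃ : BddMeas f₃)
    (h₄ : BddMeas f₄) (h : SepCoord f₁ f₃)
    (h0 : ∫ ω, f₁ ω ∂iidLaw π = 0) : crossMoment π B B' f₁ f₂ f₃ f₄ = 0 := by
  rw [← crossMoment_flip h₁ h₂ h₃ h₄]
  exact crossMoment_eq_zero_right h₁ h₃ h h0

/-- The group of `f₁` is placed in `A`, which leaves eight cases. A variable alone in its group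
enters every term through its mean, so all terms vanish. If the groups are two pairs, the fourth
moment equals exactly one of the three subtracted terms and the other two are zero. -/
theorem cumulant₄_eq_zero (h₁ : BddMeas f₁) (h₂ : BddMeas f₂) (h₃ : BddMeas f₃)
    (h₄ : BddMeas f₄) (z₁ : ∫ ω, f₁ ω ∂iidLaw π = 0) (z₂ : ∫ ω, f₂ ω ∂iidLaw π = 0)
    (z₃ : ∫ ω, f₃ ω ∂iidLaw π = 0) (z₄ : ∫ ω, f₄ ω ∂iidLaw π = 0) {A : Set ℤ}
    (d₁ : DependsOn f₁ A) (d₂ : DependsOn f₂ A ∨ DependsOn f₂ Aᶜ)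
    (d₃ : DependsOn f₃ A ∨ DependsOn f₃ Aᶜ) (d₄ : DependsOn f₄ A ∨ DependsOn f₄ Aᶜ)
    (hne : DependsOn f₂ Aᶜ ∨ DependsOn f₃ Aᶜ ∨ DependsOn f₄ Aᶜ) :
    cumulant₄ π B B' f₁ f₂ f₃ f₄ = 0 := by
  have hi := ((h₁.bilin h₂ B).mul (h₃.bilin h₄ B')).integrable (iidLaw π)
  have hint := integral_integral_mer A hi
  have hint' := integral_integral_mer Aᶜ hi
  have sAc : ∀ {f g : (ℤ → S) → E}, DependsOn f A → DependsOn g Aᶜ → SepCoord f g :=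
    fun hf hg => ⟨A, hf, hg⟩
  have m : ∀ {f : (ℤ → S) → E}, DependsOn f A → ∀ ω ω', f (mer A ω ω') = f ω :=
    fun hf => hf.apply_mer subset_rfl
  have n : ∀ {f : (ℤ → S) → E}, DependsOn f Aᶜ → ∀ ω ω', f (mer A ω ω') = f ω' :=
    fun hf => hf.apply_mer_of_disjoint disjoint_compl_left
  have m' : ∀ {f : (ℤ → S) → E}, DependsOn f A → ∀ ω ω', f (mer Aᶜ ω ω') = f ω' :=
    fun hf => hf.apply_mer_of_disjoint disjoint_compl_right
  have n' : ∀ {f : (ℤ → S) → E}, DependsOn f Aᶜ → ∀ ω ω', f (mer Aᶜ ω ω') = f ω :=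
    fun hf => hf.apply_mer subset_rfl
  have zr : ∀ (D : E →L[ℝ] E →L[ℝ] ℂ) {f : (ℤ → S) → E}, BddMeas f → ∫ ω, f ω ∂iidLaw π = 0 →
      ∀ x, ∫ ω', D x (f ω') ∂iidLaw π = 0 := fun D f hf h0 x => by
    rw [(D x).integral_comp_comm (hf.integrable _), h0, map_zero]
  have zl : ∀ (D : E →L[ℝ] E →L[ℝ] ℂ) {f : (ℤ → S) → E}, BddMeas f → ∫ ω, f ω ∂iidLaw π = 0 →
      ∀ x, ∫ ω', D (f ω') x ∂iidLaw π = 0 := fun D f hf h0 x => zr D.flip hf h0 x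
  rcases d₂ with d₂ | d₂ <;> rcases d₃ with d₃ | d₃ <;> rcases d₄ with d₄ | d₄
  -- All four depend on `A`. By `hne` one of them depends on `Aᶜ` as well; it is then constant and,
  -- being centered, zero.
  · have triv : ∀ {f : (ℤ → S) → E}, BddMeas f → ∫ ω, f ω ∂iidLaw π = 0 → DependsOn f A →
        DependsOn f Aᶜ → f = 0 := fun {f} hf h0 ha hb => by
      funext ω
      have e : ∀ ω', f ω = f ω' := fun ω' => by
        have e1 := ha.apply_mer subset_rfl ω ω'
        have e2 := hb.apply_mer_of_disjoint disjoint_compl_left ω ω'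
        rw [← e1, e2]
      have : ∫ ω', f ω' ∂iidLaw π = f ω := by
        rw [integral_congr_ae (g := fun _ => f ω) (Eventually.of_forall fun ω' => (e ω').symm)]
        simp
      rw [← this, h0]; rfl
    rcases hne with h | h | h
    · rw [triv h₂ z₂ d₂ h]; simp [cumulant₄, crossMoment]
    · rw [triv h₃ z₃ d₃ h]; simp [cumulant₄, crossMoment]
    · rw [triv h₄ z₄ d₄ h]; simp [cumulant₄, crossMoment]
  · rw [cumulant₄, ← hint, (sAc d₃ d₄).integral_bilin_eq_zero h₃ h₄ z₄,
      crossMoment_eq_zero_right h₂ h₄ (sAc d₂ d₄) z₂,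
      crossMoment_eq_zero_left h₁ h₂ h₄ h₃ (sAc d₁ d₄) z₁]
    simp only [m d₁, m d₂, m d₃, n d₄, integral_const_mul, zr B' h₄ z₄, mul_zero, integral_zero,
      sub_zero]
  · rw [cumulant₄, ← hint, (sAc d₄ d₃).symm.integral_bilin_eq_zero h₃ h₄ z₄,
      crossMoment_eq_zero_left h₁ h₂ h₃ h₄ (sAc d₁ d₃) z₁,
      crossMoment_eq_zero_right h₂ h₃ (sAc d₂ d₃) z₂]
    simp only [m d₁, m d₂, n d₃, m d₄, integral_const_mul, zl B' h₃ z₃, mul_zero, integral_zero,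
      sub_zero]
  · rw [cumulant₄, ← hint, crossMoment_eq_zero_left h₁ h₂ h₃ h₄ (sAc d₁ d₃) z₁,
      crossMoment_eq_zero_left h₁ h₂ h₄ h₃ (sAc d₁ d₄) z₁]
    simp only [m d₁, m d₂, n d₃, n d₄, integral_const_mul, integral_mul_const, sub_self]
  · rw [cumulant₄, ← hint, (sAc d₁ d₂).integral_bilin_eq_zero h₁ h₂ z₂,
      crossMoment_eq_zero_right h₂ h₄ (sAc d₄ d₂).symm z₂,
      crossMoment_eq_zero_right h₂ h₃ (sAc d₃ d₂).symm z₂]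
    simp only [m d₁, n d₂, m d₃, m d₄, integral_mul_const, zr B h₂ z₂, zero_mul, integral_zero,
      sub_zero]
  · rw [cumulant₄, ← hint, (sAc d₁ d₂).integral_bilin_eq_zero h₁ h₂ z₂,
      crossMoment_eq_zero_right h₂ h₃ (sAc d₃ d₂).symm z₂]
    simp only [m d₁, n d₂, m d₃, n d₄, crossMoment, zero_mul, sub_zero, sub_self]
  · rw [cumulant₄, ← hint, (sAc d₁ d₂).integral_bilin_eq_zero h₁ h₂ z₂,
      crossMoment_eq_zero_right h₂ h₄ (sAc d₄ d₂).symm z₂]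
    simp only [m d₁, n d₂, n d₃, m d₄, crossMoment, zero_mul, sub_zero,
      ContinuousLinearMap.flip_apply, sub_self]
  · rw [cumulant₄, ← hint', (sAc d₁ d₂).integral_bilin_eq_zero h₁ h₂ z₂,
      crossMoment_eq_zero_left h₁ h₂ h₃ h₄ (sAc d₁ d₃) z₁,
      crossMoment_eq_zero_left h₁ h₂ h₄ h₃ (sAc d₁ d₄) z₁]
    simp only [m' d₁, n' d₂, n' d₃, n' d₄, integral_mul_const, zl B h₁ z₁, zero_mul, integral_zero,
      sub_zero]

theorem norm_cumulant₄_le {M : ℝ} (b₁ : ∀ ω, ‖f₁ ω‖ ≤ M) (b₂ : ∀ ω, ‖f₂ ω‖ ≤ M)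
    (b₃ : ∀ ω, ‖f₃ ω‖ ≤ M) (b₄ : ∀ ω, ‖f₄ ω‖ ≤ M) :
    ‖cumulant₄ π B B' f₁ f₂ f₃ f₄‖ ≤ 4 * ((‖B‖ * M * M) * (‖B'‖ * M * M)) := by
  obtain ⟨ω₀⟩ : Nonempty (ℤ → S) := (iidLaw π).nonempty_of_neZero
  have hM : 0 ≤ M := (norm_nonneg _).trans (b₁ ω₀)
  have hb : ∀ (D : E →L[ℝ] E →L[ℝ] ℂ) {x y : E}, ‖x‖ ≤ M → ‖y‖ ≤ M → ‖D x y‖ ≤ ‖D‖ * M * M :=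
    fun D x y hx hy => (D.le_opNorm₂ x y).trans (by gcongr)
  have hI : ∀ {f : (ℤ → S) → ℂ} {C : ℝ}, (∀ ω, ‖f ω‖ ≤ C) → ‖∫ ω, f ω ∂iidLaw π‖ ≤ C :=
    fun {f C} h => by
      simpa using norm_integral_le_of_norm_le_const (μ := iidLaw π) (Eventually.of_forall h)
  have hm : ∀ {z z' : ℂ} {C C' : ℝ}, ‖z‖ ≤ C → ‖z'‖ ≤ C' → ‖z * z'‖ ≤ C * C' :=
    fun {z z' C C'} h h' => by
      rw [norm_mul]
      exact mul_le_mul h h' (norm_nonneg _) ((norm_nonneg _).trans h)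
  have hf : ‖B'.flip‖ = ‖B'‖ := B'.opNorm_flip
  have e1 : ‖∫ ω, B (f₁ ω) (f₂ ω) * B' (f₃ ω) (f₄ ω) ∂iidLaw π‖ ≤ _ :=
    hI fun ω => hm (hb B (b₁ ω) (b₂ ω)) (hb B' (b₃ ω) (b₄ ω))
  have e2 : ‖(∫ ω, B (f₁ ω) (f₂ ω) ∂iidLaw π) * ∫ ω, B' (f₃ ω) (f₄ ω) ∂iidLaw π‖ ≤ _ :=
    hm (hI fun ω => hb B (b₁ ω) (b₂ ω)) (hI fun ω => hb B' (b₃ ω) (b₄ ω))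
  have e3 : ‖crossMoment π B B' f₁ f₂ f₃ f₄‖ ≤ _ :=
    hI fun ω => hI fun ω' => hm (hb B (b₁ ω) (b₂ ω')) (hb B' (b₃ ω) (b₄ ω'))
  have e4 : ‖crossMoment π B B'.flip f₁ f₂ f₄ f₃‖ ≤ _ :=
    hI fun ω => hI fun ω' => hm (hb B (b₁ ω) (b₂ ω')) (hb B'.flip (b₄ ω) (b₃ ω'))
  rw [hf] at e4
  refine (norm_sub_le _ _).trans ?_
  refine (add_le_add ((norm_sub_le _ _).trans (add_le_add (norm_sub_le _ _) le_rfl)) le_rfl).trans ?_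
  linarith

end FourthOrder

/-! ### Asymptotic covariances of lag-window forms of `m`-dependent processes -/

section MDependent

set_option linter.unusedSectionVars false

variable {S : Type*} [MeasurableSpace S] {π : Measure S} [IsProbabilityMeasure π]
variable {E : Type*} [NormedAddCommGroup E] [NormedSpace ℝ E] [CompleteSpace E]

/-- The stationary process generated by `G`. -/
def proc (G : (ℤ → S) → E) (t : ℤ) (ω : ℤ → S) : E := G (shift t ω)

/-- `G` generates a bounded, centered, `m`-dependent process. -/
structure MDep (π : Measure S) [IsProbabilityMeasure π] (m : ℕ) (G : (ℤ → S) → E) : Prop where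
  bddMeas : BddMeas G
  mean : ∫ ω, G ω ∂iidLaw π = 0
  dep : DependsOn G (Set.Icc (-m : ℤ) 0)

variable {m : ℕ} {G : (ℤ → S) → E}

theorem MDep.proc_bddMeas (hG : MDep π m G) (t : ℤ) : BddMeas (proc G t) :=
  hG.bddMeas.comp (measurable_shift t)

theorem MDep.proc_mean (hG : MDep π m G) (t : ℤ) : ∫ ω, proc G t ω ∂iidLaw π = 0 := by
  rw [← hG.mean]; exact integral_comp_shift G t

theorem DependsOn.proc {A : Set ℤ} (hG : DependsOn G A) {t : ℤ} {C : Set ℤ}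
    (h : ∀ i ∈ A, i + t ∈ C) : DependsOn (proc G t) C := by
  intro x y hxy
  exact hG fun i hi => hxy (i + t) (h i hi)

theorem MDep.proc_dep (hG : MDep π m G) {t : ℤ} {C : Set ℤ} (h : Set.Icc (t - m) t ⊆ C) :
    DependsOn (proc G t) C := by
  refine hG.dep.proc fun i hi => h ?_
  simp only [Set.mem_Icc] at hi ⊢
  omega

theorem MDep.sep (hG : MDep π m G) {s t : ℤ} (h : (m : ℤ) < |s - t|) :
    SepCoord (proc G s) (proc G t) := by
  rcases abs_cases (s - t) with ⟨h1, _⟩ | ⟨h1, _⟩ <;> rw [h1] at h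
  · refine ⟨Set.Ioi t, hG.proc_dep fun i hi => ?_, hG.proc_dep fun i hi => ?_⟩ <;>
    simp only [Set.mem_Icc, Set.mem_Ioi, Set.mem_compl_iff] at hi ⊢ <;> omega
  · refine ⟨Set.Iic s, hG.proc_dep fun i hi => ?_, hG.proc_dep fun i hi => ?_⟩ <;>
    simp only [Set.mem_Icc, Set.mem_Iic, Set.mem_compl_iff] at hi ⊢ <;> omega

/-- Times not all within `3m` of `i₁` spread over more than `3m`, so one of the three gaps between
consecutive times exceeds `m`. The cut `c` is the time just before that gap, which is why it
suffices to test `c` at the four times. -/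
theorem exists_gap {m i₁ i₂ i₃ i₄ : ℤ} (hm : 0 ≤ m)
    (h : ¬ (|i₂ - i₁| ≤ 3 * m ∧ |i₃ - i₁| ≤ 3 * m ∧ |i₄ - i₁| ≤ 3 * m)) :
    ∃ c, (i₁ ≤ c ∨ c + m < i₁) ∧ (i₂ ≤ c ∨ c + m < i₂) ∧ (i₃ ≤ c ∨ c + m < i₃) ∧
      (i₄ ≤ c ∨ c + m < i₄) ∧ (i₁ ≤ c ∨ i₂ ≤ c ∨ i₃ ≤ c ∨ i₄ ≤ c) ∧
      (c < i₁ ∨ c < i₂ ∨ c < i₃ ∨ c < i₄) := by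
  simp only [abs_le] at h
  by_contra! hc
  have h1 := hc i₁
  have h2 := hc i₂
  have h3 := hc i₃
  have h4 := hc i₄
  clear hc
  omega

variable {B B' : E →L[ℝ] E →L[ℝ] ℂ}

/-- At a cut `c` from `exists_gap`, times up to `c` involve only the coordinates in `Iic c`, and
times after `c + m` only those beyond `c`. The two branches give the role of `A` to the side on
which `i₁` lies. -/
theorem MDep.cumulant₄_eq_zero (hG : MDep π m G) {i₁ i₂ i₃ i₄ : ℤ}
    (h : ¬ (|i₂ - i₁| ≤ 3 * m ∧ |i₃ - i₁| ≤ 3 * m ∧ |i₄ - i₁| ≤ 3 * m)) :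
    cumulant₄ π B B' (proc G i₁) (proc G i₂) (proc G i₃) (proc G i₄) = 0 := by
  obtain ⟨c, h1, h2, h3, h4, h5, h6⟩ := exists_gap (by positivity) h
  have lo : ∀ {i : ℤ}, i ≤ c → DependsOn (proc G i) (Set.Iic c) := fun hi =>
    hG.proc_dep fun j hj => by simp only [Set.mem_Icc, Set.mem_Iic] at hj ⊢; omega
  have hi : ∀ {i : ℤ}, c + m < i → DependsOn (proc G i) (Set.Iic c)ᶜ := fun hi =>
    hG.proc_dep fun j hj => by
      simp only [Set.mem_Icc, Set.mem_compl_iff, Set.mem_Iic] at hj ⊢; omega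
  have hb := fun i => hG.proc_bddMeas i
  have hz := fun i => hG.proc_mean i
  rcases h1 with h1 | h1
  · refine _root_.cumulant₄_eq_zero (hb _) (hb _) (hb _) (hb _) (hz _) (hz _) (hz _) (hz _) (lo h1)
      (h2.imp lo hi) (h3.imp lo hi) (h4.imp lo hi) ?_
    rcases h6 with h6 | h6 | h6 | h6
    · omega
    · exact Or.inl (hi (h2.resolve_left (by omega)))
    · exact Or.inr (Or.inl (hi (h3.resolve_left (by omega))))
    · exact Or.inr (Or.inr (hi (h4.resolve_left (by omega))))
  · have lo' : ∀ {i : ℤ}, i ≤ c → DependsOn (proc G i) (Set.Iic c)ᶜᶜ := fun hi => by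
      rw [compl_compl]; exact lo hi
    refine _root_.cumulant₄_eq_zero (hb _) (hb _) (hb _) (hb _) (hz _) (hz _) (hz _) (hz _) (hi h1)
      (h2.symm.imp hi lo') (h3.symm.imp hi lo') (h4.symm.imp hi lo') ?_
    rcases h5 with h5 | h5 | h5 | h5
    · omega
    · exact Or.inl (lo' h5)
    · exact Or.inr (Or.inl (lo' h5))
    · exact Or.inr (Or.inr (lo' h5))

variable (π) in
/-- The covariance kernel `E B(X_u, X'_v) B'(X_0, X'_0)` with `X'` an independent copy of `X`. -/
def covKernel (B B' : E →L[ℝ] E →L[ℝ] ℂ) (G : (ℤ → S) → E) (u v : ℤ) : ℂ :=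
  crossMoment π B B' (proc G u) (proc G v) (proc G 0) (proc G 0)

/-- The two copies are independent, so each may be shifted by its own amount. -/
theorem crossMoment_proc (s t s' t' : ℤ) :
    crossMoment π B B' (proc G s) (proc G t) (proc G s') (proc G t')
      = covKernel π B B' G (s - s') (t - t') := by
  have h : ∀ (i j : ℤ) (ω : ℤ → S), proc G i ω = proc G (i - j) (shift j ω) := fun i j ω => by
    simp [proc, shift_shift]
  have h0 : ∀ (j : ℤ) (ω : ℤ → S), proc G j ω = proc G 0 (shift j ω) := fun j ω => by
    simp [proc]
  rw [covKernel, crossMoment, crossMoment]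
  conv_rhs => rw [← integral_comp_shift _ s']
  refine integral_congr_ae (Eventually.of_forall fun ω => ?_)
  simp only
  conv_rhs => rw [← integral_comp_shift _ t']
  refine integral_congr_ae (Eventually.of_forall fun ω' => ?_)
  simp only
  rw [← h s s', ← h t t', ← h0, ← h0]

theorem MDep.covKernel_eq_zero (hG : MDep π m G) {u v : ℤ}
    (h : u ∉ Finset.Icc (-m : ℤ) m ∨ v ∉ Finset.Icc (-m : ℤ) m) : covKernel π B B' G u v = 0 := by
  have key : ∀ {u : ℤ}, u ∉ Finset.Icc (-m : ℤ) m → SepCoord (proc G u) (proc G 0) := fun hu =>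
    hG.sep (by rw [Finset.mem_Icc, ← abs_le] at hu; simpa using hu)
  rcases h with h | h
  · exact crossMoment_eq_zero_left (hG.proc_bddMeas _) (hG.proc_bddMeas _) (hG.proc_bddMeas _)
      (hG.proc_bddMeas _) (key h) (hG.proc_mean _)
  · exact crossMoment_eq_zero_right (hG.proc_bddMeas _) (hG.proc_bddMeas _) (key h) (hG.proc_mean _)

/-- The coefficients of the lag-window estimator. -/
def winCoef (w : ℝ → ℝ) (b lam : ℝ) (s t : ℤ) : ℂ :=
  (w (b * ((t : ℝ) - s)) : ℂ) * Complex.exp (Complex.I * lam * ((t : ℂ) - s))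

/-- The lag-window form `∑ w(b(t-s)) e^{iλ(t-s)} B(X_s, X_t)`. -/
def winForm (B : E →L[ℝ] E →L[ℝ] ℂ) (G : (ℤ → S) → E) (w : ℝ → ℝ) (b lam : ℝ) (τ : ℕ)
    (ω : ℤ → S) : ℂ :=
  ∑ s ∈ Finset.Icc (1 : ℤ) τ, ∑ t ∈ Finset.Icc (1 : ℤ) τ,
    winCoef w b lam s t * B (proc G s ω) (proc G t ω)

theorem MDep.bddMeas_winForm (hG : MDep π m G) (B : E →L[ℝ] E →L[ℝ] ℂ) (w : ℝ → ℝ) (b lam : ℝ)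
    (τ : ℕ) : BddMeas (winForm B G w b lam τ) :=
  BddMeas.sum fun _ _ => BddMeas.sum fun _ _ =>
    ((hG.proc_bddMeas _).bilin (hG.proc_bddMeas _) B).const_mul _

/-- The moment–cumulant identity for centered variables summed against the coefficients. The product
of the means cancels, and each of the two remaining pairings depends on time differences only. -/
theorem MDep.cov_winForm (hG : MDep π m G) (w : ℝ → ℝ) (b lam lam' : ℝ) (τ : ℕ) :
    ∫ ω, winForm B G w b lam τ ω * winForm B' G w b lam' τ ω ∂iidLaw π
      - (∫ ω, winForm B G w b lam τ ω ∂iidLaw π) * ∫ ω, winForm B' G w b lam' τ ω ∂iidLaw π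
      = ∑ s ∈ Finset.Icc (1 : ℤ) τ, ∑ t ∈ Finset.Icc (1 : ℤ) τ,
        ∑ s' ∈ Finset.Icc (1 : ℤ) τ, ∑ t' ∈ Finset.Icc (1 : ℤ) τ,
          winCoef w b lam s t * winCoef w b lam' s' t' *
          (covKernel π B B' G (s - s') (t - t') + covKernel π B B'.flip G (s - t') (t - s')
            + cumulant₄ π B B' (proc G s) (proc G t) (proc G s') (proc G t')) := by
  have hb := fun (D : E →L[ℝ] E →L[ℝ] ℂ) s t => (hG.proc_bddMeas s).bilin (hG.proc_bddMeas t) D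
  have e : ∀ (D : E →L[ℝ] E →L[ℝ] ℂ) lam, ∫ ω, winForm D G w b lam τ ω ∂iidLaw π
      = ∑ s ∈ Finset.Icc (1 : ℤ) τ, ∑ t ∈ Finset.Icc (1 : ℤ) τ,
        winCoef w b lam s t * ∫ ω, D (proc G s ω) (proc G t ω) ∂iidLaw π := by
    intro D lam
    simp only [winForm]
    rw [integral_finsetSum _ fun s _ => (BddMeas.sum fun t _ => (hb D s t).const_mul _).integrable _]
    refine Finset.sum_congr rfl fun s _ => ?_
    rw [integral_finsetSum _ fun t _ => ((hb D s t).const_mul _).integrable _]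
    simp only [integral_const_mul]
  have e2 : ∫ ω, winForm B G w b lam τ ω * winForm B' G w b lam' τ ω ∂iidLaw π
      = ∑ s ∈ Finset.Icc (1 : ℤ) τ, ∑ t ∈ Finset.Icc (1 : ℤ) τ,
        ∑ s' ∈ Finset.Icc (1 : ℤ) τ, ∑ t' ∈ Finset.Icc (1 : ℤ) τ,
          winCoef w b lam s t * winCoef w b lam' s' t' * ∫ ω, B (proc G s ω) (proc G t ω)
            * B' (proc G s' ω) (proc G t' ω) ∂iidLaw π := by
    have i4 : ∀ s t s' t', BddMeas fun ω => winCoef w b lam s t * winCoef w b lam' s' t' *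
        (B (proc G s ω) (proc G t ω) * B' (proc G s' ω) (proc G t' ω)) :=
      fun s t s' t' => ((hb B s t).mul (hb B' s' t')).const_mul _
    have : ∀ ω, winForm B G w b lam τ ω * winForm B' G w b lam' τ ω
        = ∑ s ∈ Finset.Icc (1 : ℤ) τ, ∑ t ∈ Finset.Icc (1 : ℤ) τ,
        ∑ s' ∈ Finset.Icc (1 : ℤ) τ, ∑ t' ∈ Finset.Icc (1 : ℤ) τ,
          winCoef w b lam s t * winCoef w b lam' s' t' * (B (proc G s ω) (proc G t ω)
            * B' (proc G s' ω) (proc G t' ω)) := by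
      intro ω
      simp only [winForm, Finset.sum_mul]
      simp only [Finset.mul_sum]
      refine Finset.sum_congr rfl fun s _ => Finset.sum_congr rfl fun t _ =>
        Finset.sum_congr rfl fun s' _ => Finset.sum_congr rfl fun t' _ => by ring
    simp only [this]
    rw [integral_finsetSum _ fun s _ => (BddMeas.sum fun t _ => BddMeas.sum fun s' _ =>
      BddMeas.sum fun t' _ => i4 s t s' t').integrable _]
    refine Finset.sum_congr rfl fun s _ => ?_
    rw [integral_finsetSum _ fun t _ => (BddMeas.sum fun s' _ =>
      BddMeas.sum fun t' _ => i4 s t s' t').integrable _]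
    refine Finset.sum_congr rfl fun t _ => ?_
    rw [integral_finsetSum _ fun s' _ => (BddMeas.sum fun t' _ => i4 s t s' t').integrable _]
    refine Finset.sum_congr rfl fun s' _ => ?_
    rw [integral_finsetSum _ fun t' _ => (i4 s t s' t').integrable _]
    simp only [integral_const_mul]
  rw [e2, e, e]
  simp only [Finset.sum_mul]
  simp only [Finset.mul_sum, ← Finset.sum_sub_distrib]
  refine Finset.sum_congr rfl fun s _ => Finset.sum_congr rfl fun t _ =>
    Finset.sum_congr rfl fun s' _ => Finset.sum_congr rfl fun t' _ => ?_
  rw [cumulant₄, ← crossMoment_proc, ← crossMoment_proc]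
  ring

theorem Finset.sum_sub_right_eq {I J : Finset ℤ} (s : ℤ) (g : ℤ → ℤ → ℂ)
    (hg : ∀ i u, u ∉ J → g i u = 0) :
    ∑ s' ∈ I, g s' (s - s') = ∑ u ∈ J, if s - u ∈ I then g (s - u) u else 0 := by
  have h1 : ∀ u ∈ J, (if s - u ∈ I then g (s - u) u else 0)
      = ∑ s' ∈ I, if s - u = s' then g s' u else 0 := fun u _ => by
    rw [Finset.sum_ite_eq]
  rw [Finset.sum_congr rfl h1, Finset.sum_comm]
  refine Finset.sum_congr rfl fun s' _ => ?_
  have h2 : ∀ u ∈ J, (if s - u = s' then g s' u else 0)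
      = if u = s - s' then g s' u else 0 := fun u _ => if_congr (by omega) rfl rfl
  rw [Finset.sum_congr rfl h2, Finset.sum_ite_eq']
  split_ifs with h
  · rfl
  · exact hg _ _ h

variable {w : ℝ → ℝ} {ι : Type*} {l : Filter ι} {b : ι → ℝ} {τ : ι → ℕ}

/-- With `u = s - s'` and `v = t - t'` the kernel vanishes unless both are at most `m` in absolute
value, so the fourfold sum is a finite sum over `(u, v)` of double sums. The exponentials combine to
frequency `λ + λ'` in the lag `t - s` and a factor `e^{iλ'(u - v)}` that does not depend on it. -/
theorem MDep.tendsto_sum_covKernel (hG : MDep π m G) (hw : LagWindow w)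
    (hb : Tendsto b l (𝓝[>] 0)) (hbτ : Tendsto (fun i => b i * τ i) l atTop) (lam lam' : ℝ) :
    Tendsto (fun i => ((b i / τ i : ℝ) : ℂ) *
      ∑ s ∈ Finset.Icc (1 : ℤ) (τ i), ∑ t ∈ Finset.Icc (1 : ℤ) (τ i),
        ∑ s' ∈ Finset.Icc (1 : ℤ) (τ i), ∑ t' ∈ Finset.Icc (1 : ℤ) (τ i),
          winCoef w (b i) lam s t * winCoef w (b i) lam' s' t'
            * covKernel π B B' G (s - s') (t - t')) l
      (𝓝 ((if Complex.exp (Complex.I * (lam + lam' : ℝ)) = 1 then (windowEnergy w : ℂ) else 0)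
        * ∑ u ∈ Finset.Icc (-m : ℤ) m, ∑ v ∈ Finset.Icc (-m : ℤ) m,
          Complex.exp (Complex.I * lam' * ((u : ℂ) - v)) * covKernel π B B' G u v)) := by
  have key := tendsto_finsetSum (Finset.Icc (-m : ℤ) m) fun u _ =>
    tendsto_finsetSum (Finset.Icc (-m : ℤ) m) fun v _ =>
      (hw.tendsto_overlap_sum hb hbτ u v (lam + lam')).mul_const
        (Complex.exp (Complex.I * lam' * ((u : ℂ) - v)) * covKernel π B B' G u v)
  simp only [← Finset.mul_sum] at key
  refine key.congr fun i => ?_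
  set I := Finset.Icc (1 : ℤ) (τ i)
  set J := Finset.Icc (-m : ℤ) m
  have e1 : ∀ s t : ℤ, ∑ s' ∈ I, ∑ t' ∈ I, winCoef w (b i) lam s t * winCoef w (b i) lam' s' t'
      * covKernel π B B' G (s - s') (t - t') = ∑ u ∈ J, ∑ v ∈ J,
        if s - u ∈ I ∧ t - v ∈ I then winCoef w (b i) lam s t
          * winCoef w (b i) lam' (s - u) (t - v) * covKernel π B B' G u v else 0 := by
    intro s t
    rw [Finset.sum_sub_right_eq (J := J) s fun s' u => ∑ t' ∈ I, winCoef w (b i) lam s t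
      * winCoef w (b i) lam' s' t' * covKernel π B B' G u (t - t')]
    · refine Finset.sum_congr rfl fun u _ => ?_
      rw [Finset.sum_sub_right_eq (J := J) t fun t' v => winCoef w (b i) lam s t
        * winCoef w (b i) lam' (s - u) t' * covKernel π B B' G u v]
      · split_ifs with h <;> simp [h]
      · intro t' v hv
        rw [hG.covKernel_eq_zero (Or.inr hv), mul_zero]
    · intro s' u hu
      exact Finset.sum_eq_zero fun t' _ => by rw [hG.covKernel_eq_zero (Or.inl hu), mul_zero]
  simp only [e1]
  have e2 : ∑ s ∈ I, ∑ t ∈ I, ∑ u ∈ J, ∑ v ∈ J, (if s - u ∈ I ∧ t - v ∈ I then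
      winCoef w (b i) lam s t * winCoef w (b i) lam' (s - u) (t - v) * covKernel π B B' G u v else 0)
      = ∑ u ∈ J, ∑ v ∈ J, ∑ s ∈ I, ∑ t ∈ I, (if s - u ∈ I ∧ t - v ∈ I then
      winCoef w (b i) lam s t * winCoef w (b i) lam' (s - u) (t - v) * covKernel π B B' G u v
        else 0) := by
    have : ∀ s ∈ I, ∑ t ∈ I, ∑ u ∈ J, ∑ v ∈ J, (if s - u ∈ I ∧ t - v ∈ I then
      winCoef w (b i) lam s t * winCoef w (b i) lam' (s - u) (t - v) * covKernel π B B' G u v else 0)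
      = ∑ u ∈ J, ∑ v ∈ J, ∑ t ∈ I, (if s - u ∈ I ∧ t - v ∈ I then
      winCoef w (b i) lam s t * winCoef w (b i) lam' (s - u) (t - v) * covKernel π B B' G u v
        else 0) := fun s _ => by
      rw [Finset.sum_comm]
      exact Finset.sum_congr rfl fun u _ => Finset.sum_comm
    rw [Finset.sum_congr rfl this, Finset.sum_comm]
    exact Finset.sum_congr rfl fun u _ => Finset.sum_comm
  rw [e2]
  simp only [Finset.mul_sum, Finset.sum_mul]
  refine Finset.sum_congr rfl fun u _ => Finset.sum_congr rfl fun v _ =>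
    Finset.sum_congr rfl fun s _ => Finset.sum_congr rfl fun t _ => ?_
  split_ifs with h
  · have e3 : winCoef w (b i) lam s t * winCoef w (b i) lam' (s - u) (t - v)
        = (w (b i * (t - s : ℤ)) * w (b i * (t - s + (u - v) : ℤ)) : ℂ)
          * Complex.exp (Complex.I * (lam + lam' : ℝ) * (t - s : ℤ))
          * Complex.exp (Complex.I * lam' * ((u : ℂ) - v)) := by
      have a1 : b i * (((t - v : ℤ) : ℝ) - (s - u : ℤ)) = b i * (t - s + (u - v) : ℤ) := by
        push_cast; ring
      have a2 : b i * ((t : ℝ) - s) = b i * (t - s : ℤ) := by push_cast; ring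
      rw [winCoef, winCoef, a1, a2, mul_mul_mul_comm, mul_assoc (_ * _) _ (Complex.exp _),
        ← Complex.exp_add, ← Complex.exp_add]
      congr 2
      push_cast
      ring
    rw [e3]
    ring
  · simp

/-- By evenness of `w`, exchanging the two times only reverses the frequency. The pairing of `s`
with `t'` thereby becomes the pairing of `s` with `s'` at frequency `-λ'`. -/
theorem LagWindow.winCoef_swap (hw : LagWindow w) (b lam : ℝ) (s t : ℤ) :
    winCoef w b (-lam) t s = winCoef w b lam s t := by
  rw [winCoef, winCoef, ← hw.even]
  congr 2
  · congr 1; ring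
  · push_cast; ring

theorem norm_winCoef_le {M : ℝ} (hM : ∀ x, |w x| ≤ M) (b lam : ℝ) (s t : ℤ) :
    ‖winCoef w b lam s t‖ ≤ M := by
  have : Complex.I * lam * ((t : ℂ) - s) = ((lam * (t - s) : ℝ) : ℂ) * Complex.I := by
    push_cast; ring
  rw [winCoef, norm_mul, this, Complex.norm_exp_ofReal_mul_I, mul_one, Complex.norm_real]
  exact hM _

theorem sum_abs_le_one_le (I : Finset ℤ) (s : ℤ) (k : ℕ) :
    ∑ t ∈ I, (if |t - s| ≤ (k : ℤ) then (1 : ℝ) else 0) ≤ 2 * k + 1 := by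
  rw [Finset.sum_boole]
  have : (I.filter fun t => |t - s| ≤ (k : ℤ)) ⊆ Finset.Icc (s - k) (s + k) := by
    intro t ht
    simp only [Finset.mem_filter, abs_le, Finset.mem_Icc] at ht ⊢
    omega
  have h := Finset.card_le_card this
  rw [Int.card_Icc] at h
  have h' : (I.filter fun t => |t - s| ≤ (k : ℤ)).card ≤ 2 * k + 1 := by omega
  exact_mod_cast h'

/-- For each `s` at most `(6m + 1)³` triples of times give a nonzero cumulant, so the fourfold sum
is `O(τ)` and the factor `b / τ` leaves `O(b)`. -/
theorem MDep.tendsto_sum_cumulant₄ (hG : MDep π m G) (hw : LagWindow w)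
    (hb : Tendsto b l (𝓝[>] 0)) (lam lam' : ℝ) :
    Tendsto (fun i => ((b i / τ i : ℝ) : ℂ) *
      ∑ s ∈ Finset.Icc (1 : ℤ) (τ i), ∑ t ∈ Finset.Icc (1 : ℤ) (τ i),
        ∑ s' ∈ Finset.Icc (1 : ℤ) (τ i), ∑ t' ∈ Finset.Icc (1 : ℤ) (τ i),
          winCoef w (b i) lam s t * winCoef w (b i) lam' s' t'
            * cumulant₄ π B B' (proc G s) (proc G t) (proc G s') (proc G t')) l (𝓝 0) := by
  obtain ⟨W, hW⟩ := hw.bounded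
  obtain ⟨M, hM⟩ := hG.bddMeas.bdd
  set K := 4 * ((‖B‖ * M * M) * (‖B'‖ * M * M)) with hK
  have hK0 : 0 ≤ K := (norm_nonneg _).trans (norm_cumulant₄_le (π := π) (B := B) (B' := B') hM hM hM hM)
  have hW0 : 0 ≤ W := (abs_nonneg _).trans (hW 0)
  set D := W * W * K * (2 * (3 * m : ℕ) + 1 : ℝ) ^ 3 with hD
  have hlim : Tendsto (fun i => b i * D) l (𝓝 0) := by
    simpa using (hb.mono_right nhdsWithin_le_nhds).mul_const D
  refine squeeze_zero_norm' ?_ hlim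
  filter_upwards [hb.eventually self_mem_nhdsWithin] with i hbi
  have hb0 : 0 < b i := hbi
  set I := Finset.Icc (1 : ℤ) (τ i)
  have h1 : ‖∑ s ∈ I, ∑ t ∈ I, ∑ s' ∈ I, ∑ t' ∈ I, winCoef w (b i) lam s t * winCoef w (b i) lam' s' t'
      * cumulant₄ π B B' (proc G s) (proc G t) (proc G s') (proc G t')‖ ≤ τ i * D := by
    have hc : ∀ s ∈ I, ‖∑ t ∈ I, ∑ s' ∈ I, ∑ t' ∈ I, winCoef w (b i) lam s t
        * winCoef w (b i) lam' s' t'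
        * cumulant₄ π B B' (proc G s) (proc G t) (proc G s') (proc G t')‖ ≤ D := by
      intro s _
      set r : ℤ → ℝ := fun t => if |t - s| ≤ ((3 * m : ℕ) : ℤ) then (1 : ℝ) else 0 with hr
      have hr0 : ∀ t, 0 ≤ r t := fun t => by simp only [hr]; split_ifs <;> norm_num
      have hterm : ∀ t s' t', ‖winCoef w (b i) lam s t * winCoef w (b i) lam' s' t'
          * cumulant₄ π B B' (proc G s) (proc G t) (proc G s') (proc G t')‖
          ≤ W * W * K * (r t * (r s' * r t')) := by
        intro t s' t'
        by_cases h : |t - s| ≤ 3 * m ∧ |s' - s| ≤ 3 * m ∧ |t' - s| ≤ 3 * m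
        · have e : ∀ {j : ℤ}, |j - s| ≤ 3 * m → r j = 1 := fun hj => by
            simp only [hr]; rw [if_pos]; push_cast; exact hj
          rw [e h.1, e h.2.1, e h.2.2, mul_one, mul_one, mul_one, norm_mul, norm_mul]
          have a1 := norm_winCoef_le hW (b i) lam s t
          have a2 := norm_winCoef_le hW (b i) lam' s' t'
          have a3 := norm_cumulant₄_le (π := π) (B := B) (B' := B') (f₁ := proc G s)
            (f₂ := proc G t) (f₃ := proc G s') (f₄ := proc G t') (fun ω => hM _) (fun ω => hM _)
            (fun ω => hM _) (fun ω => hM _)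
          gcongr
        · rw [hG.cumulant₄_eq_zero h, mul_zero, norm_zero]
          have := hr0 t
          have := hr0 s'
          have := hr0 t'
          positivity
      calc _ ≤ ∑ t ∈ I, ∑ s' ∈ I, ∑ t' ∈ I, W * W * K * (r t * (r s' * r t')) := by
            refine norm_sum_le_of_le _ fun t _ => norm_sum_le_of_le _ fun s' _ =>
              norm_sum_le_of_le _ fun t' _ => hterm t s' t'
        _ = W * W * K * ((∑ t ∈ I, r t) * ((∑ t ∈ I, r t) * ∑ t ∈ I, r t)) := by
            simp only [← Finset.mul_sum, ← Finset.sum_mul]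
        _ ≤ D := by
            have h2 := sum_abs_le_one_le I s (3 * m)
            have h3 : 0 ≤ ∑ t ∈ I, r t := Finset.sum_nonneg fun t _ => hr0 t
            rw [hD, pow_three]
            gcongr
    refine (norm_sum_le_of_le _ hc).trans ?_
    rw [Finset.sum_const, nsmul_eq_mul]
    simp [I]
  rw [norm_mul, Complex.norm_real, Real.norm_of_nonneg (by positivity)]
  rcases Nat.eq_zero_or_pos (τ i) with h0 | h0
  · simp only [h0, Nat.cast_zero, div_zero, zero_mul]
    positivity
  · have : (0 : ℝ) < τ i := by exact_mod_cast h0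
    calc b i / τ i * _ ≤ b i / τ i * (τ i * D) := by gcongr
      _ = b i * D := by field_simp

variable (π) in
/-- The limit of `(b/τ) Cov(q, q')` for lag-window forms `q`, `q'`, without conjugation. -/
def covLimit (m : ℕ) (B B' : E →L[ℝ] E →L[ℝ] ℂ) (G : (ℤ → S) → E) (w : ℝ → ℝ)
    (lam lam' : ℝ) : ℂ :=
  (if Complex.exp (Complex.I * (lam + lam' : ℝ)) = 1 then (windowEnergy w : ℂ) else 0)
    * (∑ u ∈ Finset.Icc (-m : ℤ) m, ∑ v ∈ Finset.Icc (-m : ℤ) m,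
      Complex.exp (Complex.I * lam' * ((u : ℂ) - v)) * covKernel π B B' G u v)
  + (if Complex.exp (Complex.I * (lam + -lam' : ℝ)) = 1 then (windowEnergy w : ℂ) else 0)
    * (∑ u ∈ Finset.Icc (-m : ℤ) m, ∑ v ∈ Finset.Icc (-m : ℤ) m,
      Complex.exp (Complex.I * (-lam' : ℝ) * ((u : ℂ) - v)) * covKernel π B B'.flip G u v)

theorem MDep.tendsto_cov_winForm (hG : MDep π m G) (hw : LagWindow w)
    (hb : Tendsto b l (𝓝[>] 0)) (hbτ : Tendsto (fun i => b i * τ i) l atTop) (lam lam' : ℝ) :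
    Tendsto (fun i => ((b i / τ i : ℝ) : ℂ) *
      (∫ ω, winForm B G w (b i) lam (τ i) ω * winForm B' G w (b i) lam' (τ i) ω ∂iidLaw π
      - (∫ ω, winForm B G w (b i) lam (τ i) ω ∂iidLaw π)
        * ∫ ω, winForm B' G w (b i) lam' (τ i) ω ∂iidLaw π)) l
      (𝓝 (covLimit π m B B' G w lam lam')) := by
  have h1 := hG.tendsto_sum_covKernel (B := B) (B' := B') hw hb hbτ lam lam'
  have h2 := hG.tendsto_sum_covKernel (B := B) (B' := B'.flip) hw hb hbτ lam (-lam')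
  have h3 := hG.tendsto_sum_cumulant₄ (B := B) (B' := B') (τ := τ) hw hb lam lam'
  have h := (h1.add h2).add h3
  rw [add_zero] at h
  refine h.congr fun i => ?_
  rw [hG.cov_winForm]
  simp only [mul_add (winCoef w _ _ _ _ * _), Finset.sum_add_distrib]
  rw [mul_add, mul_add]
  congr 2
  congr 1
  refine Finset.sum_congr rfl fun s _ => Finset.sum_congr rfl fun t _ => ?_
  rw [Finset.sum_comm]
  simp only [hw.winCoef_swap]

end MDependent

/-! ### Characteristic functions of triangular arrays -/

section CharFunArray

theorem norm_exp_I_mul_sub_le (x : ℝ) :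
    ‖Complex.exp (Complex.I * x) - (1 + Complex.I * x - (x : ℂ) ^ 2 / 2)‖ ≤ 4 * |x| ^ 3 := by
  have hn : ‖Complex.I * (x : ℂ)‖ = |x| := by simp
  rcases le_or_gt |x| 1 with h | h
  · have h1 := Complex.exp_bound (x := Complex.I * x) (by rw [hn]; exact h) (n := 3) (by norm_num)
    rw [hn] at h1
    have e : ∑ m ∈ Finset.range 3, (Complex.I * (x : ℂ)) ^ m / (m.factorial : ℂ)
        = 1 + Complex.I * x - (x : ℂ) ^ 2 / 2 := by
      have : (Complex.I * (x : ℂ)) ^ 2 = -(x : ℂ) ^ 2 := by rw [mul_pow, Complex.I_sq]; ring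
      simp only [Finset.sum_range_succ, Finset.sum_range_zero, Nat.factorial, this]
      push_cast
      ring
    rw [e] at h1
    refine h1.trans ?_
    have := pow_nonneg (abs_nonneg x) 3
    norm_num [Nat.factorial]
    nlinarith
  · have h1 : ‖Complex.exp (Complex.I * x)‖ = 1 := by
      rw [mul_comm, Complex.norm_exp_ofReal_mul_I]
    have h2 : ‖(x : ℂ) ^ 2 / 2‖ = |x| ^ 2 / 2 := by simp
    calc _ ≤ ‖Complex.exp (Complex.I * x)‖ + (‖(1 : ℂ)‖ + ‖Complex.I * (x : ℂ)‖ + ‖(x : ℂ) ^ 2 / 2‖) :=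
          (norm_sub_le _ _).trans (add_le_add_right ((norm_sub_le _ _).trans
            (add_le_add_left (norm_add_le _ _) _)) _)
      _ = 2 + |x| + |x| ^ 2 / 2 := by rw [h1, h2, hn, norm_one]; ring
      _ ≤ 4 * |x| ^ 3 := by nlinarith [mul_pos (sub_pos.2 h) (sub_pos.2 h), pow_pos (by linarith : 0 < |x|) 2, pow_pos (by linarith : 0 < |x|) 3]

/-- Second-order Taylor expansion with a cubic remainder. Cauchy–Schwarz bounds `E|v|³` by `√(E v² ·
E v⁴)`, so that only second and fourth moments are needed. -/
theorem norm_charFun_sub_le {α : Type*} [MeasurableSpace α] {μ : Measure α}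
    [IsProbabilityMeasure μ] {v : α → ℝ} (hv : MemLp v 4 μ) (h0 : ∫ x, v x ∂μ = 0) :
    ‖∫ x, Complex.exp (Complex.I * v x) ∂μ - (1 - ((∫ x, v x ^ 2 ∂μ) / 2 : ℝ))‖
      ≤ 4 * √((∫ x, v x ^ 2 ∂μ) * ∫ x, v x ^ 4 ∂μ) := by
  have hv1 : Integrable v μ := hv.integrable (by norm_num)
  have hv2' : MemLp v 2 μ := hv.mono_exponent (by norm_num)
  have hv3' : MemLp v 3 μ := hv.mono_exponent (by norm_num)
  have hv2 : Integrable (fun x => v x ^ 2) μ := by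
    simpa using hv2'.integrable_norm_pow two_ne_zero
  have hv3 : Integrable (fun x => |v x| ^ 3) μ := by
    simpa using hv3'.integrable_norm_pow three_ne_zero
  have hexp : Integrable (fun x => Complex.exp (Complex.I * v x)) μ := by
    refine Integrable.of_bound (C := 1) ?_ (Eventually.of_forall fun x => ?_)
    · exact (by fun_prop : Continuous fun y : ℝ => Complex.exp (Complex.I * y)).comp_aestronglyMeasurable
        hv.1
    · rw [mul_comm, Complex.norm_exp_ofReal_mul_I]
  have hI : Integrable (fun x => 1 + Complex.I * v x - (v x : ℂ) ^ 2 / 2) μ := by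
    refine ((integrable_const _).add (hv1.ofReal.const_mul _)).sub ?_
    have := hv2.ofReal (𝕜 := ℂ)
    simpa using this.div_const 2
  have e : (1 - ((∫ x, v x ^ 2 ∂μ) / 2 : ℝ) : ℂ)
      = ∫ x, (1 + Complex.I * v x - (v x : ℂ) ^ 2 / 2) ∂μ := by
    have a1 : Integrable (fun x => 1 + Complex.I * (v x : ℂ)) μ :=
      (integrable_const _).add (hv1.ofReal.const_mul _)
    have a2 : Integrable (fun x => Complex.I * (v x : ℂ)) μ := hv1.ofReal.const_mul _
    have a3 : Integrable (fun x => (v x : ℂ) ^ 2 / 2) μ := by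
      have := hv2.ofReal (𝕜 := ℂ)
      simpa using this.div_const 2
    rw [integral_sub a1 a3, integral_add (integrable_const _) a2, integral_const_mul,
      integral_div]
    have e1 : ∫ x, (v x : ℂ) ∂μ = 0 := by rw [integral_complex_ofReal, h0]; simp
    have e2 : ∫ x, (v x : ℂ) ^ 2 ∂μ = ((∫ x, v x ^ 2 ∂μ : ℝ) : ℂ) := by
      rw [← integral_complex_ofReal]; simp
    rw [e1, e2]
    simp
  rw [e, ← integral_sub hexp hI]
  calc _ ≤ ∫ x, 4 * |v x| ^ 3 ∂μ := norm_integral_le_of_norm_le (hv3.const_mul 4)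
        (Eventually.of_forall fun x => norm_exp_I_mul_sub_le (v x))
    _ = 4 * ∫ x, |v x| * v x ^ 2 ∂μ := by
        rw [integral_const_mul]
        congr 2
        funext x
        rw [pow_succ, sq_abs, mul_comm]
    _ ≤ 4 * √((∫ x, v x ^ 2 ∂μ) * ∫ x, v x ^ 4 ∂μ) := by
        have h := integral_mul_le_Lp_mul_Lq_of_nonneg (μ := μ) Real.HolderConjugate.two_two
          (f := fun x => |v x|) (g := fun x => v x ^ 2) (Eventually.of_forall fun x => abs_nonneg _)
          (Eventually.of_forall fun x => sq_nonneg _) (by simpa using hv2'.norm) (by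
            have hh : MemLp (fun x => v x ^ 2) 2 μ := by
              refine (memLp_two_iff_integrable_sq (f := fun x => v x ^ 2) (hv.1.pow 2)).2 ?_
              have := hv.integrable_norm_pow four_ne_zero
              refine this.congr (Eventually.of_forall fun x => ?_)
              simp only [Real.norm_eq_abs]
              rw [← pow_mul, Even.pow_abs (by decide)]
            simpa using hh)
        rw [Real.sqrt_mul (integral_nonneg fun x => sq_nonneg _), Real.sqrt_eq_rpow,
          Real.sqrt_eq_rpow]
        refine mul_le_mul_of_nonneg_left (h.trans (le_of_eq ?_)) (by norm_num)
        congr 3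
        · funext x; simp
        · funext x; norm_cast; ring

theorem sq_integral_sq_le {α : Type*} [MeasurableSpace α] {μ : Measure α}
    [IsProbabilityMeasure μ] {v : α → ℝ} (hv : MemLp v 4 μ) :
    (∫ x, v x ^ 2 ∂μ) ^ 2 ≤ ∫ x, v x ^ 4 ∂μ := by
  have hv2' : MemLp v 2 μ := hv.mono_exponent (by norm_num)
  have hv2 : Integrable (fun x => v x ^ 2) μ := by
    simpa using hv2'.integrable_norm_pow two_ne_zero
  have hv4 : Integrable (fun x => v x ^ 4) μ := by
    have := hv.integrable_norm_pow four_ne_zero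
    refine this.congr (Eventually.of_forall fun x => ?_)
    simp only [Real.norm_eq_abs]
    rw [Even.pow_abs (by decide)]
  set a := ∫ x, v x ^ 2 ∂μ with ha
  have h : 0 ≤ ∫ x, (v x ^ 2 - a) ^ 2 ∂μ := integral_nonneg fun x => sq_nonneg _
  have e : ∫ x, (v x ^ 2 - a) ^ 2 ∂μ = ∫ x, v x ^ 4 ∂μ - a ^ 2 := by
    have a1 : Integrable (fun x => v x ^ 4 - 2 * a * v x ^ 2) μ := hv4.sub (hv2.const_mul _)
    have : ∀ x, (v x ^ 2 - a) ^ 2 = v x ^ 4 - 2 * a * v x ^ 2 + a ^ 2 := fun x => by ring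
    simp only [this]
    rw [integral_add a1 (integrable_const _), integral_sub hv4 (hv2.const_mul _),
      integral_const_mul, ← ha]
    simp
    ring
  rw [e] at h
  linarith

theorem norm_pow_sub_pow_le_mul {z z' : ℂ} (hz : ‖z‖ ≤ 1) (hz' : ‖z'‖ ≤ 1) (n : ℕ) :
    ‖z ^ n - z' ^ n‖ ≤ n * ‖z - z'‖ := by
  induction n with
  | zero => simp
  | succ n ih =>
    have : z ^ (n + 1) - z' ^ (n + 1) = z * (z ^ n - z' ^ n) + (z - z') * z' ^ n := by ring
    rw [this]
    refine (norm_add_le _ _).trans ?_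
    rw [norm_mul, norm_mul, norm_pow]
    have h1 : ‖z'‖ ^ n ≤ 1 := pow_le_one₀ (norm_nonneg _) hz'
    have h2 := norm_nonneg (z - z')
    have h3 := norm_nonneg (z ^ n - z' ^ n)
    push_cast
    nlinarith [norm_nonneg z, mul_le_mul_of_nonneg_right hz h3, mul_le_mul_of_nonneg_left h1 h2]

theorem abs_exp_neg_sub_le {x : ℝ} (hx : 0 ≤ x) : |Real.exp (-x) - (1 - x)| ≤ x ^ 2 := by
  have h1 := Real.add_one_le_exp (-x)
  rw [abs_of_nonneg (by linarith)]
  rcases le_or_gt x 1 with h | h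
  · have := Real.abs_exp_sub_one_sub_id_le (x := -x) (by rwa [abs_neg, abs_of_nonneg hx])
    have := (abs_le.1 this).2
    nlinarith
  · have : Real.exp (-x) ≤ 1 := Real.exp_le_one_iff.2 (by linarith)
    nlinarith

/-- Powers of characteristic functions of small variables with negligible fourth moments. -/
theorem tendsto_pow_exp_of_moments {ι : Type*} {l : Filter ι} {φ : ι → ℂ} {N : ι → ℕ}
    {a c : ι → ℝ} {σ2 : ℝ} (hφ : ∀ i, ‖φ i‖ ≤ 1) (ha : ∀ i, 0 ≤ a i) (hac : ∀ i, a i ^ 2 ≤ c i)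
    (h : ∀ i, ‖φ i - (1 - (a i / 2 : ℝ))‖ ≤ 4 * √(a i * c i))
    (hNa : Tendsto (fun i => N i * a i) l (𝓝 σ2)) (hNc : Tendsto (fun i => N i * c i) l (𝓝 0)) :
    Tendsto (fun i => φ i ^ N i) l (𝓝 (Complex.exp (-(σ2 / 2 : ℝ)))) := by
  have h1 : Tendsto (fun i => (Complex.exp (-(a i / 2 : ℝ))) ^ N i) l
      (𝓝 (Complex.exp (-(σ2 / 2 : ℝ)))) := by
    have := ((hNa.div_const 2).neg.ofReal).cexp
    rw [← Complex.ofReal_neg]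
    refine this.congr fun i => ?_
    rw [← Complex.exp_nat_mul]
    congr 1
    push_cast
    ring
  have h2 : Tendsto (fun i => φ i ^ N i - (Complex.exp (-(a i / 2 : ℝ))) ^ N i) l (𝓝 0) := by
    -- `N √(a c) = √(N a · N c)`, whose limit is `√(σ² · 0)`.
    have hlim : Tendsto (fun i => 4 * √(N i * a i * (N i * c i)) + N i * c i) l (𝓝 0) := by
      have := (((hNa.mul hNc).sqrt).const_mul 4).add hNc
      simpa using this
    refine squeeze_zero_norm (fun i => ?_) hlim
    have hc0 : 0 ≤ c i := (sq_nonneg _).trans (hac i)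
    have e1 : ‖Complex.exp (-(a i / 2 : ℝ))‖ ≤ 1 := by
      rw [← Complex.ofReal_neg, ← Complex.ofReal_exp, Complex.norm_real,
        Real.norm_of_nonneg (Real.exp_pos _).le]
      exact Real.exp_le_one_iff.2 (by linarith [ha i])
    refine (norm_pow_sub_pow_le_mul (hφ i) e1 _).trans ?_
    have e2 : ‖Complex.exp (-(a i / 2 : ℝ)) - (1 - (a i / 2 : ℝ))‖ ≤ c i := by
      have := abs_exp_neg_sub_le (x := a i / 2) (by linarith [ha i])
      rw [← Complex.ofReal_neg, ← Complex.ofReal_exp, ← Complex.ofReal_one, ← Complex.ofReal_sub,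
        ← Complex.ofReal_sub, Complex.norm_real, Real.norm_eq_abs]
      nlinarith [hac i, sq_nonneg (a i)]
    have e3 : ‖φ i - Complex.exp (-(a i / 2 : ℝ))‖ ≤ 4 * √(a i * c i) + c i := by
      have : φ i - Complex.exp (-(a i / 2 : ℝ)) = (φ i - (1 - (a i / 2 : ℝ)))
          - (Complex.exp (-(a i / 2 : ℝ)) - (1 - (a i / 2 : ℝ))) := by ring
      rw [this]
      exact (norm_sub_le _ _).trans (add_le_add (h i) e2)
    have e4 : √(N i * a i * (N i * c i)) = N i * √(a i * c i) := by
      rw [show (N i : ℝ) * a i * (N i * c i) = (N i : ℝ) ^ 2 * (a i * c i) by ring,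
        Real.sqrt_mul (by positivity), Real.sqrt_sq (by positivity)]
    rw [e4]
    calc (N i : ℝ) * ‖φ i - Complex.exp (-(a i / 2 : ℝ))‖ ≤ N i * (4 * √(a i * c i) + c i) := by
          gcongr
      _ = _ := by ring
  simpa using h2.add h1

end CharFunArray

/-! ### Moment bounds and block decomposition of real lag-window forms -/

section BlockForms

set_option linter.unusedSectionVars false

variable {S : Type*} [MeasurableSpace S] {π : Measure S} [IsProbabilityMeasure π]
variable {H : Type*} [NormedAddCommGroup H] [InnerProductSpace ℂ H] [CompleteSpace H]
variable {m : ℕ} {G : (ℤ → S) → H} {d : Type*} [Fintype d]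

/-- The value at time `t` ignores the innovation `k` unless `0 ≤ t - k ≤ m`, and averaging changes a
function bounded by `M` by at most `2M`. One `ν` serves all exponents; `p = ∞` is what gives fourth
moments of quadratic forms. -/
theorem MDep.exists_coeffBound (hG : MDep π m G) :
    ∃ ν : ℤ → ℝ≥0∞, ∑' j, ν j ≠ ∞ ∧ ∀ p, 1 ≤ p → CoeffBound π (proc G) p ν := by
  obtain ⟨M, hM⟩ := hG.bddMeas.bdd
  refine ⟨fun j => if j ∈ Finset.Icc (0 : ℤ) m then ENNReal.ofReal (2 * M) else 0, ?_, fun p hp =>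
    ⟨fun t => (hG.proc_bddMeas t).meas, fun t => (hG.proc_bddMeas t).memLp _ p, fun t k => ?_⟩⟩
  · rw [tsum_eq_sum (s := Finset.Icc (0 : ℤ) m) fun j hj => if_neg hj]
    refine (ENNReal.sum_lt_top.2 fun j _ => ?_).ne
    split_ifs
    exact ENNReal.ofReal_lt_top
  · split_ifs with h
    · refine (eLpNorm_le_of_ae_bound (C := 2 * M) (Eventually.of_forall fun ω => ?_)).trans ?_
      · have h1 : ‖condE π {k}ᶜ (proc G t) ω‖ ≤ M := by
          have := norm_integral_le_of_norm_le_const (μ := iidLaw π)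
            (f := fun ω' => proc G t (mer {k}ᶜ ω ω')) (Eventually.of_forall fun ω' => hM _)
          rwa [probReal_univ, mul_one] at this
        have h2 : ‖proc G t ω‖ ≤ M := hM _
        refine (norm_sub_le _ _).trans ?_
        linarith
      · simp
    · have : DependsOn (proc G t) ({k}ᶜ : Set ℤ) := hG.proc_dep fun i hi => by
        simp only [Set.mem_Icc, Finset.mem_Icc, Set.mem_compl_iff, Set.mem_singleton_iff] at hi h ⊢
        omega
      rw [condE_of_dependsOn this subset_rfl, sub_self, eLpNorm_zero]

/-- The real form `Re ∑ⱼ ⟨Cⱼ, ∑ αⱼ(s,t) X_s ⊗ X_t⟩`. -/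
def reForm (C : d → S2 H) (α : d → ℤ → ℤ → ℂ) (I : Finset ℤ) (G : (ℤ → S) → H) (ω : ℤ → S) : ℝ :=
  (∑ j, inner ℂ (C j) (quadForm (α j) I (proc G) (proc G) ω)).re

theorem eLpNorm_re_sum_inner_sq_le {Ω : Type*} [MeasurableSpace Ω] {μ : Measure Ω}
    {r : ℝ≥0∞} (hr : 1 ≤ r) (C : d → S2 H) {Z : d → Ω → S2 H}
    (hZ : ∀ j, AEStronglyMeasurable (Z j) μ) :
    eLpNorm (fun ω => (∑ j, inner ℂ (C j) (Z j ω)).re) r μ ^ 2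
      ≤ (∑ j, ‖C j‖ₑ ^ 2) * ∑ j, eLpNorm (Z j) r μ ^ 2 := by
  have h1 : eLpNorm (fun ω => (∑ j, inner ℂ (C j) (Z j ω)).re) r μ
      ≤ ∑ j, ‖C j‖ₑ * eLpNorm (Z j) r μ := by
    calc _ ≤ eLpNorm (∑ j, fun ω => ‖C j‖ * ‖Z j ω‖) r μ := by
          refine eLpNorm_mono_real fun ω => ?_
          rw [Finset.sum_apply, Real.norm_eq_abs]
          refine (Complex.abs_re_le_norm _).trans (norm_sum_le_of_le _ fun j _ => ?_)
          exact norm_inner_le_norm _ _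
      _ ≤ ∑ j, eLpNorm (fun ω => ‖C j‖ * ‖Z j ω‖) r μ :=
          eLpNorm_sum_le (fun j _ => (hZ j).norm.const_mul _) hr
      _ = _ := by
          refine Finset.sum_congr rfl fun j _ => ?_
          rw [show (fun ω => ‖C j‖ * ‖Z j ω‖) = ‖C j‖ • fun ω => ‖Z j ω‖ from rfl,
            eLpNorm_const_smul, eLpNorm_norm, enorm_norm]
  calc _ ≤ (∑ j, ‖C j‖ₑ * eLpNorm (Z j) r μ) ^ 2 := by gcongr
    _ ≤ _ := by
      have := ENNReal.tsum_mul_sq_le (fun j => ‖C j‖ₑ) fun j => eLpNorm (Z j) r μ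
      simpa only [tsum_fintype] using this

theorem BddMeas.tens {f g : (ℤ → S) → H} (hf : BddMeas f) (hg : BddMeas g) :
    BddMeas fun ω => S2.tens (f ω) (g ω) := hf.bilin hg (S2.tensL H)

theorem MDep.bddMeas_quadForm (hG : MDep π m G) (α : ℤ → ℤ → ℂ) (I : Finset ℤ) :
    BddMeas (quadForm α I (proc G) (proc G)) := by
  refine BddMeas.sum fun s _ => BddMeas.sum fun t _ => ?_
  obtain ⟨h, M, hM⟩ := (hG.proc_bddMeas s).tens (hG.proc_bddMeas t)
  refine ⟨h.const_smul (α s t), ‖α s t‖ * M, fun ω => ?_⟩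
  rw [norm_smul]
  exact mul_le_mul_of_nonneg_left (hM ω) (norm_nonneg _)

theorem MDep.bddMeas_reForm (hG : MDep π m G) (C : d → S2 H) (α : d → ℤ → ℤ → ℂ) (I : Finset ℤ) :
    BddMeas (reForm C α I G) := by
  have h1 : BddMeas fun ω => ∑ j, inner ℂ (C j) (quadForm (α j) I (proc G) (proc G) ω) := by
    refine BddMeas.sum fun j _ => ?_
    obtain ⟨h, M, hM⟩ := hG.bddMeas_quadForm (α j) I
    refine ⟨(innerSL ℂ (C j)).continuous.comp_stronglyMeasurable h, ‖C j‖ * M, fun ω => ?_⟩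
    exact (norm_inner_le_norm _ _).trans (mul_le_mul_of_nonneg_left (hM ω) (norm_nonneg _))
  obtain ⟨h, M, hM⟩ := h1
  exact ⟨Complex.continuous_re.comp_stronglyMeasurable h, M,
    fun ω => (Complex.abs_re_le_norm _).trans (hM ω)⟩

theorem MDep.integral_reForm (hG : MDep π m G) (C : d → S2 H) (α : d → ℤ → ℤ → ℂ) (I : Finset ℤ) :
    ∫ ω, reForm C α I G ω ∂iidLaw π
      = (∑ j, inner ℂ (C j) (∫ ω, quadForm (α j) I (proc G) (proc G) ω ∂iidLaw π)).re := by
  have hi := fun j => (hG.bddMeas_quadForm (α j) I).integrable (iidLaw π)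
  have hj : ∀ j, Integrable (fun ω => inner ℂ (C j) (quadForm (α j) I (proc G) (proc G) ω))
      (iidLaw π) := fun j => (innerSL ℂ (C j)).integrable_comp (hi j)
  simp only [reForm]
  have h2 := integral_re (𝕜 := ℂ) (integrable_finsetSum Finset.univ fun j _ => hj j)
  simp only [RCLike.re_to_complex] at h2
  rw [h2, integral_finsetSum _ fun j _ => hj j]
  congr 2
  funext j
  exact (innerSL ℂ (C j)).integral_comp_comm (hi j)

/-- The constant depends on the process and on `C` only, not on the coefficients or the index set,
so it serves both the blocks (`r = 4`) and the discarded remainder (`r = 2`). The Hölder exponents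
are `4, 4 → 2` and `∞, 4 → 4`. -/
theorem MDep.exists_reForm_bound (hG : MDep π m G) (C : d → S2 H) :
    ∃ K : ℝ≥0∞, K ≠ ∞ ∧ ∀ r : ℝ≥0∞, (r = 2 ∨ r = 4) → ∀ (α : d → ℤ → ℤ → ℂ) (I : Finset ℤ)
      (a : ℤ → ℤ → ℝ≥0∞), (∀ j s t, ‖α j s t‖ₑ ^ 2 ≤ a s t) →
      eLpNorm (fun ω => reForm C α I G ω - ∫ ω', reForm C α I G ω' ∂iidLaw π) r (iidLaw π) ^ 2
        ≤ K * ∑ s ∈ I, ∑ t ∈ I, a s t := by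
  obtain ⟨ν, hν, hc⟩ := hG.exists_coeffBound
  set K₀ := 128 * ((∑' j, ν j) ^ 2 * (∑' j, ν j) ^ 2 + (∑' j, ν j) ^ 2 * (∑' j, ν j) ^ 2) with hK₀
  have hK₀t : K₀ ≠ ∞ := by finiteness
  have hCt : ∑ j, ‖C j‖ₑ ^ 2 ≠ ∞ :=
    (ENNReal.sum_lt_top.2 fun j _ => ENNReal.pow_lt_top enorm_lt_top).ne
  refine ⟨(∑ j, ‖C j‖ₑ ^ 2) * (Fintype.card d * K₀), ENNReal.mul_ne_top hCt
    (ENNReal.mul_ne_top (by simp) hK₀t), fun r hr α I a ha => ?_⟩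
  have hr1 : 1 ≤ r := by rcases hr with rfl | rfl <;> norm_num
  have hq : ∀ j, eLpNorm (fun ω => quadForm (α j) I (proc G) (proc G) ω
      - ∫ ω', quadForm (α j) I (proc G) (proc G) ω' ∂iidLaw π) r (iidLaw π) ^ 2
      ≤ K₀ * ∑ s ∈ I, ∑ t ∈ I, a s t := by
    intro j
    have : eLpNorm (fun ω => quadForm (α j) I (proc G) (proc G) ω
      - ∫ ω', quadForm (α j) I (proc G) (proc G) ω' ∂iidLaw π) r (iidLaw π) ^ 2
      ≤ K₀ * ∑ s ∈ I, ∑ t ∈ I, ‖α j s t‖ₑ ^ 2 := by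
      have h4 := hc 4 (by norm_num)
      have ht := hc ∞ (by simp)
      rcases hr with rfl | rfl
      · have := holderTriple_four_four_two
        exact eLpNorm_quadForm_sub_integral_sq_le (p := 4) h4 h4 h4 h4 hG.proc_mean hG.proc_mean
          (Or.inl rfl) (by norm_num) (α j) I
      · exact eLpNorm_quadForm_sub_integral_sq_le (p := ∞) h4 ht h4 ht hG.proc_mean hG.proc_mean
          (Or.inr rfl) (by simp) (α j) I
    refine this.trans (mul_le_mul_right ?_ _)
    exact Finset.sum_le_sum fun s _ => Finset.sum_le_sum fun t _ => ha j s t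
  have e : (fun ω => reForm C α I G ω - ∫ ω', reForm C α I G ω' ∂iidLaw π)
      = fun ω => (∑ j, inner ℂ (C j) (quadForm (α j) I (proc G) (proc G) ω
      - ∫ ω', quadForm (α j) I (proc G) (proc G) ω' ∂iidLaw π)).re := by
    funext ω
    rw [hG.integral_reForm, reForm]
    simp only [inner_sub_right, Finset.sum_sub_distrib, Complex.sub_re]
  rw [e]
  refine (eLpNorm_re_sum_inner_sq_le hr1 C fun j =>
    ((hG.bddMeas_quadForm (α j) I).meas.sub stronglyMeasurable_const).aestronglyMeasurable).trans ?_
  rw [mul_assoc]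
  refine mul_le_mul_right ((Finset.sum_le_sum fun j _ => hq j).trans ?_) _
  rw [Finset.sum_const, nsmul_eq_mul, Finset.card_univ]
  exact (mul_assoc _ _ _).ge

/-- Shifts by multiples of `L` of a function of `L` consecutive coordinates involve disjoint sets of
coordinates, so they are independent, and they are identically distributed by stationarity. -/
theorem integral_prod_comp_shift {ψ : (ℤ → S) → ℂ} (hψ : BddMeas ψ) {a : ℤ} {L : ℕ}
    (hd : DependsOn ψ (Set.Ioc a (a + L))) (N : ℕ) :
    ∫ ω, ∏ k ∈ Finset.range N, ψ (shift (k * L : ℕ) ω) ∂iidLaw π = (∫ ω, ψ ω ∂iidLaw π) ^ N := by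
  have hb : ∀ n : ℕ, BddMeas fun ω => ∏ k ∈ Finset.range n, ψ (shift (k * L : ℕ) ω) := by
    intro n
    induction n with
    | zero => exact ⟨by simpa using stronglyMeasurable_const, 1, by simp⟩
    | succ n ih =>
      simp only [Finset.prod_range_succ]
      exact ih.mul (hψ.comp (measurable_shift _))
  induction N with
  | zero => simp
  | succ n ih =>
    simp only [Finset.prod_range_succ]
    rw [SepCoord.integral_mul _ (hb n) (hψ.comp (measurable_shift _)), ih,
      integral_comp_shift ψ, pow_succ]
    refine ⟨Set.Iic (a + (n * L : ℕ)), ?_, ?_⟩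
    · intro x y hxy
      refine Finset.prod_congr rfl fun k hk => hd fun i hi => hxy _ ?_
      have hk' : k + 1 ≤ n := Finset.mem_range.1 hk
      have : (k + 1) * L ≤ n * L := Nat.mul_le_mul_right _ hk'
      rw [add_mul, one_mul] at this
      simp only [Set.mem_Ioc, Set.mem_Iic] at hi ⊢
      omega
    · intro x y hxy
      refine hd fun i hi => hxy _ ?_
      simp only [Set.mem_Ioc, Set.mem_Iic, Set.mem_compl_iff] at hi ⊢
      omega

theorem quadForm_comp_shift (α : ℤ → ℤ → ℂ) (hα : ∀ s t a, α (s + a) (t + a) = α s t) (ℓ : ℕ)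
    (a : ℤ) (ω : ℤ → S) : quadForm α (Finset.Icc 1 (ℓ : ℤ)) (proc G) (proc G) (shift a ω)
      = quadForm α (Finset.Ioc a (a + ℓ)) (proc G) (proc G) ω := by
  have hp : ∀ s, proc G s (shift a ω) = proc G (s + a) ω := fun s => by simp [proc, shift_shift]
  have hs : ∀ {E : Type _} [AddCommMonoid E] (f : ℤ → E), ∑ s ∈ Finset.Icc 1 (ℓ : ℤ), f (s + a)
      = ∑ s ∈ Finset.Ioc a (a + ℓ), f s := fun f => by
    refine Finset.sum_nbij' (· + a) (· - a) ?_ ?_ (by simp) (by simp) (by simp) <;>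
    · intro i hi
      simp only [Finset.mem_Icc, Finset.mem_Ioc] at hi ⊢
      omega
  simp only [quadForm, hp]
  rw [← hs]
  refine Finset.sum_congr rfl fun s _ => ?_
  rw [← hs]
  simp only [hα]

theorem quadForm_subset (α : ℤ → ℤ → ℂ) {I J : Finset ℤ} (h : J ⊆ I) (X Y : ℤ → (ℤ → S) → H)
    (ω : ℤ → S) : quadForm α J X Y ω
      = quadForm (fun s t => α s t * if s ∈ J ∧ t ∈ J then 1 else 0) I X Y ω := by
  rw [quadForm, quadForm, ← Finset.sum_subset h]
  · refine Finset.sum_congr rfl fun s hs => ?_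
    rw [← Finset.sum_subset h]
    · refine Finset.sum_congr rfl fun t ht => ?_
      rw [if_pos ⟨hs, ht⟩, mul_one]
    · intro t _ ht
      rw [if_neg fun h => ht h.2, mul_zero, zero_smul]
  · intro s _ hs
    refine Finset.sum_eq_zero fun t _ => ?_
    rw [if_neg fun h => hs h.1, mul_zero, zero_smul]

theorem winCoef_add (w : ℝ → ℝ) (b lam : ℝ) (s t a : ℤ) :
    winCoef w b lam (s + a) (t + a) = winCoef w b lam s t := by
  simp only [winCoef]; push_cast; simp

/-- The indicator that `s` and `t` lie in the same of the blocks `(kL, kL + ℓ]`, `k < N`. -/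
def sameBlock (L ℓ N : ℕ) (s t : ℤ) : ℝ :=
  ∑ k ∈ Finset.range N, if s ∈ Finset.Ioc ((k * L : ℕ) : ℤ) ((k * L : ℕ) + ℓ) ∧
    t ∈ Finset.Ioc ((k * L : ℕ) : ℤ) ((k * L : ℕ) + ℓ) then 1 else 0

theorem sameBlock_eq {L ℓ : ℕ} (h : ℓ ≤ L) (N : ℕ) (s t : ℤ) :
    sameBlock L ℓ N s t = 0 ∨ sameBlock L ℓ N s t = 1 := by
  by_cases hk : ∃ k ∈ Finset.range N, s ∈ Finset.Ioc ((k * L : ℕ) : ℤ) ((k * L : ℕ) + ℓ) ∧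
    t ∈ Finset.Ioc ((k * L : ℕ) : ℤ) ((k * L : ℕ) + ℓ)
  · obtain ⟨k, hkN, hst⟩ := hk
    right
    rw [sameBlock, Finset.sum_eq_single_of_mem k hkN, if_pos hst]
    intro k' _ hne
    refine if_neg fun hst' => ?_
    have h1 := hst.1
    have h2 := hst'.1
    simp only [Finset.mem_Ioc] at h1 h2
    rcases lt_or_gt_of_ne hne with hlt | hlt
    · have := Nat.mul_le_mul_right L (Nat.succ_le_of_lt hlt)
      rw [Nat.succ_mul] at this
      omega
    · have := Nat.mul_le_mul_right L (Nat.succ_le_of_lt hlt)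
      rw [Nat.succ_mul] at this
      omega
  · left
    push Not at hk
    exact Finset.sum_eq_zero fun k hkN => if_neg fun hst => hk k hkN hst.1 hst.2

/-- The squared Frobenius norm of the window coefficients. -/
def windowFrob (w : ℝ → ℝ) (b : ℝ) (τ : ℕ) : ℝ :=
  ∑ s ∈ Finset.Icc (1 : ℤ) τ, ∑ t ∈ Finset.Icc (1 : ℤ) τ, w (b * (t - s)) ^ 2

theorem block_subset {L ℓ N T k : ℕ} (h : ℓ ≤ L) (hN : N * L ≤ T) (hk : k ∈ Finset.range N) :
    Finset.Ioc ((k * L : ℕ) : ℤ) ((k * L : ℕ) + ℓ) ⊆ Finset.Icc (1 : ℤ) T := by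
  intro s hs
  have hk' : k + 1 ≤ N := Finset.mem_range.1 hk
  have := Nat.mul_le_mul_right L hk'
  rw [add_mul, one_mul] at this
  simp only [Finset.mem_Ioc, Finset.mem_Icc] at hs ⊢
  omega

/-- Each diagonal block is a translate of `[1, ℓ]²` and contributes `windowFrob w b ℓ`. The energy
of the discarded pairs is thus an exact difference, and its smallness follows by comparing two
limits. -/
theorem sum_mul_one_sub_sameBlock {L ℓ N T : ℕ} (h : ℓ ≤ L) (hN : N * L ≤ T) (w : ℝ → ℝ) (b : ℝ) :
    ∑ s ∈ Finset.Icc (1 : ℤ) T, ∑ t ∈ Finset.Icc (1 : ℤ) T,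
      w (b * (t - s)) ^ 2 * (1 - sameBlock L ℓ N s t) = windowFrob w b T - N * windowFrob w b ℓ := by
  simp only [mul_one_sub, Finset.sum_sub_distrib]
  congr 1
  have hk : ∀ k ∈ Finset.range N, ∑ s ∈ Finset.Icc (1 : ℤ) T, ∑ t ∈ Finset.Icc (1 : ℤ) T,
      w (b * (t - s)) ^ 2 * (if s ∈ Finset.Ioc ((k * L : ℕ) : ℤ) ((k * L : ℕ) + ℓ) ∧
    t ∈ Finset.Ioc ((k * L : ℕ) : ℤ) ((k * L : ℕ) + ℓ) then 1 else 0) = windowFrob w b ℓ := by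
    intro k hk
    have hsub := block_subset h hN hk
    set J := Finset.Ioc ((k * L : ℕ) : ℤ) ((k * L : ℕ) + ℓ) with hJ
    rw [← Finset.sum_subset hsub]
    · have hs : ∀ f : ℤ → ℝ, ∑ s ∈ Finset.Icc 1 (ℓ : ℤ), f (s + (k * L : ℕ))
          = ∑ s ∈ J, f s := fun f => by
        refine Finset.sum_nbij' (· + ((k * L : ℕ) : ℤ)) (· - ((k * L : ℕ) : ℤ)) ?_ ?_ (by simp)
          (by simp) (by simp) <;>
        · intro i hi
          simp only [hJ, Finset.mem_Icc, Finset.mem_Ioc] at hi ⊢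
          omega
      rw [windowFrob, ← hs]
      refine Finset.sum_congr rfl fun s hs' => ?_
      rw [← Finset.sum_subset hsub, ← hs]
      · refine Finset.sum_congr rfl fun t ht' => ?_
        rw [if_pos, mul_one]
        · congr 3; push_cast; ring
        · simp only [hJ, Finset.mem_Icc, Finset.mem_Ioc] at hs' ht' ⊢
          omega
      · intro t _ ht
        rw [if_neg fun h => ht h.2, mul_zero]
    · intro s _ hs
      refine Finset.sum_eq_zero fun t _ => ?_
      rw [if_neg fun h => hs h.1, mul_zero]
  have : ∀ s t : ℤ, w (b * (t - s)) ^ 2 * sameBlock L ℓ N s t = ∑ k ∈ Finset.range N,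
      w (b * (t - s)) ^ 2 * (if s ∈ Finset.Ioc ((k * L : ℕ) : ℤ) ((k * L : ℕ) + ℓ) ∧
    t ∈ Finset.Ioc ((k * L : ℕ) : ℤ) ((k * L : ℕ) + ℓ) then 1 else 0) := fun s t => by
    rw [sameBlock, Finset.mul_sum]
  simp only [this]
  calc _ = ∑ s ∈ Finset.Icc (1 : ℤ) T, ∑ k ∈ Finset.range N, ∑ t ∈ Finset.Icc (1 : ℤ) T,
      w (b * (t - s)) ^ 2 * (if s ∈ Finset.Ioc ((k * L : ℕ) : ℤ) ((k * L : ℕ) + ℓ) ∧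
    t ∈ Finset.Ioc ((k * L : ℕ) : ℤ) ((k * L : ℕ) + ℓ) then 1 else 0) :=
        Finset.sum_congr rfl fun s _ => Finset.sum_comm
    _ = _ := by
        rw [Finset.sum_comm, Finset.sum_congr rfl hk, Finset.sum_const, Finset.card_range,
          nsmul_eq_mul]

variable (G) in
/-- The real part of a linear functional of lag-window estimators, up to normalisation. -/
def winReForm (C : d → S2 H) (w : ℝ → ℝ) (lam : d → ℝ) (b : ℝ) (τ : ℕ) (ω : ℤ → S) : ℝ :=
  reForm C (fun j => winCoef w b (lam j)) (Finset.Icc (1 : ℤ) τ) G ω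

/-- The coefficients depend on `t - s` only, so the form on a block is a shift of the form on `[1,
ℓ]`. The remainder is then itself a quadratic form, with coefficients supported on the pairs in no
common block, and the moment bounds apply to it. -/
theorem winReForm_sub_sum_blocks (C : d → S2 H) (w : ℝ → ℝ) (lam : d → ℝ) (b : ℝ)
    {L ℓ N T : ℕ} (h : ℓ ≤ L) (hN : N * L ≤ T) (ω : ℤ → S) :
    winReForm G C w lam b T ω
      - ∑ k ∈ Finset.range N, winReForm G C w lam b ℓ (shift (k * L : ℕ) ω)
      = reForm C (fun j s t => winCoef w b (lam j) s t * ((1 - sameBlock L ℓ N s t : ℝ) : ℂ))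
          (Finset.Icc (1 : ℤ) T) G ω := by
  have h1 : ∀ j, quadForm (fun s t => winCoef w b (lam j) s t * ((1 - sameBlock L ℓ N s t : ℝ) : ℂ))
      (Finset.Icc (1 : ℤ) T) (proc G) (proc G) ω
      = quadForm (winCoef w b (lam j)) (Finset.Icc (1 : ℤ) T) (proc G) (proc G) ω
        - ∑ k ∈ Finset.range N, quadForm (winCoef w b (lam j)) (Finset.Icc (1 : ℤ) ℓ)
          (proc G) (proc G) (shift (k * L : ℕ) ω) := by
    intro j
    have : ∀ k ∈ Finset.range N, quadForm (winCoef w b (lam j)) (Finset.Icc (1 : ℤ) ℓ)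
          (proc G) (proc G) (shift (k * L : ℕ) ω) = _ := fun k hk =>
      (quadForm_comp_shift _ (winCoef_add w b (lam j)) ℓ _ ω).trans
        (quadForm_subset _ (block_subset h hN hk) _ _ ω)
    rw [Finset.sum_congr rfl this]
    simp only [quadForm]
    rw [Finset.sum_comm (s := Finset.range N), ← Finset.sum_sub_distrib]
    refine Finset.sum_congr rfl fun s _ => ?_
    rw [Finset.sum_comm (s := Finset.range N), ← Finset.sum_sub_distrib]
    refine Finset.sum_congr rfl fun t _ => ?_
    rw [← Finset.sum_smul, ← sub_smul, ← Finset.mul_sum, sameBlock]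
    rw [Complex.ofReal_sub, Complex.ofReal_one, mul_one_sub, Complex.ofReal_sum]
    simp only [apply_ite (Complex.ofReal), Complex.ofReal_one, Complex.ofReal_zero]
  simp only [winReForm, reForm, h1, inner_sub_right, inner_sum, Finset.sum_sub_distrib,
    Complex.sub_re]
  rw [Finset.sum_comm]
  congr 1
  rw [Complex.re_sum]

end BlockForms

/-! ### Central limit theorem for bounded `m`-dependent processes -/

section BlockCLT

set_option linter.unusedSectionVars false

theorem norm_exp_I_mul_sub_exp_le (x y : ℝ) :
    ‖Complex.exp (Complex.I * x) - Complex.exp (Complex.I * y)‖ ≤ |x - y| := by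
  have : Complex.exp (Complex.I * x) - Complex.exp (Complex.I * y)
      = Complex.exp (Complex.I * y) * (Complex.exp (Complex.I * (x - y : ℝ)) - 1) := by
    rw [mul_sub, ← Complex.exp_add, mul_one]
    congr 2
    push_cast
    ring
  rw [this, norm_mul, mul_comm Complex.I, Complex.norm_exp_ofReal_mul_I, one_mul]
  exact Real.norm_exp_I_mul_ofReal_sub_one_le

theorem integrable_exp_I_mul {α : Type*} [MeasurableSpace α] {μ : Measure α} [IsFiniteMeasure μ]
    {v : α → ℝ} (hv : AEStronglyMeasurable v μ) :
    Integrable (fun x => Complex.exp (Complex.I * v x)) μ := by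
  refine Integrable.of_bound (C := 1) ?_ (Eventually.of_forall fun x => ?_)
  · exact (by fun_prop : Continuous fun y : ℝ => Complex.exp (Complex.I * y)).comp_aestronglyMeasurable hv
  · rw [mul_comm, Complex.norm_exp_ofReal_mul_I]

theorem enorm_integral_exp_sub_le {α : Type*} [MeasurableSpace α] {μ : Measure α}
    [IsProbabilityMeasure μ] {f g : α → ℝ} (hf : AEStronglyMeasurable f μ)
    (hg : AEStronglyMeasurable g μ) :
    ‖∫ x, Complex.exp (Complex.I * f x) ∂μ - ∫ x, Complex.exp (Complex.I * g x) ∂μ‖ₑ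
      ≤ eLpNorm (fun x => f x - g x) 2 μ := by
  rw [← integral_sub (integrable_exp_I_mul hf) (integrable_exp_I_mul hg)]
  calc _ ≤ ∫⁻ x, ‖f x - g x‖ₑ ∂μ := (enorm_integral_le_lintegral_enorm _).trans
        (lintegral_mono fun x => by
          rw [← ofReal_norm, ← ofReal_norm]
          exact ENNReal.ofReal_le_ofReal (norm_exp_I_mul_sub_exp_le _ _))
    _ = eLpNorm (fun x => f x - g x) 1 μ := eLpNorm_one_eq_lintegral_enorm.symm
    _ ≤ _ := eLpNorm_le_eLpNorm_of_exponent_le (by norm_num) (hf.sub hg)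

variable {S : Type*} [MeasurableSpace S] {π : Measure S} [IsProbabilityMeasure π]
variable {H : Type*} [NormedAddCommGroup H] [InnerProductSpace ℂ H] [CompleteSpace H]
variable {m : ℕ} {G : (ℤ → S) → H} {d : Type*} [Fintype d]

/-- The form `(f, g) ↦ ⟨C, f ⊗ g⟩`. -/
def innerTens (C : S2 H) : H →L[ℝ] H →L[ℝ] ℂ :=
  (ContinuousLinearMap.compL ℝ H (S2 H) ℂ ((innerSL ℂ C).restrictScalars ℝ)).comp (S2.tensL H)

theorem innerTens_apply (C : S2 H) (f g : H) : innerTens C f g = inner ℂ C (S2.tens f g) := rfl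

/-- The complex conjugate of a form. -/
def conjForm {E : Type*} [NormedAddCommGroup E] [NormedSpace ℝ E] (B : E →L[ℝ] E →L[ℝ] ℂ) :
    E →L[ℝ] E →L[ℝ] ℂ :=
  (ContinuousLinearMap.compL ℝ E ℂ ℂ (Complex.conjCLE : ℂ →L[ℝ] ℂ)).comp B

theorem conjForm_apply {E : Type*} [NormedAddCommGroup E] [NormedSpace ℝ E]
    (B : E →L[ℝ] E →L[ℝ] ℂ) (f g : E) : conjForm B f g = conj (B f g) := rfl

theorem inner_quadForm_winCoef (C : S2 H) (w : ℝ → ℝ) (b lam : ℝ) (τ : ℕ) (ω : ℤ → S) :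
    inner ℂ C (quadForm (winCoef w b lam) (Finset.Icc (1 : ℤ) τ) (proc G) (proc G) ω)
      = winForm (innerTens C) G w b lam τ ω := by
  simp only [quadForm, winForm, inner_sum, inner_smul_right, innerTens_apply]

theorem conj_winCoef (w : ℝ → ℝ) (b lam : ℝ) (s t : ℤ) :
    conj (winCoef w b lam s t) = winCoef w b (-lam) s t := by
  rw [winCoef, winCoef, map_mul, Complex.conj_ofReal, ← Complex.exp_conj]
  simp

theorem conj_winForm {E : Type*} [NormedAddCommGroup E] [NormedSpace ℝ E]
    (B : E →L[ℝ] E →L[ℝ] ℂ) (G : (ℤ → S) → E) (w : ℝ → ℝ) (b lam : ℝ) (τ : ℕ) (ω : ℤ → S) :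
    conj (winForm B G w b lam τ ω) = winForm (conjForm B) G w b (-lam) τ ω := by
  simp only [winForm, map_sum, map_mul, conj_winCoef, conjForm_apply]

theorem winReForm_eq (C : d → S2 H) (w : ℝ → ℝ) (lam : d → ℝ) (b : ℝ) (τ : ℕ) (ω : ℤ → S) :
    winReForm G C w lam b τ ω = ∑ j, (winForm (innerTens (C j)) G w b (lam j) τ ω).re := by
  simp only [winReForm, reForm, inner_quadForm_winCoef, Complex.re_sum]

theorem BddMeas.re {α : Type*} [MeasurableSpace α] {f : α → ℂ} (hf : BddMeas f) :
    BddMeas fun x => (f x).re :=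
  ⟨Complex.continuous_re.comp_stronglyMeasurable hf.meas,
    hf.bdd.imp fun _ h x => (Complex.abs_re_le_norm _).trans (h x)⟩

theorem BddMeas.conj {α : Type*} [MeasurableSpace α] {f : α → ℂ} (hf : BddMeas f) :
    BddMeas fun x => conj (f x) :=
  ⟨Complex.continuous_conj.comp_stronglyMeasurable hf.meas,
    hf.bdd.imp fun _ h x => by rw [RCLike.norm_conj]; exact h x⟩

theorem BddMeas.mul_real {α : Type*} [MeasurableSpace α] {f g : α → ℝ} (hf : BddMeas f)
    (hg : BddMeas g) : BddMeas fun x => f x * g x := hf.bilin hg (ContinuousLinearMap.mul ℝ ℝ)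

/-- `Re z · Re z' = Re (z z' + z z̄') / 2`, so covariances of real parts come from bilinear
covariances without and with a conjugate on the second variable. -/
theorem cov_re_re {α : Type*} [MeasurableSpace α] {μ : Measure α} [IsFiniteMeasure μ]
    {f g : α → ℂ} (hf : BddMeas f) (hg : BddMeas g) :
    ∫ x, (f x).re * (g x).re ∂μ - (∫ x, (f x).re ∂μ) * ∫ x, (g x).re ∂μ
      = (((∫ x, f x * g x ∂μ - (∫ x, f x ∂μ) * ∫ x, g x ∂μ)
        + (∫ x, f x * conj (g x) ∂μ - (∫ x, f x ∂μ) * ∫ x, conj (g x) ∂μ)) / 2).re := by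
  have e1 : ∫ x, (f x).re * (g x).re ∂μ
      = ((∫ x, f x * g x ∂μ + ∫ x, f x * conj (g x) ∂μ) / 2).re := by
    rw [← integral_add ((hf.mul hg).integrable _) ((hf.mul hg.conj).integrable _), ← integral_div]
    have hi : Integrable (fun x => (f x * g x + f x * conj (g x)) / 2) μ :=
      (((hf.mul hg).integrable _).add ((hf.mul hg.conj).integrable _)).div_const 2
    have := integral_re (𝕜 := ℂ) hi
    simp only [RCLike.re_to_complex] at this
    rw [← this]
    congr 1
    funext x
    simp
  have e2 : ∀ {h : α → ℂ}, BddMeas h → ∫ x, (h x).re ∂μ = (∫ x, h x ∂μ).re := fun hh => by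
    have := integral_re (𝕜 := ℂ) (hh.integrable μ)
    simpa using this
  rw [e1, e2 hf, e2 hg, integral_conj]
  simp
  ring

variable (π) in
/-- The limit of `(b/τ) Var (Re ∑ⱼ ⟨Cⱼ, Qⱼ⟩)`. -/
def varLimit (m : ℕ) (C : d → S2 H) (G : (ℤ → S) → H) (w : ℝ → ℝ) (lam : d → ℝ) : ℝ :=
  ∑ j, ∑ k, ((covLimit π m (innerTens (C j)) (innerTens (C k)) G w (lam j) (lam k)
    + covLimit π m (innerTens (C j)) (conjForm (innerTens (C k))) G w (lam j) (-lam k)) / 2).re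

variable {w : ℝ → ℝ} {ι : Type*} {l : Filter ι} {b : ι → ℝ} {τ : ι → ℕ}

/-- By `conj_winForm` the conjugate of a lag-window form is the lag-window form of `conjForm` at the
opposite frequency, so `tendsto_cov_winForm` covers both covariances in `cov_re_re`. -/
theorem MDep.tendsto_var (hG : MDep π m G) (hw : LagWindow w) (hb : Tendsto b l (𝓝[>] 0))
    (hbτ : Tendsto (fun i => b i * τ i) l atTop) (C : d → S2 H) (lam : d → ℝ) :
    Tendsto (fun i => b i / τ i * ∫ ω, (winReForm G C w lam (b i) (τ i) ω
      - ∫ ω', winReForm G C w lam (b i) (τ i) ω' ∂iidLaw π) ^ 2 ∂iidLaw π) l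
      (𝓝 (varLimit π m C G w lam)) := by
  have h := tendsto_finsetSum Finset.univ fun j (_ : j ∈ Finset.univ) =>
    tendsto_finsetSum Finset.univ fun k (_ : k ∈ Finset.univ) =>
      (Complex.continuous_re.tendsto _).comp
        (((hG.tendsto_cov_winForm (B := innerTens (C j)) (B' := innerTens (C k)) hw hb hbτ
          (lam j) (lam k)).add
        (hG.tendsto_cov_winForm (B := innerTens (C j)) (B' := conjForm (innerTens (C k))) hw hb hbτ
          (lam j) (-lam k))).div_const 2)
  refine h.congr fun i => ?_
  have hb := fun j => hG.bddMeas_winForm (innerTens (C j)) w (b i) (lam j) (τ i)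
  set q := fun j ω => winForm (innerTens (C j)) G w (b i) (lam j) (τ i) ω with hq
  have hU : ∀ ω, winReForm G C w lam (b i) (τ i) ω = ∑ j, (q j ω).re := winReForm_eq C w lam _ _
  have e1 : ∫ ω, winReForm G C w lam (b i) (τ i) ω ∂iidLaw π
      = ∑ j, ∫ ω, (q j ω).re ∂iidLaw π := by
    simp only [hU]
    exact integral_finsetSum _ fun j _ => (hb j).re.integrable _
  have hUb : BddMeas (winReForm G C w lam (b i) (τ i)) := hG.bddMeas_reForm _ _ _
  have e2 : ∫ ω, (winReForm G C w lam (b i) (τ i) ω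
      - ∫ ω', winReForm G C w lam (b i) (τ i) ω' ∂iidLaw π) ^ 2 ∂iidLaw π
      = ∑ j, ∑ k, (∫ ω, (q j ω).re * (q k ω).re ∂iidLaw π
        - (∫ ω, (q j ω).re ∂iidLaw π) * ∫ ω, (q k ω).re ∂iidLaw π) := by
    have a : ∀ ω, (winReForm G C w lam (b i) (τ i) ω
      - ∫ ω', winReForm G C w lam (b i) (τ i) ω' ∂iidLaw π) ^ 2
      = (∑ j, ∑ k, ((q j ω).re - ∫ ω', (q j ω').re ∂iidLaw π)
        * ((q k ω).re - ∫ ω', (q k ω').re ∂iidLaw π)) := fun ω => by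
      rw [e1, hU, ← Finset.sum_sub_distrib, sq, Finset.sum_mul_sum]
    have hc : ∀ j, BddMeas fun ω => (q j ω).re - ∫ ω', (q j ω').re ∂iidLaw π := fun j => by
      obtain ⟨h1, M, hM⟩ := (hb j).re
      exact ⟨h1.sub stronglyMeasurable_const, _, fun ω => (norm_sub_le _ _).trans
        (add_le_add_left (hM ω) _)⟩
    simp only [a]
    rw [integral_finsetSum _ fun j _ => (BddMeas.sum fun k _ => (hc j).mul_real (hc k)).integrable _]
    refine Finset.sum_congr rfl fun j _ => ?_
    rw [integral_finsetSum _ fun k _ => ((hc j).mul_real (hc k)).integrable _]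
    refine Finset.sum_congr rfl fun k _ => ?_
    have b1 : Integrable (fun ω => (q j ω).re * (q k ω).re) (iidLaw π) :=
      ((hb j).re.mul_real (hb k).re).integrable _
    set mj := ∫ ω', (q j ω').re ∂iidLaw π with hmj
    set mk := ∫ ω', (q k ω').re ∂iidLaw π with hmk
    have b2 : Integrable (fun ω => (q j ω).re * mk) (iidLaw π) :=
      ((hb j).re.integrable _).mul_const _
    have b3 : Integrable (fun ω => mj * (q k ω).re) (iidLaw π) :=
      ((hb k).re.integrable _).const_mul _
    have b4 : Integrable (fun ω => (q j ω).re * (q k ω).re - (q j ω).re * mk) (iidLaw π) := b1.sub b2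
    have b5 : Integrable (fun ω => (q j ω).re * (q k ω).re - (q j ω).re * mk - mj * (q k ω).re)
      (iidLaw π) := b4.sub b3
    have : ∀ ω, ((q j ω).re - mj) * ((q k ω).re - mk)
        = (q j ω).re * (q k ω).re - (q j ω).re * mk - mj * (q k ω).re + mj * mk := fun ω => by ring
    simp only [this]
    rw [integral_add b5 (integrable_const _), integral_sub b4 b3, integral_sub b1 b2,
      integral_mul_const, integral_const_mul, ← hmj, ← hmk]
    simp
  rw [e2, Finset.mul_sum]
  refine Finset.sum_congr rfl fun j _ => ?_
  rw [Finset.mul_sum]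
  refine Finset.sum_congr rfl fun k _ => ?_
  rw [cov_re_re (hb j) (hb k), ← Complex.re_ofReal_mul]
  simp only [Function.comp, ← conj_winForm]
  congr 1
  ring

/-- Up to rounding, `L` is the geometric mean of `1/b` and `τ`, whose ratio `bτ` tends to infinity.
It is long compared with the window width and short compared with the sample. -/
theorem exists_blockLength (hb : Tendsto b l (𝓝[>] 0))
    (hbτ : Tendsto (fun i => b i * τ i) l atTop) :
    ∃ L : ι → ℕ, Tendsto (fun i => b i * L i) l atTop ∧
      Tendsto (fun i => (L i : ℝ) / τ i) l (𝓝 0) := by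
  refine ⟨fun i => ⌈√(τ i / b i)⌉₊, ?_, ?_⟩
  · refine tendsto_atTop_mono' l ?_ (Real.tendsto_sqrt_atTop.comp hbτ)
    filter_upwards [hb.eventually self_mem_nhdsWithin] with i hi
    have hb0 : 0 < b i := hi
    have h1 : b i * √(τ i / b i) = √(b i * τ i) := by
      rw [← Real.sqrt_sq hb0.le, ← Real.sqrt_mul (by positivity), Real.sqrt_sq hb0.le]
      congr 1
      field_simp
    simp only [Function.comp]
    rw [← h1]
    exact mul_le_mul_of_nonneg_left (Nat.le_ceil _) hb0.le
  · have hlim : Tendsto (fun i => (√(b i * τ i))⁻¹ + (τ i : ℝ)⁻¹) l (𝓝 0) := by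
      have := ((Real.tendsto_sqrt_atTop.comp hbτ).inv_tendsto_atTop).add
        (tendsto_natCast_inv_of_bandwidth hb hbτ)
      simpa using this
    refine tendsto_of_tendsto_of_tendsto_of_le_of_le' tendsto_const_nhds hlim
      (Eventually.of_forall fun i => by positivity) ?_
    filter_upwards [hb.eventually self_mem_nhdsWithin, hbτ.eventually_gt_atTop 0] with i hi hpos
    have hb0 : 0 < b i := hi
    have hτ0 : (0 : ℝ) < τ i := by
      by_contra h
      have : (τ i : ℝ) = 0 := le_antisymm (not_lt.1 h) (by positivity)
      rw [this] at hpos; simp at hpos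
    have h1 : √(τ i / b i) / τ i = (√(b i * τ i))⁻¹ := by
      rw [div_eq_iff hτ0.ne', Real.sqrt_div hτ0.le, Real.sqrt_mul hb0.le]
      have e1 := Real.sqrt_pos.2 hb0
      have e2 := Real.sqrt_pos.2 hτ0
      field_simp
      exact Real.sq_sqrt hτ0.le
    calc (⌈√(τ i / b i)⌉₊ : ℝ) / τ i ≤ (√(τ i / b i) + 1) / τ i := by
          gcongr
          exact (Nat.ceil_lt_add_one (Real.sqrt_nonneg _)).le
      _ = _ := by rw [add_div, h1, one_div]

/-- Dropping `m` times from each block and the incomplete last block loses at most the fraction `m/L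
+ L/τ` of the sample. -/
theorem tendsto_block_counts {L : ι → ℕ} (hb : Tendsto b l (𝓝[>] 0))
    (hbτ : Tendsto (fun i => b i * τ i) l atTop)
    (hbL : Tendsto (fun i => b i * L i) l atTop) (hL : Tendsto (fun i => (L i : ℝ) / τ i) l (𝓝 0))
    (m : ℕ) :
    Tendsto (fun i => b i * (L i - m : ℕ)) l atTop ∧
      Tendsto (fun i => ((τ i / L i : ℕ) : ℝ) * (L i - m : ℕ) / τ i) l (𝓝 1) ∧
      Tendsto (fun i => ((τ i / L i : ℕ) : ℝ)⁻¹) l (𝓝 0) := by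
  have hb0 : Tendsto b l (𝓝 0) := hb.mono_right nhdsWithin_le_nhds
  have hLi := tendsto_natCast_inv_of_bandwidth hb hbL
  have hev : ∀ᶠ i in l, 0 < b i ∧ (0 : ℝ) < τ i ∧ (0 : ℝ) < L i := by
    filter_upwards [hb.eventually self_mem_nhdsWithin, hbτ.eventually_gt_atTop 0,
      hbL.eventually_gt_atTop 0] with i hi h1 h2
    have hi' : 0 < b i := hi
    exact ⟨hi', pos_of_mul_pos_right h1 hi'.le, pos_of_mul_pos_right h2 hi'.le⟩
  refine ⟨?_, ?_, ?_⟩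
  · have h1 : Tendsto (fun i => b i * L i + -(b i * m)) l atTop := by
      refine hbL.atTop_add (C := 0) ?_
      simpa using (hb0.mul_const (m : ℝ)).neg
    refine tendsto_atTop_mono' l ?_ h1
    filter_upwards [hev] with i hi
    have : (L i : ℝ) ≤ (L i - m : ℕ) + m := by exact_mod_cast (show L i ≤ L i - m + m by omega)
    nlinarith [hi.1]
  · have hlow : Tendsto (fun i => 1 - (L i : ℝ) / τ i - m * (L i : ℝ)⁻¹) l (𝓝 1) := by
      have := (hL.const_sub 1).sub (hLi.const_mul (m : ℝ))
      simpa using this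
    refine tendsto_of_tendsto_of_tendsto_of_le_of_le' hlow tendsto_const_nhds ?_ ?_
    · filter_upwards [hev] with i ⟨_, hτ, hL0⟩
      rw [le_div_iff₀ hτ]
      have hL0' : 0 < L i := by exact_mod_cast hL0
      have h1 : (L i : ℝ) ≤ (L i - m : ℕ) + m := by exact_mod_cast (show L i ≤ L i - m + m by omega)
      have h2 : (τ i : ℝ) ≤ (τ i / L i : ℕ) * L i + L i := by
        have := Nat.lt_div_mul_add hL0' (a := τ i)
        exact_mod_cast this.le
      have h3 : ((τ i / L i : ℕ) : ℝ) ≤ τ i / L i := Nat.cast_div_le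
      have h4 : (1 - (L i : ℝ) / τ i - m * (L i : ℝ)⁻¹) * τ i = τ i - L i - m * (τ i / L i) := by
        field_simp
      rw [h4]
      have h5 : (0 : ℝ) ≤ ((τ i / L i : ℕ) : ℝ) := by positivity
      have h6 : (m : ℝ) * ((τ i / L i : ℕ) : ℝ) ≤ m * (τ i / L i) := by gcongr
      nlinarith
    · filter_upwards [hev] with i ⟨_, hτ, hL0⟩
      refine div_le_one_of_le₀ ?_ hτ.le
      have : (τ i / L i) * (L i - m) ≤ τ i :=
        (Nat.mul_le_mul_left _ (Nat.sub_le _ _)).trans (Nat.div_mul_le_self _ _)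
      exact_mod_cast this
  · have hN : Tendsto (fun i => ((τ i / L i : ℕ) : ℝ)) l atTop := by
      have h1 : Tendsto (fun i => ((L i : ℝ) / τ i)⁻¹) l atTop := by
        refine Filter.Tendsto.inv_tendsto_nhdsGT_zero (tendsto_nhdsWithin_iff.2 ⟨hL, ?_⟩)
        filter_upwards [hev] with i ⟨_, hτ, hL0⟩
        exact div_pos hL0 hτ
      refine tendsto_atTop_mono' l ?_ (tendsto_atTop_add_const_right l (-1) h1)
      filter_upwards [hev] with i ⟨_, hτ, hL0⟩
      have := Nat.lt_floor_add_one ((τ i : ℝ) / L i)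
      rw [Nat.floor_div_eq_div] at this
      rw [inv_div]
      linarith
    exact hN.inv_tendsto_atTop

theorem MDep.dependsOn_reForm (hG : MDep π m G) (C : d → S2 H) (α : d → ℤ → ℤ → ℂ) (ℓ : ℕ) :
    DependsOn (reForm C α (Finset.Icc (1 : ℤ) ℓ) G) (Set.Ioc (-m : ℤ) ℓ) := by
  intro x y hxy
  have hp : ∀ s ∈ Finset.Icc (1 : ℤ) ℓ, proc G s x = proc G s y := fun s hs =>
    hG.proc_dep (C := Set.Ioc (-m : ℤ) ℓ) (fun i hi => by
      simp only [Set.mem_Icc, Set.mem_Ioc, Finset.mem_Icc] at hi hs ⊢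
      omega) hxy
  simp only [reForm, quadForm]
  congr 2
  funext j
  congr 1
  refine Finset.sum_congr rfl fun s hs => Finset.sum_congr rfl fun t ht => ?_
  rw [hp s hs, hp t ht]

theorem enorm_winCoef_sq (w : ℝ → ℝ) (b lam : ℝ) (s t : ℤ) :
    ‖winCoef w b lam s t‖ₑ ^ 2 = ENNReal.ofReal (w (b * (t - s)) ^ 2) := by
  have : Complex.I * lam * ((t : ℂ) - s) = ((lam * (t - s) : ℝ) : ℂ) * Complex.I := by
    push_cast; ring
  rw [winCoef, enorm_mul, this, ← ofReal_norm (Complex.exp _), Complex.norm_exp_ofReal_mul_I,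
    ENNReal.ofReal_one, mul_one, enorm_complex_ofReal, Real.enorm_sq_eq_ofReal]

theorem sum_ofReal_windowFrob (w : ℝ → ℝ) (b : ℝ) (τ : ℕ) :
    ∑ s ∈ Finset.Icc (1 : ℤ) τ, ∑ t ∈ Finset.Icc (1 : ℤ) τ, ENNReal.ofReal (w (b * (t - s)) ^ 2)
      = ENNReal.ofReal (windowFrob w b τ) := by
  rw [windowFrob, ENNReal.ofReal_sum_of_nonneg fun s _ => Finset.sum_nonneg fun t _ => sq_nonneg _]
  refine Finset.sum_congr rfl fun s _ => ?_
  rw [ENNReal.ofReal_sum_of_nonneg fun t _ => sq_nonneg _]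

theorem windowFrob_nonneg (w : ℝ → ℝ) (b : ℝ) (τ : ℕ) : 0 ≤ windowFrob w b τ :=
  Finset.sum_nonneg fun _ _ => Finset.sum_nonneg fun _ _ => sq_nonneg _

theorem eLpNorm_const_mul_sq {α : Type*} [MeasurableSpace α] {μ : Measure α} (f : α → ℝ) {c : ℝ}
    (hc : 0 ≤ c) (p : ℝ≥0∞) :
    eLpNorm (fun x => √c * f x) p μ ^ 2 = ENNReal.ofReal c * eLpNorm f p μ ^ 2 := by
  rw [show (fun x => √c * f x) = √c • f from rfl, eLpNorm_const_smul, mul_pow,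
    Real.enorm_sq_eq_ofReal, Real.sq_sqrt hc]

/-- The central limit theorem for lag-window forms of bounded `m`-dependent processes. -/
theorem MDep.tendsto_charFun (hG : MDep π m G) (hw : LagWindow w) (hb : Tendsto b l (𝓝[>] 0))
    (hbτ : Tendsto (fun i => b i * τ i) l atTop) (C : d → S2 H) (lam : d → ℝ) :
    Tendsto (fun i => ∫ ω, Complex.exp (Complex.I * (√(b i / τ i) *
      (winReForm G C w lam (b i) (τ i) ω
        - ∫ ω', winReForm G C w lam (b i) (τ i) ω' ∂iidLaw π) : ℝ)) ∂iidLaw π) l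
      (𝓝 (Complex.exp (-(varLimit π m C G w lam / 2 : ℝ)))) := by
  obtain ⟨L, hbL, hL⟩ := exists_blockLength hb hbτ
  obtain ⟨hbℓ, hNℓ, hNi⟩ := tendsto_block_counts hb hbτ hbL hL m
  obtain ⟨K, hK, hKb⟩ := hG.exists_reForm_bound C
  -- Blocks recur with period `L` and have length `L - m`; the gaps of length `m` make their forms
  -- independent.
  set ℓ : ι → ℕ := fun i => L i - m with hℓ
  set N : ι → ℕ := fun i => τ i / L i with hN
  set U := fun i n ω => winReForm G C w lam (b i) n ω - ∫ ω', winReForm G C w lam (b i) n ω' ∂iidLaw π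
    with hU
  have hUb : ∀ i n, BddMeas (U i n) := fun i n => by
    obtain ⟨h1, M, hM⟩ := hG.bddMeas_reForm C (fun j => winCoef w (b i) (lam j))
      (Finset.Icc (1 : ℤ) n)
    exact ⟨h1.sub stronglyMeasurable_const, _, fun ω => (norm_sub_le _ _).trans
      (add_le_add_left (hM ω) _)⟩
  have hU0 : ∀ i n, ∫ ω, U i n ω ∂iidLaw π = 0 := fun i n => by
    have hi : Integrable (fun ω => winReForm G C w lam (b i) n ω) (iidLaw π) :=
      (hG.bddMeas_reForm C _ _).integrable _
    simp only [hU]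
    rw [integral_sub hi (integrable_const _)]
    simp
  set v := fun i ω => √(b i / τ i) * U i (ℓ i) ω with hv
  have hvb : ∀ i, BddMeas (v i) := fun i => by
    obtain ⟨h1, M, hM⟩ := hUb i (ℓ i)
    refine ⟨h1.const_mul _, |√(b i / τ i)| * M, fun ω => ?_⟩
    rw [hv, norm_mul]
    exact mul_le_mul_of_nonneg_left (hM ω) (abs_nonneg _)
  have hGℓ := hw.tendsto_sum_sq hb hbℓ
  have hGτ := hw.tendsto_sum_sq hb hbτ
  have hev : ∀ᶠ i in l, 0 < b i ∧ (0 : ℝ) < τ i ∧ (0 : ℝ) < ℓ i ∧ m < L i := by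
    filter_upwards [hb.eventually self_mem_nhdsWithin, hbτ.eventually_gt_atTop 0,
      hbℓ.eventually_gt_atTop 0] with i hi h1 h2
    have hi' : 0 < b i := hi
    have h3 : (0 : ℝ) < ℓ i := pos_of_mul_pos_right h2 hi'.le
    refine ⟨hi', pos_of_mul_pos_right h1 hi'.le, h3, ?_⟩
    have : 0 < ℓ i := by exact_mod_cast h3
    exact Nat.lt_of_sub_pos this
  -- The blocks carry asymptotically all of the window energy: the limit of the normalized Frobenius
  -- norm is the same for length `ℓ` as for length `τ`, and `N ℓ / τ → 1`.
  have hNG : Tendsto (fun i => N i * (b i / τ i * windowFrob w (b i) (ℓ i))) l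
      (𝓝 (windowEnergy w)) := by
    have := hNℓ.mul hGℓ
    rw [one_mul] at this
    refine this.congr' ?_
    filter_upwards [hev] with i ⟨_, _, h3, _⟩
    have h3' : ((L i - m : ℕ) : ℝ) ≠ 0 := h3.ne'
    simp only [windowFrob, hN, hℓ]
    field_simp
  have main : Tendsto (fun i => (∫ ω, Complex.exp (Complex.I * v i ω) ∂iidLaw π) ^ N i) l
      (𝓝 (Complex.exp (-(varLimit π m C G w lam / 2 : ℝ)))) := by
    refine tendsto_pow_exp_of_moments (a := fun i => ∫ ω, v i ω ^ 2 ∂iidLaw π)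
      (c := fun i => ∫ ω, v i ω ^ 4 ∂iidLaw π) (fun i => ?_)
      (fun i => integral_nonneg fun ω => sq_nonneg _)
      (fun i => sq_integral_sq_le ((hvb i).memLp _ _)) (fun i => ?_) ?_ ?_
    · refine (norm_integral_le_of_norm_le_const (C := 1) (Eventually.of_forall fun ω => ?_)).trans ?_
      · rw [mul_comm, Complex.norm_exp_ofReal_mul_I]
      · simp
    · refine norm_charFun_sub_le ((hvb i).memLp _ _) ?_
      simp only [hv]
      rw [integral_const_mul, hU0, mul_zero]
    · have := hNℓ.mul (hG.tendsto_var hw hb hbℓ C lam)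
      rw [one_mul] at this
      refine this.congr' ?_
      filter_upwards [hev] with i ⟨hb0, hτ0, h3, _⟩
      have h3' : ((L i - m : ℕ) : ℝ) ≠ 0 := h3.ne'
      simp only [hv, mul_pow]
      rw [integral_const_mul, Real.sq_sqrt (by positivity)]
      simp only [hU, hN, hℓ]
      field_simp
    -- Lyapunov's condition: each fourth moment is at most `(K (b/τ) F(ℓ))²` with `F = windowFrob w
    -- b`, and `N (b/τ) F(ℓ)` stays bounded, so the sum of the `N` moments is `O(1/N)`.
    · have hlim : Tendsto (fun i => (N i : ℝ)⁻¹ *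
          (N i * (b i / τ i * windowFrob w (b i) (ℓ i))) ^ 2 * K.toReal ^ 2) l (𝓝 0) := by
        have := (hNi.mul (hNG.pow 2)).mul_const (K.toReal ^ 2)
        simpa using this
      refine tendsto_of_tendsto_of_tendsto_of_le_of_le' tendsto_const_nhds hlim
        (Eventually.of_forall fun i => mul_nonneg (by positivity)
          (integral_nonneg fun ω => by positivity)) ?_
      filter_upwards [hev] with i ⟨hb0, hτ0, h3, _⟩
      have h4 := hKb 4 (Or.inr rfl) (fun j => winCoef w (b i) (lam j)) (Finset.Icc (1 : ℤ) (ℓ i))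
        (fun s t => ENNReal.ofReal (w (b i * (t - s)) ^ 2))
        fun j s t => (enorm_winCoef_sq _ _ _ _ _).le
      rw [sum_ofReal_windowFrob] at h4
      have h5 : eLpNorm (v i) 4 (iidLaw π) ^ 2
          ≤ ENNReal.ofReal (b i / τ i * (K.toReal * windowFrob w (b i) (ℓ i))) := by
        simp only [hv]
        rw [eLpNorm_const_mul_sq _ (by positivity), ENNReal.ofReal_mul (by positivity),
          ENNReal.ofReal_mul ENNReal.toReal_nonneg, ENNReal.ofReal_toReal hK]
        exact mul_le_mul_right h4 _
      have h6 : ∫ ω, v i ω ^ 4 ∂iidLaw π ≤ (b i / τ i * (K.toReal * windowFrob w (b i) (ℓ i))) ^ 2 := by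
        have e := eLpNorm_four_pow_eq ((hvb i).memLp (iidLaw π) 4)
        have h7 : eLpNorm (v i) 4 (iidLaw π) ^ 4
            ≤ ENNReal.ofReal ((b i / τ i * (K.toReal * windowFrob w (b i) (ℓ i))) ^ 2) := by
          rw [show (4 : ℕ) = 2 * 2 by norm_num, pow_mul, ENNReal.ofReal_pow]
          · gcongr
          · have := windowFrob_nonneg w (b i) (ℓ i)
            positivity
        rw [e, ENNReal.ofReal_le_ofReal_iff (by positivity)] at h7
        refine le_trans (le_of_eq ?_) h7
        congr 1
        funext ω
        rw [Real.norm_eq_abs, Even.pow_abs (by decide)]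
      have hNN : (N i : ℝ) * (b i / τ i * (K.toReal * windowFrob w (b i) (ℓ i))) ^ 2
          = (N i : ℝ)⁻¹ * (N i * (b i / τ i * windowFrob w (b i) (ℓ i))) ^ 2 * K.toReal ^ 2 := by
        rcases eq_or_ne (N i : ℝ) 0 with h0 | h0
        · simp [h0]
        · field_simp
      rw [← hNN]
      gcongr
  -- The second moment of the remainder is at most `K` times the difference of `(b/τ) F(τ)` and `N
  -- (b/τ) F(ℓ)`, two quantities with the same limit.
  have hdiff : Tendsto (fun i => ∫ ω, Complex.exp (Complex.I * (√(b i / τ i) * U i (τ i) ω : ℝ)) ∂iidLaw π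
      - (∫ ω, Complex.exp (Complex.I * v i ω) ∂iidLaw π) ^ N i) l (𝓝 0) := by
    rw [tendsto_zero_iff_enorm_tendsto_zero]
    refine ENNReal.tendsto_zero_of_sq ?_
    have hlim : Tendsto (fun i => K * ENNReal.ofReal (b i / τ i * windowFrob w (b i) (τ i)
        - N i * (b i / τ i * windowFrob w (b i) (ℓ i)))) l (𝓝 0) := by
      have h1 := ENNReal.Tendsto.const_mul (a := K) (ENNReal.tendsto_ofReal (hGτ.sub hNG))
        (Or.inr hK)
      rwa [sub_self, ENNReal.ofReal_zero, mul_zero] at h1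
    refine tendsto_of_tendsto_of_tendsto_of_le_of_le' tendsto_const_nhds hlim
      (Eventually.of_forall fun _ => zero_le) ?_
    filter_upwards [hev] with i ⟨hb0, hτ0, h3, hmL⟩
    have hℓL : ℓ i ≤ L i := Nat.sub_le _ _
    have hNL : N i * L i ≤ τ i := Nat.div_mul_le_self _ _
    -- The form on `[1, ℓ]` reaches back to the coordinate `1 - m`, so it uses exactly `L`
    -- consecutive coordinates, as `integral_prod_comp_shift` requires.
    have hdep : DependsOn (fun ω => Complex.exp (Complex.I * v i ω))
        (Set.Ioc (-m : ℤ) (-m + L i)) := by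
      have h1 := hG.dependsOn_reForm C (fun j => winCoef w (b i) (lam j)) (ℓ i)
      have h2 : ((ℓ i : ℕ) : ℤ) = -m + L i := by simp only [hℓ]; omega
      rw [h2] at h1
      intro x y hxy
      have h4 : winReForm G C w lam (b i) (ℓ i) x = winReForm G C w lam (b i) (ℓ i) y := by
        simp only [winReForm, h2]
        exact h1 hxy
      simp only [hv, hU, h4]
    have hbd : BddMeas fun ω => Complex.exp (Complex.I * v i ω) := by
      refine ⟨(by fun_prop : Continuous fun y : ℝ =>
        Complex.exp (Complex.I * y)).comp_stronglyMeasurable (hvb i).meas, 1, fun ω => ?_⟩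
      rw [mul_comm, Complex.norm_exp_ofReal_mul_I]
    rw [← integral_prod_comp_shift hbd hdep]
    have e1 : ∀ ω, ∏ k ∈ Finset.range (N i), Complex.exp (Complex.I * v i (shift (k * L i : ℕ) ω))
        = Complex.exp (Complex.I * (∑ k ∈ Finset.range (N i), v i (shift (k * L i : ℕ) ω) : ℝ)) := by
      intro ω
      rw [← Complex.exp_sum, ← Finset.mul_sum, Complex.ofReal_sum]
    simp only [e1]
    have hm1 : StronglyMeasurable fun ω => √(b i / τ i) * U i (τ i) ω := (hUb i _).meas.const_mul _
    have hm2 : StronglyMeasurable fun ω => ∑ k ∈ Finset.range (N i), v i (shift (k * L i : ℕ) ω) :=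
      Finset.stronglyMeasurable_fun_sum _ fun k _ =>
        (hvb i).meas.comp_measurable (measurable_shift _)
    have h5 := enorm_integral_exp_sub_le (μ := iidLaw π) hm1.aestronglyMeasurable
      hm2.aestronglyMeasurable
    set β : d → ℤ → ℤ → ℂ := fun j s t => winCoef w (b i) (lam j) s t
      * ((1 - sameBlock (L i) (ℓ i) (N i) s t : ℝ) : ℂ) with hβ
    have hdec := fun ω => winReForm_sub_sum_blocks (G := G) C w lam (b i) hℓL hNL ω
    have hDint : ∫ ω, reForm C β (Finset.Icc (1 : ℤ) (τ i)) G ω ∂iidLaw π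
        = ∫ ω, winReForm G C w lam (b i) (τ i) ω ∂iidLaw π
          - N i * ∫ ω, winReForm G C w lam (b i) (ℓ i) ω ∂iidLaw π := by
      simp only [hβ, ← hdec]
      have i1 : Integrable (fun ω => winReForm G C w lam (b i) (τ i) ω) (iidLaw π) :=
        (hG.bddMeas_reForm C _ _).integrable _
      have i2 : ∀ k ∈ Finset.range (N i), Integrable (fun ω =>
          winReForm G C w lam (b i) (ℓ i) (shift (k * L i : ℕ) ω)) (iidLaw π) := fun k _ =>
        ((hG.bddMeas_reForm C _ _).comp (measurable_shift _)).integrable _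
      rw [integral_sub i1 (integrable_finsetSum _ i2), integral_finsetSum _ i2]
      simp only [integral_comp_shift (winReForm G C w lam (b i) (ℓ i)), Finset.sum_const,
        Finset.card_range, nsmul_eq_mul]
    have e2 : (fun ω => √(b i / τ i) * U i (τ i) ω
        - ∑ k ∈ Finset.range (N i), v i (shift (k * L i : ℕ) ω))
        = fun ω => √(b i / τ i) * (reForm C β (Finset.Icc (1 : ℤ) (τ i)) G ω
          - ∫ ω', reForm C β (Finset.Icc (1 : ℤ) (τ i)) G ω' ∂iidLaw π) := by
      funext ω
      rw [hDint]
      simp only [hβ, ← hdec, hv, hU, ← Finset.mul_sum, Finset.sum_sub_distrib, Finset.sum_const,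
        Finset.card_range, nsmul_eq_mul]
      ring
    rw [e2] at h5
    calc _ ≤ _ := pow_le_pow_left' h5 2
      _ = ENNReal.ofReal (b i / τ i) * _ := eLpNorm_const_mul_sq _ (by positivity) _
      _ ≤ ENNReal.ofReal (b i / τ i) * (K * ∑ s ∈ Finset.Icc (1 : ℤ) (τ i),
          ∑ t ∈ Finset.Icc (1 : ℤ) (τ i), ENNReal.ofReal (w (b i * (t - s)) ^ 2
            * (1 - sameBlock (L i) (ℓ i) (N i) s t))) := by
          refine mul_le_mul_right (hKb 2 (Or.inl rfl) β _ _ fun j s t => le_of_eq ?_) _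
          simp only [hβ]
          rw [enorm_mul, mul_pow, enorm_winCoef_sq, enorm_complex_ofReal, Real.enorm_sq_eq_ofReal,
            ← ENNReal.ofReal_mul (sq_nonneg _)]
          rcases sameBlock_eq hℓL (N i) s t with h | h <;> simp [h]
      _ = _ := by
          have h0 : ∀ s t : ℤ, 0 ≤ w (b i * (t - s)) ^ 2 * (1 - sameBlock (L i) (ℓ i) (N i) s t) := by
            intro s t
            refine mul_nonneg (sq_nonneg _) ?_
            rcases sameBlock_eq hℓL (N i) s t with h | h <;> simp [h]
          rw [mul_left_comm]
          congr 1
          have h6 : ∀ s : ℤ, ∑ t ∈ Finset.Icc (1 : ℤ) (τ i), ENNReal.ofReal (w (b i * (t - s)) ^ 2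
              * (1 - sameBlock (L i) (ℓ i) (N i) s t)) = ENNReal.ofReal
              (∑ t ∈ Finset.Icc (1 : ℤ) (τ i), w (b i * (t - s)) ^ 2
              * (1 - sameBlock (L i) (ℓ i) (N i) s t)) := fun s =>
            (ENNReal.ofReal_sum_of_nonneg fun t _ => h0 s t).symm
          simp only [h6]
          rw [← ENNReal.ofReal_sum_of_nonneg fun s _ => Finset.sum_nonneg fun t _ => h0 s t,
            sum_mul_one_sub_sameBlock hℓL hNL, ← ENNReal.ofReal_mul (by positivity)]
          congr 1
          ring
  have := hdiff.add main
  simp only [sub_add_cancel, zero_add] at this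
  exact this

end BlockCLT

/-! ### Approximation by bounded finite-rank `m`-dependent processes -/

section Approximation

set_option linter.unusedSectionVars false

variable {S : Type*} [MeasurableSpace S] {π : Measure S} [IsProbabilityMeasure π]
variable {H : Type*} [NormedAddCommGroup H] [InnerProductSpace ℂ H] [CompleteSpace H]

variable (π) in
/-- The dependence coefficient of the process generated by `G`. -/
def coeff (G : (ℤ → S) → H) (j : ℤ) : ℝ≥0∞ :=
  eLpNorm (proc G j - condE π {0}ᶜ (proc G j)) 4 (iidLaw π)

variable (π) in
/-- The sum of the dependence coefficients. -/
def coeffSum (G : (ℤ → S) → H) : ℝ≥0∞ := ∑' j, coeff π G j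

variable {G G' : (ℤ → S) → H}

theorem memLp_proc {p : ℝ≥0∞} (hG : MemLp G p (iidLaw π)) (t : ℤ) :
    MemLp (proc G t) p (iidLaw π) := hG.comp_measurePreserving (measurePreserving_shift π t)

theorem integral_proc (G : (ℤ → S) → H) (t : ℤ) :
    ∫ ω, proc G t ω ∂iidLaw π = ∫ ω, G ω ∂iidLaw π := integral_comp_shift G t

theorem eLpNorm_proc {p : ℝ≥0∞} (hG : AEStronglyMeasurable G (iidLaw π)) (t : ℤ) :
    eLpNorm (proc G t) p (iidLaw π) = eLpNorm G p (iidLaw π) := eLpNorm_comp_shift hG p t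

theorem coeffBound_proc (hGm : StronglyMeasurable G) (hG : MemLp G 4 (iidLaw π)) :
    CoeffBound π (proc G) 4 (coeff π G) where
  meas t := hGm.comp_measurable (measurable_shift t)
  memLp t := memLp_proc hG t
  coeff t k := by
    have h1 : proc G t = proc G (t - k) ∘ shift k := by
      funext ω; simp [proc, shift_shift]
    have h2 : {i : ℤ | i + k ∈ ({k}ᶜ : Set ℤ)} = {0}ᶜ := by
      ext i; simp
    have h3 : condE π {k}ᶜ (proc G t) = condE π {0}ᶜ (proc G (t - k)) ∘ shift k := by
      rw [h1, condE_comp_shift, h2]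
    have h4 := memLp_proc hG (t - k)
    rw [h3, h1]
    change eLpNorm ((proc G (t - k) - condE π {0}ᶜ (proc G (t - k))) ∘ shift k) 4 (iidLaw π) ≤ _
    exact (eLpNorm_comp_shift (h4.1.sub
      (integrable_condE {0}ᶜ (h4.integrable (by norm_num))).1) 4 k).le

theorem coeff_add_le (hG : MemLp G 4 (iidLaw π)) (hG' : MemLp G' 4 (iidLaw π)) (j : ℤ) :
    coeff π (G + G') j ≤ coeff π G j + coeff π G' j := by
  have h1 := memLp_proc hG j
  have h2 := memLp_proc hG' j
  have i1 := h1.integrable (by norm_num)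
  have i2 := h2.integrable (by norm_num)
  have e : proc (G + G') j - condE π {0}ᶜ (proc (G + G') j) =ᵐ[iidLaw π]
      (proc G j - condE π {0}ᶜ (proc G j)) + (proc G' j - condE π {0}ᶜ (proc G' j)) := by
    filter_upwards [condE_add {0}ᶜ i1 i2] with ω hω
    have : proc (G + G') j = proc G j + proc G' j := rfl
    rw [this]
    simp only [Pi.sub_apply, Pi.add_apply, hω]
    abel
  rw [coeff, eLpNorm_congr_ae e]
  exact eLpNorm_add_le (h1.1.sub (integrable_condE _ i1).1) (h2.1.sub (integrable_condE _ i2).1)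
    (by norm_num)

theorem coeff_neg (G : (ℤ → S) → H) (j : ℤ) : coeff π (-G) j = coeff π G j := by
  have h1 : proc (-G) j = -proc G j := rfl
  have h2 : condE π {0}ᶜ (-proc G j) = -condE π {0}ᶜ (proc G j) := by
    funext ω; exact integral_neg _
  rw [coeff, coeff, h1, h2, ← eLpNorm_neg]
  congr 1
  abel

theorem coeffSum_add_le (hG : MemLp G 4 (iidLaw π)) (hG' : MemLp G' 4 (iidLaw π)) :
    coeffSum π (G + G') ≤ coeffSum π G + coeffSum π G' := by
  rw [coeffSum, coeffSum, coeffSum, ← ENNReal.tsum_add]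
  exact ENNReal.tsum_le_tsum fun j => coeff_add_le hG hG' j

theorem coeffSum_neg (G : (ℤ → S) → H) : coeffSum π (-G) = coeffSum π G :=
  tsum_congr fun j => coeff_neg G j

theorem coeff_le_two_mul (hG : MemLp G 4 (iidLaw π)) (j : ℤ) :
    coeff π G j ≤ 2 * eLpNorm G 4 (iidLaw π) := by
  have h1 := memLp_proc hG j
  refine (eLpNorm_sub_le h1.1 (integrable_condE _ (h1.integrable (by norm_num))).1
    (by norm_num)).trans ?_
  rw [two_mul]
  refine add_le_add (eLpNorm_proc hG.1 j).le ?_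
  exact (eLpNorm_condE_le _ h1.1 (by norm_num)).trans (eLpNorm_proc hG.1 j).le

/-- Averages over different sets of coordinates commute, so the effect of an innovation on an
averaged variable is an average of its effect on the variable. -/
theorem coeff_condE_le (hG : MemLp G 4 (iidLaw π)) (A : Set ℤ) (j : ℤ) :
    coeff π (condE π A G) j ≤ coeff π G j := by
  set B : Set ℤ := {i | i + -j ∈ A} with hB
  have h1 := memLp_proc hG j
  have i1 := h1.integrable (q := 4) (by norm_num)
  have hp : proc (condE π A G) j = condE π B (proc G j) := by
    have h3 : proc G j = G ∘ shift j := rfl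
    have h4 : {i : ℤ | i + j ∈ B} = A := by ext i; simp [hB]
    rw [h3, condE_comp_shift, h4]
    rfl
  have e : proc (condE π A G) j - condE π {0}ᶜ (proc (condE π A G) j)
      =ᵐ[iidLaw π] condE π B (proc G j - condE π {0}ᶜ (proc G j)) := by
    rw [hp]
    filter_upwards [condE_condE {0}ᶜ B i1, condE_condE B {0}ᶜ i1,
      condE_sub B i1 (integrable_condE {0}ᶜ i1)] with ω a1 a2 a3
    rw [a3]
    simp only [Pi.sub_apply]
    rw [a1, a2, Set.inter_comm]
  rw [coeff, eLpNorm_congr_ae e]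
  exact eLpNorm_condE_le _ (h1.1.sub (integrable_condE _ i1).1) (by norm_num)

theorem coeff_eq_zero_of_dependsOn {m : ℕ} (hd : DependsOn G (Set.Icc (-m : ℤ) 0)) {j : ℤ}
    (hj : j ∉ Finset.Icc (0 : ℤ) m) : coeff π G j = 0 := by
  have : DependsOn (proc G j) ({0}ᶜ : Set ℤ) := hd.proc fun i hi => by
    simp only [Set.mem_Icc, Finset.mem_Icc, Set.mem_compl_iff, Set.mem_singleton_iff] at hi hj ⊢
    omega
  rw [coeff, condE_of_dependsOn this subset_rfl, sub_self, eLpNorm_zero]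

/-- Only the lags `0, …, m` contribute. On functions of a fixed window the `L⁴` norm therefore
controls `coeffSum`, which permits a change of values once the window is fixed. -/
theorem coeffSum_le_of_dependsOn {m : ℕ} (hG : MemLp G 4 (iidLaw π))
    (hd : DependsOn G (Set.Icc (-m : ℤ) 0)) :
    coeffSum π G ≤ (m + 1 : ℕ) * (2 * eLpNorm G 4 (iidLaw π)) := by
  rw [coeffSum, tsum_eq_sum fun j hj => coeff_eq_zero_of_dependsOn hd hj]
  refine (Finset.sum_le_sum fun j _ => coeff_le_two_mul hG j).trans ?_
  simp

theorem ENNReal.tendsto_tsum_of_dominated {α : Type*} [Countable α] {f : ℕ → α → ℝ≥0∞}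
    {g : α → ℝ≥0∞} (hg : ∑' i, g i ≠ ∞) (hb : ∀ n i, f n i ≤ g i)
    (h : ∀ i, Tendsto (fun n => f n i) atTop (𝓝 0)) :
    Tendsto (fun n => ∑' i, f n i) atTop (𝓝 0) := by
  let _ : MeasurableSpace α := ⊤
  have := tendsto_lintegral_of_dominated_convergence (μ := (Measure.count : Measure α)) (F := f)
    (f := fun _ => 0) g (fun n => measurable_from_top)
    (fun n => Eventually.of_forall (hb n)) (by rwa [lintegral_count])
    (Eventually.of_forall fun i => h i)
  simpa [lintegral_count] using this

/-- Each coefficient of the difference tends to zero with its `L⁴` norm, and it is at most twice the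
coefficient of `G`, so dominated convergence for sums applies. By causality, averaging onto `[-n,
0]` agrees with averaging onto `[-n, n]`. -/
theorem tendsto_coeffSum_sub_condE (hGm : StronglyMeasurable G) (hG : MemLp G 4 (iidLaw π))
    (hd : DependsOn G (Set.Iic 0)) (hs : coeffSum π G ≠ ∞) :
    Tendsto (fun n : ℕ => coeffSum π (G - condE π (Set.Icc (-n : ℤ) 0) G)) atTop (𝓝 0) := by
  have hcl : ∀ n : ℕ, MemLp (condE π (Set.Icc (-n : ℤ) 0) G) 4 (iidLaw π) := fun n =>
    memLp_condE _ hGm (by norm_num) hG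
  have hconv : Tendsto (fun n : ℕ => eLpNorm (G - condE π (Set.Icc (-n : ℤ) 0) G) 4 (iidLaw π))
      atTop (𝓝 0) := by
    have h1 := tendsto_eLpNorm_condE_sub (I := fun n : ℕ => Set.Icc (-n : ℤ) n)
      (p := 4) (by norm_num) (by simp) hG fun F => by
        obtain ⟨N, hN⟩ : ∃ N : ℕ, ∀ i ∈ F, i.natAbs ≤ N :=
          ⟨F.sup Int.natAbs, fun i hi => Finset.le_sup (f := Int.natAbs) hi⟩
        filter_upwards [eventually_ge_atTop N] with n hn i hi
        have := hN i hi
        simp only [Set.mem_Icc]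
        omega
    refine h1.congr fun n => ?_
    have e : condE π (Set.Icc (-n : ℤ) 0) G =ᵐ[iidLaw π] condE π (Set.Icc (-n : ℤ) n) G := by
      have h2 := condE_condE (Set.Icc (-n : ℤ) n) (Set.Iic 0) (hG.integrable (by norm_num))
      rw [condE_of_dependsOn hd subset_rfl] at h2
      have h3 : Set.Icc (-n : ℤ) n ∩ Set.Iic 0 = Set.Icc (-n : ℤ) 0 := by
        ext i; simp only [Set.mem_inter_iff, Set.mem_Icc, Set.mem_Iic]; omega
      rw [h3] at h2
      exact h2.symm
    rw [eLpNorm_sub_comm]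
    exact eLpNorm_congr_ae (e.mono fun ω hω => by simp only [Pi.sub_apply, hω])
  refine ENNReal.tendsto_tsum_of_dominated (g := fun j => 2 * coeff π G j) ?_ (fun n j => ?_)
    fun j => ?_
  · rw [ENNReal.tsum_mul_left]
    exact ENNReal.mul_ne_top (by simp) hs
  · rw [sub_eq_add_neg, two_mul]
    refine (coeff_add_le hG (hcl n).neg j).trans (add_le_add_right ?_ _)
    rw [coeff_neg]
    exact coeff_condE_le hG _ j
  · have h2 := ENNReal.Tendsto.const_mul (a := 2) hconv (Or.inr (by simp))
    rw [mul_zero] at h2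
    exact tendsto_of_tendsto_of_tendsto_of_le_of_le tendsto_const_nhds h2
      (fun _ => zero_le) fun n => coeff_le_two_mul (hG.sub (hcl n)) j

/-- Approximation by bounded finite-rank `m`-dependent processes, preserving the range of a
contractive projection `R`. -/
theorem exists_mdep_approx (hGm : StronglyMeasurable G) (hG : MemLp G 4 (iidLaw π))
    (h0 : ∫ ω, G ω ∂iidLaw π = 0) (hd : DependsOn G (Set.Iic 0)) (hs : coeffSum π G ≠ ∞)
    (R : H →L[ℝ] H) (hR : ∀ x, ‖R x‖ ≤ ‖x‖) (hRR : ∀ x, R (R x) = R x) (hRG : ∀ ω, R (G ω) = G ω)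
    {η : ℝ≥0∞} (hη : η ≠ 0) :
    ∃ (m : ℕ) (G' : (ℤ → S) → H), MDep π m G' ∧
      (∃ V : Submodule ℂ H, FiniteDimensional ℂ V ∧ ∀ ω, G' ω ∈ V) ∧
      (∀ ω, R (G' ω) = G' ω) ∧ coeffSum π (G - G') ≤ η := by
  have hη2 : η / 2 ≠ 0 := (ENNReal.half_pos hη).ne'
  obtain ⟨m, hm⟩ := ((ENNReal.tendsto_nhds_zero.1 (tendsto_coeffSum_sub_condE hGm hG hd hs))
    (η / 2) (ENNReal.half_pos hη)).exists
  -- With the window fixed, an `L⁴` error `δ` costs `(m + 1) · 2 · 2δ` in `coeffSum`: one factor `2`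
  -- from `coeff_le_two_mul`, the other from recentering.
  set δ : ℝ≥0∞ := η / 2 / ((m + 1 : ℕ) * 4) with hδ
  have hδ0 : δ ≠ 0 := by
    refine (ENNReal.div_pos hη2 (ENNReal.mul_ne_top (by simp) (by simp))).ne'
  obtain ⟨φ, hφ, hφL⟩ := hG.exists_simpleFunc_eLpNorm_sub_lt (by simp) hδ0
  -- Applying `R` to a simple function keeps it simple and, since `R` is contractive and fixes the
  -- values of `G`, brings it no farther from `G`.
  obtain ⟨ψ, hψ⟩ : ∃ ψ : (ℤ → S) → H, ψ = φ.map R := ⟨_, rfl⟩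
  have hψb : BddMeas ψ := by
    obtain ⟨M, hM⟩ := (φ.map R).exists_forall_norm_le
    exact ⟨hψ ▸ (φ.map R).stronglyMeasurable, M, fun ω => hψ ▸ hM ω⟩
  have hψL : MemLp ψ 4 (iidLaw π) := hψb.memLp _ _
  have hGψ : eLpNorm (G - ψ) 4 (iidLaw π) ≤ δ := by
    refine le_trans (eLpNorm_mono fun ω => ?_) hφ.le
    have : (G - ψ) ω = R ((G - ⇑φ) ω) := by
      simp [hψ, hRG]
    rw [this]
    exact hR _
  set A : Set ℤ := Set.Icc (-m : ℤ) 0 with hA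
  set c := ∫ ω, ψ ω ∂iidLaw π with hc
  have hcb : BddMeas (condE π A ψ) := by
    obtain ⟨M, hM⟩ := hψb.bdd
    refine ⟨stronglyMeasurable_condE A hψb.meas, M, fun ω => ?_⟩
    have := norm_integral_le_of_norm_le_const (μ := iidLaw π)
      (f := fun ω' => ψ (mer A ω ω')) (Eventually.of_forall fun ω' => hM _)
    rwa [probReal_univ, mul_one] at this
  have hψi : ∀ ω, Integrable (fun ω' => ψ (mer A ω ω')) (iidLaw π) := fun ω =>
    (hψb.comp (measurable_mer_right A ω)).integrable _
  refine ⟨m, fun ω => condE π A ψ ω - c, ⟨⟨hcb.meas.sub stronglyMeasurable_const, ?_⟩, ?_, ?_⟩,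
    ⟨Submodule.span ℂ ((φ.map R).range : Set H), ?_, fun ω => ?_⟩, fun ω => ?_, ?_⟩
  · obtain ⟨M, hM⟩ := hcb.bdd
    exact ⟨M + ‖c‖, fun ω => (norm_sub_le _ _).trans (add_le_add_left (hM ω) _)⟩
  · rw [integral_sub (hcb.integrable _) (integrable_const _),
      integral_condE A (hψb.integrable _)]
    simp [hc]
  · intro x y hxy
    have := dependsOn_condE (π := π) (A := A) (f := ψ) hxy
    simp only [this]
  · exact FiniteDimensional.span_of_finite ℂ (Finset.finite_toSet _)
  -- A finite-dimensional subspace is closed and convex, so averages of functions with values in it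
  -- remain in it.
  · set V := Submodule.span ℂ ((φ.map R).range : Set H) with hV
    have : FiniteDimensional ℂ V := FiniteDimensional.span_of_finite ℂ (Finset.finite_toSet _)
    have hVc : IsClosed (V : Set H) := V.closed_of_finiteDimensional
    have hVx : Convex ℝ (V : Set H) := (V.restrictScalars ℝ).convex
    have hmem : ∀ ω, ψ ω ∈ V := fun ω => Submodule.subset_span (by simp [hψ])
    exact V.sub_mem (hVx.integral_mem hVc (Eventually.of_forall fun ω' => hmem _) (hψi ω))
      (hVx.integral_mem hVc (Eventually.of_forall fun ω' => hmem _) (hψb.integrable _))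
  · have hRψ : ∀ ω, R (ψ ω) = ψ ω := fun ω => by simp [hψ, hRR]
    rw [map_sub]
    congr 1
    · rw [condE, ← R.integral_comp_comm (hψi ω)]
      simp only [hRψ]
    · rw [hc, ← R.integral_comp_comm (hψb.integrable _)]
      simp only [hRψ]
  · have hcl : MemLp (condE π A G) 4 (iidLaw π) := memLp_condE _ hGm (by norm_num) hG
    have hcl' : MemLp (fun ω => condE π A ψ ω - c) 4 (iidLaw π) :=
      (hcb.memLp _ _).sub (memLp_const _)
    have e : G - (fun ω => condE π A ψ ω - c)
        = (G - condE π A G) + (condE π A G - fun ω => condE π A ψ ω - c) := by abel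
    rw [e]
    refine (coeffSum_add_le (hG.sub hcl) (hcl.sub hcl')).trans ?_
    rw [← ENNReal.add_halves η]
    refine add_le_add hm ?_
    refine (coeffSum_le_of_dependsOn (m := m) (hcl.sub hcl') ?_).trans ?_
    · intro x y hxy
      have h1 := dependsOn_condE (π := π) (A := A) (f := ψ) hxy
      have h2 := dependsOn_condE (π := π) (A := A) (f := G) hxy
      simp only [Pi.sub_apply, h1, h2]
    · have h3 : eLpNorm (condE π A G - fun ω => condE π A ψ ω - c) 4 (iidLaw π) ≤ 2 * δ := by
        have e2 : (condE π A G - fun ω => condE π A ψ ω - c) =ᵐ[iidLaw π]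
            condE π A (G - ψ) + fun _ => c := by
          filter_upwards [condE_sub A (hG.integrable (by norm_num)) (hψb.integrable _)] with ω hω
          simp only [Pi.sub_apply, Pi.add_apply] at hω ⊢
          rw [hω]
          abel
        rw [eLpNorm_congr_ae e2, two_mul]
        have hsub := hG.sub hψL
        refine (eLpNorm_add_le (integrable_condE _ (hsub.integrable (by norm_num))).1
          aestronglyMeasurable_const (by norm_num)).trans (add_le_add ?_ ?_)
        · exact (eLpNorm_condE_le _ hsub.1 (by norm_num)).trans hGψ
        · rw [eLpNorm_const c (by simp) (NeZero.ne _)]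
          simp only [measure_univ, ENNReal.one_rpow, mul_one]
          -- As `G` is centered, the mean of `ψ` is bounded by the distance between `ψ` and `G`.
          have h5 : c = -∫ ω, (G - ψ) ω ∂iidLaw π := by
            have : ∫ ω, (G - ψ) ω ∂iidLaw π = ∫ ω, G ω ∂iidLaw π - c :=
              integral_sub (hG.integrable (by norm_num)) (hψb.integrable _)
            rw [this, h0]; simp
          rw [h5, enorm_neg]
          refine (enorm_integral_le_lintegral_enorm _).trans ?_
          rw [← eLpNorm_one_eq_lintegral_enorm]
          exact (eLpNorm_le_eLpNorm_of_exponent_le (by norm_num) hsub.1).trans hGψ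
      calc (m + 1 : ℕ) * (2 * eLpNorm (condE π A G - fun ω => condE π A ψ ω - c) 4 (iidLaw π))
          ≤ (m + 1 : ℕ) * (2 * (2 * δ)) := by gcongr
        _ = ((m + 1 : ℕ) * 4) * δ := by ring
        _ = η / 2 := by
            rw [hδ]
            refine ENNReal.mul_div_cancel ?_ (ENNReal.mul_ne_top (by simp) (by simp))
            simp

end Approximation

/-! ### The limiting variance in terms of spectral operators -/

section SpectralVariance

set_option linter.unusedSectionVars false

variable {H : Type*} [NormedAddCommGroup H] [InnerProductSpace ℂ H] [CompleteSpace H]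

namespace S2

theorem inner_tens_right (C : S2 H) (f g : H) : inner ℂ C (tens f g) = inner ℂ (C.op g) f := by
  rw [inner_def, ← ContinuousLinearMap.adjoint_inner_right,
    ← (onb H).tsum_inner_mul_inner g (ContinuousLinearMap.adjoint C.op f)]
  refine tsum_congr fun i => ?_
  rw [op_tens, InnerProductSpace.rankOne_apply, inner_smul_right,
    ContinuousLinearMap.adjoint_inner_right]

theorem inner_tens_left (C : S2 H) (f g : H) : inner ℂ (tens f g) C = inner ℂ f (C.op g) := by
  rw [← inner_conj_symm, inner_tens_right, inner_conj_symm]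

theorem tsum_enorm_comp_le (A : S2 H) (B : H →L[ℂ] H) :
    ∑' i, ‖(A.op ∘L B) (onb H i)‖ₑ ^ 2 ≤ (‖A‖ₑ * ‖B‖ₑ) ^ 2 := by
  rw [tsum_enorm_sq_adjoint (onb H) (onb H), ContinuousLinearMap.adjoint_comp, mul_pow, enorm_sq,
    tsum_enorm_sq_adjoint (onb H) (onb H) A.op, ← ENNReal.tsum_mul_right]
  refine ENNReal.tsum_le_tsum fun i => ?_
  rw [← mul_pow, mul_comm]
  gcongr
  have := (ContinuousLinearMap.adjoint B).le_opENorm (ContinuousLinearMap.adjoint A.op (onb H i))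
  rwa [← ofReal_norm (ContinuousLinearMap.adjoint B), LinearIsometryEquiv.norm_map,
    ofReal_norm] at this

theorem comp_mem (A : S2 H) (B : H →L[ℂ] H) : A.op ∘L B ∈ hsSubmodule H := by
  rw [mem_hsSubmodule_iff (onb H)]
  exact ((tsum_enorm_comp_le A B).trans_lt
    (ENNReal.pow_lt_top (ENNReal.mul_lt_top enorm_lt_top enorm_lt_top))).ne

/-- The operator `F D F'†` for Hilbert–Schmidt operators `F`, `F'` and a bounded `D`. -/
def kron (D : H →L[ℂ] H) (F F' : S2 H) : S2 H :=
  ofMem (F.op ∘L (D ∘L ContinuousLinearMap.adjoint F'.op)) (comp_mem F _)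

theorem op_kron (D : H →L[ℂ] H) (F F' : S2 H) : (kron D F F').op = _root_.kron F.op F'.op D := rfl

theorem norm_kron_le (D : H →L[ℂ] H) (F F' : S2 H) : ‖kron D F F'‖ ≤ ‖D‖ * ‖F‖ * ‖F'‖ := by
  have h1 : ‖kron D F F'‖ₑ ≤ ‖F‖ₑ * ‖D ∘L ContinuousLinearMap.adjoint F'.op‖ₑ := by
    refine (ENNReal.pow_le_pow_left_iff two_ne_zero).1 ?_
    rw [enorm_sq]
    exact tsum_enorm_comp_le F _
  have h2 : ‖kron D F F'‖ ≤ ‖F‖ * ‖D ∘L ContinuousLinearMap.adjoint F'.op‖ := by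
    have := ENNReal.toReal_mono (ENNReal.mul_ne_top enorm_ne_top enorm_ne_top) h1
    simpa [ENNReal.toReal_mul] using this
  calc _ ≤ ‖F‖ * (‖D‖ * ‖F'‖) := by
        refine h2.trans ?_
        gcongr
        refine (ContinuousLinearMap.opNorm_comp_le _ _).trans ?_
        rw [LinearIsometryEquiv.norm_map]
        gcongr
        exact norm_op_le F'
    _ = _ := by ring

theorem kron_smul (D : H →L[ℂ] H) (a b : ℂ) (F F' : S2 H) :
    kron D (a • F) (b • F') = (a * conj b) • kron D F F' := by
  apply op_injective
  ext x
  simp [kron, map_smulₛₗ, smul_smul, mul_comm]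

theorem kron_smul_op (c : ℂ) (D : H →L[ℂ] H) (F F' : S2 H) :
    kron (c • D) F F' = c • kron D F F' := by
  apply op_injective
  ext x
  simp [kron]

theorem kron_add_op (D D' : H →L[ℂ] H) (F F' : S2 H) :
    kron (D + D') F F' = kron D F F' + kron D' F F' := by
  apply op_injective
  ext x
  simp [kron]

/-- `(F, F') ↦ F D F'†` as a bounded real bilinear map. -/
def kronL (D : H →L[ℂ] H) : S2 H →L[ℝ] S2 H →L[ℝ] S2 H :=
  LinearMap.mkContinuous₂ (LinearMap.mk₂ ℝ (kron D)
    (fun F F' K => by apply op_injective; ext x; simp [kron])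
    (fun c F F' => by
      have := kron_smul D c 1 F F'
      simpa only [one_smul, map_one, mul_one, Complex.coe_smul] using this)
    (fun F F' K => by apply op_injective; ext x; simp [kron])
    (fun c F F' => by
      have := kron_smul D 1 c F F'
      simpa only [one_smul, one_mul, Complex.conj_ofReal, Complex.coe_smul] using this))
    ‖D‖ (fun F F' => norm_kron_le D F F')

@[simp] theorem kronL_apply (D : H →L[ℂ] H) (F F' : S2 H) : kronL D F F' = kron D F F' := rfl

theorem continuous_kron (D : H →L[ℂ] H) : Continuous fun F : S2 H => kron D F F := by
  have : Continuous fun F : S2 H => kronL D F F := by fun_prop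
  exact this

theorem kron_tens (D : H →L[ℂ] H) (x x' y y' : H) :
    kron D (tens x x') (tens y y') = inner ℂ x' (D y') • tens x y := by
  apply op_injective
  ext v
  simp [kron, InnerProductSpace.adjoint_rankOne, smul_smul, mul_comm]

end S2

variable {S : Type*} [MeasurableSpace S] {π : Measure S} [IsProbabilityMeasure π]
variable {m : ℕ} {G : (ℤ → S) → H}

variable (π) in
/-- The covariance operator of `X_u` and `X_0` for the process generated by `G`. -/
def autoCov (G : (ℤ → S) → H) (u : ℤ) : S2 H :=
  ∫ ω, S2.tens (proc G u ω) (proc G 0 ω) ∂iidLaw π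

variable (π) in
/-- The spectral density operator of the process generated by `G`, without the factor `(2π)⁻¹`. -/
def specSum (G : (ℤ → S) → H) (lam : ℝ) : S2 H :=
  ∑' u : ℤ, Complex.exp (-Complex.I * lam * u) • autoCov π G u

theorem MDep.bddMeas_tens (hG : MDep π m G) (u v : ℤ) :
    BddMeas fun ω => S2.tens (proc G u ω) (proc G v ω) :=
  (hG.proc_bddMeas u).bilin (hG.proc_bddMeas v) (S2.tensL H)

theorem MDep.autoCov_eq_zero (hG : MDep π m G) {u : ℤ} (hu : u ∉ Finset.Icc (-m : ℤ) m) :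
    autoCov π G u = 0 := by
  refine ext_inner_left ℂ fun D => ?_
  have h := (hG.sep (s := u) (t := 0)
    (by rw [Finset.mem_Icc, ← abs_le] at hu; simpa using hu)).integral_bilin_eq_zero
    (hG.proc_bddMeas u) (hG.proc_bddMeas 0) (hG.proc_mean 0) (innerTens D)
  rw [inner_zero_right, autoCov, ← integral_inner ((hG.bddMeas_tens u 0).integrable _)]
  exact h

theorem MDep.specSum_eq (hG : MDep π m G) (lam : ℝ) : specSum π G lam
    = ∑ u ∈ Finset.Icc (-m : ℤ) m, Complex.exp (-Complex.I * lam * u) • autoCov π G u :=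
  tsum_eq_sum fun u hu => by rw [hG.autoCov_eq_zero hu, smul_zero]

/-- The kernel pairs `⟪C, X_u ⊗ X'_v⟫` with the scalar `⟪X_0, D X'_0⟫`, which `kron_tens` absorbs
into a product of rank-one operators; the independent copies then integrate separately. The
hypothesis is needed on the values of `G` only, which lets reality of the process be used. -/
theorem MDep.covKernel_eq (hG : MDep π m G) (C : S2 H) {B' : H →L[ℝ] H →L[ℝ] ℂ}
    {D : H →L[ℂ] H} (hB' : ∀ ω ω', B' (G ω) (G ω') = inner ℂ (G ω) (D (G ω'))) (u v : ℤ) :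
    covKernel π (innerTens C) B' G u v
      = inner ℂ C (S2.kron D (autoCov π G u) (autoCov π G v)) := by
  have hu := (hG.bddMeas_tens u 0).integrable (iidLaw π)
  have hv := (hG.bddMeas_tens v 0).integrable (iidLaw π)
  let L : S2 H →L[ℝ] ℂ := (innerSL ℂ C).restrictScalars ℝ
  have e1 : ∀ A, inner ℂ C (S2.kron D A (autoCov π G v))
      = ∫ ω', inner ℂ C (S2.kron D A (S2.tens (proc G v ω') (proc G 0 ω'))) ∂iidLaw π := fun A =>
    ((L.comp (S2.kronL D A)).integral_comp_comm hv).symm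
  have e2 : inner ℂ C (S2.kron D (autoCov π G u) (autoCov π G v))
      = ∫ ω, inner ℂ C (S2.kron D (S2.tens (proc G u ω) (proc G 0 ω)) (autoCov π G v))
        ∂iidLaw π :=
    ((L.comp ((S2.kronL D).flip (autoCov π G v))).integral_comp_comm hu).symm
  rw [e2]
  simp only [e1, S2.kron_tens, inner_smul_right]
  refine integral_congr_ae (Eventually.of_forall fun ω => integral_congr_ae
    (Eventually.of_forall fun ω' => ?_))
  have h3 := hB' (shift 0 ω) (shift 0 ω')
  simp only [innerTens_apply, proc] at h3 ⊢
  rw [h3, mul_comm]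

/-- The factor `e^{-iλ(u - v)}` splits between the two arguments of `kron D`. The second argument is
antilinear, so both sums become the spectral operator at the same frequency. -/
theorem MDep.sum_covKernel_eq (hG : MDep π m G) (C : S2 H) {B' : H →L[ℝ] H →L[ℝ] ℂ}
    {D : H →L[ℂ] H} (hB' : ∀ ω ω', B' (G ω) (G ω') = inner ℂ (G ω) (D (G ω'))) (lam : ℝ) :
    ∑ u ∈ Finset.Icc (-m : ℤ) m, ∑ v ∈ Finset.Icc (-m : ℤ) m,
      Complex.exp (Complex.I * (-lam : ℝ) * ((u : ℂ) - v)) * covKernel π (innerTens C) B' G u v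
      = inner ℂ C (S2.kron D (specSum π G lam) (specSum π G lam)) := by
  rw [hG.specSum_eq, ← S2.kronL_apply]
  simp only [map_sum, sum_apply, inner_sum, hG.covKernel_eq C hB', S2.kronL_apply, S2.kron_smul,
    inner_smul_right]
  rw [Finset.sum_comm]
  refine Finset.sum_congr rfl fun u _ => Finset.sum_congr rfl fun v _ => ?_
  congr 1
  rw [← Complex.exp_conj, ← Complex.exp_add]
  congr 1
  simp only [map_mul, map_neg, Complex.conj_I, Complex.conj_ofReal, map_intCast]
  push_cast
  ring

theorem exp_neg_eq_of_mem_zero_pi {lam : ℝ} (h : lam = 0 ∨ lam = Real.pi) (u : ℤ) :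
    Complex.exp (-Complex.I * lam * u) = Complex.exp (-Complex.I * (-lam : ℝ) * u) := by
  rcases h with rfl | rfl
  · simp
  · rw [Complex.exp_eq_exp_iff_exists_int]
    exact ⟨-u, by push_cast; ring⟩

theorem specSum_neg {lam : ℝ} (h : lam = 0 ∨ lam = Real.pi) :
    specSum π G (-lam) = specSum π G lam := by
  simp only [specSum, exp_neg_eq_of_mem_zero_pi h]

theorem exp_I_mul_eq_one_iff (x : ℝ) :
    Complex.exp (Complex.I * x) = 1 ↔ ∃ n : ℤ, x = n * (2 * Real.pi) := by
  rw [Complex.exp_eq_one_iff]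
  refine exists_congr fun n => ?_
  have : (n : ℂ) * (2 * Real.pi * Complex.I) = Complex.I * ((n * (2 * Real.pi) : ℝ) : ℂ) := by
    push_cast; ring
  rw [this, mul_right_inj' Complex.I_ne_zero, Complex.ofReal_inj]

/-- The difference of two points of `[0, π]` has modulus less than `2π`. With the next lemma this
decides which covariances survive in the limit. -/
theorem exp_I_mul_sub_eq_one_iff {x y : ℝ} (hx : x ∈ Set.Icc 0 Real.pi)
    (hy : y ∈ Set.Icc 0 Real.pi) : Complex.exp (Complex.I * (x + -y : ℝ)) = 1 ↔ x = y := by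
  rw [exp_I_mul_eq_one_iff]
  constructor
  · rintro ⟨n, hn⟩
    have hp := Real.pi_pos
    have h1 : (n : ℝ) < 1 := by nlinarith [hx.1, hx.2, hy.1, hy.2]
    have h2 : (-1 : ℝ) < n := by nlinarith [hx.1, hx.2, hy.1, hy.2]
    have h3 : n = 0 := by
      have h1' : n < 1 := by exact_mod_cast h1
      have h2' : -1 < n := by exact_mod_cast h2
      omega
    simp only [h3, Int.cast_zero, zero_mul] at hn
    linarith
  · rintro rfl
    exact ⟨0, by simp⟩

/-- The sum lies in `[0, 2π]` and is a multiple of `2π` only at the endpoints, where both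
frequencies are `0` or both are `π`. -/
theorem exp_I_mul_add_eq_one_iff {x y : ℝ} (hx : x ∈ Set.Icc 0 Real.pi)
    (hy : y ∈ Set.Icc 0 Real.pi) :
    Complex.exp (Complex.I * (x + y : ℝ)) = 1 ↔ x = y ∧ (x = 0 ∨ x = Real.pi) := by
  rw [exp_I_mul_eq_one_iff]
  constructor
  · rintro ⟨n, hn⟩
    have hp := Real.pi_pos
    have h1 : (n : ℝ) < 2 := by nlinarith [hx.1, hx.2, hy.1, hy.2]
    have h2 : (-1 : ℝ) < n := by nlinarith [hx.1, hx.2, hy.1, hy.2]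
    have h3 : n = 0 ∨ n = 1 := by
      have h1' : n < 2 := by exact_mod_cast h1
      have h2' : -1 < n := by exact_mod_cast h2
      omega
    rcases h3 with rfl | rfl
    · simp only [Int.cast_zero, zero_mul] at hn
      exact ⟨by linarith [hx.1, hy.1], Or.inl (by linarith [hx.1, hy.1])⟩
    · simp only [Int.cast_one, one_mul] at hn
      exact ⟨by linarith [hx.2, hy.2], Or.inr (by linarith [hx.2, hy.2])⟩
  · rintro ⟨rfl, rfl | rfl⟩
    · exact ⟨0, by simp⟩
    · exact ⟨1, by push_cast; ring⟩

theorem indZeroPi_eq (lam : ℝ) [Decidable (lam = 0 ∨ lam = Real.pi)] :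
    indZeroPi lam = if lam = 0 ∨ lam = Real.pi then 1 else 0 := by
  by_cases h : lam = 0 ∨ lam = Real.pi
  · rw [if_pos h, indZeroPi, Set.indicator_of_mem (by simpa using h)]; rfl
  · rw [if_neg h, indZeroPi, Set.indicator_of_notMem (by simpa using h)]

/-- The variance of `Re ⟪C, Z⟫` for the limit `Z` with spectral operator `f`; the terms weighted by
`e` are present at the frequencies `0` and `π` only. -/
def limVar (J : H ≃ₗᵢ⋆[ℂ] H) (e : ℂ) (f C : S2 H) : ℝ :=
  ((inner ℂ C (S2.kron C.op f f) + inner ℂ C (S2.kron (ContinuousLinearMap.adjoint C.op) f f)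
    + e * (inner ℂ C (S2.kron (conjOp J C.op) f f)
      + inner ℂ C (S2.kron (ContinuousLinearMap.adjoint (conjOp J C.op)) f f))) / 2).re

theorem continuous_limVar (J : H ≃ₗᵢ⋆[ℂ] H) (e : ℂ) (C : S2 H) :
    Continuous fun f => limVar J e f C := by
  have h : ∀ D : H →L[ℂ] H, Continuous fun f : S2 H => inner ℂ C (S2.kron D f f) := fun D =>
    continuous_const.inner (S2.continuous_kron D)
  exact Complex.continuous_re.comp ((((h _).add (h _)).add
    (continuous_const.mul ((h _).add (h _)))).div_const 2)

/-- The limiting variance of a bounded `m`-dependent process in terms of its spectral operators. -/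
theorem MDep.varLimit_eq {d : Type*} [Fintype d] (hG : MDep π m G) {J : H ≃ₗᵢ⋆[ℂ] H}
    (C : d → S2 H) (w : ℝ → ℝ) {lam : d → ℝ}
    (hlam : ∀ j, lam j ∈ Set.Icc 0 Real.pi) (hinj : Function.Injective lam)
    (hreal : (∃ j, lam j = 0 ∨ lam j = Real.pi) → ∀ ω, J (G ω) = G ω) :
    varLimit π m C G w lam
      = windowEnergy w * ∑ j, limVar J (indZeroPi (lam j)) (specSum π G (lam j)) (C j) := by
  classical
  have c1 : ∀ j k, Complex.exp (Complex.I * (lam j + -lam k : ℝ)) = 1 ↔ j = k := fun j k => by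
    rw [exp_I_mul_sub_eq_one_iff (hlam j) (hlam k), hinj.eq_iff]
  have c2 : ∀ j k, Complex.exp (Complex.I * (lam j + lam k : ℝ)) = 1
      ↔ j = k ∧ (lam j = 0 ∨ lam j = Real.pi) := fun j k => by
    rw [exp_I_mul_add_eq_one_iff (hlam j) (hlam k), hinj.eq_iff]
  -- `e1` to `e4` write the four forms that occur as `⟪x, D y⟫` on the values of `G`. The first two
  -- are of this type always. The last two have the linear and the antilinear argument exchanged and
  -- need `J x = x`, which is available exactly at the frequencies where they contribute.
  have e1 : ∀ j ω ω', (innerTens (C j)).flip (G ω) (G ω')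
      = inner ℂ (G ω) (ContinuousLinearMap.adjoint (C j).op (G ω')) := fun j ω ω' => by
    rw [ContinuousLinearMap.flip_apply, innerTens_apply, S2.inner_tens_right,
      ContinuousLinearMap.adjoint_inner_right]
  have e2 : ∀ j ω ω', conjForm (innerTens (C j)) (G ω) (G ω')
      = inner ℂ (G ω) ((C j).op (G ω')) := fun j ω ω' => by
    rw [conjForm_apply, innerTens_apply, S2.inner_tens_right, inner_conj_symm]
  have e3 : ∀ j, (lam j = 0 ∨ lam j = Real.pi) → ∀ ω ω', innerTens (C j) (G ω) (G ω')
      = inner ℂ (G ω) (conjOp J (C j).op (G ω')) := fun j hj ω ω' => by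
    have hr := hreal ⟨j, hj⟩
    rw [innerTens_apply, S2.inner_tens_right, conjOp_apply, hr ω', ← inner_conj_conj J, hr]
  have e4 : ∀ j, (lam j = 0 ∨ lam j = Real.pi) → ∀ ω ω', (conjForm (innerTens (C j))).flip (G ω) (G ω')
      = inner ℂ (G ω) (ContinuousLinearMap.adjoint (conjOp J (C j).op) (G ω')) :=
    fun j hj ω ω' => by
      have hr := hreal ⟨j, hj⟩
      rw [ContinuousLinearMap.flip_apply, e2, ContinuousLinearMap.adjoint_inner_right,
        conjOp_apply, hr ω, ← inner_conj_conj J, hr]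
  rw [varLimit, Finset.mul_sum]
  refine Finset.sum_congr rfl fun j _ => ?_
  -- Off the diagonal neither resonance condition can hold, as `lam` is injective.
  rw [Finset.sum_eq_single j]
  · have s1 := hG.sum_covKernel_eq (C j) (e1 j) (lam j)
    have s2 := hG.sum_covKernel_eq (C j) (e2 j) (lam j)
    simp only [covLimit, c2, c1, neg_neg, true_and, if_true, s1, s2]
    by_cases hj : lam j = 0 ∨ lam j = Real.pi
    · have s3 := hG.sum_covKernel_eq (C j) (e3 j hj) (-lam j)
      have s4 := hG.sum_covKernel_eq (C j) (e4 j hj) (-lam j)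
      rw [neg_neg, specSum_neg hj] at s3 s4
      rw [s3, s4, if_pos hj, limVar, indZeroPi_eq, if_pos hj, ← Complex.re_ofReal_mul]
      congr 1
      ring
    · rw [if_neg hj, limVar, indZeroPi_eq, if_neg hj, ← Complex.re_ofReal_mul]
      congr 1
      ring
  · intro k _ hk
    simp only [covLimit, c2, c1, neg_neg, hk.symm, false_and, if_false, zero_mul, add_zero,
      zero_div, Complex.zero_re]
  · simp

end SpectralVariance

/-! ### Continuity in the process and the limit of linear functionals -/

section LimitVariance

set_option linter.unusedSectionVars false

variable {S : Type*} [MeasurableSpace S] {π : Measure S} [IsProbabilityMeasure π]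
variable {H : Type*} [NormedAddCommGroup H] [InnerProductSpace ℂ H] [CompleteSpace H]
variable {G G' : (ℤ → S) → H}

variable (π) in
/-- `G` generates a centered causal process in `L⁴` with summable dependence coefficients. -/
structure Causal4 (G : (ℤ → S) → H) : Prop where
  meas : StronglyMeasurable G
  memLp : MemLp G 4 (iidLaw π)
  mean : ∫ ω, G ω ∂iidLaw π = 0
  dep : DependsOn G (Set.Iic 0)
  summable : coeffSum π G ≠ ∞

theorem MDep.causal4 {m : ℕ} (hG : MDep π m G) : Causal4 π G where
  meas := hG.bddMeas.meas
  memLp := hG.bddMeas.memLp _ _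
  mean := hG.mean
  dep := fun _ _ hxy => hG.dep fun i hi => hxy i hi.2
  summable := ne_top_of_le_ne_top (ENNReal.mul_ne_top (by simp)
    (ENNReal.mul_ne_top (by simp) (hG.bddMeas.memLp _ _).2.ne))
    (coeffSum_le_of_dependsOn (hG.bddMeas.memLp _ _) hG.dep)

theorem Causal4.stronglyMeasurable_proc (hG : Causal4 π G) (t : ℤ) :
    StronglyMeasurable (proc G t) := hG.meas.comp_measurable (measurable_shift t)

theorem Causal4.memLp_two_proc (hG : Causal4 π G) (t : ℤ) : MemLp (proc G t) 2 (iidLaw π) :=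
  (memLp_proc hG.memLp t).mono_exponent (by norm_num)

theorem Causal4.memLp_two_quadForm (hG : Causal4 π G) (α : ℤ → ℤ → ℂ) (I : Finset ℤ) :
    MemLp (quadForm α I (proc G) (proc G)) 2 (iidLaw π) :=
  have := holderTriple_four_four_two
  memLp_quadForm (p := 4) (q := 4) (r := 2) α I (memLp_proc hG.memLp) (memLp_proc hG.memLp)

theorem quadForm_sub_quadForm (α : ℤ → ℤ → ℂ) (I : Finset ℤ) (G G' : (ℤ → S) → H) (ω : ℤ → S) :
    quadForm α I (proc G) (proc G) ω - quadForm α I (proc G') (proc G') ω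
      = quadForm α I (proc (G - G')) (proc G) ω + quadForm α I (proc G') (proc (G - G')) ω := by
  simp only [quadForm, ← Finset.sum_sub_distrib, ← Finset.sum_add_distrib]
  refine Finset.sum_congr rfl fun s _ => Finset.sum_congr rfl fun t _ => ?_
  have h : ∀ t, proc (G - G') t ω = proc G t ω - proc G' t ω := fun t => rfl
  rw [h, h, S2.tens_sub_left, S2.tens_sub_right, ← smul_sub, ← smul_add]
  congr 1
  abel

theorem eLpNorm_quadForm_sub_integral_le {G₁ G₂ : (ℤ → S) → H} (hm₁ : StronglyMeasurable G₁)
    (hm₂ : StronglyMeasurable G₂) (h₁ : MemLp G₁ 4 (iidLaw π)) (h₂ : MemLp G₂ 4 (iidLaw π))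
    (z₁ : ∫ ω, G₁ ω ∂iidLaw π = 0) (z₂ : ∫ ω, G₂ ω ∂iidLaw π = 0) (α : ℤ → ℤ → ℂ)
    (I : Finset ℤ) :
    eLpNorm (fun ω => quadForm α I (proc G₁) (proc G₂) ω
      - ∫ ω', quadForm α I (proc G₁) (proc G₂) ω' ∂iidLaw π) 2 (iidLaw π) ^ 2
      ≤ 256 * (coeffSum π G₁ ^ 2 * coeffSum π G₂ ^ 2) * ∑ s ∈ I, ∑ t ∈ I, ‖α s t‖ₑ ^ 2 := by
  have := holderTriple_four_four_two
  have b₁ := coeffBound_proc (π := π) hm₁ h₁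
  have b₂ := coeffBound_proc (π := π) hm₂ h₂
  refine (eLpNorm_quadForm_sub_integral_sq_le (r := 2) b₁ b₁ b₂ b₂
    (fun t => (integral_proc _ t).trans z₁) (fun t => (integral_proc _ t).trans z₂)
    (Or.inl rfl) (by norm_num) α I).trans (le_of_eq ?_)
  change 128 * (coeffSum π G₁ ^ 2 * coeffSum π G₂ ^ 2 + coeffSum π G₂ ^ 2 * coeffSum π G₁ ^ 2) * _
    = _
  ring

/-- By bilinearity the difference is a sum of two quadratic forms with `G - G'` in one slot, and the
moment bound applies to each. Here `512 = 2 · 256`, the `2` from squaring a sum. -/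
theorem eLpNorm_quadForm_sub_sub_sq_le (hG : Causal4 π G) (hG' : Causal4 π G') (α : ℤ → ℤ → ℂ)
    (I : Finset ℤ) :
    eLpNorm (fun ω => (quadForm α I (proc G) (proc G) ω
        - ∫ ω', quadForm α I (proc G) (proc G) ω' ∂iidLaw π)
      - (quadForm α I (proc G') (proc G') ω
        - ∫ ω', quadForm α I (proc G') (proc G') ω' ∂iidLaw π)) 2 (iidLaw π) ^ 2
      ≤ 512 * coeffSum π (G - G') ^ 2 * (coeffSum π G ^ 2 + coeffSum π G' ^ 2)
        * ∑ s ∈ I, ∑ t ∈ I, ‖α s t‖ₑ ^ 2 := by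
  have := holderTriple_four_four_two
  have hm := hG.meas.sub hG'.meas
  have hL := hG.memLp.sub hG'.memLp
  have hz : ∫ ω, (G - G') ω ∂iidLaw π = 0 := by
    have := integral_sub (hG.memLp.integrable (by norm_num)) (hG'.memLp.integrable (by norm_num))
    simpa [hG.mean, hG'.mean] using this
  have q₁ : MemLp (quadForm α I (proc (G - G')) (proc G)) 2 (iidLaw π) :=
    memLp_quadForm (p := 4) (q := 4) α I (memLp_proc hL) (memLp_proc hG.memLp)
  have q₂ : MemLp (quadForm α I (proc G') (proc (G - G'))) 2 (iidLaw π) :=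
    memLp_quadForm (p := 4) (q := 4) α I (memLp_proc hG'.memLp) (memLp_proc hL)
  have i := (hG.memLp_two_quadForm α I).integrable one_le_two
  have i' := (hG'.memLp_two_quadForm α I).integrable one_le_two
  have e : (fun ω => (quadForm α I (proc G) (proc G) ω
        - ∫ ω', quadForm α I (proc G) (proc G) ω' ∂iidLaw π)
      - (quadForm α I (proc G') (proc G') ω
        - ∫ ω', quadForm α I (proc G') (proc G') ω' ∂iidLaw π))
      = (fun ω => quadForm α I (proc (G - G')) (proc G) ω
          - ∫ ω', quadForm α I (proc (G - G')) (proc G) ω' ∂iidLaw π)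
        + fun ω => quadForm α I (proc G') (proc (G - G')) ω
          - ∫ ω', quadForm α I (proc G') (proc (G - G')) ω' ∂iidLaw π := by
    funext ω
    have h1 := integral_sub i i'
    simp only [quadForm_sub_quadForm] at h1
    rw [integral_add (q₁.integrable one_le_two) (q₂.integrable one_le_two)] at h1
    have h2 := quadForm_sub_quadForm α I G G' ω
    rw [Pi.add_apply, sub_sub_sub_comm, h2, ← h1]
    abel
  rw [e]
  have t := eLpNorm_add_le (p := 2) (q₁.1.sub (aestronglyMeasurable_const
    (b := ∫ ω', quadForm α I (proc (G - G')) (proc G) ω' ∂iidLaw π)))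
    (q₂.1.sub (aestronglyMeasurable_const
    (b := ∫ ω', quadForm α I (proc G') (proc (G - G')) ω' ∂iidLaw π))) one_le_two
  refine (pow_le_pow_left' t 2).trans ((ENNReal.add_sq_le _ _).trans ?_)
  have a₁ := eLpNorm_quadForm_sub_integral_le hm hG.meas hL hG.memLp hz hG.mean α I
  have a₂ := eLpNorm_quadForm_sub_integral_le hG'.meas hm hG'.memLp hL hG'.mean hz α I
  refine (mul_le_mul_right (add_le_add a₁ a₂) 2).trans (le_of_eq ?_)
  ring

variable (π) in
/-- The normalized centered lag-window form `√(b/τ) (Q - E Q)`. -/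
def devForm (G : (ℤ → S) → H) (w : ℝ → ℝ) (b lam : ℝ) (τ : ℕ) (ω : ℤ → S) : S2 H :=
  √(b / τ) • (quadForm (winCoef w b lam) (Finset.Icc (1 : ℤ) τ) (proc G) (proc G) ω
    - ∫ ω', quadForm (winCoef w b lam) (Finset.Icc (1 : ℤ) τ) (proc G) (proc G) ω' ∂iidLaw π)

theorem Causal4.stronglyMeasurable_devForm (hG : Causal4 π G) (w : ℝ → ℝ) (b lam : ℝ) (τ : ℕ) :
    StronglyMeasurable (devForm π G w b lam τ) :=
  ((stronglyMeasurable_quadForm _ _ hG.stronglyMeasurable_proc hG.stronglyMeasurable_proc).sub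
    stronglyMeasurable_const).const_smul (√(b / τ))

theorem eLpNorm_real_smul_sq {α E : Type*} [MeasurableSpace α] {μ : Measure α}
    [NormedAddCommGroup E] [NormedSpace ℝ E] (f : α → E) {c : ℝ} (hc : 0 ≤ c) (p : ℝ≥0∞) :
    eLpNorm (fun x => √c • f x) p μ ^ 2 = ENNReal.ofReal c * eLpNorm f p μ ^ 2 := by
  rw [show (fun x => √c • f x) = √c • f from rfl, eLpNorm_const_smul, mul_pow,
    Real.enorm_sq_eq_ofReal, Real.sq_sqrt hc]

theorem sum_enorm_winCoef_sq (w : ℝ → ℝ) (b lam : ℝ) (τ : ℕ) :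
    ∑ s ∈ Finset.Icc (1 : ℤ) τ, ∑ t ∈ Finset.Icc (1 : ℤ) τ, ‖winCoef w b lam s t‖ₑ ^ 2
      = ENNReal.ofReal (windowFrob w b τ) := by
  simp only [enorm_winCoef_sq, sum_ofReal_windowFrob]

theorem eLpNorm_devForm_sub_sq_le (hG : Causal4 π G) (hG' : Causal4 π G') (w : ℝ → ℝ) {b : ℝ}
    (hb : 0 ≤ b) (lam : ℝ) (τ : ℕ) :
    eLpNorm (fun ω => devForm π G w b lam τ ω - devForm π G' w b lam τ ω) 2 (iidLaw π) ^ 2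
      ≤ ENNReal.ofReal (b / τ * windowFrob w b τ)
        * (512 * coeffSum π (G - G') ^ 2 * (coeffSum π G ^ 2 + coeffSum π G' ^ 2)) := by
  have hc : 0 ≤ b / τ := by positivity
  simp only [devForm, ← smul_sub]
  rw [eLpNorm_real_smul_sq _ hc, ENNReal.ofReal_mul hc, ← sum_enorm_winCoef_sq w b lam τ, mul_assoc]
  refine mul_le_mul_right ((eLpNorm_quadForm_sub_sub_sq_le hG hG' _ _).trans (le_of_eq ?_)) _
  ring

theorem eLpNorm_devForm_sq_le (hG : Causal4 π G) (w : ℝ → ℝ) {b : ℝ}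
    (hb : 0 ≤ b) (lam : ℝ) (τ : ℕ) :
    eLpNorm (devForm π G w b lam τ) 2 (iidLaw π) ^ 2
      ≤ ENNReal.ofReal (b / τ * windowFrob w b τ) * (256 * coeffSum π G ^ 4) := by
  have hc : 0 ≤ b / τ := by positivity
  have := eLpNorm_quadForm_sub_integral_le hG.meas hG.meas hG.memLp hG.memLp hG.mean hG.mean
    (winCoef w b lam) (Finset.Icc (1 : ℤ) τ)
  change eLpNorm (fun ω => devForm π G w b lam τ ω) 2 (iidLaw π) ^ 2 ≤ _
  simp only [devForm]
  rw [eLpNorm_real_smul_sq _ hc, ENNReal.ofReal_mul hc, ← sum_enorm_winCoef_sq w b lam τ, mul_assoc]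
  refine mul_le_mul_right (this.trans (le_of_eq ?_)) _
  ring

/-! ### Continuity of the spectral operators -/

/-- Expanded over martingale increments, the lag-`u` covariance is bounded by `∑_k ν(u - k) ν'(-k)`,
where `ν` and `ν'` are the coefficients of the two processes. Summation over `u` factors into the
product of the two totals. -/
theorem tsum_enorm_integral_tens_le (hm : StronglyMeasurable G) (hm' : StronglyMeasurable G')
    (hG : MemLp G 4 (iidLaw π)) (hG' : MemLp G' 4 (iidLaw π)) (h0 : ∫ ω, G ω ∂iidLaw π = 0) :
    ∑' u : ℤ, ‖∫ ω, S2.tens (proc G u ω) (proc G' 0 ω) ∂iidLaw π‖ₑ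
      ≤ coeffSum π G * coeffSum π G' := by
  have hc : ∀ {F : (ℤ → S) → H}, StronglyMeasurable F → MemLp F 4 (iidLaw π) → ∀ t k : ℤ,
      eLpNorm (coordProj π k (proc F t)) 2 (iidLaw π) ≤ coeff π F (t - k) := fun hm hF t k => by
    have hi := (memLp_proc hF t).integrable (q := 4) (by norm_num)
    refine (eLpNorm_coordProj_le k one_le_two hi).trans ?_
    refine (eLpNorm_le_eLpNorm_of_exponent_le (q := 4) (by norm_num)
      (hi.1.sub (integrable_condE _ hi).1)).trans ?_
    exact (coeffBound_proc hm hF).coeff t k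
  calc ∑' u : ℤ, ‖∫ ω, S2.tens (proc G u ω) (proc G' 0 ω) ∂iidLaw π‖ₑ
      ≤ ∑' u : ℤ, ∑' k : ℤ, coeff π G (u - k) * coeff π G' (0 - k) := by
        refine ENNReal.tsum_le_tsum fun u => ?_
        refine (enorm_integral_bilin_le_tsum (b := S2.tensL H)
          (fun x y => (S2.norm_tens x y).le) (hm.comp_measurable (measurable_shift u))
          (hm'.comp_measurable (measurable_shift 0))
          ((memLp_proc hG u).mono_exponent (by norm_num))
          ((memLp_proc hG' 0).mono_exponent (by norm_num))
          ((integral_proc G u).trans h0)).trans ?_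
        exact ENNReal.tsum_le_tsum fun k => mul_le_mul' (hc hm hG u k) (hc hm' hG' 0 k)
    _ = coeffSum π G * coeffSum π G' := by
        rw [ENNReal.tsum_comm]
        have h1 : ∀ k : ℤ, ∑' u : ℤ, coeff π G (u - k) * coeff π G' (0 - k)
            = coeffSum π G * coeff π G' (0 - k) := fun k => by
          rw [ENNReal.tsum_mul_right, coeffSum, ← (Equiv.subRight k).tsum_eq (coeff π G)]
          rfl
        simp only [h1]
        rw [ENNReal.tsum_mul_left, show coeffSum π G' = ∑' j, coeff π G' j from rfl, ← (Equiv.subLeft (0 : ℤ)).tsum_eq (coeff π G')]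
        rfl

theorem enorm_exp_smul {E : Type*} [NormedAddCommGroup E] [NormedSpace ℂ E] (lam : ℝ) (u : ℤ)
    (x : E) : ‖Complex.exp (-Complex.I * lam * u) • x‖ₑ = ‖x‖ₑ := by
  have : -Complex.I * lam * u = ((-(lam * u) : ℝ) : ℂ) * Complex.I := by push_cast; ring
  rw [enorm_smul, this, ← ofReal_norm (Complex.exp _), Complex.norm_exp_ofReal_mul_I,
    ENNReal.ofReal_one, one_mul]

theorem Causal4.summable_spec (hG : Causal4 π G) (lam : ℝ) :
    Summable fun u : ℤ => Complex.exp (-Complex.I * lam * u) • autoCov π G u := by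
  refine summable_of_tsum_enorm_ne_top ?_
  simp only [enorm_exp_smul]
  exact ne_top_of_le_ne_top (ENNReal.mul_ne_top hG.summable hG.summable)
    (tsum_enorm_integral_tens_le hG.meas hG.meas hG.memLp hG.memLp hG.mean)

theorem autoCov_sub (hG : Causal4 π G) (hG' : Causal4 π G') (u : ℤ) :
    autoCov π G u - autoCov π G' u
      = ∫ ω, S2.tens (proc (G - G') u ω) (proc G 0 ω) ∂iidLaw π
        + ∫ ω, S2.tens (proc G' u ω) (proc (G - G') 0 ω) ∂iidLaw π := by
  have hs : ∀ t, MemLp (proc (G - G') t) 2 (iidLaw π) := fun t =>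
    (hG.memLp_two_proc t).sub (hG'.memLp_two_proc t)
  have i : ∀ {X Y : (ℤ → S) → H}, MemLp X 2 (iidLaw π) → MemLp Y 2 (iidLaw π) →
      Integrable (fun ω => S2.tens (X ω) (Y ω)) (iidLaw π) := fun hX hY =>
    integrable_bilin (S2.tensL H) hX hY
  rw [autoCov, autoCov, ← integral_sub (i (hG.memLp_two_proc u) (hG.memLp_two_proc 0))
    (i (hG'.memLp_two_proc u) (hG'.memLp_two_proc 0)),
    ← integral_add (i (hs u) (hG.memLp_two_proc 0)) (i (hG'.memLp_two_proc u) (hs 0))]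
  refine integral_congr_ae (Eventually.of_forall fun ω => ?_)
  have h : ∀ t, proc (G - G') t ω = proc G t ω - proc G' t ω := fun t => rfl
  simp only [h, S2.tens_sub_left, S2.tens_sub_right]
  abel

theorem enorm_specSum_sub_le (hG : Causal4 π G) (hG' : Causal4 π G') (lam : ℝ) :
    ‖specSum π G lam - specSum π G' lam‖ₑ
      ≤ coeffSum π (G - G') * (coeffSum π G + coeffSum π G') := by
  have hm := hG.meas.sub hG'.meas
  have hL := hG.memLp.sub hG'.memLp
  have hz : ∫ ω, (G - G') ω ∂iidLaw π = 0 := by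
    have := integral_sub (hG.memLp.integrable (by norm_num)) (hG'.memLp.integrable (by norm_num))
    simpa [hG.mean, hG'.mean] using this
  rw [specSum, specSum, ← (hG.summable_spec lam).tsum_sub (hG'.summable_spec lam)]
  simp only [← smul_sub, autoCov_sub hG hG']
  refine enorm_tsum_le_tsum_enorm.trans ?_
  simp only [enorm_exp_smul]
  refine (ENNReal.tsum_le_tsum fun u => enorm_add_le _ _).trans ?_
  rw [ENNReal.tsum_add, mul_add]
  refine add_le_add (tsum_enorm_integral_tens_le hm hG.meas hL hG.memLp hz) ?_
  rw [mul_comm]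
  exact tsum_enorm_integral_tens_le hG'.meas hm hG'.memLp hL hG'.mean

/-! ### The central limit theorem for linear functionals -/

/-- The real part of a vector with respect to a conjugation, as a real-linear contraction. -/
def conjRealPart (J : H ≃ₗᵢ⋆[ℂ] H) : H →L[ℝ] H :=
  LinearMap.mkContinuous
    { toFun := fun x => (1 / 2 : ℝ) • (x + J x)
      map_add' := fun x y => by rw [map_add, ← smul_add]; congr 1; abel
      map_smul' := fun c x => by
        have : J (c • x) = c • J x := by
          rw [← Complex.coe_smul, map_smulₛₗ, Complex.conj_ofReal, Complex.coe_smul]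
        rw [this, ← smul_add, smul_comm]; rfl }
    1 fun x => by
      change ‖(1 / 2 : ℝ) • (x + J x)‖ ≤ 1 * ‖x‖
      rw [norm_smul, one_mul]
      have := norm_add_le x (J x)
      rw [LinearIsometryEquiv.norm_map] at this
      rw [Real.norm_of_nonneg (by norm_num)]
      linarith

theorem conjRealPart_apply (J : H ≃ₗᵢ⋆[ℂ] H) (x : H) : conjRealPart J x = (1 / 2 : ℝ) • (x + J x) := rfl

theorem conjRealPart_of_eq {J : H ≃ₗᵢ⋆[ℂ] H} {x : H} (h : J x = x) : conjRealPart J x = x := by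
  rw [conjRealPart_apply, h, ← two_smul ℝ x, smul_smul]
  norm_num

theorem conj_conjRealPart {J : H ≃ₗᵢ⋆[ℂ] H} (hJ : ∀ x, J (J x) = x) (x : H) :
    J (conjRealPart J x) = conjRealPart J x := by
  rw [conjRealPart_apply, ← Complex.coe_smul, map_smulₛₗ, Complex.conj_ofReal, map_add, hJ, add_comm]

theorem norm_conjRealPart_le (J : H ≃ₗᵢ⋆[ℂ] H) (x : H) : ‖conjRealPart J x‖ ≤ ‖x‖ := by
  simpa using (conjRealPart J).le_of_opNorm_le (LinearMap.mkContinuous_norm_le _ zero_le_one _) x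

/-- Approximation by bounded finite-rank `m`-dependent processes; real processes are approximated
by real ones. -/
theorem Causal4.exists_approx (hG : Causal4 π G) {J : H ≃ₗᵢ⋆[ℂ] H} (hJ : ∀ x, J (J x) = x)
    {P : Prop} (hreal : P → ∀ ω, J (G ω) = G ω) {η : ℝ≥0∞} (hη : η ≠ 0) :
    ∃ (m : ℕ) (G' : (ℤ → S) → H), MDep π m G' ∧
      (∃ V : Submodule ℂ H, FiniteDimensional ℂ V ∧ ∀ ω, G' ω ∈ V) ∧
      (P → ∀ ω, J (G' ω) = G' ω) ∧ coeffSum π (G - G') ≤ η := by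
  by_cases hP : P
  · obtain ⟨m, G', h1, h2, h3, h4⟩ := exists_mdep_approx hG.meas hG.memLp hG.mean hG.dep
      hG.summable (conjRealPart J) (norm_conjRealPart_le J)
      (fun x => conjRealPart_of_eq (conj_conjRealPart hJ x)) (fun ω => conjRealPart_of_eq (hreal hP ω)) hη
    exact ⟨m, G', h1, h2, fun _ ω => by rw [← h3, conj_conjRealPart hJ], h4⟩
  · obtain ⟨m, G', h1, h2, h3, h4⟩ := exists_mdep_approx hG.meas hG.memLp hG.mean hG.dep
      hG.summable (ContinuousLinearMap.id ℝ H) (fun x => le_rfl) (fun x => rfl) (fun ω => rfl) hη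
    exact ⟨m, G', h1, h2, fun h => absurd h hP, h4⟩

/-- A three-`ε` argument. The hypothesis is on squares because it will be met by second-moment
bounds; the point from which it holds may depend on `n`, but the bound `r n` is uniform in `i`. -/
theorem tendsto_of_approx {ι E : Type*} [SeminormedAddCommGroup E] {l : Filter ι} {a : ι → E}
    {a' : ℕ → ι → E} {L' : ℕ → E} {L : E} {r : ℕ → ℝ≥0∞}
    (h : ∀ n, Tendsto (a' n) l (𝓝 (L' n))) (hL : Tendsto L' atTop (𝓝 L))
    (hr : Tendsto r atTop (𝓝 0)) (hd : ∀ n, ∀ᶠ i in l, ‖a i - a' n i‖ₑ ^ 2 ≤ r n) :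
    Tendsto a l (𝓝 L) := by
  rw [EMetric.tendsto_nhds]
  intro ε hε
  have h3 : 0 < ε / 3 := ENNReal.div_pos hε.ne' (by simp)
  obtain ⟨n, hn1, hn2⟩ := ((EMetric.tendsto_nhds.1 hL (ε / 3) h3).and
    (hr.eventually (gt_mem_nhds (ENNReal.pow_pos h3 2)))).exists
  filter_upwards [hd n, EMetric.tendsto_nhds.1 (h n) (ε / 3) h3] with i h1 h2
  calc edist (a i) L ≤ edist (a i) (a' n i) + edist (a' n i) (L' n) + edist (L' n) L :=
        edist_triangle4 _ _ _ _
    _ < ε / 3 + ε / 3 + ε / 3 := by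
        refine ENNReal.add_lt_add (ENNReal.add_lt_add ?_ h2) hn1
        rw [edist_eq_enorm_sub]
        by_contra hlt
        exact absurd (pow_le_pow_left' (not_lt.1 hlt) 2) (not_le.2 (h1.trans_lt hn2))
    _ = ε := ENNReal.add_thirds ε

variable {d : Type*} [Fintype d] {w : ℝ → ℝ} {ι : Type*} {l : Filter ι} {b : ι → ℝ} {τ : ι → ℕ}

theorem MDep.re_sum_inner_devForm {m : ℕ} (hG : MDep π m G) (C : d → S2 H) (w : ℝ → ℝ)
    (lam : d → ℝ) (b : ℝ) (τ : ℕ) (ω : ℤ → S) :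
    (∑ j, inner ℂ (C j) (devForm π G w b (lam j) τ ω)).re
      = √(b / τ) * (winReForm G C w lam b τ ω
        - ∫ ω', winReForm G C w lam b τ ω' ∂iidLaw π) := by
  simp only [winReForm]
  rw [hG.integral_reForm, reForm, ← Complex.sub_re, ← Finset.sum_sub_distrib, ← Complex.re_ofReal_mul,
    Finset.mul_sum]
  congr 2
  funext j
  rw [devForm, ← Complex.coe_smul, inner_smul_right, inner_sub_right]

theorem LagWindow.eventually_frob_le (hw : LagWindow w) (hb : Tendsto b l (𝓝[>] 0))
    (hbτ : Tendsto (fun i => b i * τ i) l atTop) :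
    ∀ᶠ i in l, 0 < b i ∧ b i / τ i * windowFrob w (b i) (τ i) ≤ windowEnergy w + 1 := by
  filter_upwards [hb.eventually self_mem_nhdsWithin,
    (hw.tendsto_sum_sq hb hbτ).eventually (ge_mem_nhds (lt_add_one _))] with i h1 h2
  exact ⟨h1, h2⟩

variable (π) in
/-- An `L²`-bound for the error in replacing `G` by an approximation at distance at most `η`. -/
def approxErr (G : (ℤ → S) → H) (w : ℝ → ℝ) (η : ℝ≥0∞) : ℝ≥0∞ :=
  ENNReal.ofReal (windowEnergy w + 1)
    * (512 * η ^ 2 * (coeffSum π G ^ 2 + (coeffSum π G + η) ^ 2))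

theorem Causal4.coeffSum_le_add (hG : Causal4 π G) (hG' : Causal4 π G') :
    coeffSum π G' ≤ coeffSum π G + coeffSum π (G - G') := by
  rw [← coeffSum_neg (G - G')]
  convert coeffSum_add_le hG.memLp (hG.memLp.sub hG'.memLp).neg using 2
  abel

theorem eLpNorm_devForm_sub_sq_le_approxErr (hG : Causal4 π G) (hG' : Causal4 π G') {η : ℝ≥0∞}
    (hη : coeffSum π (G - G') ≤ η) {b : ℝ} {τ : ℕ} (hb : 0 < b)
    (h : b / τ * windowFrob w b τ ≤ windowEnergy w + 1) (lam : ℝ) :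
    eLpNorm (fun ω => devForm π G w b lam τ ω - devForm π G' w b lam τ ω) 2 (iidLaw π) ^ 2
      ≤ approxErr π G w η := by
  refine (eLpNorm_devForm_sub_sq_le hG hG' w hb.le lam τ).trans ?_
  rw [approxErr]
  have := hG.coeffSum_le_add hG'
  gcongr
  exact this.trans (by gcongr)

theorem Causal4.tendsto_approxErr (hG : Causal4 π G) (w : ℝ → ℝ) {η : ℕ → ℝ≥0∞}
    (hη : Tendsto η atTop (𝓝 0)) : Tendsto (fun n => approxErr π G w (η n)) atTop (𝓝 0) := by
  have h1 := (ENNReal.Tendsto.pow (n := 2) (hη.const_add (coeffSum π G))).const_add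
    (coeffSum π G ^ 2)
  have h2 := ENNReal.Tendsto.const_mul (a := 512) (ENNReal.Tendsto.pow (n := 2) hη)
    (Or.inr (by simp))
  have hf : coeffSum π G ^ 2 + (coeffSum π G + 0) ^ 2 ≠ ∞ := by
    simp [hG.summable]
  have h3 := ENNReal.Tendsto.mul h2 (Or.inr hf) h1 (Or.inr (by simp))
  have h4 := ENNReal.Tendsto.const_mul (a := ENNReal.ofReal (windowEnergy w + 1)) h3
    (Or.inr ENNReal.ofReal_ne_top)
  simpa [approxErr] using h4

/-- The limit is known for bounded `m`-dependent approximations. Their deviations are eventually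
within `approxErr` in squared `L²` norm, which carries over to the characteristic functions, and the
limiting variances converge because the spectral operators do. -/
theorem Causal4.tendsto_charFun (hG : Causal4 π G) {J : H ≃ₗᵢ⋆[ℂ] H} (hJ : ∀ x, J (J x) = x)
    (hw : LagWindow w) (hb : Tendsto b l (𝓝[>] 0)) (hbτ : Tendsto (fun i => b i * τ i) l atTop)
    (C : d → S2 H) {lam : d → ℝ}
    (hlam : ∀ j, lam j ∈ Set.Icc 0 Real.pi) (hinj : Function.Injective lam)
    (hreal : (∃ j, lam j = 0 ∨ lam j = Real.pi) → ∀ ω, J (G ω) = G ω) :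
    Tendsto (fun i => ∫ ω, Complex.exp (Complex.I *
      ((∑ j, inner ℂ (C j) (devForm π G w (b i) (lam j) (τ i) ω)).re : ℝ)) ∂iidLaw π) l
      (𝓝 (Complex.exp (-(windowEnergy w
        * ∑ j, limVar J (indZeroPi (lam j)) (specSum π G (lam j)) (C j) / 2 : ℝ)))) := by
  set η : ℕ → ℝ≥0∞ := fun n => ((n : ℝ≥0∞) + 1)⁻¹ with hηd
  have hη0 : Tendsto η atTop (𝓝 0) := by
    have := ENNReal.tendsto_inv_nat_nhds_zero.comp (tendsto_add_atTop_nat 1)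
    refine this.congr fun n => by simp [hηd]
  have hex : ∀ n, _ := fun n => hG.exists_approx hJ hreal (η := η n)
    (ENNReal.inv_ne_zero.2 (by simp))
  choose m Gn hM hV hR hd using hex
  have hc : ∀ n, Causal4 π (Gn n) := fun n => (hM n).causal4
  refine tendsto_of_approx
    (a' := fun n i => ∫ ω, Complex.exp (Complex.I *
      ((∑ j, inner ℂ (C j) (devForm π (Gn n) w (b i) (lam j) (τ i) ω)).re : ℝ)) ∂iidLaw π)
    (L' := fun n => Complex.exp (-(windowEnergy w
        * ∑ j, limVar J (indZeroPi (lam j)) (specSum π (Gn n) (lam j)) (C j) / 2 : ℝ)))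
    (r := fun n => (∑ j, ‖C j‖ₑ ^ 2) * (Fintype.card d * approxErr π G w (η n)))
    (fun n => ?_) ?_ ?_ fun n => ?_
  · have h1 := (hM n).tendsto_charFun hw hb hbτ C lam
    rw [(hM n).varLimit_eq C w hlam hinj (hR n), mul_div_assoc, Finset.sum_div] at h1
    simpa only [(hM n).re_sum_inner_devForm] using h1
  · have hs : ∀ lam, Tendsto (fun n => specSum π (Gn n) lam) atTop (𝓝 (specSum π G lam)) := by
      intro lam
      rw [tendsto_iff_edist_tendsto_0]
      have hu : Tendsto (fun n => η n * (coeffSum π G + (coeffSum π G + η n))) atTop (𝓝 0) := by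
        have h1 := (hη0.const_add (coeffSum π G)).const_add (coeffSum π G)
        have h3 := ENNReal.Tendsto.mul hη0 (Or.inr (by simp [hG.summable])) h1 (Or.inr (by simp))
        simpa using h3
      refine tendsto_of_tendsto_of_tendsto_of_le_of_le tendsto_const_nhds hu (fun _ => zero_le)
        fun n => ?_
      dsimp only
      rw [edist_comm, edist_eq_enorm_sub]
      refine (enorm_specSum_sub_le hG (hc n) lam).trans ?_
      have := hG.coeffSum_le_add (hc n)
      have h5 := hd n
      gcongr
      exact this.trans (by gcongr)
    have h2 := tendsto_finsetSum Finset.univ fun j (_ : j ∈ Finset.univ) =>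
      (((continuous_limVar J (indZeroPi (lam j)) (C j)).tendsto _).comp (hs (lam j))).div_const 2
    have h3 := (Complex.continuous_ofReal.tendsto _).comp (h2.const_mul (windowEnergy w))
    exact (Complex.continuous_exp.tendsto _).comp h3.neg
  · have h1 := ENNReal.Tendsto.const_mul (a := ∑ j, ‖C j‖ₑ ^ 2)
      (ENNReal.Tendsto.const_mul (a := (Fintype.card d : ℝ≥0∞)) (hG.tendsto_approxErr w hη0)
        (Or.inr (by simp))) (Or.inr (by simp))
    simpa using h1
  · filter_upwards [hw.eventually_frob_le hb hbτ] with i ⟨hb0, hi⟩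
    have hmeas : ∀ {F : (ℤ → S) → H}, Causal4 π F → AEStronglyMeasurable (fun ω =>
        (∑ j, inner ℂ (C j) (devForm π F w (b i) (lam j) (τ i) ω)).re) (iidLaw π) := fun hF =>
      (Complex.continuous_re.comp_stronglyMeasurable (Finset.stronglyMeasurable_fun_sum _ fun j _ =>
        stronglyMeasurable_const.inner
          (hF.stronglyMeasurable_devForm _ _ _ _))).aestronglyMeasurable
    refine (pow_le_pow_left' (enorm_integral_exp_sub_le (hmeas hG) (hmeas (hc n))) 2).trans ?_
    simp only [← Complex.sub_re, ← Finset.sum_sub_distrib, ← inner_sub_right]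
    refine (eLpNorm_re_sum_inner_sq_le one_le_two C fun j =>
      ((hG.stronglyMeasurable_devForm _ _ _ _).sub
        ((hc n).stronglyMeasurable_devForm _ _ _ _)).aestronglyMeasurable).trans ?_
    refine mul_le_mul_right ((Finset.sum_le_sum fun j _ =>
      eLpNorm_devForm_sub_sq_le_approxErr hG (hc n) (hd n) hb0 hi (lam j)).trans ?_) _
    simp

end LimitVariance

/-! ### Tightness and identification of weak limits -/

section WeakLimits

set_option linter.unusedSectionVars false

/-! ### Tightness and characteristic functionals in Banach spaces -/

/-- If `1/(k + 1) < ε/2`, a finite `ε/2`-net of `K k` is an `ε`-net of its thickening, hence of the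
intersection. -/
theorem totallyBounded_iInter_cthickening {E : Type*} [PseudoMetricSpace E] {K : ℕ → Set E}
    (hK : ∀ k, IsCompact (K k)) :
    TotallyBounded (⋂ k : ℕ, Metric.cthickening (1 / (k + 1) : ℝ) (K k)) := by
  rw [Metric.totallyBounded_iff]
  intro ε hε
  obtain ⟨k, hk⟩ := exists_nat_one_div_lt (half_pos hε)
  obtain ⟨t, ht, hKt⟩ := Metric.totallyBounded_iff.1 (hK k).totallyBounded (ε / 2) (half_pos hε)
  refine ⟨t, ht, fun x hx => ?_⟩
  have hx' := Metric.cthickening_subset_thickening' (half_pos hε) hk (K k) (Set.mem_iInter.1 hx k)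
  obtain ⟨y, hy, hxy⟩ := Metric.mem_thickening_iff.1 hx'
  obtain ⟨z, hz, hyz⟩ := Set.mem_iUnion₂.1 (hKt hy)
  refine Set.mem_iUnion₂.2 ⟨z, hz, ?_⟩
  rw [Metric.mem_ball] at hyz ⊢
  linarith [dist_triangle x y z]

theorem measure_ge_le_of_eLpNorm_two_le {Ω E : Type*} [MeasurableSpace Ω] {μ : Measure Ω}
    [IsProbabilityMeasure μ] [NormedAddCommGroup E] {f : Ω → E} (hf : AEStronglyMeasurable f μ)
    {c δ : ℝ≥0∞} (hc : c ≠ 0) (hc' : c ≠ ∞) (h : eLpNorm f 2 μ ≤ c * δ) :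
    μ {ω | c ≤ ‖f ω‖ₑ} ≤ δ := by
  have h1 := mul_meas_ge_le_pow_eLpNorm' μ one_ne_zero ENNReal.one_ne_top hf c
  simp only [ENNReal.toReal_one, ENNReal.rpow_one] at h1
  have h2 := h1.trans ((eLpNorm_le_eLpNorm_of_exponent_le (by norm_num) hf).trans h)
  exact (ENNReal.mul_le_mul_iff_right hc hc').1 h2

/-- A family of random vectors that can be uniformly approximated in `L²` by `L²`-bounded families
with values in finite-dimensional subspaces is tight. -/
theorem isTightMeasureSet_of_finiteDimensional_approx {Ω E ι : Type*} [MeasurableSpace Ω]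
    {μ : Measure Ω} [IsProbabilityMeasure μ] [NormedAddCommGroup E] [NormedSpace ℝ E]
    [CompleteSpace E] [MeasurableSpace E] [BorelSpace E] {Z : ι → Ω → E}
    (hZ : ∀ i, StronglyMeasurable (Z i))
    (h : ∀ r : ℝ≥0∞, r ≠ 0 → ∃ (W : Submodule ℝ E) (M : ℝ≥0∞) (Y : ι → Ω → E),
      FiniteDimensional ℝ W ∧ M ≠ ∞ ∧ ∀ i, StronglyMeasurable (Y i) ∧ (∀ ω, Y i ω ∈ W) ∧
        eLpNorm (Y i) 2 μ ≤ M ∧ eLpNorm (fun ω => Z i ω - Y i ω) 2 μ ≤ r) :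
    IsTightMeasureSet (Set.range fun i => μ.map (Z i)) := by
  rw [isTightMeasureSet_iff_exists_isCompact_measure_compl_le]
  intro ε hε
  obtain ⟨δ, hδ0, hδ⟩ := ENNReal.exists_pos_sum_of_countable' hε.ne' ℕ
  have hc0 : ∀ k : ℕ, ENNReal.ofReal (1 / (k + 1)) ≠ 0 := fun k => by
    rw [Ne, ENNReal.ofReal_eq_zero, not_le]; positivity
  have hδ2 : ∀ k, δ k / 2 ≠ 0 := fun k => (ENNReal.half_pos (hδ0 k).ne').ne'
  -- At level `k` the approximation error exceeds `1/(k + 1)` with probability at most `δ k / 2`, by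
  -- Markov's inequality.
  have hex : ∀ k : ℕ, _ := fun k => h (ENNReal.ofReal (1 / (k + 1)) * (δ k / 2))
    (mul_ne_zero (hc0 k) (hδ2 k))
  choose W M Y hW hM hY using hex
  -- A radius at which Markov's inequality leaves mass at most `δ k / 2` outside the ball; the `+ 1`
  -- keeps it positive.
  have hR : ∀ k, ∃ R : ℝ, 0 < R ∧ M k ≤ ENNReal.ofReal R * (δ k / 2) := fun k => by
    refine ⟨(M k / (δ k / 2)).toReal + 1, by positivity, ?_⟩
    have hfin : M k / (δ k / 2) ≠ ∞ := ENNReal.div_ne_top (hM k) (hδ2 k)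
    have hδf : δ k / 2 ≠ ∞ := by
      have : δ k ≤ ∑' i, δ i := ENNReal.le_tsum k
      exact ne_top_of_le_ne_top (this.trans_lt (hδ.trans_le le_top)).ne ENNReal.half_le_self
    calc M k = (M k / (δ k / 2)) * (δ k / 2) := (ENNReal.div_mul_cancel (hδ2 k) hδf).symm
      _ ≤ _ := by
        gcongr
        rw [ENNReal.ofReal_add (by positivity) zero_le_one, ENNReal.ofReal_toReal hfin]
        exact le_self_add
  choose R hR0 hR using hR
  set K : ℕ → Set E := fun k => (W k : Set E) ∩ Metric.closedBall 0 (R k) with hKdef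
  have hK : ∀ k, IsCompact (K k) := fun k => by
    have := hW k
    have h1 : K k = (Subtype.val : W k → E) '' Metric.closedBall 0 (R k) := by
      ext x
      simp only [hKdef, Set.mem_inter_iff, Metric.mem_closedBall, dist_zero_right, Set.mem_image]
      constructor
      · rintro ⟨hx, hx'⟩
        exact ⟨⟨x, hx⟩, hx', rfl⟩
      · rintro ⟨y, hy, rfl⟩
        exact ⟨y.2, hy⟩
    have : ProperSpace (W k) := FiniteDimensional.proper ℝ (W k)
    rw [h1]
    exact (isCompact_closedBall _ _).image continuous_subtype_val
  set U : ℕ → Set E := fun k => Metric.cthickening (1 / (k + 1) : ℝ) (K k) with hU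
  refine ⟨⋂ k, U k, (totallyBounded_iInter_cthickening hK).isCompact_of_isClosed
    (isClosed_iInter fun k => Metric.isClosed_cthickening), ?_⟩
  rintro _ ⟨i, rfl⟩
  have hmeas : MeasurableSet (⋂ k, U k)ᶜ :=
    (isClosed_iInter fun k => Metric.isClosed_cthickening).measurableSet.compl
  rw [Measure.map_apply (hZ i).measurable hmeas]
  -- Missing the compact set means missing some `U k`, and then either the approximation at level
  -- `k` is poor or the approximant is large.
  have hsub : Z i ⁻¹' (⋂ k, U k)ᶜ ⊆ ⋃ k : ℕ, ({ω | ENNReal.ofReal (1 / (k + 1)) ≤ ‖Z i ω - Y k i ω‖ₑ}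
      ∪ {ω | ENNReal.ofReal (R k) ≤ ‖Y k i ω‖ₑ}) := by
    intro ω hω
    simp only [Set.mem_preimage, Set.mem_compl_iff, Set.mem_iInter, not_forall] at hω
    obtain ⟨k, hk⟩ := hω
    refine Set.mem_iUnion.2 ⟨k, ?_⟩
    by_contra hcon
    simp only [Set.mem_union, Set.mem_ofPred_eq, not_or, not_le, ← ofReal_norm] at hcon
    rw [ENNReal.ofReal_lt_ofReal_iff (by positivity), ENNReal.ofReal_lt_ofReal_iff (hR0 k)] at hcon
    refine hk (Metric.mem_cthickening_of_dist_le (Z i ω) (Y k i ω) _ _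
      ⟨((hY k) i).2.1 ω, by simpa using hcon.2.le⟩ ?_)
    rw [dist_eq_norm]
    exact hcon.1.le
  refine (measure_mono hsub).trans ((measure_iUnion_le _).trans (le_trans ?_ hδ.le))
  refine ENNReal.tsum_le_tsum fun k => (measure_union_le _ _).trans ?_
  obtain ⟨h1, -, h3, h4⟩ := hY k i
  rw [← ENNReal.add_halves (δ k)]
  refine add_le_add ?_ ?_
  · exact measure_ge_le_of_eLpNorm_two_le ((hZ i).sub h1).aestronglyMeasurable (hc0 k)
      ENNReal.ofReal_ne_top h4
  · exact measure_ge_le_of_eLpNorm_two_le h1.aestronglyMeasurable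
      (by rw [Ne, ENNReal.ofReal_eq_zero, not_le]; exact hR0 k) ENNReal.ofReal_ne_top
      (h3.trans (hR k))

section CharFunDual

variable {E : Type*} [NormedAddCommGroup E] [NormedSpace ℝ E] [CompleteSpace E]
  [SecondCountableTopology E] [MeasurableSpace E] [BorelSpace E]

theorem tendsto_charFunDual {ι : Type*} {l : Filter ι} {P : ι → ProbabilityMeasure E}
    {N : ProbabilityMeasure E} (h : Tendsto P l (𝓝 N)) (L : StrongDual ℝ E) :
    Tendsto (fun i => charFunDual (P i : Measure E) L) l (𝓝 (charFunDual (N : Measure E) L)) := by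
  let g : BoundedContinuousFunction E ℂ := BoundedContinuousFunction.ofNormedAddCommGroup
    (fun v => Complex.exp (L v * Complex.I)) (by fun_prop) 1 fun v => by
      rw [Complex.norm_exp_ofReal_mul_I]
  exact (ProbabilityMeasure.tendsto_iff_forall_integral_rclike_tendsto ℂ).1 h g

/-- A tight sequence whose characteristic functionals converge pointwise converges weakly. -/
theorem exists_tendsto_of_tendsto_charFunDual {P : ℕ → ProbabilityMeasure E}
    (ht : IsTightMeasureSet (Set.range fun n => (P n : Measure E))) {φ : StrongDual ℝ E → ℂ}
    (h : ∀ L, Tendsto (fun n => charFunDual (P n : Measure E) L) atTop (𝓝 (φ L))) :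
    ∃ N : ProbabilityMeasure E, (∀ L, charFunDual (N : Measure E) L = φ L) ∧
      Tendsto P atTop (𝓝 N) := by
  have hc : IsCompact (closure (Set.range P)) :=
    isCompact_closure_of_isTightMeasureSet (by
      convert ht using 1
      ext μ
      simp)
  -- Relative compactness gives a limit along every ultrafilter, and its characteristic functional
  -- must be `φ`. Since the characteristic functional determines the measure, all these limits
  -- coincide.
  have key : ∀ U : Ultrafilter ℕ, (U : Filter ℕ) ≤ atTop → ∃ N : ProbabilityMeasure E,
      (∀ L, charFunDual (N : Measure E) L = φ L) ∧ Tendsto P U (𝓝 N) := fun U hU => by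
    obtain ⟨N, -, hN⟩ := hc.ultrafilter_le_nhds (U.map P)
      (.trans (by simp) (monotone_principal subset_closure))
    have hN' : Tendsto P U (𝓝 N) := hN
    exact ⟨N, fun L => tendsto_nhds_unique (tendsto_charFunDual hN' L) ((h L).mono_left hU), hN'⟩
  obtain ⟨N, hN, -⟩ := key (Ultrafilter.of atTop) (Ultrafilter.of_le _)
  refine ⟨N, hN, (tendsto_iff_ultrafilter _ _ _).2 fun U hU => ?_⟩
  obtain ⟨N', hN', ht'⟩ := key U hU
  have : N' = N := by
    apply Subtype.ext
    have := N.2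
    have := N'.2
    exact Measure.ext_of_charFunDual (funext fun L => (hN' L).trans (hN L).symm)
  exact this ▸ ht'

/-- A probability measure with characteristic functional `exp (-V/2)`, with `V` homogeneous of
degree two along lines, is centered Gaussian with variances `V`. -/
theorem gaussian_of_charFunDual {N : Measure E} [IsProbabilityMeasure N] {V : StrongDual ℝ E → ℝ}
    (h : ∀ (t : ℝ) L, charFunDual N (t • L) = Complex.exp (-(t ^ 2 * V L / 2 : ℝ))) :
    IsGaussian N ∧ ∫ z, z ∂N = 0 ∧ ∀ L : StrongDual ℝ E, ∫ z, L z ^ 2 ∂N = V L := by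
  -- Nonnegativity of `V` is not assumed; it follows from the bound by one on characteristic
  -- functions.
  have hV0 : ∀ L, 0 ≤ V L := fun L => by
    have h1 : ‖charFunDual N L‖ ≤ 1 := by
      rw [charFunDual_eq_charFun_map_one]
      have : IsProbabilityMeasure (N.map L) :=
        Measure.isProbabilityMeasure_map L.continuous.measurable.aemeasurable
      exact norm_charFun_le_one 1
    rw [← one_smul ℝ L, h 1 L, Complex.norm_exp, ← Complex.ofReal_neg, Complex.ofReal_re, Real.exp_le_one_iff] at h1
    linarith
  have hmap : ∀ L : StrongDual ℝ E, N.map L = gaussianReal 0 (V L).toNNReal := fun L => by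
    have : IsProbabilityMeasure (N.map L) :=
      Measure.isProbabilityMeasure_map L.continuous.measurable.aemeasurable
    refine Measure.ext_of_charFun (funext fun t => ?_)
    rw [charFun_map_eq_charFunDual_smul L t, h, charFun_gaussianReal]
    congr 1
    push_cast
    rw [Real.coe_toNNReal _ (hV0 L)]
    simp only [mul_zero, zero_mul]
    ring
  have hG : IsGaussian N := isGaussian_of_map_eq_gaussianReal fun L => ⟨0, _, hmap L⟩
  have hmean : ∀ L : StrongDual ℝ E, ∫ z, L z ∂N = 0 := fun L => by
    have h1 := integral_map (μ := N) L.continuous.measurable.aemeasurable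
      (f := fun x : ℝ => x) (by fun_prop)
    rw [hmap L, integral_id_gaussianReal] at h1
    exact h1.symm
  refine ⟨hG, ?_, fun L => ?_⟩
  · refine (SeparatingDual.eq_zero_iff_forall_dual_eq_zero (R := ℝ) _).2 fun L => ?_
    exact (L.integral_comp_comm (IsGaussian.integrable_id (μ := N))).symm.trans (hmean L)
  · have h1 := variance_id_gaussianReal (μ := 0) (v := (V L).toNNReal)
    rw [← hmap L, variance_map (by fun_prop) (by fun_prop)] at h1
    have h2 := variance_of_integral_eq_zero (X := (id : ℝ → ℝ) ∘ L) (μ := N) (by fun_prop)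
      (hmean L)
    rw [h1, Real.coe_toNNReal _ (hV0 L)] at h2
    exact h2.symm

end CharFunDual

/-- A real functional is the real part of a complex one, to which the Riesz representation applies.
-/
theorem exists_re_inner_eq {E : Type*} [NormedAddCommGroup E] [InnerProductSpace ℂ E]
    [CompleteSpace E] (L : StrongDual ℝ E) : ∃ C : E, ∀ z, L z = (inner ℂ C z).re := by
  refine ⟨(InnerProductSpace.toDual ℂ E).symm (L.extendRCLike (𝕜 := ℂ)), fun z => ?_⟩
  rw [InnerProductSpace.toDual_symm_apply]
  exact (L.re_extendRCLike_apply (𝕜 := ℂ) z).symm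

theorem exists_re_sum_inner_eq {d : Type*} [Fintype d] {E : Type*} [NormedAddCommGroup E]
    [InnerProductSpace ℂ E] [CompleteSpace E] (L : StrongDual ℝ (d → E)) :
    ∃ C : d → E, ∀ z, L z = (∑ j, inner ℂ (C j) (z j)).re := by
  classical
  choose C hC using fun j => exists_re_inner_eq (L.comp (.single ℝ (fun _ : d => E) j))
  refine ⟨C, fun z => ?_⟩
  rw [← L.sum_comp_single, Complex.re_sum]
  exact Finset.sum_congr rfl fun j _ => hC j (z j)

end WeakLimits

/-! ### From variances of real functionals to covariance and pseudocovariance operators -/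

section CovarianceOperators

set_option linter.unusedSectionVars false

variable {H : Type*} [NormedAddCommGroup H] [InnerProductSpace ℂ H] [CompleteSpace H]
variable {J : H ≃ₗᵢ⋆[ℂ] H}

theorem adjoint_eq_of_symm {A B : H →L[ℂ] H} (h : ∀ x y, inner ℂ (A x) y = inner ℂ x (B y)) :
    ContinuousLinearMap.adjoint A = B := by
  ext y
  refine ext_inner_left ℂ fun x => ?_
  rw [ContinuousLinearMap.adjoint_inner_right, h]

theorem S2.kron_tens_op (x y : H) (F F' : S2 H) :
    S2.kron (S2.tens x y).op F F' = S2.tens (F.op x) (F'.op y) := by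
  apply S2.op_injective
  ext v
  simp [S2.kron, ContinuousLinearMap.adjoint_inner_right]

theorem conjOp_tens (hJ : ∀ x, J (J x) = x) (x y : H) :
    conjOp J (S2.tens x y).op = (S2.tens (J x) (J y)).op := by
  ext v
  have := inner_conj_conj J v (J y)
  rw [hJ] at this
  simp [← this, map_smulₛₗ]

theorem adjoint_tens (x y : H) :
    ContinuousLinearMap.adjoint (S2.tens x y).op = (S2.tens y x).op := by
  simp [InnerProductSpace.adjoint_rankOne]

/-- The linear part of the covariance structure. -/
def covLin (J : H ≃ₗᵢ⋆[ℂ] H) (e : ℂ) (F C : S2 H) : S2 H :=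
  S2.kron C.op F F + e • S2.kron (ContinuousLinearMap.adjoint (conjOp J C.op)) F F

/-- The antilinear part of the covariance structure. -/
def covAnti (J : H ≃ₗᵢ⋆[ℂ] H) (e : ℂ) (F C : S2 H) : S2 H :=
  S2.kron (ContinuousLinearMap.adjoint C.op) F F + e • S2.kron (conjOp J C.op) F F

theorem conjOp_add (A B : H →L[ℂ] H) : conjOp J (A + B) = conjOp J A + conjOp J B := by
  ext x; simp

theorem conjOp_smul (c : ℂ) (A : H →L[ℂ] H) : conjOp J (c • A) = conj c • conjOp J A := by
  ext x; simp [map_smulₛₗ]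

theorem covLin_add (e : ℂ) (F C D : S2 H) :
    covLin J e F (C + D) = covLin J e F C + covLin J e F D := by
  simp only [covLin, S2.op_add, conjOp_add, map_add, S2.kron_add_op, smul_add]
  abel

theorem covAnti_add (e : ℂ) (F C D : S2 H) :
    covAnti J e F (C + D) = covAnti J e F C + covAnti J e F D := by
  simp only [covAnti, S2.op_add, conjOp_add, map_add, S2.kron_add_op, smul_add]
  abel

theorem covLin_smul (e c : ℂ) (F C : S2 H) : covLin J e F (c • C) = c • covLin J e F C := by
  simp only [covLin, S2.op_smul, conjOp_smul, map_smulₛₗ, S2.kron_smul_op, smul_add,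
    RingHomCompTriple.comp_apply, RingHom.id_apply, smul_comm e c]

theorem covAnti_smul (e c : ℂ) (F C : S2 H) :
    covAnti J e F (c • C) = conj c • covAnti J e F C := by
  simp only [covAnti, S2.op_smul, conjOp_smul, map_smulₛₗ, S2.kron_smul_op, smul_add,
    smul_comm e (conj c)]

theorem limVar_eq (e : ℂ) (F C : S2 H) :
    limVar J e F C = ((inner ℂ C (covLin J e F C) + inner ℂ C (covAnti J e F C)) / 2).re := by
  simp only [limVar, covLin, covAnti, inner_add_right, inner_smul_right]
  congr 2
  ring

theorem limVar_smul_real (e : ℂ) (F C : S2 H) (c : ℝ) :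
    limVar J e F ((c : ℂ) • C) = c ^ 2 * limVar J e F C := by
  simp only [limVar_eq, covLin_smul, covAnti_smul, inner_smul_left, inner_smul_right,
    Complex.conj_ofReal]
  rw [← Complex.re_ofReal_mul]
  congr 1
  push_cast
  ring

theorem limVar_smul_spec (e : ℂ) (F C : S2 H) (c : ℝ) :
    limVar J e ((c : ℂ) • F) C = c ^ 2 * limVar J e F C := by
  simp only [limVar, S2.kron_smul, inner_smul_right, Complex.conj_ofReal]
  rw [← Complex.re_ofReal_mul]
  congr 1
  push_cast
  ring

/-- Self-adjointness of the linear part: it rests on that of `F` and, when the second term is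
present, on `F` commuting with the conjugation. For a rank-one argument both sides reduce to inner
products in `H`, and rank-one operators are enough to determine the covariance. -/
theorem inner_covLin_tens {e : ℂ} {F : S2 H} (hJ : ∀ x, J (J x) = x)
    (he : e = 0 ∨ e = 1 ∧ ∀ x, F.op (J x) = J (F.op x))
    (hF : ∀ x y, inner ℂ (F.op x) y = inner ℂ x (F.op y)) (C : S2 H) (x y : H) :
    inner ℂ C (covLin J e F (S2.tens x y)) = conj (inner ℂ (S2.tens x y) (covLin J e F C)) := by
  have hadj := adjoint_eq_of_symm hF
  rw [covLin, covLin, inner_add_right, inner_add_right, map_add, inner_smul_right, inner_smul_right,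
    map_mul]
  congr 1
  · rw [S2.kron_tens_op, S2.inner_tens_right, S2.inner_tens_left, inner_conj_symm, S2.op_kron,
      _root_.kron, hadj]
    simp [hF]
  · rcases he with rfl | ⟨rfl, he⟩
    · simp
    · rw [conjOp_tens hJ, adjoint_tens, S2.kron_tens_op, S2.inner_tens_right, S2.inner_tens_left,
        inner_conj_symm, S2.op_kron, _root_.kron, hadj, he, he]
      simp only [map_one, one_mul, ContinuousLinearMap.comp_apply]
      rw [hF, ContinuousLinearMap.adjoint_inner_left, conjOp_apply, ← inner_conj_conj J, hJ]

/-- Antilinearity makes the corresponding identity symmetric, without a conjugate; it uses the same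
two properties of `F`. -/
theorem inner_covAnti_tens {e : ℂ} {F : S2 H} (hJ : ∀ x, J (J x) = x)
    (he : e = 0 ∨ e = 1 ∧ ∀ x, F.op (J x) = J (F.op x))
    (hF : ∀ x y, inner ℂ (F.op x) y = inner ℂ x (F.op y)) (C : S2 H) (x y : H) :
    inner ℂ C (covAnti J e F (S2.tens x y)) = inner ℂ (S2.tens x y) (covAnti J e F C) := by
  have hadj := adjoint_eq_of_symm hF
  rw [covAnti, covAnti, inner_add_right, inner_add_right, inner_smul_right, inner_smul_right]
  congr 1
  · rw [adjoint_tens, S2.kron_tens_op, S2.inner_tens_right, S2.inner_tens_left, S2.op_kron,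
      _root_.kron, hadj]
    simp only [ContinuousLinearMap.comp_apply]
    rw [← hF x, ContinuousLinearMap.adjoint_inner_right]
  · rcases he with rfl | ⟨rfl, he⟩
    · simp
    · rw [conjOp_tens hJ, S2.kron_tens_op, S2.inner_tens_right, S2.inner_tens_left,
        S2.op_kron, _root_.kron, hadj, he, he]
      simp only [ContinuousLinearMap.comp_apply]
      rw [← hF, conjOp_apply, ← inner_conj_conj J, hJ]

theorem S2.enorm_conj (J : H ≃ₗᵢ⋆[ℂ] H) (A : S2 H) : ‖A.conj J‖ₑ = ‖A‖ₑ := by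
  have h : ‖A.conj J‖ₑ ^ 2 = ‖A‖ₑ ^ 2 := by
    rw [S2.enorm_sq, S2.enorm_sq, tsum_enorm_sq_adjoint (onb H) (onb H) A.op]
    have h1 : ∀ i, ‖(A.conj J).op (onb H i)‖ₑ ^ 2 = ∑' j, ‖inner ℂ
        (J.symm (ContinuousLinearMap.adjoint A.op (onb H j))) (onb H i)‖ₑ ^ 2 := fun i => by
      change ‖J (A.op (J (onb H i)))‖ₑ ^ 2 = _
      rw [← ofReal_norm, LinearIsometryEquiv.norm_map, ofReal_norm, ← tsum_enorm_inner_sq (onb H)]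
      refine tsum_congr fun j => ?_
      have h3 := inner_conj_conj J (J.symm (ContinuousLinearMap.adjoint A.op (onb H j))) (onb H i)
      rw [LinearIsometryEquiv.apply_symm_apply] at h3
      rw [← ContinuousLinearMap.adjoint_inner_left, h3, ← inner_conj_symm, RCLike.enorm_conj]
    simp_rw [h1]
    rw [ENNReal.tsum_comm]
    refine tsum_congr fun j => ?_
    have h2 := tsum_enorm_inner_sq (onb H) (J.symm (ContinuousLinearMap.adjoint A.op (onb H j)))
    rw [← ofReal_norm (J.symm _), LinearIsometryEquiv.norm_map, ofReal_norm] at h2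
    rw [← h2]
    refine tsum_congr fun i => ?_
    rw [← inner_conj_symm, RCLike.enorm_conj]
  exact le_antisymm ((ENNReal.pow_le_pow_left_iff two_ne_zero).1 h.le)
    ((ENNReal.pow_le_pow_left_iff two_ne_zero).1 h.ge)

/-- Conjugation of Hilbert–Schmidt operators as an antilinear isometry. -/
def S2.conjL (hJ : ∀ x, J (J x) = x) : S2 H ≃ₗᵢ⋆[ℂ] S2 H where
  toFun A := A.conj J
  invFun A := A.conj J
  left_inv A := by apply S2.op_injective; ext x; simp [S2.conj, hJ]
  right_inv A := by apply S2.op_injective; ext x; simp [S2.conj, hJ]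
  map_add' A B := by apply S2.op_injective; ext x; simp [S2.conj]
  map_smul' c A := by apply S2.op_injective; ext x; simp [S2.conj, map_smulₛₗ]
  norm_map' A := by
    have := congrArg ENNReal.toReal (S2.enorm_conj J A)
    simpa using this

theorem S2.conj_conj (hJ : ∀ x, J (J x) = x) (A : S2 H) : (A.conj J).conj J = A :=
  (S2.conjL hJ).left_inv A

theorem S2.inner_conj_left (hJ : ∀ x, J (J x) = x) (z C : S2 H) :
    inner ℂ (z.conj J) C = inner ℂ (C.conj J) z := by
  have := inner_conj_conj (S2.conjL hJ) z (C.conj J)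
  rw [← this]
  change _ = inner ℂ (z.conj J) ((C.conj J).conj J)
  rw [S2.conj_conj hJ]

section Moments

variable [SecondCountableTopology H] {ν : Measure (S2 H)} [IsProbabilityMeasure ν] {κ : ℝ} {e : ℂ}
  {F : S2 H}

/-- Polarization of `hV` at `D = S2.tens x y`, `C` and `D + C`. The symmetries of `covLin` and
`covAnti` identify the two mixed terms. -/
theorem integral_re_mul_re (h2 : MemLp id 2 ν)
    (hV : ∀ C : S2 H, ∫ z, (inner ℂ C z).re ^ 2 ∂ν = κ * limVar J e F C)
    (hJ : ∀ x, J (J x) = x) (he : e = 0 ∨ e = 1 ∧ ∀ x, F.op (J x) = J (F.op x))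
    (hF : ∀ x y, inner ℂ (F.op x) y = inner ℂ x (F.op y)) (C : S2 H) (x y : H) :
    ∫ z, (inner ℂ (S2.tens x y) z).re * (inner ℂ C z).re ∂ν
      = κ / 2 * (inner ℂ (S2.tens x y) (covLin J e F C)
        + inner ℂ (S2.tens x y) (covAnti J e F C)).re := by
  have hL : ∀ C : S2 H, MemLp (fun z => (inner ℂ C z).re) 2 ν := fun C =>
    ((Complex.reCLM.comp ((innerSL ℂ C).restrictScalars ℝ)).comp_memLp' h2)
  set D := S2.tens x y with hD
  have e1 : ∫ z, (inner ℂ (D + C) z).re ^ 2 ∂ν = ∫ z, (inner ℂ D z).re ^ 2 ∂ν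
      + 2 * (∫ z, (inner ℂ D z).re * (inner ℂ C z).re ∂ν) + ∫ z, (inner ℂ C z).re ^ 2 ∂ν := by
    have i1 := (hL D).integrable_sq
    have i2 := (hL C).integrable_sq
    have i3 := ((hL D).integrable_mul (hL C)).const_mul 2
    simp only [Pi.mul_apply] at i3
    have i4 : Integrable (fun z => (inner ℂ D z).re ^ 2
      + 2 * ((inner ℂ D z).re * (inner ℂ C z).re)) ν := i1.add i3
    rw [← integral_const_mul, ← integral_add i1 i3, ← integral_add i4 i2]
    refine integral_congr_ae (Eventually.of_forall fun z => ?_)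
    simp only [inner_add_left, Complex.add_re]
    ring
  rw [hV, hV, hV, limVar_eq, limVar_eq, limVar_eq, covLin_add, covAnti_add] at e1
  simp only [inner_add_left, inner_add_right] at e1
  have s1 := congrArg Complex.re (inner_covLin_tens hJ he hF C x y)
  have s2 := congrArg Complex.re (inner_covAnti_tens hJ he hF C x y)
  rw [Complex.conj_re, ← hD] at s1
  rw [← hD] at s2
  simp only [Complex.div_ofNat_re, Complex.add_re] at e1 ⊢
  rw [s1, s2] at e1
  linarith

theorem re_inner_I_smul_left (D z : S2 H) :
    (inner ℂ (Complex.I • D) z).re = (inner ℂ D z).im := by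
  simp

/-- Replacing `C` and `D` by `i C` and `i D` in the polarized identity yields all products of real
and imaginary parts. In `⟪z, C⟫ ⟪D, z⟫` the antilinear part cancels and in `⟪C, z⟫ ⟪D, z⟫` the
linear part does; the surviving part is doubled, which turns `κ / 2` into `κ`. -/
theorem integral_inner_mul_inner (h2 : MemLp id 2 ν)
    (hV : ∀ C : S2 H, ∫ z, (inner ℂ C z).re ^ 2 ∂ν = κ * limVar J e F C)
    (hJ : ∀ x, J (J x) = x) (he : e = 0 ∨ e = 1 ∧ ∀ x, F.op (J x) = J (F.op x))
    (hF : ∀ x y, inner ℂ (F.op x) y = inner ℂ x (F.op y)) (C : S2 H) (x y : H) :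
    ∫ z, inner ℂ z C * inner ℂ (S2.tens x y) z ∂ν
        = κ * inner ℂ (S2.tens x y) (covLin J e F C) ∧
      ∫ z, inner ℂ C z * inner ℂ (S2.tens x y) z ∂ν
        = κ * inner ℂ (S2.tens x y) (covAnti J e F C) := by
  have hL : ∀ C : S2 H, MemLp (fun z => inner ℂ C z) 2 ν := fun C =>
    (((innerSL ℂ C).restrictScalars ℝ).comp_memLp' h2)
  have hLr : ∀ C : S2 H, MemLp (fun z => (inner ℂ C z).re) 2 ν := fun C => (hL C).re
  have hLi : ∀ C : S2 H, MemLp (fun z => (inner ℂ C z).im) 2 ν := fun C => (hL C).im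
  have key := integral_re_mul_re h2 hV hJ he hF
  have hIx : S2.tens (Complex.I • x) y = Complex.I • S2.tens x y := S2.tens_smul_left _ _ _
  have k1 := key C x y
  have k2 := key (Complex.I • C) x y
  have k3 := key C (Complex.I • x) y
  have k4 := key (Complex.I • C) (Complex.I • x) y
  set D := S2.tens x y with hD
  rw [hIx] at k3 k4
  simp only [re_inner_I_smul_left] at k2 k3 k4
  simp only [covLin_smul, covAnti_smul, inner_smul_left, inner_smul_right, Complex.conj_I] at k2 k3 k4
  have i1 := (hLr D).integrable_mul (hLr C)
  have i2 := (hLr D).integrable_mul (hLi C)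
  have i3 := (hLi D).integrable_mul (hLr C)
  have i4 := (hLi D).integrable_mul (hLi C)
  simp only [Pi.mul_def] at i1 i2 i3 i4
  have j1 : Integrable (fun z => inner ℂ z C * inner ℂ D z) ν := by
    have := (hL C).star.integrable_mul (hL D)
    refine this.congr (Eventually.of_forall fun z => ?_)
    change star (inner ℂ C z) * inner ℂ D z = inner ℂ z C * inner ℂ D z
    rw [← inner_conj_symm z C]
    rfl
  have j2 : Integrable (fun z => inner ℂ C z * inner ℂ D z) ν := (hL C).integrable_mul (hL D)
  constructor
  · apply Complex.ext
    · have := integral_re (𝕜 := ℂ) j1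
      simp only [RCLike.re_to_complex] at this
      rw [← this]
      have e1 : ∀ z, (inner ℂ z C * inner ℂ D z : ℂ).re = (inner ℂ D z).re * (inner ℂ C z).re
          + (inner ℂ D z).im * (inner ℂ C z).im := fun z => by
        rw [← inner_conj_symm z C, Complex.mul_re, Complex.conj_re, Complex.conj_im]
        ring
      simp only [e1]
      rw [integral_add i1 i4, k1, k4]
      simp
      ring
    · have := integral_im (𝕜 := ℂ) j1
      simp only [RCLike.im_to_complex] at this
      rw [← this]
      have e1 : ∀ z, (inner ℂ z C * inner ℂ D z : ℂ).im = (inner ℂ D z).im * (inner ℂ C z).re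
          - (inner ℂ D z).re * (inner ℂ C z).im := fun z => by
        rw [← inner_conj_symm z C, Complex.mul_im, Complex.conj_re, Complex.conj_im]
        ring
      simp only [e1]
      rw [integral_sub i3 i2, k3, k2]
      simp
      ring
  · apply Complex.ext
    · have := integral_re (𝕜 := ℂ) j2
      simp only [RCLike.re_to_complex] at this
      rw [← this]
      have e1 : ∀ z, (inner ℂ C z * inner ℂ D z : ℂ).re = (inner ℂ D z).re * (inner ℂ C z).re
          - (inner ℂ D z).im * (inner ℂ C z).im := fun z => by
        rw [Complex.mul_re]
        ring
      simp only [e1]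
      rw [integral_sub i1 i4, k1, k4]
      simp
      ring
    · have := integral_im (𝕜 := ℂ) j2
      simp only [RCLike.im_to_complex] at this
      rw [← this]
      have e1 : ∀ z, (inner ℂ C z * inner ℂ D z : ℂ).im = (inner ℂ D z).im * (inner ℂ C z).re
          + (inner ℂ D z).re * (inner ℂ C z).im := fun z => by
        rw [Complex.mul_im]
        ring
      simp only [e1]
      rw [integral_add i3 i2, k3, k2]
      simp
      ring

theorem S2.ext_inner_tens {A B : S2 H}
    (h : ∀ x y, inner ℂ (S2.tens x y) A = inner ℂ (S2.tens x y) B) : A = B := by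
  apply S2.op_injective
  ext y
  refine ext_inner_left ℂ fun x => ?_
  rw [← S2.inner_tens_left, ← S2.inner_tens_left, h]

theorem continuous_rankOne {E : Type*} [NormedAddCommGroup E] [InnerProductSpace ℂ E] :
    Continuous fun p : E × E => InnerProductSpace.rankOne ℂ p.1 p.2 := by
  rw [continuous_iff_continuousAt]
  rintro ⟨f, g⟩
  rw [ContinuousAt, tendsto_iff_norm_sub_tendsto_zero]
  have key : ∀ p : E × E, ‖InnerProductSpace.rankOne ℂ p.1 p.2 - InnerProductSpace.rankOne ℂ f g‖
      ≤ ‖p.1 - f‖ * ‖p.2‖ + ‖f‖ * ‖p.2 - g‖ := by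
    intro p
    have : InnerProductSpace.rankOne ℂ p.1 p.2 - InnerProductSpace.rankOne ℂ f g
        = InnerProductSpace.rankOne ℂ (p.1 - f) p.2 + InnerProductSpace.rankOne ℂ f (p.2 - g) := by
      simp
    rw [this, ← InnerProductSpace.norm_rankOne (𝕜 := ℂ), ← InnerProductSpace.norm_rankOne (𝕜 := ℂ)]
    exact norm_add_le _ _
  refine squeeze_zero (fun _ => norm_nonneg _) key ?_
  have hc : Continuous fun p : E × E => ‖p.1 - f‖ * ‖p.2‖ + ‖f‖ * ‖p.2 - g‖ := by fun_prop
  simpa using hc.tendsto (f, g)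

theorem integrable_rankOne {α E : Type*} [MeasurableSpace α] {μ : Measure α}
    [NormedAddCommGroup E] [InnerProductSpace ℂ E] {f g : α → E} (hf : MemLp f 2 μ)
    (hg : MemLp g 2 μ) : Integrable (fun x => InnerProductSpace.rankOne ℂ (f x) (g x)) μ := by
  have h : Integrable (fun x => ‖f x‖ * ‖g x‖) μ := hf.norm.integrable_mul hg.norm
  have hm : AEStronglyMeasurable (fun x => InnerProductSpace.rankOne ℂ (f x) (g x)) μ :=
    Continuous.comp_aestronglyMeasurable (f := fun x => (f x, g x))
      (g := fun p : E × E => InnerProductSpace.rankOne ℂ p.1 p.2) continuous_rankOne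
      (hf.1.prodMk hg.1)
  have hn : ∀ x, ‖InnerProductSpace.rankOne ℂ (f x) (g x)‖ ≤ ‖f x‖ * ‖g x‖ := fun x => by
    rw [InnerProductSpace.norm_rankOne]
  exact Integrable.mono' h hm (Eventually.of_forall hn)

theorem inner_integral_rankOne {α E : Type*} [MeasurableSpace α] {μ : Measure α}
    [NormedAddCommGroup E] [InnerProductSpace ℂ E] [CompleteSpace E] {f g : α → E}
    (hf : MemLp f 2 μ) (hg : MemLp g 2 μ) (C D : E) :
    inner ℂ D ((∫ x, InnerProductSpace.rankOne ℂ (f x) (g x) ∂μ) C)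
      = ∫ x, inner ℂ (g x) C * inner ℂ D (f x) ∂μ := by
  have hi := integrable_rankOne hf hg
  rw [ContinuousLinearMap.integral_apply hi, ← integral_inner]
  · simp only [InnerProductSpace.rankOne_apply, inner_smul_right]
  · exact (ContinuousLinearMap.apply ℂ E C).integrable_comp hi

/-- The covariance and pseudocovariance operators are determined by the variances of the real
linear functionals. -/
theorem covariance_operators (h2 : MemLp id 2 ν)
    (hV : ∀ C : S2 H, ∫ z, (inner ℂ C z).re ^ 2 ∂ν = κ * limVar J e F C)
    (hJ : ∀ x, J (J x) = x) (he : e = 0 ∨ e = 1 ∧ ∀ x, F.op (J x) = J (F.op x))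
    (hF : ∀ x y, inner ℂ (F.op x) y = inner ℂ x (F.op y)) (C : S2 H) :
    ((∫ z, InnerProductSpace.rankOne ℂ z z ∂ν) C).op
        = (κ : ℂ) • (kron F.op F.op C.op + e • kronT J F.op F.op C.op) ∧
      ((∫ z, InnerProductSpace.rankOne ℂ z (z.conj J) ∂ν) C).op
        = (κ : ℂ) • (e • kron F.op F.op C.op + kronT J F.op (conjOp J F.op) C.op) := by
  have hc2 : MemLp (fun z : S2 H => z.conj J) 2 ν := by
    refine h2.of_le ((S2.conjL hJ).continuous.comp_aestronglyMeasurable h2.1)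
      (Eventually.of_forall fun z => ((S2.conjL hJ).norm_map z).le)
  constructor
  · have h1 : (∫ z, InnerProductSpace.rankOne ℂ z z ∂ν) C = (κ : ℂ) • covLin J e F C := by
      refine S2.ext_inner_tens fun x y => ?_
      rw [inner_integral_rankOne (f := fun z => z) (g := fun z => z) h2 h2, inner_smul_right]
      exact (integral_inner_mul_inner h2 hV hJ he hF C x y).1
    rw [h1]
    simp only [covLin, S2.op_smul, S2.op_add, S2.op_kron]
    congr 2
    -- The conjugate of `F` implicit in `kronT J F F` is harmless: for `e = 0` the term is absent,
    -- and for `e = 1` the operator `F` equals its conjugate.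
    rcases he with rfl | ⟨rfl, he⟩
    · simp
    · have : conjOp J F.op = F.op := by
        ext x
        rw [conjOp_apply, he, hJ]
      rw [kronT, this]
  -- Since `⟪z̄, C⟫ = ⟪C̄, z⟫`, the pseudocovariance operator is the antilinear part evaluated at
  -- the conjugate of `C`.
  · have h1 : (∫ z, InnerProductSpace.rankOne ℂ z (z.conj J) ∂ν) C
        = (κ : ℂ) • covAnti J e F (C.conj J) := by
      refine S2.ext_inner_tens fun x y => ?_
      rw [inner_integral_rankOne (f := fun z => z) h2 hc2, inner_smul_right]
      simp only [S2.inner_conj_left hJ]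
      exact (integral_inner_mul_inner h2 hV hJ he hF (C.conj J) x y).2
    have hcc : ∀ A : H →L[ℂ] H, conjOp J (conjOp J A) = A := fun A => by ext x; simp [hJ]
    rw [h1]
    have hop : (C.conj J).op = conjOp J C.op := rfl
    simp only [covAnti, S2.op_smul, S2.op_add, S2.op_kron, kronT, hop, hcc]
    rw [add_comm]

end Moments

end CovarianceOperators

/-! ### The Gaussian limit on the canonical space -/

section CanonicalLimit

set_option linter.unusedSectionVars false

variable {S : Type*} [MeasurableSpace S] {π : Measure S} [IsProbabilityMeasure π]
variable {H : Type*} [NormedAddCommGroup H] [InnerProductSpace ℂ H] [CompleteSpace H]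
variable {G : (ℤ → S) → H} {J : H ≃ₗᵢ⋆[ℂ] H}

/-! ### Symmetry of the spectral operators -/

theorem Causal4.inner_tens_autoCov (hG : Causal4 π G) (x y : H) (u : ℤ) :
    inner ℂ (S2.tens x y) (autoCov π G u)
      = ∫ ω, inner ℂ x (proc G u ω) * inner ℂ (proc G 0 ω) y ∂iidLaw π := by
  have hi : Integrable (fun ω => S2.tens (proc G u ω) (proc G 0 ω)) (iidLaw π) :=
    integrable_bilin (S2.tensL H) (hG.memLp_two_proc u) (hG.memLp_two_proc 0)
  rw [autoCov, ← integral_inner hi]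
  refine integral_congr_ae (Eventually.of_forall fun ω => ?_)
  simp only [S2.inner_tens_left, S2.op_tens, InnerProductSpace.rankOne_apply, inner_smul_right]
  ring

theorem Causal4.inner_specSum (hG : Causal4 π G) (lam : ℝ) (x y : H) :
    inner ℂ x ((specSum π G lam).op y) = ∑' u : ℤ, Complex.exp (-Complex.I * lam * u)
      * ∫ ω, inner ℂ x (proc G u ω) * inner ℂ (proc G 0 ω) y ∂iidLaw π := by
  rw [← S2.inner_tens_left, specSum]
  have := (innerSL ℂ (S2.tens x y)).map_tsum (hG.summable_spec lam)
  rw [innerSL_apply_apply] at this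
  rw [this]
  simp only [innerSL_apply_apply, inner_smul_right, hG.inner_tens_autoCov]

theorem conj_exp_neg (lam : ℝ) (u : ℤ) :
    conj (Complex.exp (-Complex.I * lam * u)) = Complex.exp (-Complex.I * lam * (-u : ℤ)) := by
  rw [← Complex.exp_conj]
  simp

/-- Stationarity shifts lag `-u` to lag `u` with the two factors exchanged, so the Fourier terms at
`u` and `-u` are adjoint to each other. -/
theorem Causal4.specSum_symm (hG : Causal4 π G) (lam : ℝ) (x y : H) :
    inner ℂ ((specSum π G lam).op x) y = inner ℂ x ((specSum π G lam).op y) := by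
  rw [← inner_conj_symm, hG.inner_specSum, hG.inner_specSum, Complex.conj_tsum]
  rw [← (Equiv.neg ℤ).tsum_eq fun u : ℤ => Complex.exp (-Complex.I * lam * u)
      * ∫ ω, inner ℂ x (proc G u ω) * inner ℂ (proc G 0 ω) y ∂iidLaw π]
  refine tsum_congr fun u => ?_
  rw [map_mul, conj_exp_neg, Equiv.neg_apply, ← integral_conj]
  congr 1
  rw [← integral_comp_shift (fun ω => inner ℂ x (proc G (-u) ω) * inner ℂ (proc G 0 ω) y) u]
  refine integral_congr_ae (Eventually.of_forall fun ω => ?_)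
  simp only [map_mul, inner_conj_symm, proc, shift_shift]
  rw [show -u + u = 0 by ring, zero_add, mul_comm]

/-- The autocovariances of a real process commute with the conjugation, and at the frequencies `0`
and `π` the Fourier weights are real. -/
theorem Causal4.specSum_conj (hG : Causal4 π G) (hJ : ∀ x, J (J x) = x) {lam : ℝ}
    (hlam : lam = 0 ∨ lam = Real.pi) (hreal : ∀ ω, J (G ω) = G ω) (y : H) :
    (specSum π G lam).op (J y) = J ((specSum π G lam).op y) := by
  refine ext_inner_left ℂ fun x => ?_
  have h1 : inner ℂ x (J ((specSum π G lam).op y))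
      = conj (inner ℂ (J x) ((specSum π G lam).op y)) := by
    have := inner_conj_conj J (J x) ((specSum π G lam).op y)
    rw [hJ] at this
    rw [this, inner_conj_symm]
  have hp : ∀ u ω, J (proc G u ω) = proc G u ω := fun u ω => hreal _
  rw [h1, hG.inner_specSum, hG.inner_specSum, Complex.conj_tsum]
  refine tsum_congr fun u => ?_
  rw [map_mul, conj_exp_neg, ← integral_conj, exp_neg_eq_of_mem_zero_pi hlam]
  congr 1
  · congr 1
    push_cast
    ring
  · refine integral_congr_ae (Eventually.of_forall fun ω => ?_)
    simp only [map_mul, inner_conj_symm]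
    congr 1
    · rw [← inner_conj_conj J, hp]
    · rw [← inner_conj_conj J, hJ, hp]

/-! ### Tightness -/

/-- The tensors of vectors of `V` span a finite-dimensional real space, real because `⊗` is only
real bilinear. It contains the forms and, being closed and convex, their means. One subspace serves
all windows, bandwidths, frequencies and lengths, as tightness requires. -/
theorem MDep.exists_finiteDimensional {m : ℕ} (hG : MDep π m G) {V : Submodule ℂ H}
    (hV : FiniteDimensional ℂ V) (hGV : ∀ ω, G ω ∈ V) :
    ∃ W : Submodule ℝ (S2 H), FiniteDimensional ℝ W ∧
      ∀ w b lam τ ω, devForm π G w b lam τ ω ∈ W := by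
  set VR : Submodule ℝ H := V.restrictScalars ℝ with hVR
  have hfd : FiniteDimensional ℝ VR := FiniteDimensional.complexToReal V
  have hfg : VR.FG := (Submodule.fg_iff_finiteDimensional _).2 hfd
  set W : Submodule ℝ (S2 H) := Submodule.map₂ (S2.tensL H).toLinearMap₁₂ VR VR with hW
  have hWfd : FiniteDimensional ℝ W :=
    (Submodule.fg_iff_finiteDimensional _).1 (hfg.map₂ _ hfg)
  have hq : ∀ α I ω, quadForm α I (proc G) (proc G) ω ∈ W := fun α I ω => by
    refine Submodule.sum_mem _ fun s _ => Submodule.sum_mem _ fun t _ => ?_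
    rw [← S2.tens_smul_left]
    exact Submodule.apply_mem_map₂ (S2.tensL H).toLinearMap₁₂
      (V.smul_mem _ (hGV _) : α s t • proc G s ω ∈ VR) (hGV _ : proc G t ω ∈ VR)
  refine ⟨W, hWfd, fun w b lam τ ω => W.smul_mem _ (W.sub_mem (hq _ _ _) ?_)⟩
  exact W.convex.integral_mem W.closed_of_finiteDimensional
    (Eventually.of_forall fun ω' => hq _ _ _) ((hG.bddMeas_quadForm _ _).integrable _)

theorem eLpNorm_pi_le {Ω E d : Type*} [MeasurableSpace Ω] {μ : Measure Ω} [NormedAddCommGroup E]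
    [Fintype d] {p : ℝ≥0∞} (hp : 1 ≤ p) {f : d → Ω → E} (hf : ∀ j, AEStronglyMeasurable (f j) μ) :
    eLpNorm (fun ω j => f j ω) p μ ≤ ∑ j, eLpNorm (f j) p μ := by
  calc eLpNorm (fun ω j => f j ω) p μ ≤ eLpNorm (∑ j, fun ω => ‖f j ω‖) p μ := by
        refine eLpNorm_mono_real fun ω => ?_
        rw [Finset.sum_apply]
        refine (pi_norm_le_iff_of_nonneg (Finset.sum_nonneg fun j _ => norm_nonneg _)).2 fun j => ?_
        exact Finset.single_le_sum (f := fun j => ‖f j ω‖) (fun j _ => norm_nonneg _)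
          (Finset.mem_univ j)
    _ ≤ ∑ j, eLpNorm (fun ω => ‖f j ω‖) p μ := eLpNorm_sum_le (fun j _ => (hf j).norm) hp
    _ = _ := by simp only [eLpNorm_norm]

variable {d : Type*} [Fintype d]

variable (π) in
/-- The vector of normalized deviations of the spectral density estimators. -/
def specDev (G : (ℤ → S) → H) (w : ℝ → ℝ) (b : ℝ) (lam : d → ℝ) (τ : ℕ) (ω : ℤ → S) (j : d) : S2 H :=
  (1 / (2 * Real.pi) : ℝ) • devForm π G w b (lam j) τ ω

theorem enorm_one_div_two_pi_le : ‖(1 / (2 * Real.pi) : ℝ)‖ₑ ≤ 1 := by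
  rw [Real.enorm_of_nonneg (by positivity), ENNReal.ofReal_le_one, div_le_one (by positivity)]
  linarith [Real.pi_gt_three]

theorem Causal4.stronglyMeasurable_specDev (hG : Causal4 π G) (w : ℝ → ℝ) (b : ℝ) (lam : d → ℝ)
    (τ : ℕ) [SecondCountableTopology H] : StronglyMeasurable (specDev π G w b lam τ) :=
  (measurable_pi_lambda _ fun j => ((hG.stronglyMeasurable_devForm w b (lam j) τ).const_smul
    (1 / (2 * Real.pi) : ℝ)).measurable).stronglyMeasurable

theorem ENNReal.le_add_one_of_sq_le {a B : ℝ≥0∞} (h : a ^ 2 ≤ B) : a ≤ B + 1 := by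
  rcases le_total a 1 with h1 | h1
  · exact h1.trans le_add_self
  · refine (le_trans ?_ h).trans le_self_add
    calc a = a * 1 := (mul_one a).symm
      _ ≤ a * a := by gcongr
      _ = a ^ 2 := (sq a).symm

/-- A single finite-rank approximation of the process works for all `i`, because the error bound
`approxErr` involves the bandwidth and the length only through the assumed bound on the window
energy. -/
theorem Causal4.isTight_specDev (hG : Causal4 π G) {w : ℝ → ℝ} {ι : Type*} {b : ι → ℝ}
    {τ : ι → ℕ} (lam : d → ℝ)
    (h : ∀ i, 0 < b i ∧ b i / τ i * windowFrob w (b i) (τ i) ≤ windowEnergy w + 1)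
    [SecondCountableTopology H] :
    IsTightMeasureSet (Set.range fun i => (iidLaw π).map (specDev π G w (b i) lam (τ i))) := by
  refine isTightMeasureSet_of_finiteDimensional_approx
    (fun i => hG.stronglyMeasurable_specDev _ _ _ _) fun r hr => ?_
  -- The error is shared among the components; the `+ 1` covers an empty index type.
  set r' : ℝ≥0∞ := r / (Fintype.card d + 1) with hr'
  have hr'0 : r' ≠ 0 := (ENNReal.div_pos hr (by simp)).ne'
  have hη : Tendsto (fun n : ℕ => ((n : ℝ≥0∞) + 1)⁻¹) atTop (𝓝 0) := by
    have := ENNReal.tendsto_inv_nat_nhds_zero.comp (tendsto_add_atTop_nat 1)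
    exact this.congr fun n => by simp
  obtain ⟨n, hn⟩ := ((hG.tendsto_approxErr w hη).eventually
    (gt_mem_nhds (ENNReal.pow_pos (pos_iff_ne_zero.2 hr'0) 2))).exists
  obtain ⟨m, G', hM, ⟨V, hV, hGV⟩, -, hd⟩ := exists_mdep_approx hG.meas hG.memLp
    hG.mean hG.dep hG.summable (ContinuousLinearMap.id ℝ H) (fun x => le_rfl) (fun x => rfl)
    (fun ω => rfl) (η := ((n : ℝ≥0∞) + 1)⁻¹) (ENNReal.inv_ne_zero.2 (by simp))
  have hG' := hM.causal4
  obtain ⟨W, hW, hdev⟩ := hM.exists_finiteDimensional hV hGV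
  let Φ : (d → W) →ₗ[ℝ] (d → S2 H) := LinearMap.pi fun j => W.subtype ∘ₗ LinearMap.proj j
  refine ⟨LinearMap.range Φ, ∑ _j : d, (ENNReal.ofReal (windowEnergy w + 1)
    * (256 * coeffSum π G' ^ 4) + 1), fun i => specDev π G' w (b i) lam (τ i), inferInstance, ?_,
    fun i => ⟨hG'.stronglyMeasurable_specDev _ _ _ _, fun ω => ?_, ?_, ?_⟩⟩
  · have := hG'.summable
    refine ENNReal.sum_ne_top.2 fun j _ => ENNReal.add_ne_top.2 ⟨ENNReal.mul_ne_top
      ENNReal.ofReal_ne_top (ENNReal.mul_ne_top (by simp) (ENNReal.pow_ne_top this)), by simp⟩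
  · exact ⟨fun j => ⟨specDev π G' w (b i) lam (τ i) ω j, W.smul_mem _ (hdev _ _ _ _ _)⟩, rfl⟩
  · refine (eLpNorm_pi_le one_le_two fun j => ((hG'.stronglyMeasurable_devForm w (b i) (lam j)
      (τ i)).const_smul (1 / (2 * Real.pi) : ℝ)).aestronglyMeasurable).trans
      (Finset.sum_le_sum fun j _ => ?_)
    rw [eLpNorm_const_smul]
    refine (mul_le_of_le_one_left' enorm_one_div_two_pi_le).trans
      (ENNReal.le_add_one_of_sq_le ((eLpNorm_devForm_sq_le hG' w (h i).1.le _ _).trans ?_))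
    gcongr
    exact (h i).2
  · have e : (fun ω => specDev π G w (b i) lam (τ i) ω - specDev π G' w (b i) lam (τ i) ω)
        = fun ω j => ((1 / (2 * Real.pi) : ℝ) • fun ω => devForm π G w (b i) (lam j) (τ i) ω
          - devForm π G' w (b i) (lam j) (τ i) ω) ω := by
      funext ω j
      simp only [specDev, Pi.sub_apply, Pi.smul_apply, smul_sub]
    rw [e]
    refine (eLpNorm_pi_le one_le_two fun j =>
      (((hG.stronglyMeasurable_devForm w (b i) (lam j) (τ i)).sub
      (hG'.stronglyMeasurable_devForm w (b i) (lam j) (τ i))).const_smul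
        (1 / (2 * Real.pi) : ℝ)).aestronglyMeasurable).trans ?_
    calc _ ≤ ∑ _j : d, r' := by
          refine Finset.sum_le_sum fun j _ => ?_
          rw [eLpNorm_const_smul]
          refine (mul_le_of_le_one_left' enorm_one_div_two_pi_le).trans ?_
          refine (ENNReal.pow_le_pow_left_iff two_ne_zero).1 (le_trans ?_ hn.le)
          exact eLpNorm_devForm_sub_sq_le_approxErr hG hG' hd (h i).1 (h i).2 (lam j)
      _ ≤ (Fintype.card d + 1) * r' := by
          rw [Finset.sum_const, nsmul_eq_mul, Finset.card_univ]
          gcongr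
          exact le_self_add
      _ ≤ r := ENNReal.mul_div_le

/-! ### The Gaussian limit -/

/-- The real linear functional `z ↦ Re ∑ ⟪Cⱼ, zⱼ⟫`. -/
def reInnerL {E : Type*} [NormedAddCommGroup E] [InnerProductSpace ℂ E] (C : d → E) :
    StrongDual ℝ (d → E) :=
  ∑ j, (Complex.reCLM.comp ((innerSL ℂ (C j)).restrictScalars ℝ)).comp
    (ContinuousLinearMap.proj (R := ℝ) (φ := fun _ : d => E) j)

theorem reInnerL_apply {E : Type*} [NormedAddCommGroup E] [InnerProductSpace ℂ E] (C z : d → E) :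
    reInnerL C z = (∑ j, inner ℂ (C j) (z j)).re := by
  simp [reInnerL, Complex.re_sum]

theorem exists_reInnerL_eq {E : Type*} [NormedAddCommGroup E] [InnerProductSpace ℂ E]
    [CompleteSpace E] (L : StrongDual ℝ (d → E)) : ∃ C : d → E, L = reInnerL C := by
  obtain ⟨C, hC⟩ := exists_re_sum_inner_eq L
  exact ⟨C, ContinuousLinearMap.ext fun z => by rw [hC, reInnerL_apply]⟩

theorem eventually_bandwidth {b : ℕ → ℝ} (hb : Tendsto b atTop (𝓝 0))
    (hbT : Tendsto (fun T : ℕ => b T * T) atTop atTop) : Tendsto b atTop (𝓝[>] 0) := by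
  refine tendsto_nhdsWithin_iff.2 ⟨hb, ?_⟩
  filter_upwards [hbT.eventually_gt_atTop 0] with T hT
  exact pos_of_mul_pos_left hT (Nat.cast_nonneg T)

variable {w : ℝ → ℝ} {lam : d → ℝ}

/-- Tightness is available only from some `T₀` on, where the normalized window energy is at most `κ²
+ 1`, so the compactness argument is run for the sequence shifted by `T₀`. The factor `1/(2π)` is
first absorbed into `C`; the variance is homogeneous of degree two in both arguments, which moves it
to the spectral operator. -/
theorem Causal4.exists_limit [SecondCountableTopology H] (hG : Causal4 π G)
    (hJ : ∀ x, J (J x) = x) (hw : LagWindow w) (hlam : ∀ j, lam j ∈ Set.Icc 0 Real.pi)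
    (hinj : Function.Injective lam)
    (hreal : (∃ j, lam j = 0 ∨ lam j = Real.pi) → ∀ ω, J (G ω) = G ω) {b : ℕ → ℝ}
    (hb : Tendsto b atTop (𝓝 0)) (hbT : Tendsto (fun T : ℕ => b T * T) atTop atTop) :
    ∃ N : ProbabilityMeasure (d → S2 H), (∀ C : d → S2 H, charFunDual (N : Measure (d → S2 H))
        (reInnerL C) = Complex.exp (-(windowEnergy w * ∑ j, limVar J (indZeroPi (lam j))
          (((1 / (2 * Real.pi) : ℝ) : ℂ) • specSum π G (lam j)) (C j) / 2 : ℝ))) ∧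
      TendstoInDistribution (fun T ω => specDev π G w (b T) lam T ω) atTop (fun z => z)
        (fun _ => iidLaw π) (N : Measure (d → S2 H)) := by
  have hb' := eventually_bandwidth hb hbT
  obtain ⟨T₀, hT₀⟩ := eventually_atTop.1 (hw.eventually_frob_le hb' hbT)
  have hmeas : ∀ T, Measurable (specDev π G w (b T) lam T) := fun T =>
    (hG.stronglyMeasurable_specDev w (b T) lam T).measurable
  let P : ℕ → ProbabilityMeasure (d → S2 H) := fun T =>
    ⟨(iidLaw π).map (specDev π G w (b T) lam T),
      Measure.isProbabilityMeasure_map (hmeas T).aemeasurable⟩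
  have ht : IsTightMeasureSet (Set.range fun n => (P (n + T₀) : Measure (d → S2 H))) :=
    hG.isTight_specDev (b := fun n => b (n + T₀)) (τ := fun n => n + T₀) lam
      fun n => hT₀ (n + T₀) (Nat.le_add_left _ _)
  have hchar : ∀ C : d → S2 H, Tendsto (fun T => charFunDual (P T : Measure (d → S2 H))
      (reInnerL C)) atTop (𝓝 (Complex.exp (-(windowEnergy w * ∑ j, limVar J (indZeroPi (lam j))
          (((1 / (2 * Real.pi) : ℝ) : ℂ) • specSum π G (lam j)) (C j) / 2 : ℝ)))) := fun C => by
    have h1 := hG.tendsto_charFun (τ := fun T => T) hJ hw hb' hbT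
      (fun j => ((1 / (2 * Real.pi) : ℝ) : ℂ) • C j) hlam hinj hreal
    simp only [limVar_smul_real, ← limVar_smul_spec] at h1
    refine h1.congr fun T => ?_
    rw [charFunDual_apply]
    change _ = ∫ v, Complex.exp (reInnerL C v * Complex.I)
      ∂((iidLaw π).map (specDev π G w (b T) lam T))
    rw [integral_map (hmeas T).aemeasurable
      (by fun_prop : Continuous fun v : d → S2 H =>
        Complex.exp (reInnerL C v * Complex.I)).aestronglyMeasurable]
    refine integral_congr_ae (Eventually.of_forall fun ω => ?_)
    dsimp only
    rw [mul_comm, reInnerL_apply]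
    simp only [specDev, inner_smul_left, Complex.conj_ofReal, ← Complex.coe_smul, inner_smul_right]
  choose Cf hCf using fun L : StrongDual ℝ (d → S2 H) => exists_reInnerL_eq L
  obtain ⟨N, hN, hlim⟩ := exists_tendsto_of_tendsto_charFunDual ht
    (φ := fun L => Complex.exp (-(windowEnergy w * ∑ j, limVar J (indZeroPi (lam j))
          (((1 / (2 * Real.pi) : ℝ) : ℂ) • specSum π G (lam j)) (Cf L j) / 2 : ℝ)))
    fun L => by
      have := (hchar (Cf L)).comp (tendsto_add_atTop_nat T₀)
      rwa [← hCf L] at this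
  have hlim' : Tendsto P atTop (𝓝 N) := (tendsto_add_atTop_iff_nat T₀).1 hlim
  refine ⟨N, fun C => tendsto_nhds_unique (tendsto_charFunDual hlim' _) (hchar C),
    ⟨fun T => (hmeas T).aemeasurable, aemeasurable_id, ?_⟩⟩
  have hid : ∀ h, (⟨(N : Measure (d → S2 H)).map fun z => z, h⟩ :
      ProbabilityMeasure (d → S2 H)) = N := fun _ => Subtype.ext Measure.map_id
  rw [hid]
  exact hlim'

theorem limVar_zero (e : ℂ) (F : S2 H) : limVar J e F 0 = 0 := by
  have := limVar_smul_real (J := J) e F 0 0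
  simpa using this

theorem re_inner_left_injective {E : Type*} [NormedAddCommGroup E] [InnerProductSpace ℂ E]
    {C C' : E} (h : ∀ z, (inner ℂ C z).re = (inner ℂ C' z).re) : C = C' := by
  have h1 := h (C - C')
  rw [← sub_eq_zero, ← Complex.sub_re, ← inner_sub_left] at h1
  exact sub_eq_zero.1 (inner_self_eq_zero.1 (by
    apply Complex.ext
    · exact h1
    · exact inner_self_im (𝕜 := ℂ) (C - C')))

/-- The joint limit of the lag-window estimators of a process on the canonical space. -/
theorem Causal4.exists_gaussian_limit [SecondCountableTopology H] (hG : Causal4 π G)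
    (hJ : ∀ x, J (J x) = x) (hw : LagWindow w) (hlam : ∀ j, lam j ∈ Set.Icc 0 Real.pi)
    (hinj : Function.Injective lam)
    (hreal : (∃ j, lam j = 0 ∨ lam j = Real.pi) → ∀ ω, J (G ω) = G ω) {F : d → S2 H}
    (hF : ∀ j, F j = ((1 / (2 * Real.pi) : ℝ) : ℂ) • specSum π G (lam j)) :
    ∃ ν : d → ProbabilityMeasure (S2 H),
      (∀ j, IsCenteredComplexGaussian J (ν j : Measure (S2 H))
        (fun C => (windowEnergy w : ℂ) • (kron (F j).op (F j).op C
            + indZeroPi (lam j) • kronT J (F j).op (F j).op C))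
        (fun C => (windowEnergy w : ℂ) • (indZeroPi (lam j) • kron (F j).op (F j).op C
            + kronT J (F j).op (conjOp J (F j).op) C))) ∧
      ∀ b : ℕ → ℝ, Tendsto b atTop (𝓝 0) → Tendsto (fun T : ℕ => b T * T) atTop atTop →
        TendstoInDistribution (fun T ω => specDev π G w (b T) lam T ω) atTop (fun z => z)
          (fun _ => iidLaw π) (Measure.pi fun j => (ν j : Measure (S2 H))) := by
  classical
  -- The laws have to be fixed before the bandwidth is given. They are read off from one admissible
  -- bandwidth; for any other, the limit has the same characteristic functional.
  set b₀ : ℕ → ℝ := fun T => 1 / √T with hb₀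
  have hs : Tendsto (fun T : ℕ => √(T : ℝ)) atTop atTop :=
    Real.tendsto_sqrt_atTop.comp tendsto_natCast_atTop_atTop
  have h₀ : Tendsto b₀ atTop (𝓝 0) := by
    refine hs.inv_tendsto_atTop.congr fun T => ?_
    simp [hb₀]
  have h₁ : Tendsto (fun T : ℕ => b₀ T * T) atTop atTop := by
    refine hs.congr fun T => ?_
    rw [hb₀, one_div_mul_eq_div, Real.div_sqrt]
  obtain ⟨N, hN, -⟩ := hG.exists_limit hJ hw hlam hinj hreal h₀ h₁
  simp only [← hF] at hN
  have hNp : IsProbabilityMeasure (N : Measure (d → S2 H)) := N.2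
  let ν : d → ProbabilityMeasure (S2 H) := fun j =>
    ⟨(N : Measure (d → S2 H)).map fun z => z j,
      Measure.isProbabilityMeasure_map (measurable_pi_apply j).aemeasurable⟩
  have hνc : ∀ j (L : StrongDual ℝ (S2 H)) (C : S2 H), (∀ z, L z = (inner ℂ C z).re) →
      charFunDual (ν j : Measure (S2 H)) L = Complex.exp (-(windowEnergy w
        * limVar J (indZeroPi (lam j)) (F j) C / 2 : ℝ)) := fun j L C hC => by
    have h1 : charFunDual (ν j : Measure (S2 H)) L = charFunDual (N : Measure (d → S2 H))
        (L.comp (ContinuousLinearMap.proj (R := ℝ) (φ := fun _ : d => S2 H) j)) :=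
      charFunDual_map (ContinuousLinearMap.proj (R := ℝ) (φ := fun _ : d => S2 H) j) L
    have h2 : L.comp (ContinuousLinearMap.proj (R := ℝ) (φ := fun _ : d => S2 H) j)
        = reInnerL (Pi.single j C) := by
      refine ContinuousLinearMap.ext fun z => ?_
      rw [reInnerL_apply, Finset.sum_eq_single j]
      · simpa using hC (z j)
      · intro k _ hk
        simp [hk]
      · simp
    rw [h1, h2, hN, Finset.sum_eq_single j]
    · rw [Pi.single_eq_same, mul_div_assoc]
    · intro k _ hk
      simp [hk, limVar_zero]
    · simp
  -- The characteristic functional is a product over `j`, so the joint limit is the product of its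
  -- marginals. This is the independence of the limits at different frequencies.
  have hpi : (N : Measure (d → S2 H)) = Measure.pi fun j => (ν j : Measure (S2 H)) := by
    refine Measure.ext_of_charFunDual (funext fun L => ?_)
    obtain ⟨C, rfl⟩ := exists_reInnerL_eq L
    rw [charFunDual_pi, hN]
    have h3 : ∀ j, charFunDual (ν j : Measure (S2 H)) ((reInnerL C).comp
        (.single ℝ (fun _ : d => S2 H) j)) = Complex.exp (-(windowEnergy w
        * limVar J (indZeroPi (lam j)) (F j) (C j) / 2 : ℝ)) := fun j => hνc j _ (C j) fun z => by
      rw [ContinuousLinearMap.comp_apply, reInnerL_apply, Finset.sum_eq_single j]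
      · simp
      · intro k _ hk
        simp [hk]
      · simp
    simp only [h3]
    rw [← Complex.exp_sum]
    congr 1
    push_cast
    rw [Finset.mul_sum, Finset.sum_neg_distrib]
    simp only [mul_div_assoc]
  refine ⟨ν, fun j => ?_, fun b hb hbT => ?_⟩
  · have hνp : IsProbabilityMeasure (ν j : Measure (S2 H)) := (ν j).2
    choose Cf hCf using fun L : StrongDual ℝ (S2 H) => exists_re_inner_eq L
    obtain ⟨hGauss, hmean, hvar⟩ := gaussian_of_charFunDual (N := (ν j : Measure (S2 H)))
      (V := fun L => windowEnergy w * limVar J (indZeroPi (lam j)) (F j) (Cf L)) fun t L => by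
        rw [hνc j (t • L) ((t : ℂ) • Cf L) fun z => by
          rw [smul_apply, hCf L z, inner_smul_left, Complex.conj_ofReal,
            Complex.re_ofReal_mul, smul_eq_mul], limVar_smul_real]
        congr 4
        ring
    have hV : ∀ C : S2 H, ∫ z, (inner ℂ C z).re ^ 2 ∂(ν j : Measure (S2 H))
        = windowEnergy w * limVar J (indZeroPi (lam j)) (F j) C := fun C => by
      have h4 := hvar (Complex.reCLM.comp ((innerSL ℂ C).restrictScalars ℝ))
      have h5 : Cf (Complex.reCLM.comp ((innerSL ℂ C).restrictScalars ℝ)) = C :=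
        re_inner_left_injective fun z => (hCf _ z).symm
      rw [h5] at h4
      exact h4
    have he : indZeroPi (lam j) = 0 ∨ indZeroPi (lam j) = 1 ∧ ∀ x, (F j).op (J x) = J ((F j).op x) := by
      rw [indZeroPi_eq]
      by_cases h : lam j = 0 ∨ lam j = Real.pi
      · refine Or.inr ⟨if_pos h, fun x => ?_⟩
        rw [hF, S2.op_smul, smul_apply, smul_apply,
          hG.specSum_conj hJ h (hreal ⟨j, h⟩), map_smulₛₗ, Complex.conj_ofReal]
      · exact Or.inl (if_neg h)
    have hsymm : ∀ x y, inner ℂ ((F j).op x) y = inner ℂ x ((F j).op y) := fun x y => by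
      rw [hF, S2.op_smul, smul_apply, smul_apply,
        inner_smul_left, inner_smul_right, hG.specSum_symm, Complex.conj_ofReal]
    have hcov := covariance_operators (IsGaussian.memLp_two_id (μ := (ν j : Measure (S2 H))))
      hV hJ he hsymm
    exact ⟨hGauss, hmean, fun C => (hcov C).1, fun C => (hcov C).2⟩
  · obtain ⟨N', hN', hlim⟩ := hG.exists_limit hJ hw hlam hinj hreal hb hbT
    simp only [← hF] at hN'
    have hN'p : IsProbabilityMeasure (N' : Measure (d → S2 H)) := N'.2
    have : (N' : Measure (d → S2 H)) = Measure.pi fun j => (ν j : Measure (S2 H)) := by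
      rw [← hpi]
      refine Measure.ext_of_charFunDual (funext fun L => ?_)
      obtain ⟨C, rfl⟩ := exists_reInnerL_eq L
      rw [hN', hN]
    simpa only [this] using hlim

end CanonicalLimit

/-! ### Transfer from the given probability space to the canonical one -/

section Transfer

set_option linter.unusedSectionVars false

variable {Ω S : Type*} [MeasurableSpace Ω] [MeasurableSpace S] {μ : Measure Ω}
  [IsProbabilityMeasure μ] {π : Measure S} [IsProbabilityMeasure π] {ε ε' : ℤ → Ω → S}

/-- The path of a process. -/
def path (ε : ℤ → Ω → S) (ω : Ω) : ℤ → S := fun t => ε t ω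

/-- `(ε, ε')` has the law of two independent i.i.d. sequences with marginal `π`. -/
structure IIDModel (μ : Measure Ω) (ε ε' : ℤ → Ω → S) (π : Measure S)
    [IsProbabilityMeasure π] : Prop where
  measurable : ∀ t, Measurable (ε t)
  measurable_copy : ∀ t, Measurable (ε' t)
  map_prod : μ.map (fun ω => (path ε ω, path ε' ω)) = (iidLaw π).prod (iidLaw π)

theorem measurable_path (h : ∀ t, Measurable (ε t)) : Measurable (path ε) :=
  measurable_pi_lambda _ h

theorem IsIIDWithCopy.exists_model (h : IsIIDWithCopy μ ε ε') :
    ∃ (π : Measure S) (_ : IsProbabilityMeasure π), IIDModel μ ε ε' π := by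
  have hπ : IsProbabilityMeasure (μ.map (ε 0)) :=
    Measure.isProbabilityMeasure_map (h.measurable 0).aemeasurable
  refine ⟨μ.map (ε 0), hπ, h.measurable, h.measurable_copy, ?_⟩
  have h1 : μ.map (path ε) = iidLaw (μ.map (ε 0)) := by
    have := h.indep.map_fun_eq_infinitePi_map h.measurable
    rw [show μ.map (path ε) = _ from this, iidLaw]
    congr 1
    funext t
    exact (h.ident t).map_eq
  have h2 : μ.map (path ε') = iidLaw (μ.map (ε 0)) := h.ident_copy.map_eq.trans h1
  have h3 := (indepFun_iff_map_prod_eq_prod_map_map (measurable_path h.measurable).aemeasurable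
    (measurable_path h.measurable_copy).aemeasurable).1 h.indep_copy
  rw [h1, h2] at h3
  exact h3

theorem IIDModel.measurePreserving (h : IIDModel μ ε ε' π) :
    MeasurePreserving (path ε) μ (iidLaw π) := by
  refine ⟨measurable_path h.measurable, ?_⟩
  have h1 := congrArg (Measure.map Prod.fst) h.map_prod
  rw [Measure.map_map measurable_fst ((measurable_path h.measurable).prodMk
    (measurable_path h.measurable_copy)), Measure.map_fst_prod, measure_univ, one_smul] at h1
  exact h1

/-- Freezing the future at a fixed sequence `x₀` presents the past as a single random element of the
sequence space, so its events are preimages of measurable sets of sequences. -/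
theorem pastSigma_eq_comap (V : ℤ → Ω → S) (t : ℤ) (x₀ : ℤ → S) :
    pastSigma V t = MeasurableSpace.comap (fun ω => mer (Set.Iic t) (path V ω) x₀)
      inferInstance := by
  refine le_antisymm (iSup_le fun k => measurable_iff_comap_le.1 ?_) (measurable_iff_comap_le.1 ?_)
  · have : V (t - k) = (fun x : ℤ → S => x (t - k)) ∘ fun ω => mer (Set.Iic t) (path V ω) x₀ := by
      funext ω
      exact (mer_of_mem (A := Set.Iic t) (Set.mem_Iic.2 (by omega)) (path V ω) x₀).symm
    rw [this]
    exact (measurable_pi_apply _).comp (comap_measurable _)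
  · refine @measurable_pi_lambda _ ℤ (fun _ => S) (pastSigma V t) _ _ fun i => ?_
    by_cases hi : i ≤ t
    · simp only [mer_of_mem (Set.mem_Iic.2 hi)]
      obtain ⟨k, hk⟩ := Int.eq_ofNat_of_zero_le (sub_nonneg.2 hi)
      obtain rfl : i = t - k := by omega
      exact measurable_iff_comap_le.2
        (le_iSup (fun k : ℕ => MeasurableSpace.comap (V (t - k)) inferInstance) k)
    · simp only [mer_of_notMem (mt Set.mem_Iic.1 hi)]
      exact measurable_const

variable {E : Type*} [NormedAddCommGroup E] [NormedSpace ℝ E] [CompleteSpace E]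
  {f : (ℤ → S) → E}

/-- Membership in `D` is unchanged when the coordinates off `A` are redrawn, so the indicator of `D`
passes through the average. -/
theorem setIntegral_condE {A : Set ℤ} (hf : Integrable f (iidLaw π)) {D : Set (ℤ → S)}
    (hD : MeasurableSet D) (hdep : DependsOn (· ∈ D) A) :
    ∫ ω in D, condE π A f ω ∂iidLaw π = ∫ ω in D, f ω ∂iidLaw π := by
  have h : D.indicator (condE π A f) = condE π A (D.indicator f) := by
    funext ω
    have h1 : ∀ ω', mer A ω ω' ∈ D ↔ ω ∈ D := fun ω' =>
      iff_of_eq (DependsOn.apply_mer hdep le_rfl ω ω')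
    by_cases h2 : ω ∈ D
    · simp [condE, h1, h2, Set.indicator]
    · simp [condE, h1, h2, Set.indicator]
  rw [← integral_indicator hD, h, integral_condE _ (hf.indicator hD), integral_indicator hD]

/-- The conditional expectation given the past of a sequence that agrees with `ε` on `B` and with
its copy off `B`. -/
theorem IIDModel.condExp_eq (h : IIDModel μ ε ε' π) (B : Set ℤ) (t : ℤ)
    (hf : StronglyMeasurable f) (hfi : Integrable f (iidLaw π)) {V : ℤ → Ω → S}
    (hV : ∀ ω, path V ω = mer B (path ε ω) (path ε' ω)) :
    (fun ω => condE π (Set.Iic t ∩ B) f (path ε ω)) =ᵐ[μ]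
      μ[fun ω => f (path ε ω) | pastSigma V t] := by
  have hmp := h.measurePreserving
  have hm : Measurable fun ω => (path ε ω, path ε' ω) :=
    (measurable_path h.measurable).prodMk (measurable_path h.measurable_copy)
  obtain ⟨x₀⟩ : Nonempty (ℤ → S) := nonempty_of_isProbabilityMeasure (iidLaw π)
  set F : Ω → ℤ → S := fun ω => mer (Set.Iic t) (path V ω) x₀ with hF
  let Q : (ℤ → S) × (ℤ → S) → ℤ → S := fun p => mer (Set.Iic t) (mer B p.1 p.2) x₀
  have hQ : Measurable Q :=
    ((measurable_mer (Set.Iic t)).comp measurable_prodMk_right).comp (measurable_mer B)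
  have hFQ : ∀ ω, F ω = Q (path ε ω, path ε' ω) := fun ω => by rw [hF]; simp only [Q, hV]
  have hFm : Measurable F := by
    rw [funext hFQ]
    exact hQ.comp hm
  rw [pastSigma_eq_comap V t x₀]
  have hic := integrable_condE (π := π) (Set.Iic t ∩ B) hfi
  refine ae_eq_condExp_of_forall_setIntegral_eq hFm.comap_le
    (hmp.integrable_comp_of_integrable hfi)
    (fun s _ _ => (hmp.integrable_comp_of_integrable hic).integrableOn) ?_ ?_
  · rintro _ ⟨D, hD, rfl⟩ -
    -- The conditioning event also involves the copy. After integrating over the copy `ω'` last,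
    -- each section of the event is determined by the coordinates of `ε` in `Iic t ∩ B`, and
    -- `setIntegral_condE` applies to it.
    have key : ∀ {k : (ℤ → S) → E}, StronglyMeasurable k → Integrable k (iidLaw π) →
        ∫ ω in F ⁻¹' D, k (path ε ω) ∂μ
          = ∫ ω', ∫ ω in (fun ω => Q (ω, ω')) ⁻¹' D, k ω ∂iidLaw π ∂iidLaw π := by
      intro k hk hki
      have hk1 : Integrable ((Q ⁻¹' D).indicator fun p : (ℤ → S) × (ℤ → S) => k p.1)
          ((iidLaw π).prod (iidLaw π)) := (hki.comp_fst _).indicator (hQ hD)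
      have e1 : ∫ ω in F ⁻¹' D, k (path ε ω) ∂μ
          = ∫ p, (Q ⁻¹' D).indicator (fun p => k p.1) p ∂((iidLaw π).prod (iidLaw π)) := by
        rw [← h.map_prod, integral_map hm.aemeasurable
          (by rw [h.map_prod]; exact hk1.aestronglyMeasurable), ← integral_indicator (hFm hD)]
        refine integral_congr_ae (Eventually.of_forall fun ω => ?_)
        have hD' : ω ∈ F ⁻¹' D ↔ (path ε ω, path ε' ω) ∈ Q ⁻¹' D := by
          rw [Set.mem_preimage, Set.mem_preimage, hFQ]
        dsimp only
        by_cases hp : ω ∈ F ⁻¹' D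
        · rw [Set.indicator_of_mem hp, Set.indicator_of_mem (hD'.1 hp)]
        · rw [Set.indicator_of_notMem hp, Set.indicator_of_notMem (mt hD'.2 hp)]
      rw [e1, integral_prod_symm _ hk1]
      refine integral_congr_ae (Eventually.of_forall fun ω' => ?_)
      dsimp only
      have hDm : MeasurableSet ((fun ω => Q (ω, ω')) ⁻¹' D) :=
        (hQ.comp measurable_prodMk_right) hD
      rw [← integral_indicator hDm]
      rfl
    rw [key (stronglyMeasurable_condE _ hf) hic, key hf hfi]
    refine integral_congr_ae (Eventually.of_forall fun ω' => ?_)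
    refine setIntegral_condE hfi ((hQ.comp measurable_prodMk_right) hD) ?_
    intro x y hxy
    have : Q (x, ω') = Q (y, ω') := by
      funext i
      by_cases h1 : i ∈ Set.Iic t
      · simp only [Q, mer_of_mem h1]
        by_cases h2 : i ∈ B
        · simp only [mer_of_mem h2]
          exact hxy i ⟨h1, h2⟩
        · simp only [mer_of_notMem h2]
      · simp only [Q, mer_of_notMem h1]
    simp only [Set.mem_preimage, this]
  · have : (fun ω => condE π (Set.Iic t ∩ B) f (path ε ω))
        = fun ω => condE π (Set.Iic t ∩ B) f (F ω) := by
      funext ω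
      refine dependsOn_condE fun i hi => ?_
      rw [hFQ]
      simp only [Q, mer_of_mem hi.1, mer_of_mem hi.2]
    rw [this]
    exact ((stronglyMeasurable_condE _ hf).comp_measurable
      (comap_measurable F)).aestronglyMeasurable

theorem path_coupled (ω : Ω) :
    path (coupled ε ε' {0}) ω = mer {0}ᶜ (path ε ω) (path ε' ω) := by
  funext i
  by_cases h : i = 0
  · rw [mer_of_notMem (by simp [h])]
    simp [path, coupled, h]
  · rw [mer_of_mem (by simp [h])]
    simp [path, coupled, h]

variable {H : Type*} [NormedAddCommGroup H] [InnerProductSpace ℂ H] [CompleteSpace H]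
  {G : (ℤ → S) → H} {X : ℤ → Ω → H}

/-- The coupled past consists of `ε` up to time `t` except at time `0`, where it holds an
independent copy that carries no information on `X t`. Conditioning on it therefore averages out the
coordinate `0`; the coordinates after `t` do not matter by causality. -/
theorem IIDModel.depCoeff_eq (h : IIDModel μ ε ε' π) (hG : StronglyMeasurable G)
    (hL : MemLp G 4 (iidLaw π)) (hdep : DependsOn G (Set.Iic 0))
    (hX : ∀ t, X t =ᵐ[μ] fun ω => proc G t (path ε ω)) (t : ℤ) :
    depCoeff μ ε ε' X 4 t = coeff π G t := by
  have hm : StronglyMeasurable (proc G t) := hG.comp_measurable (measurable_shift t)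
  have hi : Integrable (proc G t) (iidLaw π) := (memLp_proc hL t).integrable (by norm_num)
  have h1 := h.condExp_eq {0}ᶜ t hm hi path_coupled
  have hd : DependsOn (proc G t) (Set.Iic t) := hdep.proc fun i hi => by
    simp only [Set.mem_Iic] at hi ⊢; omega
  have h2 : condE π {0}ᶜ (proc G t) =ᵐ[iidLaw π] condE π (Set.Iic t ∩ {0}ᶜ) (proc G t) := by
    have := condE_condE {0}ᶜ (Set.Iic t) hi
    rwa [condE_of_dependsOn hd le_rfl, Set.inter_comm] at this
  have h3 := h.measurePreserving.quasiMeasurePreserving.ae h2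
  rw [depCoeff, coeff, ← eLpNorm_comp_measurePreserving
    ((memLp_proc hL t).1.sub (integrable_condE _ hi).1) h.measurePreserving]
  refine eLpNorm_congr_ae ?_
  filter_upwards [h1, h3, hX t, condExp_congr_ae (m := pastSigma (coupled ε ε' {0}) t) (hX t)]
    with ω a1 a2 a3 a4
  simp only [Pi.sub_apply, Function.comp]
  rw [a3, a4, ← a1, a2]

theorem IIDModel.causal4 (h : IIDModel μ ε ε' π) (hG : StronglyMeasurable G)
    (hdep : DependsOn G (Set.Iic 0)) (hX : ∀ t, X t =ᵐ[μ] fun ω => proc G t (path ε ω))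
    (hD : DependenceCondition μ ε ε' X 4) : Causal4 π G := by
  have hmp := h.measurePreserving
  have h0 : ∀ ω : ℤ → S, proc G 0 ω = G ω := fun ω => by rw [proc, shift_zero]
  have hX0 : X 0 =ᵐ[μ] G ∘ path ε := by
    filter_upwards [hX 0] with ω hω
    rw [hω, h0]; rfl
  have hL : MemLp G 4 (iidLaw π) := by
    rw [← hmp.map_eq, memLp_map_measure_iff hG.aestronglyMeasurable hmp.measurable.aemeasurable]
    exact (memLp_congr_ae hX0).1 (hD.memLp 0)
  refine ⟨hG, hL, ?_, hdep, ?_⟩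
  · rw [← hmp.map_eq, integral_map hmp.measurable.aemeasurable hG.aestronglyMeasurable,
      ← hD.centered 0]
    exact (integral_congr_ae hX0).symm
  -- The dependence condition sums over `j ≥ 0` and `coeffSum` over `ℤ`. At negative times a causal
  -- process does not see the innovation at time `0`.
  · have hneg : Function.support (coeff π G) ⊆ Set.range ((↑) : ℕ → ℤ) := by
      intro j hj
      by_contra hn
      have hj0 : j < 0 := by
        by_contra hc
        exact hn ⟨j.toNat, Int.toNat_of_nonneg (not_lt.1 hc)⟩
      refine hj ?_
      have hd : DependsOn (proc G j) ({0}ᶜ : Set ℤ) := hdep.proc fun i hi => by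
        simp only [Set.mem_Iic, Set.mem_compl_iff, Set.mem_singleton_iff] at hi ⊢; omega
      rw [coeff, condE_of_dependsOn hd le_rfl, sub_self, eLpNorm_zero]
    rw [coeffSum, ← Nat.cast_injective.tsum_eq hneg]
    simpa only [← h.depCoeff_eq hG hL hdep hX] using hD.summable

theorem IIDModel.lagCov_eq (h : IIDModel μ ε ε' π) (hG : StronglyMeasurable G)
    (hX : ∀ t, X t =ᵐ[μ] fun ω => proc G t (path ε ω)) (u : ℤ) :
    lagCov μ X u = autoCov π G u := by
  have hmp := h.measurePreserving
  have hm : ∀ t, StronglyMeasurable (proc G t) := fun t => hG.comp_measurable (measurable_shift t)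
  have ht : StronglyMeasurable fun ω => S2.tens (proc G u ω) (proc G 0 ω) :=
    S2.continuous_tens.comp_stronglyMeasurable ((hm u).prodMk (hm 0))
  rw [lagCov, autoCov, ← hmp.map_eq, integral_map hmp.measurable.aemeasurable
    ht.aestronglyMeasurable]
  refine integral_congr_ae ?_
  filter_upwards [hX u, hX 0] with ω h1 h2
  rw [h1, h2]

theorem IIDModel.specDensity_eq (h : IIDModel μ ε ε' π) (hG : StronglyMeasurable G)
    (hX : ∀ t, X t =ᵐ[μ] fun ω => proc G t (path ε ω)) (lam : ℝ) :
    specDensity μ X lam = ((1 / (2 * Real.pi) : ℝ) : ℂ) • specSum π G lam := by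
  rw [specDensity, specSum]
  simp only [h.lagCov_eq hG hX]
  push_cast
  rfl

theorem specEstimator_eq (hX : ∀ t, X t =ᵐ[μ] fun ω => proc G t (path ε ω)) (w : ℝ → ℝ)
    (b : ℝ) (T : ℕ) (lam : ℝ) : specEstimator X w b T lam =ᵐ[μ] fun ω =>
      (1 / (2 * Real.pi * T) : ℝ) • quadForm (winCoef w b lam) (Finset.Icc (1 : ℤ) T)
        (proc G) (proc G) (path ε ω) := by
  filter_upwards [ae_all_iff.2 hX] with ω hω
  rw [specEstimator, ← Complex.coe_smul]
  simp only [hω, quadForm, winCoef]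
  push_cast
  rfl

theorem sqrt_mul_div_eq (b : ℝ) (T : ℕ) :
    √(b * T) * (1 / (2 * Real.pi * T)) = 1 / (2 * Real.pi) * √(b / T) := by
  rcases Nat.eq_zero_or_pos T with rfl | hT
  · simp
  · have hT' : (0 : ℝ) < T := by exact_mod_cast hT
    have h1 : b * T = b / T * (T * T) := by field_simp
    rw [h1, Real.sqrt_mul' _ (by positivity), Real.sqrt_mul_self hT'.le]
    field_simp

theorem IIDModel.integral_specEstimator (h : IIDModel μ ε ε' π) (hG : Causal4 π G)
    (hX : ∀ t, X t =ᵐ[μ] fun ω => proc G t (path ε ω)) (w : ℝ → ℝ) (b : ℝ) (T : ℕ) (lam : ℝ) :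
    ∫ ω, specEstimator X w b T lam ω ∂μ = (1 / (2 * Real.pi * T) : ℝ) •
      ∫ ω, quadForm (winCoef w b lam) (Finset.Icc (1 : ℤ) T) (proc G) (proc G) ω ∂iidLaw π := by
  have hmp := h.measurePreserving
  rw [integral_congr_ae (specEstimator_eq hX w b T lam), integral_smul]
  conv_rhs => rw [← hmp.map_eq]
  rw [integral_map hmp.measurable.aemeasurable
    (by rw [hmp.map_eq]; exact (hG.memLp_two_quadForm _ _).1)]

theorem IIDModel.deviation_eq (h : IIDModel μ ε ε' π) (hG : Causal4 π G)
    (hX : ∀ t, X t =ᵐ[μ] fun ω => proc G t (path ε ω)) (w : ℝ → ℝ) (b : ℝ) (T : ℕ)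
    {d : Type*} [Fintype d] (lam : d → ℝ) :
    (fun ω j => √(b * T) • (specEstimator X w b T (lam j) ω
      - ∫ ω', specEstimator X w b T (lam j) ω' ∂μ)) =ᵐ[μ]
      fun ω => specDev π G w b lam T (path ε ω) := by
  filter_upwards [ae_all_iff.2 fun j => specEstimator_eq hX w b T (lam j)] with ω hω
  funext j
  rw [hω j, h.integral_specEstimator hG hX, ← smul_sub, smul_smul, sqrt_mul_div_eq, ← smul_smul]
  rfl

theorem IIDModel.tendsto_deviation [SecondCountableTopology H] (h : IIDModel μ ε ε' π)
    (hG : Causal4 π G)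
    (hX : ∀ t, X t =ᵐ[μ] fun ω => proc G t (path ε ω)) (w : ℝ → ℝ) (b : ℕ → ℝ)
    {d : Type*} [Fintype d] (lam : d → ℝ) {N : Measure (d → S2 H)} [IsProbabilityMeasure N]
    (hlim : TendstoInDistribution (fun T ω => specDev π G w (b T) lam T ω) atTop (fun z => z)
      (fun _ => iidLaw π) N) :
    TendstoInDistribution (fun (T : ℕ) (ω : Ω) (j : d) => √(b T * T) •
        (specEstimator X w (b T) T (lam j) ω - ∫ ω', specEstimator X w (b T) T (lam j) ω' ∂μ))
      atTop (fun z => z) (fun _ => μ) N := by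
  have hmp := h.measurePreserving
  refine TendstoInDistribution.congr (X := fun T ω => specDev π G w (b T) lam T (path ε ω))
    (fun T => (h.deviation_eq hG hX w (b T) T lam).symm) EventuallyEq.rfl
    ⟨fun T => ((hG.stronglyMeasurable_specDev w (b T) lam T).measurable.comp
      hmp.measurable).aemeasurable, aemeasurable_id, ?_⟩
  refine hlim.tendsto.congr fun T => Subtype.ext ?_
  change (iidLaw π).map (specDev π G w (b T) lam T)
    = μ.map (specDev π G w (b T) lam T ∘ path ε)
  rw [← Measure.map_map (hG.stronglyMeasurable_specDev w (b T) lam T).measurable hmp.measurable,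
    hmp.map_eq]

/-- A causal process has a representation on the canonical space, which is real everywhere when
the process is real almost surely. -/
theorem exists_generator [SecondCountableTopology H] [MeasurableSpace H] [BorelSpace H]
    {J : H ≃ₗᵢ⋆[ℂ] H} (hJ : ∀ x, J (J x) = x)
    {g : (ℕ → S) → H} (hg : Measurable g) (hX : X = causal g ε) {P : Prop}
    (hreal : P → ∀ t, ∀ᵐ ω ∂μ, J (X t ω) = X t ω) :
    ∃ G : (ℤ → S) → H, StronglyMeasurable G ∧ DependsOn G (Set.Iic 0) ∧
      (∀ t, X t =ᵐ[μ] fun ω => proc G t (path ε ω)) ∧ (P → ∀ ω, J (G ω) = G ω) := by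
  let G₀ : (ℤ → S) → H := fun ω => g fun k => ω (-k)
  have hm : StronglyMeasurable G₀ := (hg.comp (by fun_prop :
    Measurable fun (ω : ℤ → S) (k : ℕ) => ω (-k))).stronglyMeasurable
  have hd : DependsOn G₀ (Set.Iic 0) := fun x y hxy =>
    congrArg g (funext fun k => hxy _ (by simp))
  have hX₀ : ∀ t ω, X t ω = proc G₀ t (path ε ω) := fun t ω => by
    rw [hX]
    refine congrArg g (funext fun k => ?_)
    simp only [shift, path]
    rw [show t - (k : ℤ) = -k + t by ring]
  by_cases hP : P
  -- Along the path, the real part of `G₀` agrees with `G₀` almost surely, and it is real at every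
  -- point, as the approximation by real processes requires.
  · refine ⟨fun ω => conjRealPart J (G₀ ω), (conjRealPart J).continuous.comp_stronglyMeasurable hm,
      fun x y hxy => by simp only [hd hxy], fun t => ?_, fun _ ω => conj_conjRealPart hJ _⟩
    filter_upwards [hreal hP t] with ω hω
    rw [hX₀] at hω ⊢
    exact (conjRealPart_of_eq hω).symm
  · exact ⟨G₀, hm, hd, fun t => Eventually.of_forall (hX₀ t), fun h => absurd h hP⟩

end Transfer

/-! ### The bias of the estimator -/

section Bias

set_option linter.unusedSectionVars false

variable {Ω S : Type*} [MeasurableSpace Ω] [MeasurableSpace S] {μ : Measure Ω}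
  [IsProbabilityMeasure μ] {π : Measure S} [IsProbabilityMeasure π] {ε ε' : ℤ → Ω → S}
variable {H : Type*} [NormedAddCommGroup H] [InnerProductSpace ℂ H] [CompleteSpace H]
  {G : (ℤ → S) → H} {X : ℤ → Ω → H} {w : ℝ → ℝ}

theorem IIDModel.eLpNorm_martProj (h : IIDModel μ ε ε' π) (hG : Causal4 π G)
    (hX : ∀ t, X t =ᵐ[μ] fun ω => proc G t (path ε ω)) (t : ℤ) :
    eLpNorm (martProj μ ε 0 (X t)) 2 μ = eLpNorm (coordProj π 0 (proc G t)) 2 (iidLaw π) := by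
  have hi : Integrable (proc G t) (iidLaw π) := (memLp_proc hG.memLp t).integrable (by norm_num)
  have hV : ∀ ω, path ε ω = mer Set.univ (path ε ω) (path ε' ω) := fun ω =>
    funext fun i => (mer_of_mem (Set.mem_univ i) _ _).symm
  have h1 := fun k : ℤ => h.condExp_eq Set.univ k (hG.stronglyMeasurable_proc t) hi hV
  simp only [Set.inter_univ] at h1
  rw [← eLpNorm_comp_measurePreserving (integrable_coordProj 0 hi).1 h.measurePreserving]
  refine eLpNorm_congr_ae ?_
  filter_upwards [h1 0, h1 (0 - 1), condExp_congr_ae (m := pastSigma ε 0) (hX t),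
    condExp_congr_ae (m := pastSigma ε (0 - 1)) (hX t)] with ω a1 a2 a3 a4
  simp only [martProj, coordProj, Pi.sub_apply, Function.comp]
  rw [a3, a4, ← a1, ← a2]

theorem eLpNorm_coordProj_proc (hG : Causal4 π G) (k u : ℤ) :
    eLpNorm (coordProj π k (proc G u)) 2 (iidLaw π)
      = eLpNorm (coordProj π 0 (proc G (u - k))) 2 (iidLaw π) := by
  have hi : Integrable (proc G (u - k)) (iidLaw π) :=
    (memLp_proc hG.memLp _).integrable (by norm_num)
  have h1 : proc G u = proc G (u - k) ∘ shift k := by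
    funext ω
    simp only [proc, Function.comp, shift_shift, sub_add_cancel]
  rw [h1, coordProj_comp_shift, sub_self, eLpNorm_comp_shift (integrable_coordProj 0 hi).1]

/-- Weighted summability of the projections gives weighted summability of the covariances. -/
theorem tsum_natAbs_mul_enorm_autoCov_ne_top (hG : Causal4 π G)
    (h : ∑' u : ℤ, (u.natAbs : ℝ≥0∞) * eLpNorm (coordProj π 0 (proc G u)) 2 (iidLaw π) ≠ ∞) :
    ∑' u : ℤ, (u.natAbs : ℝ≥0∞) * ‖autoCov π G u‖ₑ ≠ ∞ := by
  set a : ℤ → ℝ≥0∞ := fun u => eLpNorm (coordProj π 0 (proc G u)) 2 (iidLaw π) with ha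
  have ha0 : ∑' u, a u ≠ ∞ := by
    refine ne_top_of_le_ne_top hG.summable (ENNReal.tsum_le_tsum fun u => ?_)
    have hi := (memLp_proc hG.memLp u).integrable (by norm_num)
    exact (eLpNorm_coordProj_le 0 one_le_two hi).trans
      (eLpNorm_le_eLpNorm_of_exponent_le (by norm_num) (hi.1.sub (integrable_condE _ hi).1))
  have h1 : ∀ u, ‖autoCov π G u‖ₑ ≤ ∑' k : ℤ, a (u - k) * a (0 - k) := fun u => by
    refine (enorm_integral_bilin_le_tsum (b := S2.tensL H)
      (fun x y => (S2.norm_tens x y).le) (hG.stronglyMeasurable_proc u)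
      (hG.stronglyMeasurable_proc 0) (hG.memLp_two_proc u) (hG.memLp_two_proc 0)
      ((integral_proc G u).trans hG.mean)).trans ?_
    exact ENNReal.tsum_le_tsum fun k => mul_le_mul' (eLpNorm_coordProj_proc hG k u).le
      (eLpNorm_coordProj_proc hG k 0).le
  -- `|u| ≤ |u - k| + |k|` distributes the weight over the two factors of the convolution.
  have h2 : ∀ u k : ℤ, (u.natAbs : ℝ≥0∞) * (a (u - k) * a (0 - k))
      ≤ ((u - k).natAbs * a (u - k)) * a (0 - k) + a (u - k) * ((0 - k).natAbs * a (0 - k)) :=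
    fun u k => by
      have : (u.natAbs : ℝ≥0∞) ≤ (u - k).natAbs + (0 - k).natAbs := by
        exact_mod_cast (by omega : u.natAbs ≤ (u - k).natAbs + (0 - k).natAbs)
      calc (u.natAbs : ℝ≥0∞) * (a (u - k) * a (0 - k))
          ≤ ((u - k).natAbs + (0 - k).natAbs) * (a (u - k) * a (0 - k)) := by gcongr
        _ = _ := by ring
  have h3 : ∀ f g : ℤ → ℝ≥0∞, ∑' u : ℤ, ∑' k : ℤ, f (u - k) * g (0 - k)
      = (∑' u, f u) * ∑' u, g u := fun f g => by
    rw [ENNReal.tsum_comm]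
    have e1 : ∀ k : ℤ, ∑' u : ℤ, f (u - k) * g (0 - k) = (∑' u, f u) * g (0 - k) := fun k => by
      rw [ENNReal.tsum_mul_right, ← (Equiv.subRight k).tsum_eq f]
      rfl
    simp only [e1]
    rw [ENNReal.tsum_mul_left, ← (Equiv.subLeft (0 : ℤ)).tsum_eq g]
    rfl
  refine ne_top_of_le_ne_top (b := (∑' u : ℤ, (u.natAbs : ℝ≥0∞) * a u) * ∑' u, a u
    + (∑' u, a u) * ∑' u : ℤ, (u.natAbs : ℝ≥0∞) * a u)
    (ENNReal.add_ne_top.2 ⟨ENNReal.mul_ne_top h ha0, ENNReal.mul_ne_top ha0 h⟩) ?_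
  rw [← h3, ← h3, ← ENNReal.tsum_add]
  refine ENNReal.tsum_le_tsum fun u => ?_
  rw [← ENNReal.tsum_add]
  refine (mul_le_mul' le_rfl (h1 u)).trans ?_
  rw [← ENNReal.tsum_mul_left]
  exact ENNReal.tsum_le_tsum fun k => h2 u k

theorem integral_tens_proc (G : (ℤ → S) → H) (s t : ℤ) :
    ∫ ω, S2.tens (proc G s ω) (proc G t ω) ∂iidLaw π = autoCov π G (s - t) := by
  rw [autoCov, ← integral_comp_shift (fun ω => S2.tens (proc G (s - t) ω) (proc G 0 ω)) t]
  simp only [proc, shift_shift, zero_add, sub_add_cancel]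

theorem integral_quadForm_eq (hG : Causal4 π G) (α : ℤ → ℤ → ℂ) (I : Finset ℤ) :
    ∫ ω, quadForm α I (proc G) (proc G) ω ∂iidLaw π
      = ∑ s ∈ I, ∑ t ∈ I, α s t • autoCov π G (s - t) := by
  have hi : ∀ s t, Integrable (fun ω => α s t • S2.tens (proc G s ω) (proc G t ω)) (iidLaw π) :=
    fun s t => (integrable_bilin (S2.tensL H) (hG.memLp_two_proc s)
      (hG.memLp_two_proc t)).smul (α s t)
  simp only [quadForm]
  rw [integral_finsetSum _ fun s _ => integrable_finsetSum _ fun t _ => hi s t]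
  refine Finset.sum_congr rfl fun s _ => ?_
  rw [integral_finsetSum _ fun t _ => hi s t]
  refine Finset.sum_congr rfl fun t _ => ?_
  rw [integral_smul, integral_tens_proc]

theorem card_filter_sub_notMem_le (T : ℕ) (u : ℤ) :
    ((Finset.Icc (1 : ℤ) T).filter fun s => s - u ∉ Finset.Icc (1 : ℤ) T).card ≤ u.natAbs := by
  rcases le_total 0 u with hu | hu
  · have : ((Finset.Icc (1 : ℤ) T).filter fun s => s - u ∉ Finset.Icc (1 : ℤ) T)
        ⊆ Finset.Icc 1 u := fun s hs => by
      simp only [Finset.mem_filter, Finset.mem_Icc] at hs ⊢; omega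
    refine (Finset.card_le_card this).trans ?_
    rw [Int.card_Icc]; omega
  · have : ((Finset.Icc (1 : ℤ) T).filter fun s => s - u ∉ Finset.Icc (1 : ℤ) T)
        ⊆ Finset.Icc (T + u + 1) T := fun s hs => by
      simp only [Finset.mem_filter, Finset.mem_Icc] at hs ⊢; omega
    refine (Finset.card_le_card this).trans ?_
    rw [Int.card_Icc]; omega

theorem enorm_exp_sub_winCoef_le {K : ℝ} (hK : ∀ x, |w x - 1| ≤ K * |x|) {b : ℝ} (hb : 0 ≤ b)
    (lam : ℝ) (s u : ℤ) :
    ‖Complex.exp (-Complex.I * lam * u) - winCoef w b lam s (s - u)‖ₑ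
      ≤ ENNReal.ofReal (K * b) * u.natAbs := by
  have h1 : winCoef w b lam s (s - u) = (w (-(b * u)) : ℂ) * Complex.exp (-Complex.I * lam * u) := by
    simp only [winCoef]
    push_cast
    ring_nf
  have h2 : Complex.exp (-Complex.I * lam * u) - winCoef w b lam s (s - u)
      = ((1 - w (-(b * u)) : ℝ) : ℂ) * Complex.exp (-Complex.I * lam * u) := by
    rw [h1]; push_cast; ring
  have h3 : ‖Complex.exp (-Complex.I * lam * u)‖ = 1 := by
    rw [show -Complex.I * lam * u = ((-(lam * u) : ℝ) : ℂ) * Complex.I by push_cast; ring,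
      Complex.norm_exp_ofReal_mul_I]
  have h4 := hK (-(b * u))
  rw [abs_neg, abs_mul, abs_of_nonneg hb, abs_sub_comm] at h4
  rw [h2, ← ofReal_norm, norm_mul, h3, mul_one, Complex.norm_real, Real.norm_eq_abs,
    ← ENNReal.ofReal_natCast, ← ENNReal.ofReal_mul' (by positivity)]
  refine ENNReal.ofReal_le_ofReal (h4.trans (le_of_eq ?_))
  rw [Nat.cast_natAbs, Int.cast_abs]
  ring

open Classical in
theorem specSum_sub_sum_eq (hG : Causal4 π G) (lam : ℝ) (I : Finset ℤ) (α : ℤ → ℂ) (s : ℤ) :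
    specSum π G lam - ∑ t ∈ I, α t • autoCov π G (s - t)
      = ∑' u : ℤ, (Complex.exp (-Complex.I * lam * u) - if s - u ∈ I then α (s - u) else 0) •
        autoCov π G u := by
  obtain ⟨f, hf⟩ : ∃ f : ℤ → S2 H, ∀ t, f t = if t ∈ I then α t • autoCov π G (s - t) else 0 :=
    ⟨_, fun _ => rfl⟩
  have hf0 : ∀ t ∉ I, f t = 0 := fun t ht => by rw [hf, if_neg ht]
  have hfs' : Summable fun u => f (Equiv.subLeft s u) :=
    (Equiv.subLeft s).summable_iff.2 (summable_of_ne_finset_zero (s := I) hf0)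
  have e1 : ∑ t ∈ I, α t • autoCov π G (s - t) = ∑' t, f t := by
    rw [tsum_eq_sum hf0]
    exact Finset.sum_congr rfl fun t ht => by rw [hf, if_pos ht]
  have e2 := (hG.summable_spec lam).tsum_sub hfs'
  rw [(Equiv.subLeft s).tsum_eq f] at e2
  rw [e1]
  refine e2.symm.trans (tsum_congr fun u => ?_)
  rw [hf, Equiv.subLeft_apply, sub_smul, sub_sub_cancel]
  split_ifs
  · rfl
  · rw [zero_smul]

/-- For each `s` the Fourier series is compared with the weighted sum over the lags available from
`s`. An available lag `u` costs `K b |u|`, and `u` is unavailable for at most `|u|` values of `s`;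
summed over the `T` values of `s`, both effects are multiples of `|u|`. -/
theorem enorm_smul_specSum_sub_le (hG : Causal4 π G) {K : ℝ} (hK : ∀ x, |w x - 1| ≤ K * |x|)
    {b : ℝ} (hb : 0 ≤ b) (lam : ℝ) (T : ℕ) :
    ‖(T : ℝ) • specSum π G lam - ∫ ω, quadForm (winCoef w b lam) (Finset.Icc (1 : ℤ) T)
        (proc G) (proc G) ω ∂iidLaw π‖ₑ
      ≤ (T * ENNReal.ofReal (K * b) + 1) * ∑' u : ℤ, (u.natAbs : ℝ≥0∞) * ‖autoCov π G u‖ₑ := by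
  classical
  set I := Finset.Icc (1 : ℤ) T with hI
  have hcard : I.card = T := by rw [hI, Int.card_Icc]; simp
  let c : ℤ → ℤ → ℂ := fun s u => Complex.exp (-Complex.I * lam * u)
    - if s - u ∈ I then winCoef w b lam s (s - u) else 0
  have h1 : ∀ s ∈ I, specSum π G lam - ∑ t ∈ I, winCoef w b lam s t • autoCov π G (s - t)
      = ∑' u : ℤ, c s u • autoCov π G u := fun s _ =>
    specSum_sub_sum_eq hG lam I (winCoef w b lam s) s
  have h2 : (T : ℝ) • specSum π G lam - ∫ ω, quadForm (winCoef w b lam) I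
        (proc G) (proc G) ω ∂iidLaw π = ∑ s ∈ I, ∑' u : ℤ, c s u • autoCov π G u := by
    rw [integral_quadForm_eq hG, ← Finset.sum_congr rfl h1, Finset.sum_sub_distrib,
      Finset.sum_const, hcard, Nat.cast_smul_eq_nsmul]
  have h3 : ∀ s u, ‖c s u‖ₑ ≤ ENNReal.ofReal (K * b) * u.natAbs
      + if s - u ∉ I then 1 else 0 := fun s u => by
    by_cases h : s - u ∈ I
    · simp only [c, h, if_true, not_true, if_false, add_zero]
      exact enorm_exp_sub_winCoef_le hK hb lam s u
    · simp only [c, h, if_false, not_false_iff, if_true, sub_zero]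
      have : ‖Complex.exp (-Complex.I * lam * u)‖ₑ = 1 := by
        have := enorm_exp_smul (E := ℂ) lam u 1
        simpa using this
      rw [this]
      exact le_add_self
  rw [h2]
  calc ‖∑ s ∈ I, ∑' u : ℤ, c s u • autoCov π G u‖ₑ
      ≤ ∑ s ∈ I, ∑' u : ℤ, (ENNReal.ofReal (K * b) * u.natAbs
          + if s - u ∉ I then 1 else 0) * ‖autoCov π G u‖ₑ := by
        refine (enorm_sum_le _ _).trans (Finset.sum_le_sum fun s _ => ?_)
        refine (enorm_tsum_le_tsum_enorm).trans (ENNReal.tsum_le_tsum fun u => ?_)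
        rw [enorm_smul]
        exact mul_le_mul' (h3 s u) le_rfl
    _ = ∑' u : ℤ, (∑ s ∈ I, (ENNReal.ofReal (K * b) * u.natAbs
          + if s - u ∉ I then 1 else 0)) * ‖autoCov π G u‖ₑ := by
        rw [← Summable.tsum_finsetSum fun _ _ => ENNReal.summable]
        simp only [Finset.sum_mul]
    _ ≤ ∑' u : ℤ, ((T * ENNReal.ofReal (K * b) + 1) * u.natAbs) * ‖autoCov π G u‖ₑ := by
        refine ENNReal.tsum_le_tsum fun u => mul_le_mul' ?_ le_rfl
        rw [Finset.sum_add_distrib, Finset.sum_const, hcard, nsmul_eq_mul, add_mul, one_mul,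
          mul_assoc, Finset.sum_boole]
        gcongr
        exact_mod_cast card_filter_sub_notMem_le T u
    _ = _ := by
        rw [← ENNReal.tsum_mul_left]
        exact tsum_congr fun u => by ring

/-- Near zero this is the hypothesis; away from zero boundedness of `w` gives a linear bound with
slope `(M + 1) / δ`. -/
theorem exists_abs_sub_one_le (hw : LagWindow w)
    (h : (fun x => w x - 1) =O[𝓝 0] (fun x => x)) : ∃ K, 0 ≤ K ∧ ∀ x, |w x - 1| ≤ K * |x| := by
  obtain ⟨M, hM⟩ := hw.bounded
  have hM0 : 0 ≤ M := (abs_nonneg _).trans (hM 0)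
  obtain ⟨K₀, hK₀⟩ := h.bound
  obtain ⟨δ, hδ, hb⟩ := Metric.eventually_nhds_iff.1 hK₀
  refine ⟨max K₀ ((M + 1) / δ), le_max_of_le_right (by positivity), fun x => ?_⟩
  by_cases hx : |x| < δ
  · have := hb (y := x) (by simpa using hx)
    simp only [Real.norm_eq_abs] at this
    exact this.trans (by gcongr; exact le_max_left _ _)
  · have h1 : |w x - 1| ≤ M + 1 := (abs_sub _ _).trans (by simpa using hM x)
    refine h1.trans ?_
    calc M + 1 = (M + 1) / δ * δ := by field_simp
      _ ≤ max K₀ ((M + 1) / δ) * |x| := by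
        gcongr
        · exact le_max_right _ _
        · exact not_lt.1 hx

/-- The product equals `K √(b³T) + √(b/T)`. The rate `b = o(T^{-1/3})` is what makes the first term
vanish; the second vanishes since `b → 0`. -/
theorem tendsto_sqrt_mul_bias {b : ℕ → ℝ} (hb : Tendsto b atTop (𝓝 0))
    (hbT : Tendsto (fun T : ℕ => b T * T) atTop atTop)
    (ho : b =o[atTop] (fun T : ℕ => (T : ℝ) ^ (-(1 / 3) : ℝ))) (K : ℝ) :
    Tendsto (fun T : ℕ => √(b T * T) * (K * b T + 1 / T)) atTop (𝓝 0) := by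
  have h1 : Tendsto (fun T : ℕ => b T ^ 3 * T) atTop (𝓝 0) := by
    have := (ho.tendsto_div_nhds_zero).pow 3
    rw [zero_pow three_ne_zero] at this
    refine this.congr fun T => ?_
    rw [div_pow, ← Real.rpow_natCast ((T : ℝ) ^ (-(1 / 3) : ℝ)) 3,
      ← Real.rpow_mul (Nat.cast_nonneg T)]
    norm_num [Real.rpow_neg_one]
  have h2 : Tendsto (fun T : ℕ => b T / T) atTop (𝓝 0) := by
    simpa [div_eq_mul_inv] using hb.mul tendsto_inv_atTop_nhds_zero_nat
  have h3 := (h1.sqrt.const_mul K).add h2.sqrt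
  simp only [Real.sqrt_zero, mul_zero, add_zero] at h3
  refine h3.congr' ?_
  filter_upwards [hbT.eventually_gt_atTop 0, eventually_gt_atTop 0] with T hT hT0
  have hT' : (0 : ℝ) < T := by exact_mod_cast hT0
  have hb0 : 0 < b T := pos_of_mul_pos_left hT hT'.le
  have e1 : √(b T ^ 3 * T) = √(b T * T) * b T := by
    rw [show b T ^ 3 * T = (b T * T) * (b T * b T) by ring, Real.sqrt_mul hT.le,
      Real.sqrt_mul_self hb0.le]
  have e2 : √(b T / T) = √(b T * T) * (1 / T) := by
    rw [show b T * T = b T / T * (T * T) by field_simp, Real.sqrt_mul' _ (by positivity),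
      Real.sqrt_mul_self hT'.le]
    field_simp
  rw [e1, e2]
  ring

/-- The scaled bias of the lag-window estimator vanishes. -/
theorem IIDModel.tendsto_bias (h : IIDModel μ ε ε' π) (hG : Causal4 π G)
    (hX : ∀ t, X t =ᵐ[μ] fun ω => proc G t (path ε ω)) (hw : LagWindow w)
    (hsum : ∑' u : ℤ, (u.natAbs : ℝ≥0∞) * eLpNorm (martProj μ ε 0 (X u)) 2 μ ≠ ∞)
    (hwO : (fun x => w x - 1) =O[𝓝 0] (fun x => x)) {b : ℕ → ℝ} (hb : Tendsto b atTop (𝓝 0))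
    (hbT : Tendsto (fun T : ℕ => b T * T) atTop atTop)
    (ho : b =o[atTop] (fun T : ℕ => (T : ℝ) ^ (-(1 / 3) : ℝ))) (lam : ℝ) :
    Tendsto (fun T : ℕ => √(b T * T) • (∫ ω, specEstimator X w (b T) T lam ω ∂μ
      - specDensity μ X lam)) atTop (𝓝 0) := by
  obtain ⟨K, hK0, hK⟩ := exists_abs_sub_one_le hw hwO
  simp only [h.eLpNorm_martProj hG hX] at hsum
  have hA := tsum_natAbs_mul_enorm_autoCov_ne_top hG hsum
  set A := ∑' u : ℤ, (u.natAbs : ℝ≥0∞) * ‖autoCov π G u‖ₑ with hAdef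
  have hlim := (tendsto_sqrt_mul_bias hb hbT ho K).mul_const A.toReal
  rw [zero_mul] at hlim
  refine squeeze_zero_norm' ?_ hlim
  filter_upwards [hbT.eventually_gt_atTop 0, eventually_gt_atTop 0] with T hT hT0
  have hT' : (0 : ℝ) < T := by exact_mod_cast hT0
  have hb0 : 0 ≤ b T := (pos_of_mul_pos_left hT hT'.le).le
  have h1 := enorm_smul_specSum_sub_le hG hK hb0 lam T
  have hR : (T * ENNReal.ofReal (K * b T) + 1) * A
      = ENNReal.ofReal ((T * (K * b T) + 1) * A.toReal) := by
    rw [ENNReal.ofReal_mul (p := T * (K * b T) + 1) (by positivity), ENNReal.ofReal_toReal hA,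
      ENNReal.ofReal_add (by positivity) zero_le_one, ENNReal.ofReal_mul (p := T) (by positivity),
      ENNReal.ofReal_natCast, ENNReal.ofReal_one]
  rw [hR, ← ofReal_norm, ENNReal.ofReal_le_ofReal_iff (by positivity), norm_sub_rev] at h1
  have e : ∫ ω, specEstimator X w (b T) T lam ω ∂μ - specDensity μ X lam
      = (1 / (2 * Real.pi * T) : ℝ) • (∫ ω, quadForm (winCoef w (b T) lam)
          (Finset.Icc (1 : ℤ) T) (proc G) (proc G) ω ∂iidLaw π - (T : ℝ) • specSum π G lam) := by
    rw [h.integral_specEstimator hG hX, h.specDensity_eq hG.meas hX, Complex.coe_smul, smul_sub,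
      smul_smul]
    congr 2
    field_simp
  rw [e, norm_smul, norm_smul, Real.norm_of_nonneg (Real.sqrt_nonneg _),
    Real.norm_of_nonneg (by positivity), mul_assoc (√(b T * T))]
  refine mul_le_mul_of_nonneg_left ?_ (Real.sqrt_nonneg _)
  calc 1 / (2 * Real.pi * T) * _ ≤ 1 / T * ((T * (K * b T) + 1) * A.toReal) := by
        gcongr
        nlinarith [Real.pi_gt_three]
    _ = (K * b T + 1 / T) * A.toReal := by field_simp

theorem TendstoInDistribution.add_deterministic {E : Type*} [NormedAddCommGroup E]
    [MeasurableSpace E] [BorelSpace E] [SecondCountableTopology E] {Y : ℕ → Ω → E} {N : Measure E}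
    [IsProbabilityMeasure N]
    (hY : TendstoInDistribution Y atTop (fun z => z) (fun _ => μ) N) {c : ℕ → E}
    (hc : Tendsto c atTop (𝓝 0)) :
    TendstoInDistribution (fun T ω => Y T ω + c T) atTop (fun z => z) (fun _ => μ) N := by
  have h1 : TendstoInMeasure μ (fun T _ => c T) atTop (fun _ : Ω => (0 : E)) :=
    tendstoInMeasure_of_tendsto_ae (fun _ => aestronglyMeasurable_const)
      (Eventually.of_forall fun _ => hc)
  have h2 := hY.add_of_tendstoInMeasure_const h1 fun _ => aemeasurable_const
  simp only [add_zero] at h2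
  exact h2

end Bias

end

/-! ### The theorem -/

theorem theorem4p3 {Ω S H : Type*} [MeasurableSpace Ω] [MeasurableSpace S]
    [NormedAddCommGroup H] [InnerProductSpace ℂ H] [CompleteSpace H] [SecondCountableTopology H]
    [MeasurableSpace H] [BorelSpace H]
    (J : H ≃ₗᵢ⋆[ℂ] H) (hJ : ∀ x, J (J x) = x)
    (μ : Measure Ω) [IsProbabilityMeasure μ]
    (ε ε' : ℤ → Ω → S) (hε : IsIIDWithCopy μ ε ε')
    (g : (ℕ → S) → H) (hg : Measurable g)
    (X : ℤ → Ω → H) (hX : X = causal g ε)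
    (hdep : DependenceCondition μ ε ε' X 4)
    (w : ℝ → ℝ) (hw : LagWindow w)
    (d : ℕ) (lam : Fin d → ℝ) (hlam : ∀ j, lam j ∈ Set.Icc 0 Real.pi)
    (hinj : Function.Injective lam)
    (hreal : (∃ j, lam j = 0 ∨ lam j = Real.pi) → ∀ t, ∀ᵐ ω ∂μ, J (X t ω) = X t ω) :
    ∃ ν : Fin d → ProbabilityMeasure (S2 H),
      (∀ j, IsCenteredComplexGaussian J (ν j : Measure (S2 H))
        (fun C => (windowEnergy w : ℂ) •
          (kron (specDensity μ X (lam j)).op (specDensity μ X (lam j)).op C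
            + indZeroPi (lam j) •
              kronT J (specDensity μ X (lam j)).op (specDensity μ X (lam j)).op C))
        (fun C => (windowEnergy w : ℂ) •
          (indZeroPi (lam j) •
              kron (specDensity μ X (lam j)).op (specDensity μ X (lam j)).op C
            + kronT J (specDensity μ X (lam j)).op
                (conjOp J (specDensity μ X (lam j)).op) C))) ∧
      (∀ b : ℕ → ℝ, Tendsto b atTop (𝓝 0) → Tendsto (fun T : ℕ => b T * T) atTop atTop →
        TendstoInDistribution
          (fun (T : ℕ) (ω : Ω) (j : Fin d) => √(b T * T) •
            (specEstimator X w (b T) T (lam j) ω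
              - ∫ ω', specEstimator X w (b T) T (lam j) ω' ∂μ))
          atTop (fun z => z) (fun _ => μ) (Measure.pi fun j => (ν j : Measure (S2 H)))) ∧
      (∑' h : ℤ, (h.natAbs : ℝ≥0∞) * eLpNorm (martProj μ ε 0 (X h)) 2 μ ≠ ∞ →
        (fun x => w x - 1) =O[𝓝 0] (fun x => x) →
        ∀ b : ℕ → ℝ, Tendsto b atTop (𝓝 0) → Tendsto (fun T : ℕ => b T * T) atTop atTop →
          b =o[atTop] (fun T : ℕ => (T : ℝ) ^ (-(1 / 3) : ℝ)) →
          TendstoInDistribution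
            (fun (T : ℕ) (ω : Ω) (j : Fin d) => √(b T * T) •
              (specEstimator X w (b T) T (lam j) ω - specDensity μ X (lam j)))
            atTop (fun z => z) (fun _ => μ) (Measure.pi fun j => (ν j : Measure (S2 H)))) := by
  obtain ⟨π, hπ, hM⟩ := hε.exists_model
  obtain ⟨G, hGm, hGd, hXG, hGr⟩ := exists_generator (ε := ε) hJ hg hX hreal
  have hG : Causal4 π G := hM.causal4 hGm hGd hXG hdep
  obtain ⟨ν, hν, hlim⟩ := hG.exists_gaussian_limit hJ hw hlam hinj hGr
    fun j => hM.specDensity_eq hGm hXG (lam j)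
  refine ⟨ν, hν, fun b hb hbT => hM.tendsto_deviation hG hXG w b lam (hlim b hb hbT),
    fun hsum hwO b hb hbT ho => ?_⟩
  have h1 := hM.tendsto_deviation hG hXG w b lam (hlim b hb hbT)
  -- Centering at the spectral density instead of the mean adds a deterministic bias, which tends to
  -- zero after scaling, so the limit law is unchanged.
  have h2 := TendstoInDistribution.add_deterministic h1 (c := fun (T : ℕ) (j : Fin d) => √(b T * T) •
    (∫ ω, specEstimator X w (b T) T (lam j) ω ∂μ - specDensity μ X (lam j)))
    (tendsto_pi_nhds.2 fun j => hM.tendsto_bias hG hXG hw hsum hwO hb hbT ho (lam j))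
  refine h2.congr (fun T => Eventually.of_forall fun ω => ?_) EventuallyEq.rfl
  funext j
  rw [Pi.add_apply, ← smul_add, sub_add_sub_cancel]
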